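/- **Setting.** Let $d\ge 1$ and let $(\mathcal M,\mathcal F_{\mathcal M},\mu_{\mathcal M})$ be a probability space (of marks). For every finite $\mathcal X\subset\mathbb R^d\times\mathcal M$ and $(x,t)\in\mathcal X$ let $\xi(x,t;\mathcal X,\cdot)$ be a finite Borel measure on $\mathbb R^d$, with $\xi(x,t;\mathcal X,A)$ measurable in $(x,t,\mathcal X)$ for each Borel $A$; if $(x,t)\notin\mathcal X$, write $\xi(x,t;\mathcal X):=\xi(x,t;\mathcal X\cup\{(x,t)\})$. Translations and dilations of subsets of $\mathbb R^d\times\mathcal M$ act on the first component only. Let $B_r$ be the closed Euclidean ball of radius $r$ about $0$. For locally finite $\mathcal X$ (finitely many points above each bounded set) put $\xi(x,t;\mathcal X,A):=\limsup_{K\to\infty}\xi(x,t;\mathcal X\cap(B_K\times\mathcal M),A)$ and $\xi_\infty^{x,t}(\mathcal X,A):=\xi(x,t;x+\mathcal X,x+A)$. The radius of stabilization $R(x,t;\mathcal X)\in\{0,1,\dots,\infty\}$ is the smallest integer $r\ge0$ such that $$\xi\bigl(x,t;x+([\mathcal X\cap(B_r\times\mathcal M)]\cup\mathcal Y),B\bigr)=\xi\bigl(x,t;x+[\mathcal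 X\cap(B_r\times\mathcal M)],B\bigr)$$ for all finite $\mathcal Y\subset(\mathbb R^d\setminus B_r)\times\mathcal M$ and all Borel $B\subseteq\mathbb R^d$, and $R(x,t;\mathcal X)=\infty$ if there is none. Let $\kappa$ be a bounded, Lebesgue-a.e. continuous probability density on $\mathbb R^d$; write $\kappa$ also for the corresponding probability measure. For $\lambda>0$ let $\mathcal P_\lambda$ be a Poisson process in $\mathbb R^d\times\mathcal M$ with intensity measure $\lambda\,\kappa\times\mu_{\mathcal M}$; for $n\in\mathbb N$ let $\mathcal X_n$ consist of $n$ i.i.d. points with law $\kappa\times\mu_{\mathcal M}$; for $a\ge0$ let $\mathcal H_a$ be a Poisson process with intensity measure $a\,\mathrm{Leb}\times\mu_{\mathcal M}$. Let $T,T'$ have law $\mu_{\mathcal M}$ and $X$ have law $\kappa$, independent of each other and of the point processes. Let $(\Gamma_\lambda)_{\lambda\ge1}$ be a nondecreasing family of Borel subsets of $\mathbb R^d$ with union $\Gamma$, such that $\partial\Gamma$ is Lebesgue-null and $\operatorname{int}\Gamma=\bigcup_{\lambda\ge1}\operatorname{int}\Gamma_\lambda$. Put $$\xi_\lambda(x,t;\mathcal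 X,A):=\xi\bigl(x,t;x+\lambda^{1/d}(-x+\mathcal X),x+\lambda^{1/d}(-x+A)\bigr)\mathbf 1_{\Gamma_\lambda}(x),$$ $\xi^*(x,t;\mathcal X,\cdot):=\xi(x,t;\mathcal X,\mathbb R^d)\,\delta_x$, with $\xi^*_\lambda$ obtained from $\xi^*$ in the same way, and $$\mu_\lambda^\xi:=\sum_{(x,t)\in\mathcal P_\lambda}\xi_\lambda(x,t;\mathcal P_\lambda),\qquad \nu_{\lambda,n}^\xi:=\sum_{(x,t)\in\mathcal X_n}\xi_\lambda(x,t;\mathcal X_n),\qquad \langle f,\mu\rangle:=\int f\,d\mu .$$ **Theorem.** Suppose that $R(x,T;\mathcal H_{\kappa(x)})<\infty$ almost surely for $\kappa$-almost every $x\in\Gamma$. Let $f:\mathbb R^d\to\mathbb R$ be bounded and Borel, and suppose at least one of the following holds: (A1) $\xi=\xi^*$; (A2) every $\xi(x,t;\mathcal X,\cdot)$ is absolutely continuous with respect to Lebesgue measure, with densities bounded by a common finite constant; (A3) $f$ is Lebesgue-a.e. continuous. Let $q\in\{1,2\}$. (i) If for some $p>q$ $$\sup_{\lambda\ge1,\,x\in\operatorname{supp}\kappa}\mathbb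 E\bigl[\xi_\lambda(x,T;\mathcal P_\lambda,\mathbb R^d)^p\bigr]<\infty\quad\text{and}\quad\sup_{\lambda\ge1,\,x,y\in\operatorname{supp}\kappa}\mathbb E\bigl[\xi_\lambda(x,T;\mathcal P_\lambda\cup\{(y,T')\},\mathbb R^d)^p\bigr]<\infty,$$ then, as $\lambda\to\infty$, $$\lambda^{-1}\langle f,\mu_\lambda^\xi\rangle\xrightarrow{L^q}\int_\Gamma f(x)\,\mathbb E\,\xi_\infty^{x,T}(\mathcal H_{\kappa(x)},\mathbb R^d)\,\kappa(x)\,dx,$$ $$\lambda^{-1}\sum_{(x,t)\in\mathcal P_\lambda}\bigl|\langle f,\xi_\lambda(x,t;\mathcal P_\lambda)-\xi_\lambda^*(x,t;\mathcal P_\lambda)\rangle\bigr|\xrightarrow{L^1}0 .$$ (ii) If $\lambda(n)/n\to1$ as $n\to\infty$ and for some $n_0>0$ and $p>q$ $$\sup_{n\ge n_0}\mathbb E\bigl[\xi_{\lambda(n)}(X,T;\mathcal X_{n-1},\mathbb R^d)^p\bigr]<\infty,$$ then, as $n\to\infty$, $$n^{-1}\langle f,\nu_{\lambda(n),n}^\xi\rangle\xrightarrow{L^q}\int_\Gamma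 f(x)\,\mathbb E\,\xi_\infty^{x,T}(\mathcal H_{\kappa(x)},\mathbb R^d)\,\kappa(x)\,dx,$$ $$n^{-1}\sum_{(x,t)\in\mathcal X_n}\bigl|\langle f,\xi_{\lambda(n)}(x,t;\mathcal X_n)-\xi_{\lambda(n)}^*(x,t;\mathcal X_n)\rangle\bigr|\xrightarrow{L^1}0 .$$ In both parts the expectation in the limit is finite for $\kappa$-almost every $x\in\Gamma$ and the integral over $\Gamma$ converges absolutely. -/

import Mathlib

open MeasureTheory ProbabilityTheory Filter Topology
open scoped ENNReal NNReal

noncomputable section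

namespace StabLLN

/-- `ℝ^d` with the Euclidean norm. -/
abbrev Sp (d : ℕ) : Type := EuclideanSpace ℝ (Fin d)

section PointProcess

/-- The usual `σ`-algebra on configurations (sets of points): the one generated by the counting
maps `X ↦ #(X ∩ B)` with `B` measurable. -/
@[reducible]
def configSigma (α : Type*) [MeasurableSpace α] : MeasurableSpace (Set α) :=
  ⨆ (B : Set α) (_ : MeasurableSet B),
    MeasurableSpace.comap (fun X : Set α => (X ∩ B).encard) inferInstance

variable {d : ℕ} {M Ω : Type*} [MeasurableSpace M] [MeasurableSpace Ω]

/-- Locally finite subsets of `ℝ^d × M`: finitely many points above each bounded set. -/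
def IsLocFinite (X : Set (Sp d × M)) : Prop :=
  ∀ B : Set (Sp d), Bornology.IsBounded B → (X ∩ (B ×ˢ Set.univ)).Finite

/-- `η` is a Poisson point process in `ℝ^d × M` with intensity measure `Λ`, defined on the
probability space `(Ω, P)`: a random locally finite set whose numbers of points in measurable sets
of finite intensity are Poisson distributed, with independent numbers of points in disjoint sets. -/
structure IsPoissonProcess (η : Ω → Set (Sp d × M)) (Λ : Measure (Sp d × M))
    (P : Measure Ω) : Prop where
  locFinite : ∀ ω, IsLocFinite (η ω)
  measurable : Measurable[inferInstance, configSigma (Sp d × M)] η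
  law_count : ∀ B : Set (Sp d × M), MeasurableSet B → Λ B ≠ ∞ →
    P.map (fun ω => (η ω ∩ B).encard)
      = (poissonMeasure (Λ B).toNNReal).map (fun k : ℕ => (k : ℕ∞))
  indep_count : ∀ (n : ℕ) (B : Fin n → Set (Sp d × M)), (∀ i, MeasurableSet (B i)) →
    Pairwise (fun i j => Disjoint (B i) (B j)) →
    iIndepFun (fun i ω => (η ω ∩ B i).encard) P

/-- The probability measure on `ℝ^d` with density `κ`. -/
def densityMeasure (κ : Sp d → ℝ≥0) : Measure (Sp d) :=
  volume.withDensity (fun x => (κ x : ℝ≥0∞))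

/-- The binomial process: the set of values of the `n` random elements `Z 0, …, Z (n-1)`. -/
def binomialProcess {n : ℕ} (Z : Fin n → Ω → Sp d × M) (ω : Ω) : Set (Sp d × M) :=
  Set.range fun i => Z i ω

end PointProcess

section Score

variable {d : ℕ} {M : Type*} [MeasurableSpace M]

/-- `ξ z X` is the measure `ξ(x,t;X,·)` for `z = (x,t)`. It is meaningful only for finite `X` with
`z ∈ X`; its values at other arguments carry no information. -/
abbrev Score (d : ℕ) (M : Type*) : Type _ := Sp d × M → Set (Sp d × M) → Measure (Sp d)

/-- The standing assumptions on `ξ`: each `ξ(x,t;X,·)` is a finite measure, and `ξ(x,t;X,A)` is,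
for each Borel set `A`, a measurable function of the triple `(x,t,X)`, `X` finite, `(x,t) ∈ X`. -/
structure IsScore (ξ : Score d M) : Prop where
  finite : ∀ (z : Sp d × M) (X : Set (Sp d × M)), X.Finite → z ∈ X → ξ z X Set.univ < ∞
  measurable : ∀ A : Set (Sp d), MeasurableSet A →
    Measurable[MeasurableSpace.comap Subtype.val
        (@Prod.instMeasurableSpace _ _ inferInstance (configSigma (Sp d × M))), inferInstance]
      (fun p : {p : (Sp d × M) × Set (Sp d × M) // p.2.Finite ∧ p.1 ∈ p.2} => ξ p.1.1 p.1.2 A)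

/-- Convention: `ξ(x,t;X)` stands for `ξ(x,t;X ∪ {(x,t)})`, also when `(x,t) ∉ X`. -/
def scoreAt (ξ : Score d M) (z : Sp d × M) (X : Set (Sp d × M)) : Measure (Sp d) :=
  ξ z (insert z X)

/-- The point measure `ξ*(x,t;X,·)` at `x` with the same total mass as `ξ(x,t;X,·)`. -/
def star (ξ : Score d M) : Score d M :=
  fun z X => ξ z X Set.univ • Measure.dirac z.1

/-- The map `y ↦ x + r (-x + y)` on `ℝ^d`. -/
def dilate (x : Sp d) (r : ℝ) (y : Sp d) : Sp d := x + r • (-x + y)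

/-- The marked set `x + r (-x + X)`; marks are left unchanged. -/
def dilateSet (x : Sp d) (r : ℝ) (X : Set (Sp d × M)) : Set (Sp d × M) :=
  (fun w : Sp d × M => (dilate x r w.1, w.2)) '' X

/-- The marked set `x + X`; marks are left unchanged. -/
def shiftSet (x : Sp d) (X : Set (Sp d × M)) : Set (Sp d × M) :=
  (fun w : Sp d × M => (x + w.1, w.2)) '' X

/-- The part of `X` above the closed ball of radius `K` about the origin. -/
def restrictBall (K : ℝ) (X : Set (Sp d × M)) : Set (Sp d × M) :=
  X ∩ (Metric.closedBall 0 K ×ˢ Set.univ)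

open Classical in
/-- The rescaled measure
`ξ_l(x,t;X,A) = ξ(x,t; x + l^{1/d}(-x + X), x + l^{1/d}(-x + A)) 1_{Γ_l}(x)`. The set
`x + l^{1/d}(-x + A)` is the preimage of `A` under `y ↦ x + l^{-1/d}(-x + y)`, so this is the
image measure under the latter map. -/
def rescaled (Γ : ℝ → Set (Sp d)) (ξ : Score d M) (l : ℝ) (z : Sp d × M)
    (X : Set (Sp d × M)) : Measure (Sp d) :=
  if z.1 ∈ Γ l then
    (scoreAt ξ z (dilateSet z.1 (l ^ (1 / (d : ℝ))) X)).map (dilate z.1 (l ^ (-(1 / (d : ℝ)))))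
  else 0

/-- The measure `∑_{(x,t) ∈ X} ξ_l(x,t;X)`; this is `μ_l^ξ` for `X = 𝒫_l` and `ν_{l,n}^ξ` for
`X = 𝒳_n`. -/
def totalMeasure (Γ : ℝ → Set (Sp d)) (ξ : Score d M) (l : ℝ) (X : Set (Sp d × M)) :
    Measure (Sp d) :=
  Measure.sum fun z : X => rescaled Γ ξ l z X

/-- `∑_{(x,t) ∈ X} |⟨f, ξ_l(x,t;X) - ξ*_l(x,t;X)⟩|`. -/
def discrepancy (Γ : ℝ → Set (Sp d)) (ξ : Score d M) (l : ℝ) (f : Sp d → ℝ)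
    (X : Set (Sp d × M)) : ℝ :=
  ∑' z : X, |∫ y, f y ∂(rescaled Γ ξ l z X) - ∫ y, f y ∂(rescaled Γ (star ξ) l z X)|

/-- Extension of `ξ(x,t;X,A)` to locally finite `X`, as the upper limit as `K → ∞` of its values
at the restrictions of `X` to the balls of radius `K` about the origin. -/
def scoreExt (ξ : Score d M) (z : Sp d × M) (X : Set (Sp d × M)) (A : Set (Sp d)) : ℝ≥0∞ :=
  limsup (fun K : ℝ => scoreAt ξ z (restrictBall K X) A) atTop

/-- `ξ_∞^{x,t}(X,A) = ξ(x,t; x + X, x + A)` for locally finite `X`. -/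
def scoreInf (ξ : Score d M) (z : Sp d × M) (X : Set (Sp d × M)) (A : Set (Sp d)) : ℝ≥0∞ :=
  scoreExt ξ z (shiftSet z.1 X) ((fun y => z.1 + y) '' A)

/-- The radius of stabilization `R(x,t;X,A)`: the smallest integer `r ≥ 0` such that adding to
`X ∩ B_r` a finite set of points above `A \ B_r` does not change the measure, and `∞` if there is
no such `r`. -/
def stabRadius (ξ : Score d M) (z : Sp d × M) (X : Set (Sp d × M)) (A : Set (Sp d)) : ℕ∞ :=
  ⨅ (r : ℕ) (_ : ∀ Y : Set (Sp d × M), Y.Finite →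
      Y ⊆ (A \ Metric.closedBall 0 (r : ℝ)) ×ˢ Set.univ →
      ∀ B : Set (Sp d), MeasurableSet B →
      scoreAt ξ z (shiftSet z.1 (restrictBall r X ∪ Y)) B
        = scoreAt ξ z (shiftSet z.1 (restrictBall r X)) B), (r : ℕ∞)

/-- A1: every `ξ(x,t;X,·)` is a point mass at `x`. -/
def AssumptionA1 (ξ : Score d M) : Prop :=
  ∀ (z : Sp d × M) (X : Set (Sp d × M)), X.Finite → z ∈ X → ξ z X = star ξ z X

/-- A2: every `ξ(x,t;X,·)` has a Lebesgue density, with a common finite upper bound. -/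
def AssumptionA2 (ξ : Score d M) : Prop :=
  ∃ K₀ : ℝ≥0, ∀ (z : Sp d × M) (X : Set (Sp d × M)), X.Finite → z ∈ X →
    ξ z X ≪ volume ∧ ∀ᵐ y, (ξ z X).rnDeriv volume y ≤ K₀

/-- A3: `f` is Lebesgue-almost everywhere continuous. -/
def AssumptionA3 (f : Sp d → ℝ) : Prop := ∀ᵐ x, ContinuousAt f x

end Score

section Moments

variable {d : ℕ} {M Ω : Type*} [MeasurableSpace M] [MeasurableSpace Ω]

/-- `sup_{l ≥ 1, x ∈ supp κ} E[ξ_l(x,T;𝒫_l,ℝ^d)^p] < ∞`. The independent mark `T` is the first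
coordinate of the product space `M × Ω`. -/
def MomentPoisson (Γ : ℝ → Set (Sp d)) (ξ : Score d M) (κ : Sp d → ℝ≥0) (μM : Measure M)
    (P : Measure Ω) (PP : ℝ → Ω → Set (Sp d × M)) (p : ℝ) : Prop :=
  (⨆ (l : ℝ) (_ : 1 ≤ l) (x : Sp d) (_ : x ∈ (densityMeasure κ).support),
    ∫⁻ w : M × Ω, rescaled Γ ξ l (x, w.1) (PP l w.2) Set.univ ^ p ∂(μM.prod P)) < ∞

/-- `sup_{l ≥ 1, x, y ∈ supp κ} E[ξ_l(x,T;𝒫_l ∪ {(y,T')},ℝ^d)^p] < ∞`. -/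
def MomentPoissonPair (Γ : ℝ → Set (Sp d)) (ξ : Score d M) (κ : Sp d → ℝ≥0) (μM : Measure M)
    (P : Measure Ω) (PP : ℝ → Ω → Set (Sp d × M)) (p : ℝ) : Prop :=
  (⨆ (l : ℝ) (_ : 1 ≤ l) (x : Sp d) (_ : x ∈ (densityMeasure κ).support)
      (y : Sp d) (_ : y ∈ (densityMeasure κ).support),
    ∫⁻ w : M × M × Ω, rescaled Γ ξ l (x, w.1) (PP l w.2.2 ∪ {(y, w.2.1)}) Set.univ ^ p
      ∂(μM.prod (μM.prod P))) < ∞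

/-- `sup_{n ≥ n₀} E[ξ_{l(n)}(X,T;𝒳_{n-1},ℝ^d)^p] < ∞`, with `(X,T)` of law `κ × μM` independent
of `𝒳_{n-1}`. -/
def MomentBinomial (Γ : ℝ → Set (Sp d)) (ξ : Score d M) (κ : Sp d → ℝ≥0) (μM : Measure M)
    (P : Measure Ω) (Z : (n : ℕ) → Fin n → Ω → Sp d × M) (l : ℕ → ℝ) (n₀ : ℕ) (p : ℝ) : Prop :=
  (⨆ (n : ℕ) (_ : n₀ ≤ n),
    ∫⁻ w : (Sp d × M) × Ω,
      rescaled Γ ξ (l n) w.1 (binomialProcess (Z (n - 1)) w.2) Set.univ ^ p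
      ∂(((densityMeasure κ).prod μM).prod P)) < ∞

/-- `E ξ_∞^{x,T}(η, ℝ^d)`, with `T` of law `μM` independent of `η`. -/
def meanScoreInf (ξ : Score d M) (μM : Measure M) (P : Measure Ω) (η : Ω → Set (Sp d × M))
    (x : Sp d) : ℝ≥0∞ :=
  ∫⁻ w : M × Ω, scoreInf ξ (x, w.1) (η w.2) Set.univ ∂(μM.prod P)

/-- The integrand `f(x) E ξ_∞^{x,T}(ℋ_{κ(x)}, ℝ^d) κ(x)` of the limit. -/
def limitIntegrand (ξ : Score d M) (κ : Sp d → ℝ≥0) (μM : Measure M) (P : Measure Ω)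
    (HH : ℝ≥0 → Ω → Set (Sp d × M)) (f : Sp d → ℝ) (x : Sp d) : ℝ :=
  f x * (meanScoreInf ξ μM P (HH (κ x)) x).toReal * (κ x : ℝ)

/-- Convergence in `L^q` of the random variables `Y i` to the constant `c` along `F`. -/
def TendstoLq {ι : Type*} (q : ℝ≥0∞) (P : Measure Ω) (Y : ι → Ω → ℝ) (F : Filter ι) (c : ℝ) :
    Prop :=
  (∀ᶠ i in F, MemLp (Y i) q P) ∧ Tendsto (fun i => eLpNorm (fun ω => Y i ω - c) q P) F (𝓝 0)

end Moments

end StabLLN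

end

open StabLLN

open MeasureTheory ProbabilityTheory Filter Topology
open scoped ENNReal NNReal Nat

set_option linter.unusedSectionVars false

noncomputable section

namespace StabLLN

-- Magnified by `λ^{1/d}` about a typical point `x`, the point process looks like a homogeneous
-- Poisson process of intensity `κ(x)`. Two typical points are far apart on the magnified scale, so
-- they see asymptotically independent pictures. For a bounded functional of the score this gives `E
-- S / λ → c` and `E S² / λ² → c²` for the sum `S` over all points, the diagonal part of `S²` being
-- of order `λ`. Hence `S / λ → c` in `L²` (`tendsto_eLpNorm_bounded`). Moments of order `p > q`
-- remove the boundedness: the part of the functional above level `K` has `L^q` norm at most of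
-- order `K^{-(p-q)/q}`, uniformly in the scale (`tendsto_eLpNorm_cfgSum`).
--
-- The local limit is computed directly, without a coupling. For binomial processes
-- `lintegral_twoBall` is an exact trinomial formula for the points in two disjoint small balls; the
-- Poisson approximation of its weights and continuity of `κ` give `tendsto_lintegral_twoBall`.
-- Stabilization replaces a functional by its value on the points within magnified distance `r`. The
-- error is controlled by the probability that the limiting Poisson process is not stabilized at
-- `r`, which vanishes as `r → ∞` (`tendsto_lintegral_pair_functional`). A Poisson process of
-- intensity `λ κ` is a mixture of binomial processes whose number of points `n` satisfies `n / λ →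
-- 1` in probability (`tendsto_tsum_pw`). Both parts are therefore instances of one statement about
-- an `LLNModel`, namely `tendstoLq_of_llnModel`.
--
-- The test function enters through the images of the score under contractions towards `x`.
-- Integrals of `f` against them tend to `f(x)` times the mass (`Concentrates`): trivially for a
-- point mass at `x`, by Lebesgue differentiation for bounded densities, and by continuity of `f` at
-- `x` in the last case. The law of large numbers is applied to several functionals (`IsReadout`):
-- the total mass, the integrals of the positive and negative parts of `f`, and the discrepancy
-- between `ξ` and `ξ*`, whose limit is zero.
--
-- Two measurability problems shape the text. The mark space is arbitrary, so coincidence of marks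
-- need not be a measurable event. Points are therefore told apart by their positions, which are
-- almost surely distinct (`PosInj`, `FreshPairs`, `SepSet`). Stabilization quantifies over
-- uncountably many finite sets; it is replaced by a condition on almost every added configuration
-- (`stabSet`).

attribute [local instance] configSigma

/-! ### Measurability on the space of configurations. -/

section Config

variable {α β : Type*} [MeasurableSpace α] [MeasurableSpace β]

lemma measurable_encard_inter {B : Set α} (hB : MeasurableSet B) :
    Measurable (fun X : Set α => (X ∩ B).encard) := by
  have : MeasurableSpace.comap (fun X : Set α => (X ∩ B).encard) inferInstance ≤ configSigma α :=
    le_iSup₂_of_le B hB le_rfl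
  exact measurable_iff_comap_le.2 this

lemma measurable_config_iff {f : β → Set α} :
    Measurable f ↔ ∀ B, MeasurableSet B → Measurable fun b => (f b ∩ B).encard := by
  constructor
  · intro hf B hB
    exact (measurable_encard_inter hB).comp hf
  · intro h
    rw [measurable_iff_comap_le, configSigma, MeasurableSpace.comap_iSup]
    refine iSup_le fun B => ?_
    rw [MeasurableSpace.comap_iSup]
    refine iSup_le fun hB => ?_
    rw [MeasurableSpace.comap_comp]
    exact measurable_iff_comap_le.1 (h B hB)

lemma measurable_encard : Measurable (fun X : Set α => X.encard) := by
  simpa using measurable_encard_inter (α := α) MeasurableSet.univ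

lemma measurableSet_finite_config : MeasurableSet {X : Set α | X.Finite} := by
  have : {X : Set α | X.Finite} = (fun X : Set α => X.encard) ⁻¹' {k | k < ⊤} := by
    ext X; simp [Set.encard_lt_top_iff]
  rw [this]
  exact measurable_encard (MeasurableSet.of_discrete)

lemma measurableSet_inter_eq_empty {B : Set α} (hB : MeasurableSet B) :
    MeasurableSet {X : Set α | X ∩ B = ∅} := by
  have : {X : Set α | X ∩ B = ∅} = (fun X : Set α => (X ∩ B).encard) ⁻¹' {0} := by
    ext X; simp [Set.encard_eq_zero]
  rw [this]
  exact measurable_encard_inter hB (MeasurableSet.of_discrete)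

lemma measurable_add_enat {f g : β → ℕ∞} (hf : Measurable f) (hg : Measurable g) :
    Measurable fun b => f b + g b :=
  (Measurable.of_discrete (f := fun p : ℕ∞ × ℕ∞ => p.1 + p.2)).comp (hf.prodMk hg)

lemma measurable_config_inter {B : Set α} (hB : MeasurableSet B) :
    Measurable (fun X : Set α => X ∩ B) := by
  refine measurable_config_iff.2 fun A hA => ?_
  simp_rw [Set.inter_assoc]
  exact measurable_encard_inter (hB.inter hA)

lemma measurable_config_diff {B : Set α} (hB : MeasurableSet B) :
    Measurable (fun X : Set α => X \ B) := by
  simp_rw [Set.sdiff_eq]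
  exact measurable_config_inter hB.compl

lemma measurable_config_union_of_disjoint {f g : β → Set α} (hf : Measurable f) (hg : Measurable g)
    (h : ∀ b, Disjoint (f b) (g b)) : Measurable fun b => f b ∪ g b := by
  refine measurable_config_iff.2 fun A hA => ?_
  have : (fun b => ((f b ∪ g b) ∩ A).encard)
      = fun b => (f b ∩ A).encard + (g b ∩ A).encard := by
    ext b : 1
    rw [Set.union_inter_distrib_right, Set.encard_union_eq]
    exact (h b).mono Set.inter_subset_left Set.inter_subset_left
  rw [this]
  exact measurable_add_enat ((measurable_encard_inter hA).comp hf)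
    ((measurable_encard_inter hA).comp hg)

/-- The configuration that agrees with `X` on `B` and with `Y` off `B`. -/
def glue (B : Set α) (X Y : Set α) : Set α := X ∩ B ∪ Y \ B

lemma measurable_glue {B : Set α} (hB : MeasurableSet B) :
    Measurable (fun p : Set α × Set α => glue B p.1 p.2) := by
  refine measurable_config_union_of_disjoint ((measurable_config_inter hB).comp measurable_fst)
    ((measurable_config_diff hB).comp measurable_snd) fun p => ?_
  exact Set.disjoint_left.2 fun x hx hx' => hx'.2 hx.2

/-- By injectivity a count in the image equals a count of the original configuration in the preimage
set. -/
lemma measurable_config_image {g : α → β} (hg : Measurable g) (hi : Function.Injective g) :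
    Measurable (fun X : Set α => g '' X) := by
  refine measurable_config_iff.2 fun A hA => ?_
  have : (fun X : Set α => (g '' X ∩ A).encard) = fun X => (X ∩ g ⁻¹' A).encard := by
    ext X : 1
    rw [← Set.image_inter_preimage, hi.encard_image]
  rw [this]
  exact measurable_encard_inter (hg hA)

lemma tsum_indicator_one {α : Type*} (X C : Set α) :
    ∑' w : X, C.indicator (fun _ => (1 : ℝ≥0∞)) (w : α) = ((X ∩ C).encard : ℝ≥0∞) := by
  rw [← ENNReal.tsum_set_one, tsum_subtype X (C.indicator fun _ => (1 : ℝ≥0∞)),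
    Set.indicator_indicator, tsum_subtype (X ∩ C) (fun _ => (1 : ℝ≥0∞))]

/-- Sums over the points of a finite configuration depend measurably on the configuration and on
further parameters. -/
lemma measurable_tsum_config {V : α × β → ℝ≥0∞} (hV : Measurable V) :
    Measurable fun q : β × {X : Set α // X.Finite} => ∑' w : q.2.1, V (w, q.1) := by
  refine Measurable.ennreal_induction (motive := fun V => Measurable
    fun q : β × {X : Set α // X.Finite} => ∑' w : q.2.1, V (w, q.1)) ?_ ?_ ?_ hV
  · intro c C hC
    have key : Measurable fun q : β × {X : Set α // X.Finite} =>
        ∑' w : q.2.1, C.indicator (fun _ => (1 : ℝ≥0∞)) ((w : α), q.1) := by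
      induction C, hC using MeasurableSpace.induction_on_inter generateFrom_prod.symm
        isPiSystem_prod with
      | empty => simp
      | basic t ht =>
        obtain ⟨A, hA, B, hB, rfl⟩ := ht
        have : (fun q : β × {X : Set α // X.Finite} =>
            ∑' w : q.2.1, (A ×ˢ B).indicator (fun _ => (1 : ℝ≥0∞)) ((w : α), q.1))
            = fun q => B.indicator (fun _ => (1 : ℝ≥0∞)) q.1
              * (((q.2.1 ∩ A).encard : ℕ∞) : ℝ≥0∞) := by
          ext q
          rw [← tsum_indicator_one, ← ENNReal.tsum_mul_left]
          refine tsum_congr fun w => ?_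
          by_cases h1 : (w : α) ∈ A <;> by_cases h2 : q.1 ∈ B <;> simp [h1, h2]
        rw [this]
        refine Measurable.mul ((measurable_const.indicator hB).comp measurable_fst) ?_
        exact (Measurable.of_discrete (f := fun k : ℕ∞ => (k : ℝ≥0∞))).comp
          ((measurable_encard_inter hA).comp (measurable_subtype_coe.comp measurable_snd))
      -- Finiteness of the configuration is used here: the sum over the complement is the number of
      -- points minus the sum over `t`, and subtraction in `ℝ≥0∞` is faithful only for finite
      -- quantities.
      | compl t ht ih =>
        have : (fun q : β × {X : Set α // X.Finite} =>
            ∑' w : q.2.1, (tᶜ).indicator (fun _ => (1 : ℝ≥0∞)) ((w : α), q.1))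
            = fun q => ((q.2.1.encard : ℕ∞) : ℝ≥0∞)
              - ∑' w : q.2.1, t.indicator (fun _ => (1 : ℝ≥0∞)) ((w : α), q.1) := by
          ext q
          have hs : ((q.2.1.encard : ℕ∞) : ℝ≥0∞)
              = ∑' w : q.2.1, (tᶜ).indicator (fun _ => (1 : ℝ≥0∞)) ((w : α), q.1)
                + ∑' w : q.2.1, t.indicator (fun _ => (1 : ℝ≥0∞)) ((w : α), q.1) := by
            rw [← ENNReal.tsum_set_one, ← ENNReal.tsum_add]
            refine tsum_congr fun w => ?_
            by_cases h : ((w : α), q.1) ∈ t <;> simp [h]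
          rw [hs, ENNReal.add_sub_cancel_right]
          have hle : ∑' w : q.2.1, t.indicator (fun _ => (1 : ℝ≥0∞)) ((w : α), q.1)
              ≤ ((q.2.1.encard : ℕ∞) : ℝ≥0∞) := hs ▸ le_add_self
          refine ne_top_of_le_ne_top ?_ hle
          rw [ENat.toENNReal_ne_top]
          exact Set.encard_ne_top_iff.2 q.2.2
        rw [this]
        refine Measurable.sub ?_ ih
        exact (Measurable.of_discrete (f := fun k : ℕ∞ => (k : ℝ≥0∞))).comp
          (measurable_encard.comp (measurable_subtype_coe.comp measurable_snd))
      | iUnion g hd hm ih =>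
        have : (fun q : β × {X : Set α // X.Finite} =>
            ∑' w : q.2.1, (⋃ i, g i).indicator (fun _ => (1 : ℝ≥0∞)) ((w : α), q.1))
            = fun q => ∑' i, ∑' w : q.2.1, (g i).indicator (fun _ => (1 : ℝ≥0∞)) ((w : α), q.1) := by
          ext q
          rw [ENNReal.tsum_comm]
          refine tsum_congr fun w => ?_
          by_cases h : ((w : α), q.1) ∈ ⋃ i, g i
          · obtain ⟨i, hi⟩ := Set.mem_iUnion.1 h
            rw [Set.indicator_of_mem h, tsum_eq_single i, Set.indicator_of_mem hi]
            intro j hj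
            refine Set.indicator_of_notMem (fun hj' => ?_) _
            exact Set.disjoint_left.1 (hd hj) hj' hi
          · rw [Set.indicator_of_notMem h]
            simp only [Set.mem_iUnion, not_exists] at h
            simp [h]
        rw [this]
        exact Measurable.tsum ih
    have : (fun q : β × {X : Set α // X.Finite} =>
        ∑' w : q.2.1, C.indicator (fun _ => c) ((w : α), q.1))
        = fun q => c * ∑' w : q.2.1, C.indicator (fun _ => (1 : ℝ≥0∞)) ((w : α), q.1) := by
      ext q
      rw [← ENNReal.tsum_mul_left]
      refine tsum_congr fun w => ?_
      by_cases h : ((w : α), q.1) ∈ C <;> simp [h]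
    rw [this]
    exact key.const_mul c
  · intro f g _ hf hg ihf ihg
    simp only [Pi.add_apply, ENNReal.tsum_add]
    exact ihf.add ihg
  · intro f hf hmono ih
    have : (fun q : β × {X : Set α // X.Finite} => ∑' w : q.2.1, ⨆ n, f n ((w : α), q.1))
        = fun q => ⨆ n, ∑' w : q.2.1, f n ((w : α), q.1) := by
      ext q
      have := q.2.2.fintype
      simp only [tsum_fintype]
      exact ENNReal.finsetSum_iSup_of_monotone fun a n m hnm => hmono hnm _
    rw [this]
    exact Measurable.iSup ih

/-- The set in which points are counted moves with the parameter, so the counts generating the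
σ-algebra do not suffice. The count is a sum of indicators over the points, and passing from `ℕ∞` to
`ℝ≥0∞` is injective. -/
lemma measurable_encard_section {C : Set (α × β)} (hC : MeasurableSet C) :
    Measurable fun q : β × {X : Set α // X.Finite} => (q.2.1 ∩ {w | (w, q.1) ∈ C}).encard := by
  refine measurable_to_countable' fun k => ?_
  have h := measurable_tsum_config (measurable_const.indicator hC : Measurable
    (C.indicator fun _ => (1 : ℝ≥0∞)))
  have : (fun q : β × {X : Set α // X.Finite} => (q.2.1 ∩ {w | (w, q.1) ∈ C}).encard) ⁻¹' {k}
      = (fun q : β × {X : Set α // X.Finite} =>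
        ∑' w : q.2.1, C.indicator (fun _ => (1 : ℝ≥0∞)) ((w : α), q.1)) ⁻¹' {(k : ℝ≥0∞)} := by
    ext q
    have : ∑' w : q.2.1, C.indicator (fun _ => (1 : ℝ≥0∞)) ((w : α), q.1)
        = ((q.2.1 ∩ {w | (w, q.1) ∈ C}).encard : ℝ≥0∞) := by
      rw [← tsum_indicator_one]; rfl
    simp only [Set.mem_preimage, Set.mem_singleton_iff, this, ENat.toENNReal_inj]
  rw [this]
  exact h (measurableSet_singleton _)

end Config

/-! ### Tuples of marked points with distinct positions. -/

section Tuples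

variable {d : ℕ} {M : Type*} [MeasurableSpace M] {ι ι' : Type*}

/-- The points of the family `z` have pairwise distinct positions. -/
def PosInj (z : ι → Sp d × M) : Prop := Function.Injective fun i => (z i).1

lemma PosInj.injective {z : ι → Sp d × M} (h : PosInj z) : Function.Injective z :=
  fun _ _ hij => h (congrArg Prod.fst hij)

lemma PosInj.comp {z : ι → Sp d × M} (h : PosInj z) {e : ι' → ι} (he : Function.Injective e) :
    PosInj (z ∘ e) :=
  fun _ _ hij => he (h hij)

lemma measurableSet_posInj [Finite ι] : MeasurableSet {z : ι → Sp d × M | PosInj z} := by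
  have : {z : ι → Sp d × M | PosInj z}
      = ⋂ i, ⋂ j, {z | (z i).1 = (z j).1 → i = j} := by
    ext z; simp [PosInj, Function.Injective]
  rw [this]
  refine MeasurableSet.iInter fun i => MeasurableSet.iInter fun j => ?_
  by_cases hij : i = j
  · simp [hij]
  · simp only [hij, imp_false]
    exact (measurableSet_eq_fun (by fun_prop) (by fun_prop)).compl

open Classical in
/-- The set of points of the family `z`, or `∅` if two of its points share their position. -/
def pointSet (z : ι → Sp d × M) : Set (Sp d × M) := if PosInj z then Set.range z else ∅

lemma pointSet_of_posInj {z : ι → Sp d × M} (h : PosInj z) : pointSet z = Set.range z := if_pos h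

lemma finite_pointSet [Finite ι] (z : ι → Sp d × M) : (pointSet z).Finite := by
  unfold pointSet
  split_ifs
  · exact Set.finite_range z
  · exact Set.finite_empty

open Classical in
lemma encard_range_inter [Fintype ι] {z : ι → Sp d × M} (h : PosInj z) (B : Set (Sp d × M)) :
    (Set.range z ∩ B).encard = ∑ i, if z i ∈ B then 1 else 0 := by
  have : Set.range z ∩ B = z '' (z ⁻¹' B) := by
    rw [Set.image_preimage_eq_inter_range, Set.inter_comm]
  rw [this, h.injective.encard_image, Set.encard_eq_coe_toFinset_card]
  have : (z ⁻¹' B).toFinset = Finset.univ.filter fun i => z i ∈ B := by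
    ext i; simp
  rw [this, Finset.sum_boole]

/-- On tuples with distinct positions a count is a sum of indicators. Off them it would depend on
which marks coincide, and the diagonal of `M × M` need not be measurable; the value `∅` avoids this.
-/
lemma measurable_pointSet [Fintype ι] :
    Measurable (pointSet : (ι → Sp d × M) → Set (Sp d × M)) := by
  classical
  refine measurable_config_iff.2 fun B hB => ?_
  have : (fun z : ι → Sp d × M => (pointSet z ∩ B).encard)
      = {z | PosInj z}.piecewise (fun z => ∑ i, if z i ∈ B then (1 : ℕ∞) else 0) fun _ => 0 := by
    ext z : 1
    by_cases h : PosInj z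
    · rw [Set.piecewise_eq_of_mem _ _ _ h, pointSet_of_posInj h, encard_range_inter h]
    · rw [Set.piecewise_eq_of_notMem _ _ _ h]
      simp [pointSet, h]
  rw [this]
  refine Measurable.piecewise measurableSet_posInj ?_ measurable_const
  have h : ∀ s : Finset ι, Measurable fun z : ι → Sp d × M =>
      ∑ i ∈ s, if z i ∈ B then (1 : ℕ∞) else 0 := by
    intro s
    induction s using Finset.induction_on with
    | empty => simp
    | insert a s ha ih =>
      simp_rw [Finset.sum_insert ha]
      refine measurable_add_enat ?_ ih
      exact Measurable.ite (measurable_pi_apply a hB) measurable_const measurable_const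
  exact h _

lemma pointSet_comp_equiv (e : ι' ≃ ι) (z : ι → Sp d × M) :
    pointSet (z ∘ e) = pointSet z := by
  by_cases h : PosInj z
  · rw [pointSet_of_posInj h, pointSet_of_posInj (h.comp e.injective), e.surjective.range_comp]
  · have : ¬ PosInj (z ∘ e) := fun h' => h (by
      have := h'.comp e.symm.injective
      simpa [Function.comp_assoc] using this)
    simp [pointSet, h, this]

/-- No fibre over a single position carries mass. -/
def NoPosAtoms (ν : Measure (Sp d × M)) : Prop := ∀ x : Sp d, ν ({x} ×ˢ Set.univ) = 0

lemma NoPosAtoms.mono {ν ν' : Measure (Sp d × M)} (h : NoPosAtoms ν) (hν : ν' ≪ ν) :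
    NoPosAtoms ν' := fun x => hν (h x)

lemma NoPosAtoms.restrict {ν : Measure (Sp d × M)} (h : NoPosAtoms ν) (B : Set (Sp d × M)) :
    NoPosAtoms (ν.restrict B) := h.mono Measure.restrict_le_self.absolutelyContinuous

/-- Fubini in the coordinate `i`: with the other coordinates frozen, sharing a position with one of
them confines `z i` to a null fibre. -/
lemma ae_posInj {ν : Measure (Sp d × M)} [SigmaFinite ν] (hν : NoPosAtoms ν) (n : ℕ) :
    ∀ᵐ z ∂(Measure.pi fun _ : Fin n => ν), PosInj z := by
  have key : ∀ i j : Fin n, i ≠ j →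
      ∀ᵐ z ∂(Measure.pi fun _ : Fin n => ν), (z i).1 ≠ (z j).1 := by
    intro i j hij
    cases n with
    | zero => exact i.elim0
    | succ n =>
      obtain ⟨k, rfl⟩ := Fin.exists_succAbove_eq hij.symm
      have mp := measurePreserving_piFinSuccAbove (fun _ : Fin (n + 1) => ν) i
      have hm : MeasurableSet {p : (Sp d × M) × (Fin n → Sp d × M) | p.1.1 = (p.2 k).1} :=
        measurableSet_eq_fun (by fun_prop) (by fun_prop)
      have h0 : (ν.prod (Measure.pi fun _ : Fin n => ν))
          {p : (Sp d × M) × (Fin n → Sp d × M) | p.1.1 = (p.2 k).1} = 0 := by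
        rw [Measure.prod_apply_symm hm]
        refine lintegral_eq_zero_of_ae_eq_zero (Eventually.of_forall fun z => ?_)
        refine measure_mono_null ?_ (hν (z k).1)
        intro w hw
        exact ⟨hw, trivial⟩
      have h1 := mp.measure_preimage hm.nullMeasurableSet
      rw [h0] at h1
      exact measure_mono_null (fun z hz => by simpa [Fin.removeNth] using hz) h1
  have h2 : ∀ᵐ z ∂(Measure.pi fun _ : Fin n => ν), ∀ i j, i ≠ j → (z i).1 ≠ (z j).1 := by
    refine ae_all_iff.2 fun i => ae_all_iff.2 fun j => ?_
    by_cases hij : i = j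
    · simp [hij]
    · simpa [hij] using key i j hij
  filter_upwards [h2] with z hz i j hij
  by_contra hne
  exact hz i j hne hij

end Tuples

/-! ### Binomial point processes and their splitting along a measurable set. -/

section BinLaw

variable {d : ℕ} {M : Type*} [MeasurableSpace M]

/-- The (unnormalized) law of the set of `n` independent points distributed according to `ν`. -/
def binLaw (ν : Measure (Sp d × M)) (n : ℕ) : Measure (Set (Sp d × M)) :=
  (Measure.pi fun _ : Fin n => ν).map pointSet

instance (ν : Measure (Sp d × M)) [SigmaFinite ν] (n : ℕ) : SFinite (binLaw ν n) := by
  unfold binLaw; infer_instance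

instance (ν : Measure (Sp d × M)) [IsFiniteMeasure ν] (n : ℕ) : IsFiniteMeasure (binLaw ν n) := by
  unfold binLaw; infer_instance

instance (ν : Measure (Sp d × M)) [IsProbabilityMeasure ν] (n : ℕ) :
    IsProbabilityMeasure (binLaw ν n) := by
  unfold binLaw
  exact Measure.isProbabilityMeasure_map measurable_pointSet.aemeasurable

lemma lintegral_binLaw (ν : Measure (Sp d × M)) (n : ℕ) {F : Set (Sp d × M) → ℝ≥0∞}
    (hF : Measurable F) :
    ∫⁻ X, F X ∂(binLaw ν n) = ∫⁻ z, F (pointSet z) ∂(Measure.pi fun _ : Fin n => ν) :=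
  lintegral_map hF measurable_pointSet

lemma binLaw_univ (ν : Measure (Sp d × M)) [SigmaFinite ν] (n : ℕ) :
    binLaw ν n Set.univ = ν Set.univ ^ n := by
  rw [binLaw, Measure.map_apply measurable_pointSet MeasurableSet.univ]
  simp [Measure.pi_univ]

lemma ae_finite_binLaw (ν : Measure (Sp d × M)) (n : ℕ) : ∀ᵐ X ∂(binLaw ν n), X.Finite := by
  rw [binLaw, ae_map_iff measurable_pointSet.aemeasurable measurableSet_finite_config]
  exact Eventually.of_forall fun z => finite_pointSet z

/-- `pointSet` forgets the labelling, so only the cardinality of the index type matters. The index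
types needed below are subtypes of `Fin n`. -/
lemma binLaw_eq_map_pi {ι : Type*} [Fintype ι] (ν : Measure (Sp d × M)) [SigmaFinite ν] {n : ℕ}
    (h : Fintype.card ι = n) : (Measure.pi fun _ : ι => ν).map pointSet = binLaw ν n := by
  subst h
  have mp := measurePreserving_piCongrLeft (α := fun _ : ι => Sp d × M) (fun _ : ι => ν)
    (Fintype.equivFin ι).symm
  rw [← mp.map_eq, Measure.map_map measurable_pointSet mp.measurable, binLaw]
  congr 1
  ext1 z
  simp only [Function.comp_apply]
  rw [← pointSet_comp_equiv (Fintype.equivFin ι).symm]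
  congr 1
  ext1 i
  simp [MeasurableEquiv.coe_piCongrLeft, Equiv.piCongrLeft_apply_apply]

/-- On the cell where exactly the indices in `A` fall into `B`, the restricted product measure is a
product of restrictions, and the two groups of coordinates yield the points in `B` and off `B`. -/
lemma binLaw_split_cell (ν : Measure (Sp d × M)) [IsFiniteMeasure ν] (hν : NoPosAtoms ν)
    {B : Set (Sp d × M)} (hB : MeasurableSet B) (n : ℕ) (A : Finset (Fin n)) :
    ((Measure.pi fun _ : Fin n => ν).restrict
        (Set.univ.pi fun i => if i ∈ A then B else Bᶜ)).map
        (fun z => (pointSet z ∩ B, pointSet z \ B))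
      = (binLaw (ν.restrict B) A.card).prod (binLaw (ν.restrict Bᶜ) (n - A.card)) := by
  have hB' : ∀ i : Fin n, MeasurableSet (if i ∈ A then B else Bᶜ) := fun i => by
    split_ifs
    · exact hB
    · exact hB.compl
  have mp := measurePreserving_piEquivPiSubtypeProd (α := fun _ : Fin n => Sp d × M)
    (fun i : Fin n => ν.restrict (if i ∈ A then B else Bᶜ)) (fun i => i ∈ A)
  have e1 : (fun i : {i // i ∈ A} => ν.restrict (if (i : Fin n) ∈ A then B else Bᶜ))
      = fun _ => ν.restrict B := by
    ext1 i; rw [if_pos i.2]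
  have e2 : (fun i : {i // i ∉ A} => ν.restrict (if (i : Fin n) ∈ A then B else Bᶜ))
      = fun _ => ν.restrict Bᶜ := by
    ext1 i; rw [if_neg i.2]
  rw [e1, e2] at mp
  have c1 : Fintype.card {i // i ∈ A} = A.card := by simp
  have c2 : Fintype.card {i // i ∉ A} = n - A.card := by
    simp [Fintype.card_subtype_compl]
  rw [← binLaw_eq_map_pi (ν.restrict B) c1, ← binLaw_eq_map_pi (ν.restrict Bᶜ) c2,
    Measure.map_prod_map _ _ measurable_pointSet measurable_pointSet]
  have hmp : (Measure.pi fun _ : {i // i ∈ A} => ν.restrict B).prod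
      (Measure.pi fun _ : {i // i ∉ A} => ν.restrict Bᶜ)
      = (Measure.pi fun i : Fin n => ν.restrict (if i ∈ A then B else Bᶜ)).map
        (MeasurableEquiv.piEquivPiSubtypeProd (fun _ : Fin n => Sp d × M) fun i => i ∈ A) := by
    convert mp.map_eq.symm
  rw [hmp, Measure.map_map (measurable_pointSet.prodMap measurable_pointSet) mp.measurable,
    ← Measure.restrict_pi_pi]
  refine Measure.map_congr ?_
  have hinj := ae_restrict_of_ae (s := Set.univ.pi fun i => if i ∈ A then B else Bᶜ)
    (ae_posInj hν n)
  filter_upwards [hinj, ae_restrict_mem (MeasurableSet.univ_pi hB')] with z hz hzA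
  have hzA' : ∀ i, z i ∈ B ↔ i ∈ A := by
    intro i
    have := hzA i trivial
    by_cases hi : i ∈ A <;> simp_all
  have h1 : pointSet (fun i : {i // i ∈ A} => z i) = Set.range fun i : {i // i ∈ A} => z i :=
    pointSet_of_posInj (hz.comp Subtype.val_injective)
  have h2 : pointSet (fun i : {i // i ∉ A} => z i) = Set.range fun i : {i // i ∉ A} => z i :=
    pointSet_of_posInj (hz.comp Subtype.val_injective)
  have h3 : (Prod.map pointSet pointSet ∘
      (MeasurableEquiv.piEquivPiSubtypeProd (fun _ : Fin n => Sp d × M) fun i => i ∈ A)) z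
      = (pointSet (fun i : {i // i ∈ A} => z i), pointSet (fun i : {i // i ∉ A} => z i)) := rfl
  rw [h3, h1, h2, pointSet_of_posInj hz]
  refine Prod.ext ?_ ?_
  · ext w
    simp only [Set.mem_inter_iff, Set.mem_range, Subtype.exists]
    constructor
    · rintro ⟨⟨i, rfl⟩, hi⟩
      exact ⟨i, (hzA' i).1 hi, rfl⟩
    · rintro ⟨i, hi, rfl⟩
      exact ⟨⟨i, rfl⟩, (hzA' i).2 hi⟩
  · ext w
    simp only [Set.mem_sdiff, Set.mem_range, Subtype.exists]
    constructor
    · rintro ⟨⟨i, rfl⟩, hi⟩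
      exact ⟨i, fun h => hi ((hzA' i).2 h), rfl⟩
    · rintro ⟨i, hi, rfl⟩
      exact ⟨⟨i, rfl⟩, fun h => hi ((hzA' i).1 h)⟩

/-- Splitting the points of a binomial process according to a measurable set. -/
lemma binLaw_split (ν : Measure (Sp d × M)) [IsFiniteMeasure ν] (hν : NoPosAtoms ν)
    {B : Set (Sp d × M)} (hB : MeasurableSet B) (n : ℕ) {F : Set (Sp d × M) × Set (Sp d × M) → ℝ≥0∞}
    (hF : Measurable F) :
    ∫⁻ X, F (X ∩ B, X \ B) ∂(binLaw ν n)
      = ∑ j ∈ Finset.range (n + 1), (n.choose j : ℝ≥0∞) *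
        ∫⁻ p, F p ∂((binLaw (ν.restrict B) j).prod (binLaw (ν.restrict Bᶜ) (n - j))) := by
  have hm : Measurable fun X : Set (Sp d × M) => (X ∩ B, X \ B) :=
    (measurable_config_inter hB).prodMk (measurable_config_diff hB)
  have hm' : Measurable fun z : Fin n → Sp d × M => (pointSet z ∩ B, pointSet z \ B) :=
    hm.comp measurable_pointSet
  have hcell : ∀ A : Finset (Fin n), MeasurableSet
      (Set.univ.pi fun i : Fin n => if i ∈ A then B else Bᶜ) := fun A =>
    MeasurableSet.univ_pi fun i => by
      split_ifs
      · exact hB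
      · exact hB.compl
  rw [lintegral_binLaw ν n (F := fun X => F (X ∩ B, X \ B)) (hF.comp hm)]
  -- Each tuple lies in the cell given by the set of indices `i` with `z i ∈ B`.
  have hU : (Set.univ : Set (Fin n → Sp d × M))
      = ⋃ A ∈ (Finset.univ : Finset (Finset (Fin n))),
        Set.univ.pi fun i : Fin n => if i ∈ A then B else Bᶜ := by
    classical
    refine (Set.eq_univ_of_forall fun z => ?_).symm
    simp only [Finset.mem_univ, Set.iUnion_true, Set.mem_iUnion]
    refine ⟨Finset.univ.filter fun i => z i ∈ B, fun i _ => ?_⟩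
    by_cases h : z i ∈ B <;> simp [h]
  have hd : (↑(Finset.univ : Finset (Finset (Fin n))) : Set (Finset (Fin n))).PairwiseDisjoint
      (fun A => Set.univ.pi fun i : Fin n => if i ∈ A then B else Bᶜ) := by
    intro A _ A' _ hne
    refine Set.disjoint_left.2 fun z hz hz' => hne ?_
    ext i
    have h1 := hz i trivial
    have h2 := hz' i trivial
    by_cases hi : i ∈ A <;> by_cases hi' : i ∈ A' <;> simp_all
  rw [← setLIntegral_univ, hU, lintegral_biUnion_finset hd (fun A _ => hcell A)]
  have hA : ∀ A : Finset (Fin n), ∫⁻ z in Set.univ.pi fun i : Fin n => if i ∈ A then B else Bᶜ,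
      F (pointSet z ∩ B, pointSet z \ B) ∂(Measure.pi fun _ : Fin n => ν)
      = ∫⁻ p, F p ∂((binLaw (ν.restrict B) A.card).prod
          (binLaw (ν.restrict Bᶜ) (n - A.card))) := by
    intro A
    rw [← binLaw_split_cell ν hν hB n A, lintegral_map hF hm']
  simp_rw [hA]
  -- The integral over a cell depends only on the size of its index set; grouping by size produces
  -- the binomial coefficients.
  have := Finset.sum_powerset_apply_card (fun j => ∫⁻ p, F p ∂((binLaw (ν.restrict B) j).prod
          (binLaw (ν.restrict Bᶜ) (n - j)))) (x := (Finset.univ : Finset (Fin n)))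
  rw [Finset.powerset_univ] at this
  rw [this]
  simp [nsmul_eq_mul]

end BinLaw

/-! ### Insertion, extraction, mapping and reweighting of points. -/

section BinLawOps

variable {d : ℕ} {M : Type*} [MeasurableSpace M]

open Classical in
lemma measurable_encard_section_ite {α β : Type*} [MeasurableSpace α] [MeasurableSpace β]
    {C : Set (α × β)} (hC : MeasurableSet C) :
    Measurable fun q : β × Set α =>
      if q.2.Finite then (q.2 ∩ {w | (w, q.1) ∈ C}).encard else 0 := by
  have hS : MeasurableSet {q : β × Set α | q.2.Finite} :=
    measurable_snd measurableSet_finite_config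
  refine measurable_of_restrict_of_restrict_compl hS ?_ ?_
  · have : {q : β × Set α | q.2.Finite}.domRestrict (fun q : β × Set α =>
        if q.2.Finite then (q.2 ∩ {w | (w, q.1) ∈ C}).encard else 0)
        = (fun q : β × {X : Set α // X.Finite} => (q.2.1 ∩ {w | (w, q.1) ∈ C}).encard) ∘
          fun q : {q : β × Set α | q.2.Finite} => (q.1.1, ⟨q.1.2, q.2⟩) := by
      ext1 q
      exact if_pos q.2
    rw [this]
    refine (measurable_encard_section hC).comp ?_
    exact (measurable_fst.comp measurable_subtype_coe).prodMk
      ((measurable_snd.comp measurable_subtype_coe).subtype_mk)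
  · have : {q : β × Set α | q.2.Finite}ᶜ.domRestrict (fun q : β × Set α =>
        if q.2.Finite then (q.2 ∩ {w | (w, q.1) ∈ C}).encard else 0) = fun _ => 0 := by
      ext1 q
      exact if_neg q.2
    rw [this]
    exact measurable_const

/-- The pairs of a point and a finite configuration without points above the same position. -/
def FreshPairs (d : ℕ) (M : Type*) : Set ((Sp d × M) × Set (Sp d × M)) :=
  {p | p.2.Finite ∧ p.2 ∩ ({p.1.1} ×ˢ Set.univ) = ∅}

/-- The number of points sharing the position of `p.1` is a count in a section of the set of pairs
with equal positions. Positions, unlike marks, have a measurable diagonal. -/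
lemma measurableSet_freshPairs : MeasurableSet (FreshPairs d M) := by
  classical
  have hC : MeasurableSet {p : (Sp d × M) × (Sp d × M) | p.1.1 = p.2.1} :=
    measurableSet_eq_fun (by fun_prop) (by fun_prop)
  have h := measurable_encard_section_ite hC
  have : FreshPairs d M = {p | p.2.Finite} ∩ (fun q : (Sp d × M) × Set (Sp d × M) =>
      if q.2.Finite then (q.2 ∩ {w | (w, q.1) ∈ {p : (Sp d × M) × (Sp d × M) | p.1.1 = p.2.1}}).encard
        else 0) ⁻¹' {0} := by
    ext p
    simp only [FreshPairs, Set.mem_ofPred_eq, Set.mem_inter_iff, Set.mem_preimage,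
      Set.mem_singleton_iff]
    refine and_congr_right fun hp => ?_
    rw [if_pos hp, Set.encard_eq_zero]
    have : ({p.1.1} ×ˢ Set.univ : Set (Sp d × M)) = {w | w.1 = p.1.1} := by
      ext w; simp
    rw [this]
  rw [this]
  exact (measurable_snd measurableSet_finite_config).inter (h (measurableSet_singleton _))

open Classical in
/-- Insertion of a point into a configuration, made measurable by a convention off `FreshPairs`. -/
def ins (w : Sp d × M) (X : Set (Sp d × M)) : Set (Sp d × M) :=
  if (w, X) ∈ FreshPairs d M then insert w X else ∅

lemma ins_of_mem {w : Sp d × M} {X : Set (Sp d × M)} (h : (w, X) ∈ FreshPairs d M) :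
    ins w X = insert w X := if_pos h

lemma notMem_of_mem_freshPairs {w : Sp d × M} {X : Set (Sp d × M)} (h : (w, X) ∈ FreshPairs d M) :
    w ∉ X := fun hw => by
  have : w ∈ X ∩ ({w.1} ×ˢ Set.univ) := ⟨hw, rfl, trivial⟩
  rw [h.2] at this
  exact this

lemma finite_ins (w : Sp d × M) (X : Set (Sp d × M)) : (ins w X).Finite := by
  unfold ins
  split_ifs with h
  · exact h.1.insert w
  · exact Set.finite_empty

lemma measurable_ins : Measurable fun p : (Sp d × M) × Set (Sp d × M) => ins p.1 p.2 := by
  classical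
  refine measurable_config_iff.2 fun B hB => ?_
  have : (fun p : (Sp d × M) × Set (Sp d × M) => (ins p.1 p.2 ∩ B).encard)
      = (FreshPairs d M).piecewise
        (fun p => (if p.1 ∈ B then 1 else 0) + (p.2 ∩ B).encard) fun _ => 0 := by
    ext p : 1
    by_cases h : p ∈ FreshPairs d M
    · rw [Set.piecewise_eq_of_mem _ _ _ h, ins_of_mem h]
      by_cases hB : p.1 ∈ B
      · rw [Set.insert_inter_of_mem hB, Set.encard_insert_of_notMem, if_pos hB, add_comm]
        exact fun h' => notMem_of_mem_freshPairs h h'.1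
      · rw [Set.insert_inter_of_notMem hB, if_neg hB, zero_add]
    · rw [Set.piecewise_eq_of_notMem _ _ _ h]
      simp [ins, h]
  rw [this]
  refine Measurable.piecewise measurableSet_freshPairs (measurable_add_enat ?_ ?_) measurable_const
  · exact Measurable.ite (measurable_fst hB) measurable_const measurable_const
  · exact (measurable_encard_inter hB).comp measurable_snd

lemma ae_inter_eq_empty_binLaw {ν : Measure (Sp d × M)} [SigmaFinite ν] (hν : NoPosAtoms ν) (n : ℕ)
    (x : Sp d) : ∀ᵐ X ∂(binLaw ν n), X ∩ ({x} ×ˢ Set.univ) = ∅ := by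
  have hm : MeasurableSet ({x} ×ˢ Set.univ : Set (Sp d × M)) :=
    (measurableSet_singleton x).prod MeasurableSet.univ
  rw [binLaw, ae_map_iff measurable_pointSet.aemeasurable (measurableSet_inter_eq_empty hm)]
  have h : ∀ i : Fin n, ∀ᵐ z ∂(Measure.pi fun _ : Fin n => ν), z i ∉ ({x} ×ˢ Set.univ : Set _) := by
    intro i
    exact (Measure.tendsto_eval_ae_ae (μ := fun _ : Fin n => ν) (i := i)).eventually
      (measure_eq_zero_iff_ae_notMem.1 (hν x) : ∀ᵐ w ∂ν, w ∉ ({x} ×ˢ Set.univ : Set _))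
  filter_upwards [ae_all_iff.2 h] with z hz
  refine Set.eq_empty_of_forall_notMem fun w hw => ?_
  by_cases hinj : PosInj z
  · rw [pointSet_of_posInj hinj] at hw
    obtain ⟨⟨i, rfl⟩, h2⟩ := hw
    exact hz i h2
  · simp [pointSet, hinj] at hw

lemma ae_mem_freshPairs {ν ν' : Measure (Sp d × M)} [SigmaFinite ν] (hν : NoPosAtoms ν) (n : ℕ) :
    ∀ᵐ p ∂(ν'.prod (binLaw ν n)), p ∈ FreshPairs d M := by
  rw [Measure.ae_prod_mem_iff_ae_ae_mem measurableSet_freshPairs]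
  refine Eventually.of_forall fun w => ?_
  filter_upwards [ae_finite_binLaw ν n, ae_inter_eq_empty_binLaw hν n w.1] with X h1 h2
  exact ⟨h1, h2⟩

/-- Extraction of one point from a family of independent points. -/
lemma lintegral_pi_extract (ν : Measure (Sp d × M)) [SigmaFinite ν] (n : ℕ) (i : Fin (n + 1))
    {F : (Sp d × M) × Set (Sp d × M) → ℝ≥0∞} (hF : Measurable F) :
    ∫⁻ z, F (z i, pointSet (i.removeNth z)) ∂(Measure.pi fun _ : Fin (n + 1) => ν)
      = ∫⁻ p, F p ∂(ν.prod (binLaw ν n)) := by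
  have mp := measurePreserving_piFinSuccAbove (fun _ : Fin (n + 1) => ν) i
  have hm : Measurable fun p : (Sp d × M) × (Fin n → Sp d × M) => (p.1, pointSet p.2) :=
    measurable_fst.prodMk (measurable_pointSet.comp measurable_snd)
  have e : ν.prod (binLaw ν n) = (ν.prod (Measure.pi fun _ : Fin n => ν)).map
      (fun p : (Sp d × M) × (Fin n → Sp d × M) => (p.1, pointSet p.2)) := by
    have := Measure.map_prod_map ν (Measure.pi fun _ : Fin n => ν) measurable_id
      (measurable_pointSet (d := d) (M := M) (ι := Fin n))
    rw [Measure.map_id] at this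
    exact this
  rw [e, lintegral_map hF hm]
  exact mp.lintegral_comp (hF.comp hm)

lemma pointSet_eq_ins {n : ℕ} {z : Fin (n + 1) → Sp d × M} (h : PosInj z) (i : Fin (n + 1)) :
    pointSet z = ins (z i) (pointSet (i.removeNth z)) := by
  have h' : PosInj (i.removeNth z) := h.comp Fin.succAbove_right_injective
  have hf : (z i, pointSet (i.removeNth z)) ∈ FreshPairs d M := by
    refine ⟨finite_pointSet _, Set.eq_empty_of_forall_notMem ?_⟩
    rintro w ⟨hw, hw1, -⟩
    rw [pointSet_of_posInj h'] at hw
    obtain ⟨j, rfl⟩ := hw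
    exact Fin.succAbove_ne i j (h hw1)
  rw [ins_of_mem hf, pointSet_of_posInj h, pointSet_of_posInj h']
  ext w
  simp only [Set.mem_range, Set.mem_insert_iff, Fin.exists_iff_succAbove i, Fin.removeNth]
  exact or_congr_left eq_comm

/-- Transfers almost sure statements and integrals from `n + 1` points to `n` points together with
an independent inserted one, which is the situation of two points seeing each other. -/
lemma binLaw_succ {ν : Measure (Sp d × M)} [SigmaFinite ν] (hν : NoPosAtoms ν) (n : ℕ) :
    binLaw ν (n + 1) = (ν.prod (binLaw ν n)).map fun p => ins p.1 p.2 := by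
  refine Measure.ext_of_lintegral _ fun F hF => ?_
  rw [lintegral_map hF measurable_ins, lintegral_binLaw ν _ hF,
    ← lintegral_pi_extract ν n 0 (F := fun p => F (ins p.1 p.2)) (hF.comp measurable_ins)]
  refine lintegral_congr_ae ?_
  filter_upwards [ae_posInj hν (n + 1)] with z hz
  rw [← pointSet_eq_ins hz 0]

/-- Action of a map of positions on marked points. -/
def posMap (e : Sp d → Sp d) (w : Sp d × M) : Sp d × M := (e w.1, w.2)

lemma measurable_posMap {e : Sp d → Sp d} (he : Measurable e) :
    Measurable (posMap e : Sp d × M → Sp d × M) :=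
  (he.comp measurable_fst).prodMk measurable_snd

lemma posMap_injective {e : Sp d → Sp d} (he : Function.Injective e) :
    Function.Injective (posMap e : Sp d × M → Sp d × M) := by
  rintro ⟨a, b⟩ ⟨a', b'⟩ h
  simp only [posMap, Prod.mk.injEq] at h
  rw [he h.1, h.2]

lemma pointSet_posMap {ι : Type*} {e : Sp d → Sp d} (he : Function.Injective e)
    (z : ι → Sp d × M) : pointSet (fun i => posMap e (z i)) = posMap e '' pointSet z := by
  by_cases h : PosInj z
  · have h' : PosInj fun i => posMap e (z i) := fun i j hij => h (he hij)
    rw [pointSet_of_posInj h, pointSet_of_posInj h', ← Set.range_comp]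
    rfl
  · have h' : ¬ PosInj fun i => posMap e (z i) := fun h' => h fun i j hij =>
      h' (congrArg e hij)
    simp [pointSet, h, h']

lemma binLaw_map {e : Sp d → Sp d} (he : Measurable e) (hi : Function.Injective e)
    (ν : Measure (Sp d × M)) [IsFiniteMeasure ν] (n : ℕ) :
    binLaw (ν.map (posMap e)) n = (binLaw ν n).map fun X => posMap e '' X := by
  have hpi : Measurable fun (z : Fin n → Sp d × M) (i : Fin n) => (posMap e (z i) : Sp d × M) :=
    measurable_pi_iff.2 fun i => (measurable_posMap he).comp (measurable_pi_apply i)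
  rw [binLaw, binLaw, Measure.map_map
    (measurable_config_image (measurable_posMap he) (posMap_injective hi)) measurable_pointSet,
    ← Measure.pi_map_pi (fun _ => (measurable_posMap he).aemeasurable),
    Measure.map_map measurable_pointSet hpi]
  congr 1
  ext1 z
  exact pointSet_posMap hi z

lemma pi_smul_const (ν : Measure (Sp d × M)) [IsFiniteMeasure ν] {c : ℝ≥0∞} (hc : c ≠ ∞) (n : ℕ) :
    (Measure.pi fun _ : Fin n => c • ν) = c ^ n • Measure.pi fun _ : Fin n => ν := by
  have : IsFiniteMeasure (c • ν) := ν.smul_finite hc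
  refine Measure.pi_eq fun s _ => ?_
  simp [Finset.prod_mul_distrib]

lemma binLaw_smul (ν : Measure (Sp d × M)) [IsFiniteMeasure ν] {c : ℝ≥0∞} (hc : c ≠ ∞) (n : ℕ) :
    binLaw (c • ν) n = c ^ n • binLaw ν n := by
  rw [binLaw, pi_smul_const ν hc, Measure.map_smul, binLaw]

lemma lintegral_pi_prod {α : Type*} [MeasurableSpace α] (ν : Measure α) [SigmaFinite ν] (n : ℕ)
    {g : Fin n → α → ℝ≥0∞} (hg : ∀ i, Measurable (g i)) :
    ∫⁻ z, ∏ i, g i (z i) ∂(Measure.pi fun _ : Fin n => ν) = ∏ i, ∫⁻ w, g i w ∂ν := by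
  induction n with
  | zero => simp
  | succ n ih =>
    have mp := measurePreserving_piFinSuccAbove (fun _ : Fin (n + 1) => ν) 0
    have hm : Measurable fun p : α × (Fin n → α) => g 0 p.1 * ∏ i : Fin n, g i.succ (p.2 i) := by
      refine ((hg 0).comp measurable_fst).mul (Finset.measurable_prod _ fun i _ => ?_)
      exact (hg _).comp ((measurable_pi_apply i).comp measurable_snd)
    have h1 := mp.lintegral_comp hm
    have h2 : Measurable fun z : Fin n → α => ∏ i : Fin n, g i.succ (z i) :=
      Finset.measurable_prod _ fun i _ => (hg _).comp (measurable_pi_apply i)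
    rw [Fin.prod_univ_succ, ← ih (fun i => hg i.succ), ← lintegral_prod_mul (hg 0).aemeasurable
      h2.aemeasurable, ← h1]
    refine lintegral_congr fun z => ?_
    rw [Fin.prod_univ_succ]
    rfl

lemma pi_withDensity {α : Type*} [MeasurableSpace α] (ν : Measure α) [SigmaFinite ν] (n : ℕ)
    {h : α → ℝ≥0} (hh : Measurable h) :
    (Measure.pi fun _ : Fin n => ν.withDensity fun w => (h w : ℝ≥0∞))
      = (Measure.pi fun _ : Fin n => ν).withDensity fun z => ∏ i, (h (z i) : ℝ≥0∞) := by
  have hh' : Measurable fun w => (h w : ℝ≥0∞) := hh.coe_nnreal_ennreal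
  have : SigmaFinite (ν.withDensity fun w => (h w : ℝ≥0∞)) := inferInstance
  refine Measure.pi_eq fun s hs => ?_
  rw [withDensity_apply _ (MeasurableSet.univ_pi hs), ← lintegral_indicator (MeasurableSet.univ_pi hs)]
  simp_rw [withDensity_apply _ (hs _), ← lintegral_indicator (hs _)]
  rw [← lintegral_pi_prod ν n fun i => hh'.indicator (hs i)]
  refine lintegral_congr fun z => ?_
  by_cases hz : z ∈ Set.univ.pi s
  · rw [Set.indicator_of_mem hz]
    exact Finset.prod_congr rfl fun i _ => 
      (Set.indicator_of_mem (hz i trivial) fun w => (h w : ℝ≥0∞)).symm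
  · rw [Set.indicator_of_notMem hz]
    simp only [Set.mem_pi, Set.mem_univ, forall_true_left, not_forall] at hz
    obtain ⟨i, hi⟩ := hz
    exact (Finset.prod_eq_zero (Finset.mem_univ i) (Set.indicator_of_notMem hi _)).symm

/-- Moves the density from the law into the integrand, so that dominated convergence can be used
over a fixed product measure. -/
lemma lintegral_binLaw_withDensity (ν : Measure (Sp d × M)) [SigmaFinite ν] (n : ℕ)
    {h : Sp d × M → ℝ≥0} (hh : Measurable h) {F : Set (Sp d × M) → ℝ≥0∞} (hF : Measurable F) :
    ∫⁻ X, F X ∂(binLaw (ν.withDensity fun w => (h w : ℝ≥0∞)) n)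
      = ∫⁻ z, (∏ i, (h (z i) : ℝ≥0∞)) * F (pointSet z) ∂(Measure.pi fun _ : Fin n => ν) := by
  have h1 : Measurable fun z : Fin n → Sp d × M => ∏ i, (h (z i) : ℝ≥0∞) :=
    Finset.measurable_prod _ fun i _ => (hh.comp (measurable_pi_apply i)).coe_nnreal_ennreal
  rw [lintegral_binLaw _ _ hF, pi_withDensity ν n hh]
  exact lintegral_withDensity_eq_lintegral_mul _ h1 (hF.comp measurable_pointSet)

end BinLawOps

/-! ### Poisson laws of finite intensity as mixtures of binomial laws. -/

section PoisLaw

variable {d : ℕ} {M : Type*} [MeasurableSpace M]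

/-- The law of a Poisson process with finite intensity measure `ν`. -/
def poisLaw (ν : Measure (Sp d × M)) : Measure (Set (Sp d × M)) :=
  Measure.sum fun n : ℕ => ENNReal.ofReal (Real.exp (-(ν Set.univ).toReal) / n !) • binLaw ν n

lemma lintegral_poisLaw (ν : Measure (Sp d × M)) (F : Set (Sp d × M) → ℝ≥0∞) :
    ∫⁻ X, F X ∂(poisLaw ν) = ∑' n : ℕ, ENNReal.ofReal (Real.exp (-(ν Set.univ).toReal) / n !) *
      ∫⁻ X, F X ∂(binLaw ν n) := by
  rw [poisLaw, lintegral_sum_measure]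
  simp_rw [lintegral_smul_measure, smul_eq_mul]

lemma tsum_mul_tsum_antidiagonal (a b : ℕ → ℝ≥0∞) :
    (∑' j, a j) * ∑' k, b k = ∑' n, ∑ j ∈ Finset.range (n + 1), a j * b (n - j) := by
  rw [← ENNReal.tsum_mul_right]
  simp_rw [← ENNReal.tsum_mul_left]
  rw [← ENNReal.tsum_prod, ← Equiv.tsum_eq (Finset.HasAntidiagonal.sigmaAntidiagonalEquivProd (A := ℕ))
    (fun p : ℕ × ℕ => a p.1 * b p.2), ENNReal.tsum_sigma']
  refine tsum_congr fun n => ?_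
  rw [tsum_fintype, ← Finset.Nat.sum_antidiagonal_eq_sum_range_succ (fun i j => a i * b j) n,
    ← Finset.sum_coe_sort (Finset.HasAntidiagonal.antidiagonal n) (fun ij => a ij.1 * b ij.2)]
  rfl

lemma tsum_poisson_weights {v : ℝ≥0∞} (hv : v ≠ ∞) :
    ∑' n : ℕ, ENNReal.ofReal (Real.exp (-v.toReal) / n !) * v ^ n = 1 := by
  have h := hasSum_one_poissonMeasure v.toNNReal
  have h2 : ∀ n : ℕ, ENNReal.ofReal (Real.exp (-v.toReal) / n !) * v ^ n
      = ENNReal.ofReal (Real.exp (-(v.toNNReal : ℝ)) * (v.toNNReal : ℝ) ^ n / n !) := by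
    intro n
    have : v ^ n = ENNReal.ofReal (v.toReal ^ n) := by
      rw [ENNReal.ofReal_pow ENNReal.toReal_nonneg, ENNReal.ofReal_toReal hv]
    rw [this, ← ENNReal.ofReal_mul (by positivity)]
    congr 1
    simp only [ENNReal.coe_toNNReal_eq_toReal]
    ring
  simp_rw [h2]
  rw [← ENNReal.ofReal_tsum_of_nonneg (fun n => by positivity) h.summable, h.tsum_eq,
    ENNReal.ofReal_one]

instance (ν : Measure (Sp d × M)) [IsFiniteMeasure ν] : IsProbabilityMeasure (poisLaw ν) := by
  constructor
  have := lintegral_poisLaw ν fun _ => 1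
  rw [lintegral_const, one_mul] at this
  rw [this]
  simp_rw [lintegral_const, one_mul, binLaw_univ]
  exact tsum_poisson_weights (measure_ne_top ν _)

lemma ae_poisLaw_of_forall {ν : Measure (Sp d × M)} {p : Set (Sp d × M) → Prop}
    (h : ∀ n, ∀ᵐ X ∂(binLaw ν n), p X) : ∀ᵐ X ∂(poisLaw ν), p X := by
  rw [poisLaw, Measure.ae_sum_iff]
  exact fun n => Measure.ae_smul_measure (h n) _

/-- Restrictions of a Poisson process to complementary sets are independent. After `binLaw_split`
the mixture is a Cauchy product, because `exp(-ν) / n!` times `choose n j` is the weight of `j`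
points in `B` times the weight of `n - j` points off `B`. -/
lemma poisLaw_split {ν : Measure (Sp d × M)} [IsFiniteMeasure ν] (hν : NoPosAtoms ν)
    {B : Set (Sp d × M)} (hB : MeasurableSet B) {G G' : Set (Sp d × M) → ℝ≥0∞}
    (hG : Measurable G) (hG' : Measurable G') :
    ∫⁻ X, G (X ∩ B) * G' (X \ B) ∂(poisLaw ν)
      = (∫⁻ X, G X ∂(poisLaw (ν.restrict B))) * ∫⁻ X, G' X ∂(poisLaw (ν.restrict Bᶜ)) := by
  simp_rw [lintegral_poisLaw]
  rw [tsum_mul_tsum_antidiagonal]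
  refine tsum_congr fun n => ?_
  have hF : Measurable fun p : Set (Sp d × M) × Set (Sp d × M) => G p.1 * G' p.2 :=
    (hG.comp measurable_fst).mul (hG'.comp measurable_snd)
  rw [binLaw_split ν hν hB n hF, Finset.mul_sum]
  refine Finset.sum_congr rfl fun j hj => ?_
  rw [lintegral_prod_mul hG.aemeasurable hG'.aemeasurable]
  have hj' : j ≤ n := Nat.lt_succ_iff.1 (Finset.mem_range.1 hj)
  have hc : ENNReal.ofReal (Real.exp (-(ν Set.univ).toReal) / n !) * (n.choose j : ℝ≥0∞)
      = ENNReal.ofReal (Real.exp (-((ν.restrict B) Set.univ).toReal) / j !) *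
        ENNReal.ofReal (Real.exp (-((ν.restrict Bᶜ) Set.univ).toReal) / (n - j)!) := by
    rw [← ENNReal.ofReal_natCast, ← ENNReal.ofReal_mul (by positivity),
      ← ENNReal.ofReal_mul (by positivity)]
    congr 1
    have hs : (ν Set.univ).toReal
        = ((ν.restrict B) Set.univ).toReal + ((ν.restrict Bᶜ) Set.univ).toReal := by
      rw [← ENNReal.toReal_add (measure_ne_top _ _) (measure_ne_top _ _),
        Measure.restrict_apply_univ, Measure.restrict_apply_univ, measure_add_measure_compl hB]
    rw [hs, neg_add, Real.exp_add, Nat.cast_choose ℝ hj']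
    field_simp
  calc _ = (ENNReal.ofReal (Real.exp (-(ν Set.univ).toReal) / n !) * (n.choose j : ℝ≥0∞)) *
        ((∫⁻ X, G X ∂(binLaw (ν.restrict B) j)) *
          ∫⁻ X, G' X ∂(binLaw (ν.restrict Bᶜ) (n - j))) := by ring
    _ = _ := by rw [hc]; ring

lemma ae_encard_binLaw {ν : Measure (Sp d × M)} [SigmaFinite ν] (hν : NoPosAtoms ν) (n : ℕ) :
    ∀ᵐ X ∂(binLaw ν n), X.encard = (n : ℕ∞) := by
  have hm : MeasurableSet {X : Set (Sp d × M) | X.encard = n} :=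
    measurable_encard (measurableSet_singleton (n : ℕ∞))
  rw [binLaw, ae_map_iff measurable_pointSet.aemeasurable hm]
  filter_upwards [ae_posInj hν n] with z hz
  have := encard_range_inter hz Set.univ
  simpa [pointSet_of_posInj hz] using this

/-- The number of points of the Poisson process has a Poisson distribution. -/
lemma poisLaw_map_encard {ν : Measure (Sp d × M)} [IsFiniteMeasure ν] (hν : NoPosAtoms ν) :
    (poisLaw ν).map Set.encard
      = (poissonMeasure (ν Set.univ).toNNReal).map (fun k : ℕ => (k : ℕ∞)) := by
  refine Measure.ext_of_singleton fun k => ?_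
  have hk : Measurable fun X : Set (Sp d × M) => ({k} : Set ℕ∞).indicator (fun _ => (1 : ℝ≥0∞)) X.encard :=
    (Measurable.of_discrete (f := ({k} : Set ℕ∞).indicator fun _ => (1 : ℝ≥0∞))).comp
      measurable_encard
  have h1 : (poisLaw ν).map Set.encard {k}
      = ∑' n : ℕ, ENNReal.ofReal (Real.exp (-(ν Set.univ).toReal) / n !) *
        (ν Set.univ ^ n * ({k} : Set ℕ∞).indicator (fun _ => (1 : ℝ≥0∞)) n) := by
    rw [← setLIntegral_one, ← lintegral_indicator (measurableSet_singleton k),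
      lintegral_map (Measurable.of_discrete) measurable_encard, lintegral_poisLaw]
    refine tsum_congr fun n => ?_
    congr 1
    have : ∫⁻ X, ({k} : Set ℕ∞).indicator (fun _ => (1 : ℝ≥0∞)) X.encard ∂(binLaw ν n)
        = ∫⁻ _, ({k} : Set ℕ∞).indicator (fun _ => (1 : ℝ≥0∞)) n ∂(binLaw ν n) := by
      refine lintegral_congr_ae ?_
      filter_upwards [ae_encard_binLaw hν n] with X hX
      rw [hX]
    rw [this, lintegral_const, binLaw_univ, mul_comm]
  have h2 : (poissonMeasure (ν Set.univ).toNNReal).map (fun k : ℕ => (k : ℕ∞)) {k}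
      = ∑' n : ℕ, ENNReal.ofReal (Real.exp (-(ν Set.univ).toReal) / n !) *
        (ν Set.univ ^ n * ({k} : Set ℕ∞).indicator (fun _ => (1 : ℝ≥0∞)) n) := by
    rw [← setLIntegral_one, ← lintegral_indicator (measurableSet_singleton k),
      lintegral_map (Measurable.of_discrete) (Measurable.of_discrete), lintegral_countable']
    refine tsum_congr fun n => ?_
    rw [poissonMeasure_singleton, mul_comm, ← mul_assoc]
    congr 1
    have : ν Set.univ ^ n = ENNReal.ofReal ((ν Set.univ).toReal ^ n) := by
      rw [ENNReal.ofReal_pow ENNReal.toReal_nonneg, ENNReal.ofReal_toReal (measure_ne_top _ _)]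
    rw [this, ← ENNReal.ofReal_mul (by positivity)]
    congr 1
    simp only [ENNReal.coe_toNNReal_eq_toReal]
    ring
  rw [h1, h2]

/-- Counts in disjoint sets are independent under `poisLaw`. -/
lemma lintegral_prod_counts_poisLaw {ι : Type*} (s : Finset ι) {B : ι → Set (Sp d × M)}
    (hB : ∀ i, MeasurableSet (B i)) (hd : Pairwise fun i j => Disjoint (B i) (B j))
    (g : ι → ℕ∞ → ℝ≥0∞) {ν : Measure (Sp d × M)} [IsFiniteMeasure ν] (hν : NoPosAtoms ν) :
    ∫⁻ X, ∏ i ∈ s, g i (X ∩ B i).encard ∂(poisLaw ν)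
      = ∏ i ∈ s, ∫⁻ k, g i k ∂((poissonMeasure (ν (B i)).toNNReal).map fun k : ℕ => (k : ℕ∞)) := by
  classical
  induction s using Finset.induction_on generalizing ν with
  | empty => simp
  | insert a s ha ih =>
    have hG : Measurable fun X : Set (Sp d × M) => g a X.encard :=
      (Measurable.of_discrete (f := g a)).comp measurable_encard
    have hG' : Measurable fun X : Set (Sp d × M) => ∏ i ∈ s, g i (X ∩ B i).encard :=
      Finset.measurable_prod _ fun i _ =>
        (Measurable.of_discrete (f := g i)).comp (measurable_encard_inter (hB i))
    -- The other sets are disjoint from `B a`, so their counts do not change when the points in `B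
    -- a` are removed; splitting at `B a` then detaches one factor.
    have e : ∀ X : Set (Sp d × M), ∏ i ∈ insert a s, g i (X ∩ B i).encard
        = g a (X ∩ B a).encard * ∏ i ∈ s, g i ((X \ B a) ∩ B i).encard := by
      intro X
      rw [Finset.prod_insert ha]
      congr 1
      refine Finset.prod_congr rfl fun i hi => ?_
      have hne : i ≠ a := fun h => ha (h ▸ hi)
      congr 2
      ext w
      simp only [Set.mem_inter_iff, Set.mem_sdiff]
      constructor
      · rintro ⟨h1, h2⟩
        exact ⟨⟨h1, fun h3 => Set.disjoint_left.1 (hd hne) h2 h3⟩, h2⟩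
      · rintro ⟨⟨h1, -⟩, h2⟩
        exact ⟨h1, h2⟩
    simp_rw [e]
    rw [poisLaw_split hν (hB a) hG hG', Finset.prod_insert ha, ih (hν.restrict _)]
    congr 1
    · rw [← lintegral_map (f := g a) Measurable.of_discrete measurable_encard,
        poisLaw_map_encard (hν.restrict _), Measure.restrict_apply_univ]
    · refine Finset.prod_congr rfl fun i hi => ?_
      have hne : i ≠ a := fun h => ha (h ▸ hi)
      rw [Measure.restrict_apply (hB i), Set.inter_eq_left.2]
      exact Set.disjoint_left.1 (hd hne)

end PoisLaw

/-! ### The law of a Poisson process on a set of finite intensity. -/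

section PoissonProcess

variable {d : ℕ} {M Ω : Type*} [MeasurableSpace M] [MeasurableSpace Ω]

/-- Events prescribing finitely many counts form a π-system that generates the σ-algebra. A family
of overlapping sets is refined into the disjoint atoms of the algebra it generates, and its counts
are sums of counts in atoms; hence disjoint families determine the measure. -/
lemma config_measure_ext {α : Type*} [MeasurableSpace α] {μ ν : Measure (Set α)}
    [IsProbabilityMeasure μ] [IsProbabilityMeasure ν]
    (h : ∀ (n : ℕ) (B : Fin n → Set α), (∀ i, MeasurableSet (B i)) →
      Pairwise (fun i j => Disjoint (B i) (B j)) → ∀ k : Fin n → ℕ∞,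
      μ {X | ∀ i, (X ∩ B i).encard = k i} = ν {X | ∀ i, (X ∩ B i).encard = k i}) : μ = ν := by
  classical
  -- the laws of the counts in finitely many disjoint sets agree
  have hjoint : ∀ (ι : Type) [Fintype ι] (B : ι → Set α), (∀ i, MeasurableSet (B i)) →
      Pairwise (fun i j => Disjoint (B i) (B j)) →
      μ.map (fun X i => (X ∩ B i).encard) = ν.map (fun X i => (X ∩ B i).encard) := by
    intro ι _ B hB hd
    have hm : Measurable fun (X : Set α) (i : ι) => (X ∩ B i).encard :=
      measurable_pi_iff.2 fun i => measurable_encard_inter (hB i)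
    refine Measure.ext_of_singleton fun k => ?_
    rw [Measure.map_apply hm (measurableSet_singleton k),
      Measure.map_apply hm (measurableSet_singleton k)]
    let e := Fintype.equivFin ι
    have := h (Fintype.card ι) (fun i => B (e.symm i)) (fun i => hB _)
      (fun i j hij => hd (fun h => hij (e.symm.injective h))) (fun i => k (e.symm i))
    have hset : (fun (X : Set α) (i : ι) => (X ∩ B i).encard) ⁻¹' {k}
        = {X | ∀ i, (X ∩ B (e.symm i)).encard = k (e.symm i)} := by
      ext X
      simp only [Set.mem_preimage, Set.mem_singleton_iff, funext_iff, Set.mem_ofPred_eq]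
      exact ⟨fun h i => h _, fun h i => by simpa using h (e i)⟩
    rw [hset, this]
  let C : Set (Set (Set α)) := {S | ∃ (n : ℕ) (B : Fin n → Set α) (k : Fin n → ℕ∞),
    (∀ i, MeasurableSet (B i)) ∧ S = {X | ∀ i, (X ∩ B i).encard = k i}}
  have hgen : configSigma α = MeasurableSpace.generateFrom C := by
    refine le_antisymm ?_ ?_
    · refine iSup₂_le fun B hB => ?_
      rw [← measurable_iff_comap_le]
      refine @measurable_to_countable' _ _ _ _ (MeasurableSpace.generateFrom C) _ fun k => ?_
      refine MeasurableSpace.measurableSet_generateFrom ⟨1, fun _ => B, fun _ => k, fun _ => hB, ?_⟩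
      ext X; simp
    · refine MeasurableSpace.generateFrom_le ?_
      rintro _ ⟨n, B, k, hB, rfl⟩
      have : {X : Set α | ∀ i, (X ∩ B i).encard = k i}
          = ⋂ i, (fun X : Set α => (X ∩ B i).encard) ⁻¹' {k i} := by
        ext X; simp
      rw [this]
      exact MeasurableSet.iInter fun i => measurable_encard_inter (hB i) (measurableSet_singleton _)
  refine ext_of_generate_finite C hgen ?_ ?_ (by simp)
  · rintro _ ⟨n, B, k, hB, rfl⟩ _ ⟨n', B', k', hB', rfl⟩ -
    refine ⟨n + n', Fin.append B B', Fin.append k k', fun i => ?_, ?_⟩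
    · refine Fin.addCases (fun i => ?_) (fun i => ?_) i
      · simpa using hB i
      · simpa using hB' i
    · ext X
      simp only [Set.mem_inter_iff, Set.mem_ofPred_eq]
      constructor
      · rintro ⟨h1, h2⟩ i
        refine Fin.addCases (fun i => ?_) (fun i => ?_) i
        · simpa using h1 i
        · simpa using h2 i
      · intro h3
        exact ⟨fun i => by simpa using h3 (Fin.castAdd n' i),
          fun i => by simpa using h3 (Fin.natAdd n i)⟩
  · rintro _ ⟨n, B, k, hB, rfl⟩
    let A : Finset (Fin n) → Set α := fun J => ⋂ i, if i ∈ J then B i else (B i)ᶜ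
    have hA : ∀ J, MeasurableSet (A J) := fun J => MeasurableSet.iInter fun i => by
      split_ifs
      · exact hB i
      · exact (hB i).compl
    have hmem : ∀ (J : Finset (Fin n)) (w : α), w ∈ A J ↔ ∀ i, w ∈ B i ↔ i ∈ J := by
      intro J w
      simp only [A, Set.mem_iInter]
      refine forall_congr' fun i => ?_
      by_cases hi : i ∈ J <;> simp [hi]
    have hAd : Pairwise fun J J' => Disjoint (A J) (A J') := by
      intro J J' hne
      refine Set.disjoint_left.2 fun w h1 h2 => hne ?_
      ext i
      rw [← (hmem J w).1 h1 i, (hmem J' w).1 h2 i]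
    have hcount : ∀ (X : Set α) (i : Fin n), (X ∩ B i).encard
        = ∑ J ∈ Finset.univ.filter (fun J : Finset (Fin n) => i ∈ J), (X ∩ A J).encard := by
      intro X i
      have hU : X ∩ B i = ⋃ J ∈ Finset.univ.filter (fun J : Finset (Fin n) => i ∈ J), X ∩ A J := by
        ext w
        simp only [Set.mem_inter_iff, Finset.mem_filter, Finset.mem_univ, true_and,
          Set.mem_iUnion, exists_prop]
        constructor
        · rintro ⟨h1, h2⟩
          refine ⟨Finset.univ.filter fun i => w ∈ B i, by simpa using h2, h1, ?_⟩
          rw [hmem]; simp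
        · rintro ⟨J, hJ, h1, h2⟩
          exact ⟨h1, ((hmem J w).1 h2 i).2 hJ⟩
      rw [hU]
      generalize Finset.univ.filter (fun J : Finset (Fin n) => i ∈ J) = s
      induction s using Finset.induction_on with
      | empty => simp
      | insert J s hJ ih =>
        rw [Finset.set_biUnion_insert, Finset.sum_insert hJ, Set.encard_union_eq, ih]
        refine Set.disjoint_left.2 fun w h1 h2 => ?_
        simp only [Set.mem_iUnion] at h2
        obtain ⟨J', hJ', h2⟩ := h2
        exact Set.disjoint_left.1 (hAd (fun h : J = J' => hJ (h ▸ hJ'))) h1.2 h2.2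
    have hm : Measurable fun (X : Set α) (J : Finset (Fin n)) => (X ∩ A J).encard :=
      measurable_pi_iff.2 fun i => measurable_encard_inter (hA i)
    let S : Set (Finset (Fin n) → ℕ∞) :=
      {c | ∀ i, ∑ J ∈ Finset.univ.filter (fun J : Finset (Fin n) => i ∈ J), c J = k i}
    have hS : {X : Set α | ∀ i, (X ∩ B i).encard = k i}
        = (fun (X : Set α) (J : Finset (Fin n)) => (X ∩ A J).encard) ⁻¹' S := by
      ext X
      simp only [Set.mem_ofPred_eq, Set.mem_preimage, S, hcount]
    rw [hS, ← Measure.map_apply hm MeasurableSet.of_discrete, hjoint _ A hA hAd,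
      Measure.map_apply hm MeasurableSet.of_discrete]

/-- On a set of finite intensity a Poisson process has the law `poisLaw`. -/
lemma IsPoissonProcess.map_inter {η : Ω → Set (Sp d × M)} {Λ : Measure (Sp d × M)} {P : Measure Ω}
    [IsProbabilityMeasure P] (h : IsPoissonProcess η Λ P) {B : Set (Sp d × M)}
    (hB : MeasurableSet B) (hΛB : Λ B ≠ ∞) (hΛ : NoPosAtoms Λ) :
    P.map (fun ω => η ω ∩ B) = poisLaw (Λ.restrict B) := by
  have hη : Measurable η := h.measurable
  have hm : Measurable fun ω => η ω ∩ B := (measurable_config_inter hB).comp hη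
  have : IsFiniteMeasure (Λ.restrict B) := ⟨by rw [Measure.restrict_apply_univ]; exact hΛB.lt_top⟩
  have : IsProbabilityMeasure (P.map fun ω => η ω ∩ B) :=
    Measure.isProbabilityMeasure_map hm.aemeasurable
  refine config_measure_ext fun n A hA hd k => ?_
  have hset : {X : Set (Sp d × M) | ∀ i, (X ∩ A i).encard = k i}
      = ⋂ i, (fun X : Set (Sp d × M) => (X ∩ A i).encard) ⁻¹' {k i} := by
    ext X; simp
  have hSm : MeasurableSet {X : Set (Sp d × M) | ∀ i, (X ∩ A i).encard = k i} := by
    rw [hset]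
    exact MeasurableSet.iInter fun i => measurable_encard_inter (hA i) (measurableSet_singleton _)
  have hfin : ∀ i, Λ (B ∩ A i) ≠ ∞ := fun i =>
    ne_top_of_le_ne_top hΛB (measure_mono Set.inter_subset_left)
  have hind := h.indep_count n (fun i => B ∩ A i) (fun i => hB.inter (hA i))
    (fun i j hij => (hd hij).mono Set.inter_subset_right Set.inter_subset_right)
  have hL : P.map (fun ω => η ω ∩ B) {X | ∀ i, (X ∩ A i).encard = k i}
      = ∏ i, (poissonMeasure (Λ (B ∩ A i)).toNNReal).map (fun k : ℕ => (k : ℕ∞)) {k i} := by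
    rw [Measure.map_apply hm hSm]
    have : (fun ω => η ω ∩ B) ⁻¹' {X | ∀ i, (X ∩ A i).encard = k i}
        = ⋂ i ∈ Finset.univ, (fun ω => (η ω ∩ (B ∩ A i)).encard) ⁻¹' {k i} := by
      ext ω; simp [Set.inter_assoc]
    rw [this, hind.measure_inter_preimage_eq_mul Finset.univ
      (fun i _ => measurableSet_singleton (k i))]
    refine Finset.prod_congr rfl fun i _ => ?_
    have hmi : Measurable fun ω => (η ω ∩ (B ∩ A i)).encard :=
      (measurable_encard_inter (hB.inter (hA i))).comp hη
    rw [← h.law_count _ (hB.inter (hA i)) (hfin i),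
      Measure.map_apply hmi (measurableSet_singleton _)]
  have hR := lintegral_prod_counts_poisLaw Finset.univ hA hd
    (fun i => ({k i} : Set ℕ∞).indicator fun _ => (1 : ℝ≥0∞)) (hΛ.restrict B)
  have hR1 : ∀ X : Set (Sp d × M), ∏ i, ({k i} : Set ℕ∞).indicator (fun _ => (1 : ℝ≥0∞)) (X ∩ A i).encard
      = {X : Set (Sp d × M) | ∀ i, (X ∩ A i).encard = k i}.indicator (fun _ => 1) X := by
    intro X
    by_cases hX : ∀ i, (X ∩ A i).encard = k i
    · rw [Set.indicator_of_mem (by exact hX)]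
      exact Finset.prod_eq_one fun i _ => by simp [hX i]
    · rw [Set.indicator_of_notMem (by exact hX)]
      push Not at hX
      obtain ⟨i, hi⟩ := hX
      exact Finset.prod_eq_zero (Finset.mem_univ i) (by simp [hi])
  simp_rw [hR1] at hR
  rw [lintegral_indicator hSm, setLIntegral_one] at hR
  rw [hL, hR]
  refine Finset.prod_congr rfl fun i _ => ?_
  rw [lintegral_indicator (measurableSet_singleton _), setLIntegral_one,
    Measure.restrict_apply (hA i), Set.inter_comm]

end PoissonProcess

/-! ### Poisson approximation of trinomial sums. -/

section Asymptotics

variable {ι : Type*} {F : Filter ι} {N : ι → ℕ} {L : ι → ℝ}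

/-- Truncation of the subtraction is irrelevant since `N` tends to infinity. -/
lemma tendsto_natSub_div (hL : Tendsto L F atTop) (hN : Tendsto (fun i => (N i : ℝ) / L i) F (𝓝 1))
    (m : ℕ) : Tendsto (fun i => ((N i - m : ℕ) : ℝ) / L i) F (𝓝 1) := by
  have hNinf : Tendsto (fun i => (N i : ℝ)) F atTop := by
    have := Tendsto.pos_mul_atTop one_pos hN hL
    refine this.congr' ?_
    filter_upwards [hL.eventually_gt_atTop 0] with i hi
    field_simp
  have h0 : Tendsto (fun i => (m : ℝ) / L i) F (𝓝 0) := tendsto_const_nhds.div_atTop hL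
  have := hN.sub h0
  rw [sub_zero] at this
  refine this.congr' ?_
  filter_upwards [hNinf.eventually_ge_atTop (m : ℝ)] with i hi
  rw [Nat.cast_sub (by exact_mod_cast hi), sub_div]

/-- Induction on `j`: passing from `j` to `j + 1` multiplies by `(N - j) / L`, which tends to one,
and divides by `j + 1`. -/
lemma tendsto_choose_mul_pow (hL : Tendsto L F atTop)
    (hN : Tendsto (fun i => (N i : ℝ) / L i) F (𝓝 1)) (j : ℕ) :
    Tendsto (fun i => ((N i).choose j : ℝ) * (L i)⁻¹ ^ j) F (𝓝 (1 / j !)) := by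
  induction j with
  | zero => simpa using tendsto_const_nhds
  | succ j ih =>
    have h := ih.mul ((tendsto_natSub_div hL hN j).div_const ((j : ℝ) + 1))
    have e : (1 : ℝ) / j ! * (1 / ((j : ℝ) + 1)) = 1 / (j + 1)! := by
      rw [Nat.factorial_succ]; push_cast; field_simp
    rw [e] at h
    refine h.congr fun i => ?_
    have hc : ((N i).choose (j + 1) : ℝ) * ((j : ℝ) + 1)
        = (N i).choose j * ((N i - j : ℕ) : ℝ) := by
      exact_mod_cast Nat.choose_succ_right_eq (N i) j
    have hc' : ((N i).choose (j + 1) : ℝ) = (N i).choose j * ((N i - j : ℕ) : ℝ) / ((j : ℝ) + 1) := by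
      rw [← hc]; field_simp
    rw [hc', pow_succ]
    ring

lemma choose_mul_pow_le {l : ℝ} {n : ℕ} (hl : 0 < l) (hn : (n : ℝ) / l ≤ 2) (j : ℕ) :
    (n.choose j : ℝ) * l⁻¹ ^ j ≤ 2 ^ j / j ! := by
  have h1 : (n.choose j : ℝ) ≤ (n : ℝ) ^ j / j ! := Nat.choose_le_pow_div j n
  calc (n.choose j : ℝ) * l⁻¹ ^ j ≤ (n : ℝ) ^ j / j ! * l⁻¹ ^ j := by gcongr
    _ = ((n : ℝ) / l) ^ j / j ! := by rw [div_pow, inv_pow]; ring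
    _ ≤ 2 ^ j / j ! := by gcongr

/-- `m log ρ` lies between `m (1 - 1/ρ)` and `m (ρ - 1)`. Since `ρ → 1` and `m (1 - ρ) → β`, both
bounds tend to `-β`. -/
lemma tendsto_pow_exp_neg {m : ι → ℕ} {ρ : ι → ℝ} {β : ℝ} (hL : Tendsto L F atTop)
    (hm : Tendsto (fun i => (m i : ℝ) / L i) F (𝓝 1))
    (hρ : Tendsto (fun i => L i * (1 - ρ i)) F (𝓝 β)) :
    Tendsto (fun i => ρ i ^ m i) F (𝓝 (Real.exp (-β))) := by
  have hε : Tendsto (fun i => 1 - ρ i) F (𝓝 0) := by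
    have := hρ.div_atTop hL
    refine this.congr' ?_
    filter_upwards [hL.eventually_gt_atTop 0] with i hi
    field_simp
  have hρ1 : Tendsto ρ F (𝓝 1) := by
    have := (tendsto_const_nhds (x := (1 : ℝ))).sub hε
    simpa using this
  have hmε : Tendsto (fun i => (m i : ℝ) * (1 - ρ i)) F (𝓝 β) := by
    have := hm.mul hρ
    rw [one_mul] at this
    refine this.congr' ?_
    filter_upwards [hL.eventually_gt_atTop 0] with i hi
    field_simp
  have hup : Tendsto (fun i => Real.exp (-((m i : ℝ) * (1 - ρ i)))) F (𝓝 (Real.exp (-β))) :=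
    (Real.continuous_exp.tendsto _).comp hmε.neg
  have hlow : Tendsto (fun i => Real.exp (-((m i : ℝ) * (1 - ρ i) / ρ i))) F
      (𝓝 (Real.exp (-β))) := by
    have := (hmε.div hρ1 one_ne_zero).neg
    rw [div_one] at this
    exact (Real.continuous_exp.tendsto _).comp this
  refine tendsto_of_tendsto_of_tendsto_of_le_of_le' hlow hup ?_ ?_
  · filter_upwards [hρ1.eventually_const_lt (show (0 : ℝ) < 1 by norm_num)] with i hi
    have h1 := Real.one_sub_inv_le_log_of_pos hi
    rw [← Real.exp_log (pow_pos hi (m i)), Real.log_pow]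
    refine Real.exp_le_exp.2 ?_
    have : -((m i : ℝ) * (1 - ρ i) / ρ i) = m i * (1 - (ρ i)⁻¹) := by field_simp; ring
    rw [this]
    gcongr
  · filter_upwards [hρ1.eventually_const_lt (show (0 : ℝ) < 1 by norm_num)] with i hi
    have h1 := Real.log_le_sub_one_of_pos hi
    rw [← Real.exp_log (pow_pos hi (m i)), Real.log_pow]
    refine Real.exp_le_exp.2 ?_
    have : -((m i : ℝ) * (1 - ρ i)) = m i * (ρ i - 1) := by ring
    rw [this]
    gcongr

/-- The Poisson approximation of trinomial sums. -/
lemma tendsto_trinomial_sum [F.IsCountablyGenerated] (hL : Tendsto L F atTop)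
    (hN : Tendsto (fun i => (N i : ℝ) / L i) F (𝓝 1)) {ρ : ι → ℝ} (hρ0 : ∀ᶠ i in F, 0 ≤ ρ i)
    (hρ1 : ∀ᶠ i in F, ρ i ≤ 1) {β : ℝ} (hρ : Tendsto (fun i => L i * (1 - ρ i)) F (𝓝 β))
    {a a' : ι → ℕ → ℝ≥0∞} {b b' : ℕ → ℝ≥0∞} {K D : ℝ≥0}
    (ha : ∀ᶠ i in F, ∀ j, a i j ≤ K * D ^ j) (ha' : ∀ᶠ i in F, ∀ j, a' i j ≤ K * D ^ j)
    (hab : ∀ j, Tendsto (fun i => a i j) F (𝓝 (b j)))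
    (hab' : ∀ j, Tendsto (fun i => a' i j) F (𝓝 (b' j)))
    (hb : ∀ j, b j ≠ ∞) (hb' : ∀ j, b' j ≠ ∞) :
    Tendsto (fun i => ∑' p : ℕ × ℕ,
      ENNReal.ofReal ((((N i).choose p.1 : ℝ) * (L i)⁻¹ ^ p.1) *
        (((N i - p.1).choose p.2 : ℝ) * (L i)⁻¹ ^ p.2) * ρ i ^ (N i - p.1 - p.2)) *
        (a i p.1 * a' i p.2)) F
      (𝓝 (∑' p : ℕ × ℕ, ENNReal.ofReal (1 / p.1 ! * (1 / p.2 !) * Real.exp (-β)) *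
        (b p.1 * b' p.2))) := by
  -- Series are integrals against counting measure, so dominated convergence applies. Eventually `N
  -- / L ≤ 2`, which accounts for the powers of `2`; the dominating series is a product of
  -- exponential series.
  simp_rw [← lintegral_count]
  refine tendsto_lintegral_filter_of_dominated_convergence'
    (fun p => ENNReal.ofReal (2 ^ p.1 / p.1 ! * (2 ^ p.2 / p.2 !)) *
      ((K * D ^ p.1) * (K * D ^ p.2))) ?_ ?_ ?_ ?_
  · exact Eventually.of_forall fun i => Measurable.of_discrete.aemeasurable
  · filter_upwards [ha, ha', hρ0, hρ1, hL.eventually_gt_atTop 0,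
      hN.eventually_le_const (show (1 : ℝ) < 2 by norm_num)] with i h1 h2 h3 h4 h5 h6
    refine Eventually.of_forall fun p => ?_
    have h7 : (((N i - p.1 : ℕ) : ℝ)) / L i ≤ 2 := by
      refine le_trans ?_ h6
      gcongr
      exact Nat.sub_le _ _
    refine mul_le_mul' (ENNReal.ofReal_le_ofReal ?_) (mul_le_mul' (h1 _) (h2 _))
    have g1 := choose_mul_pow_le h5 h6 p.1
    have g2 := choose_mul_pow_le h5 h7 p.2
    have g3 : ρ i ^ (N i - p.1 - p.2) ≤ 1 := pow_le_one₀ h3 h4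
    have g0 : 0 ≤ ((N i).choose p.1 : ℝ) * (L i)⁻¹ ^ p.1 := by positivity
    have g0' : 0 ≤ ((N i - p.1).choose p.2 : ℝ) * (L i)⁻¹ ^ p.2 := by positivity
    calc _ ≤ (2 ^ p.1 / p.1 ! * (2 ^ p.2 / p.2 !) : ℝ) * 1 := by gcongr
      _ = _ := mul_one _
  · rw [lintegral_count]
    have hs : ∑' n : ℕ, ENNReal.ofReal (2 ^ n / n !) * (K * D ^ n) ≠ ∞ := by
      have h := (Real.summable_pow_div_factorial (2 * D)).mul_left (K : ℝ)
      have e : ∀ n : ℕ, ENNReal.ofReal (2 ^ n / n !) * (K * D ^ n)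
          = ENNReal.ofReal ((K : ℝ) * ((2 * D) ^ n / n !)) := by
        intro n
        have : (K * D ^ n : ℝ≥0∞) = ENNReal.ofReal ((K : ℝ) * (D : ℝ) ^ n) := by
          rw [ENNReal.ofReal_mul K.coe_nonneg, ENNReal.ofReal_pow D.coe_nonneg, ENNReal.ofReal_coe_nnreal,
            ENNReal.ofReal_coe_nnreal]
        rw [this, ← ENNReal.ofReal_mul (by positivity)]
        congr 1
        rw [mul_pow]; ring
      simp_rw [e]
      rw [← ENNReal.ofReal_tsum_of_nonneg (fun n => by positivity) h]
      exact ENNReal.ofReal_ne_top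
    have e2 : ∀ p : ℕ × ℕ, ENNReal.ofReal (2 ^ p.1 / p.1 ! * (2 ^ p.2 / p.2 !)) *
        ((K * D ^ p.1) * (K * D ^ p.2))
        = (ENNReal.ofReal (2 ^ p.1 / p.1 !) * (K * D ^ p.1)) *
          (ENNReal.ofReal (2 ^ p.2 / p.2 !) * (K * D ^ p.2)) := by
      intro p
      rw [ENNReal.ofReal_mul (by positivity)]
      ring
    simp_rw [e2]
    rw [ENNReal.tsum_prod (f := fun p q => (ENNReal.ofReal (2 ^ p / p !) * (K * D ^ p)) *
      (ENNReal.ofReal (2 ^ q / q !) * (K * D ^ q) : ℝ≥0∞))]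
    simp_rw [ENNReal.tsum_mul_left, ENNReal.tsum_mul_right]
    exact ENNReal.mul_ne_top hs hs
  · refine Eventually.of_forall fun p => ?_
    have h1 := tendsto_choose_mul_pow hL hN p.1
    have h2 := tendsto_choose_mul_pow hL (tendsto_natSub_div hL hN p.1) p.2
    have h3 := tendsto_pow_exp_neg hL
      (tendsto_natSub_div (N := fun i => N i - p.1) hL (tendsto_natSub_div hL hN p.1) p.2) hρ
    refine ENNReal.Tendsto.mul (ENNReal.tendsto_ofReal ((h1.mul h2).mul h3)) (Or.inr ?_)
      (ENNReal.Tendsto.mul (hab _) (Or.inr (hb' _)) (hab' _) (Or.inr (hb _)))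
      (Or.inr ENNReal.ofReal_ne_top)
    exact ENNReal.mul_ne_top (hb _) (hb' _)

end Asymptotics

/-! ### Magnification about a point and the exact two-ball formula. -/

section Zoom

variable {d : ℕ} {M : Type*} [MeasurableSpace M]

/-- The map `y ↦ s (y - x)`. -/
def zoom (x : Sp d) (s : ℝ) (y : Sp d) : Sp d := s • (y - x)

lemma continuous_zoom (x : Sp d) (s : ℝ) : Continuous (zoom x s) := by
  unfold zoom; fun_prop

lemma measurable_zoom (x : Sp d) (s : ℝ) : Measurable (zoom x s) := (continuous_zoom x s).measurable

lemma zoom_injective (x : Sp d) {s : ℝ} (hs : s ≠ 0) : Function.Injective (zoom x s) := by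
  intro y y' h
  simpa using smul_right_injective _ hs h

/-- The image of the marked set `X` under `zoom x s`. -/
def zoomSet (x : Sp d) (s : ℝ) (X : Set (Sp d × M)) : Set (Sp d × M) := posMap (zoom x s) '' X

/-- The part of `ℝ^d × M` above the closed ball of radius `r` about the origin. -/
def cyl (d : ℕ) (M : Type*) (r : ℝ) : Set (Sp d × M) := Metric.closedBall 0 r ×ˢ Set.univ

lemma measurableSet_cyl (r : ℝ) : MeasurableSet (cyl d M r) :=
  Metric.isClosed_closedBall.measurableSet.prod MeasurableSet.univ

/-- The product of Lebesgue measure and the mark distribution. -/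
def leb (d : ℕ) (μM : Measure M) : Measure (Sp d × M) := (volume : Measure (Sp d)).prod μM

/-- The law of a single marked point. -/
def pointLaw (κ : Sp d → ℝ≥0) (μM : Measure M) : Measure (Sp d × M) := (densityMeasure κ).prod μM

variable {κ : Sp d → ℝ≥0} {μM : Measure M} [IsProbabilityMeasure μM]

instance : SigmaFinite (leb d μM) := by unfold leb; infer_instance

lemma leb_cyl (r : ℝ) : leb d μM (cyl d M r) = volume (Metric.closedBall (0 : Sp d) r) := by
  rw [leb, cyl, Measure.prod_prod, measure_univ, mul_one]

instance (r : ℝ) : IsFiniteMeasure ((leb d μM).restrict (cyl d M r)) :=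
  ⟨by rw [Measure.restrict_apply_univ, leb_cyl]; exact measure_closedBall_lt_top⟩

lemma noPosAtoms_leb (hd : 0 < d) : NoPosAtoms (leb d μM) := by
  intro x
  have : Nonempty (Fin d) := ⟨⟨0, hd⟩⟩
  rw [leb, Measure.prod_prod, measure_singleton, zero_mul]

lemma densityMeasure_prob (hκ1 : ∫⁻ x, (κ x : ℝ≥0∞) = 1) :
    IsProbabilityMeasure (densityMeasure κ) :=
  ⟨by rw [densityMeasure, withDensity_apply _ MeasurableSet.univ, setLIntegral_univ, hκ1]⟩

lemma pointLaw_prob (hκ1 : ∫⁻ x, (κ x : ℝ≥0∞) = 1) : IsProbabilityMeasure (pointLaw κ μM) := by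
  have := densityMeasure_prob hκ1
  unfold pointLaw; infer_instance

lemma pointLaw_eq_withDensity (hκm : Measurable κ) :
    pointLaw κ μM = (leb d μM).withDensity fun w => (κ w.1 : ℝ≥0∞) := by
  rw [pointLaw, densityMeasure, prod_withDensity_left hκm.coe_nnreal_ennreal, leb]

lemma noPosAtoms_pointLaw (hd : 0 < d) (hκm : Measurable κ) : NoPosAtoms (pointLaw κ μM) := by
  rw [pointLaw_eq_withDensity hκm]
  exact (noPosAtoms_leb hd).mono (withDensity_absolutelyContinuous _ _)

lemma map_zoom_volume (x : Sp d) {s : ℝ} (hs : 0 < s) :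
    (volume : Measure (Sp d)).map (zoom x s) = ENNReal.ofReal (s ^ d)⁻¹ • volume := by
  have h1 : zoom x s = (fun y => s • y) ∘ fun y => y - x := rfl
  rw [h1, ← Measure.map_map (by fun_prop) (by fun_prop), map_sub_right_eq_self,
    Measure.map_addHaar_smul _ hs.ne', finrank_euclideanSpace, Fintype.card_fin, abs_of_pos
    (by positivity)]

/-- The law of a point in zoomed coordinates. -/
lemma map_posMap_zoom_pointLaw (hκm : Measurable κ) (x : Sp d) {s : ℝ} (hs : 0 < s) :
    (pointLaw κ μM).map (posMap (zoom x s)) = ENNReal.ofReal (s ^ d)⁻¹ •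
      (leb d μM).withDensity fun w => (κ (x + s⁻¹ • w.1) : ℝ≥0∞) := by
  have hm : Measurable fun w : Sp d × M => (κ (x + s⁻¹ • w.1) : ℝ≥0∞) :=
    (hκm.comp (by fun_prop)).coe_nnreal_ennreal
  have hmap : (leb d μM).map (posMap (zoom x s)) = ENNReal.ofReal (s ^ d)⁻¹ • leb d μM := by
    have h2 := Measure.map_prod_map (volume : Measure (Sp d)) μM (measurable_zoom x s) measurable_id
    rw [Measure.map_id, map_zoom_volume x hs, Measure.prod_smul_left] at h2
    exact h2.symm
  refine Measure.ext_of_lintegral _ fun g hg => ?_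
  have hgm : Measurable fun w : Sp d × M => g (posMap (zoom x s) w) :=
    hg.comp (measurable_posMap (measurable_zoom x s))
  have hprod : Measurable fun w : Sp d × M => (κ (x + s⁻¹ • w.1) : ℝ≥0∞) * g w := hm.mul hg
  rw [lintegral_map hg (measurable_posMap (measurable_zoom x s)), pointLaw_eq_withDensity hκm,
    lintegral_withDensity_eq_lintegral_mul _ (by exact (hκm.comp measurable_fst).coe_nnreal_ennreal)
      hgm, lintegral_smul_measure, lintegral_withDensity_eq_lintegral_mul _ hm hg,
    ← lintegral_smul_measure]
  have e := lintegral_map (μ := leb d μM) hprod (measurable_posMap (measurable_zoom x s))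
  rw [hmap] at e
  refine Eq.trans ?_ e.symm
  refine lintegral_congr fun w => ?_
  simp only [Pi.mul_apply, posMap, zoom]
  rw [smul_smul, inv_mul_cancel₀ hs.ne', one_smul, add_sub_cancel]

/-- The (unnormalized) law of a point near `x`, in zoomed coordinates. -/
def localLaw (κ : Sp d → ℝ≥0) (μM : Measure M) (x : Sp d) (s r : ℝ) : Measure (Sp d × M) :=
  ((leb d μM).restrict (cyl d M r)).withDensity fun w => (κ (x + s⁻¹ • w.1) : ℝ≥0∞)

/-- With `s ^ d` of the order of the number of points, the factor `(s ^ d)⁻¹` is the small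
probability of a point falling near `x`, and the remaining measure is close to intensity `κ x`: the
setting of the Poisson limit. -/
lemma map_restrict_pointLaw (hκm : Measurable κ) (x : Sp d) {s : ℝ} (hs : 0 < s) (r : ℝ) :
    ((pointLaw κ μM).restrict (posMap (zoom x s) ⁻¹' cyl d M r)).map (posMap (zoom x s))
      = ENNReal.ofReal (s ^ d)⁻¹ • localLaw κ μM x s r := by
  rw [← Measure.restrict_map (measurable_posMap (measurable_zoom x s)) (measurableSet_cyl r),
    map_posMap_zoom_pointLaw hκm x hs, Measure.restrict_smul,
    restrict_withDensity (measurableSet_cyl r), localLaw]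

lemma localLaw_univ_le {C : ℝ≥0} (hκb : ∀ x, κ x ≤ C) (x : Sp d) (s r : ℝ) :
    localLaw κ μM x s r Set.univ ≤ C * volume (Metric.closedBall (0 : Sp d) r) := by
  rw [localLaw, withDensity_apply _ MeasurableSet.univ, setLIntegral_univ]
  calc ∫⁻ w, (κ (x + s⁻¹ • w.1) : ℝ≥0∞) ∂((leb d μM).restrict (cyl d M r))
      ≤ ∫⁻ _, (C : ℝ≥0∞) ∂((leb d μM).restrict (cyl d M r)) :=
        lintegral_mono fun w => ENNReal.coe_le_coe.2 (hκb _)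
    _ = _ := by rw [lintegral_const, Measure.restrict_apply_univ, leb_cyl]

lemma isFiniteMeasure_localLaw {C : ℝ≥0} (hκb : ∀ x, κ x ≤ C) (x : Sp d) (s r : ℝ) :
    IsFiniteMeasure (localLaw κ μM x s r) :=
  ⟨(localLaw_univ_le hκb x s r).trans_lt
    (ENNReal.mul_lt_top ENNReal.coe_lt_top measure_closedBall_lt_top)⟩

lemma zoomSet_inter_cyl (x : Sp d) (s r : ℝ) (X : Set (Sp d × M)) :
    zoomSet x s X ∩ cyl d M r = zoomSet x s (X ∩ posMap (zoom x s) ⁻¹' cyl d M r) := by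
  rw [zoomSet, zoomSet, Set.image_inter_preimage]

lemma measurable_zoomSet (x : Sp d) {s : ℝ} (hs : 0 < s) :
    Measurable (zoomSet x s : Set (Sp d × M) → Set (Sp d × M)) :=
  measurable_config_image (measurable_posMap (measurable_zoom x s))
    (posMap_injective (zoom_injective x hs.ne'))

lemma lintegral_zoomSet_binLaw (hκ1 : ∫⁻ x, (κ x : ℝ≥0∞) = 1) (hκm : Measurable κ) {C : ℝ≥0}
    (hκb : ∀ x, κ x ≤ C) (x : Sp d) {s : ℝ} (hs : 0 < s) (r : ℝ) (j : ℕ)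
    {w : Set (Sp d × M) → ℝ≥0∞} (hw : Measurable w) :
    ∫⁻ X, w (zoomSet x s X)
        ∂(binLaw ((pointLaw κ μM).restrict (posMap (zoom x s) ⁻¹' cyl d M r)) j)
      = ENNReal.ofReal ((s ^ d)⁻¹ ^ j) * ∫⁻ X, w X ∂(binLaw (localLaw κ μM x s r) j) := by
  have := pointLaw_prob (μM := μM) hκ1
  have := isFiniteMeasure_localLaw (μM := μM) hκb x s r
  have h := binLaw_map (measurable_zoom x s) (zoom_injective x hs.ne')
    ((pointLaw κ μM).restrict (posMap (zoom x s) ⁻¹' cyl d M r)) j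
  rw [map_restrict_pointLaw hκm x hs r, binLaw_smul _ ENNReal.ofReal_ne_top] at h
  have e := lintegral_map (μ := binLaw ((pointLaw κ μM).restrict
    (posMap (zoom x s) ⁻¹' cyl d M r)) j) hw (measurable_zoomSet x hs)
  rw [← e]
  have h' : (binLaw ((pointLaw κ μM).restrict (posMap (zoom x s) ⁻¹' cyl d M r)) j).map
      (zoomSet x s) = ENNReal.ofReal (s ^ d)⁻¹ ^ j • binLaw (localLaw κ μM x s r) j := h.symm
  rw [h', lintegral_smul_measure, smul_eq_mul, ENNReal.ofReal_pow (by positivity)]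

/-- Exact formula for the joint distribution of a binomial process in two disjoint small balls. -/
lemma lintegral_twoBall (hd : 0 < d) (hκ1 : ∫⁻ x, (κ x : ℝ≥0∞) = 1) (hκm : Measurable κ) {C : ℝ≥0}
    (hκb : ∀ x, κ x ≤ C) {x y : Sp d} {s : ℝ} (hs : 0 < s) {r : ℝ}
    (hdisj : Disjoint (posMap (zoom x s) ⁻¹' cyl d M r) (posMap (zoom y s) ⁻¹' cyl d M r))
    (n : ℕ) {w w' : Set (Sp d × M) → ℝ≥0∞} (hw : Measurable w) (hw' : Measurable w') :
    ∫⁻ X, w (zoomSet x s X ∩ cyl d M r) * w' (zoomSet y s X ∩ cyl d M r)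
        ∂(binLaw (pointLaw κ μM) n)
      = ∑' p : ℕ × ℕ, ENNReal.ofReal ((n.choose p.1 * (s ^ d)⁻¹ ^ p.1) *
          ((n - p.1).choose p.2 * (s ^ d)⁻¹ ^ p.2) *
          (1 - (s ^ d)⁻¹ * ((localLaw κ μM x s r Set.univ).toReal
            + (localLaw κ μM y s r Set.univ).toReal)) ^ (n - p.1 - p.2)) *
        ((∫⁻ X, w X ∂(binLaw (localLaw κ μM x s r) p.1)) *
          ∫⁻ X, w' X ∂(binLaw (localLaw κ μM y s r) p.2)) := by
  have := pointLaw_prob (μM := μM) hκ1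
  have hfx := isFiniteMeasure_localLaw (μM := μM) hκb x s r
  have hfy := isFiniteMeasure_localLaw (μM := μM) hκb y s r
  have hat := noPosAtoms_pointLaw (μM := μM) hd hκm
  set μ := pointLaw κ μM with hμ
  set B := (posMap (zoom x s) ⁻¹' cyl d M r : Set (Sp d × M)) with hBdef
  set B' := (posMap (zoom y s) ⁻¹' cyl d M r : Set (Sp d × M)) with hBdef'
  have hB : MeasurableSet B := measurable_posMap (measurable_zoom x s) (measurableSet_cyl r)
  have hB' : MeasurableSet B' := measurable_posMap (measurable_zoom y s) (measurableSet_cyl r)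
  have hwz : Measurable fun X : Set (Sp d × M) => w (zoomSet x s X) :=
    hw.comp (measurable_zoomSet x hs)
  have hwz' : Measurable fun X : Set (Sp d × M) => w' (zoomSet y s X) :=
    hw'.comp (measurable_zoomSet y hs)
  have hwz'' : Measurable fun X : Set (Sp d × M) => w' (zoomSet y s (X ∩ B')) :=
    hwz'.comp (measurable_config_inter hB')
  -- split off the first ball
  have hF : Measurable fun p : Set (Sp d × M) × Set (Sp d × M) =>
      w (zoomSet x s p.1) * w' (zoomSet y s (p.2 ∩ B')) :=
    (hwz.comp measurable_fst).mul (hwz''.comp measurable_snd)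
  have e1 : ∀ X : Set (Sp d × M), w (zoomSet x s X ∩ cyl d M r) * w' (zoomSet y s X ∩ cyl d M r)
      = w (zoomSet x s (X ∩ B)) * w' (zoomSet y s ((X \ B) ∩ B')) := by
    intro X
    rw [zoomSet_inter_cyl, zoomSet_inter_cyl]
    congr 3
    ext v
    simp only [Set.mem_inter_iff, Set.mem_sdiff]
    exact ⟨fun h => ⟨⟨h.1, fun h' => Set.disjoint_left.1 hdisj h' h.2⟩, h.2⟩,
      fun h => ⟨h.1.1, h.2⟩⟩
  simp_rw [e1]
  rw [binLaw_split μ hat hB n hF]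
  -- mass outside of both balls
  have hmass : ∀ z : Sp d, μ (posMap (zoom z s) ⁻¹' cyl d M r)
      = ENNReal.ofReal (s ^ d)⁻¹ * localLaw κ μM z s r Set.univ := by
    intro z
    have := congrArg (fun m : Measure (Sp d × M) => m Set.univ)
      (map_restrict_pointLaw (μM := μM) hκm z hs r)
    simp only [Measure.smul_apply, smul_eq_mul] at this
    rw [← this, Measure.map_apply (measurable_posMap (measurable_zoom z s)) MeasurableSet.univ,
      Set.preimage_univ, Measure.restrict_apply_univ]
  have hrestr : (μ.restrict Bᶜ).restrict B' = μ.restrict B' := by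
    rw [Measure.restrict_restrict hB', Set.inter_eq_left.2]
    exact fun v hv hv' => Set.disjoint_left.1 hdisj hv' hv
  have hout : (μ.restrict Bᶜ).restrict B'ᶜ Set.univ
      = ENNReal.ofReal (1 - (s ^ d)⁻¹ * ((localLaw κ μM x s r Set.univ).toReal
            + (localLaw κ μM y s r Set.univ).toReal)) := by
    rw [Measure.restrict_restrict hB'.compl, Measure.restrict_apply_univ, ← Set.compl_union,
      prob_compl_eq_one_sub (hB'.union hB), Set.union_comm, measure_union hdisj hB', hmass, hmass,
      mul_add, ENNReal.ofReal_sub _ (by positivity), ENNReal.ofReal_one,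
      ENNReal.ofReal_add (by positivity) (by positivity), ENNReal.ofReal_mul (by positivity),
      ENNReal.ofReal_mul (by positivity), ENNReal.ofReal_toReal (measure_ne_top _ _),
      ENNReal.ofReal_toReal (measure_ne_top _ _)]
  -- The two disjoint balls have total probability at most one. Nonnegativity lets `ENNReal.ofReal`
  -- commute with the power below.
  have hout0 : 0 ≤ 1 - (s ^ d)⁻¹ * ((localLaw κ μM x s r Set.univ).toReal
            + (localLaw κ μM y s r Set.univ).toReal) := by
    have h1 : μ B + μ B' ≤ 1 := by
      rw [← measure_union hdisj hB']; exact prob_le_one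
    rw [hmass, hmass, ← mul_add] at h1
    have h2 := ENNReal.toReal_mono ENNReal.one_ne_top h1
    rw [ENNReal.toReal_mul, ENNReal.toReal_ofReal (by positivity),
      ENNReal.toReal_add (measure_ne_top _ _) (measure_ne_top _ _), ENNReal.toReal_one] at h2
    linarith
  set ρ : ℝ := 1 - (s ^ d)⁻¹ * ((localLaw κ μM x s r Set.univ).toReal
            + (localLaw κ μM y s r Set.univ).toReal) with hρ
  -- the inner split
  have hinner : ∀ m : ℕ, ∫⁻ X, w' (zoomSet y s (X ∩ B')) ∂(binLaw (μ.restrict Bᶜ) m)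
      = ∑' k : ℕ, (m.choose k : ℝ≥0∞) * ((ENNReal.ofReal ((s ^ d)⁻¹ ^ k) *
          ∫⁻ X, w' X ∂(binLaw (localLaw κ μM y s r) k)) * ENNReal.ofReal (ρ ^ (m - k))) := by
    intro m
    have hG : Measurable fun p : Set (Sp d × M) × Set (Sp d × M) => w' (zoomSet y s p.1) :=
      hwz'.comp measurable_fst
    have h1 := binLaw_split (μ.restrict Bᶜ) (hat.restrict _) hB' m hG
    simp only at h1
    -- Terms with `k > m` vanish with the binomial coefficient. Summation over all of `ℕ` has a
    -- range independent of the sample size, as the later limit requires.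
    rw [h1, tsum_eq_sum (s := Finset.range (m + 1))]
    · refine Finset.sum_congr rfl fun k _ => ?_
      congr 1
      have h2 := lintegral_prod_mul (μ := binLaw ((μ.restrict Bᶜ).restrict B') k)
        (ν := binLaw ((μ.restrict Bᶜ).restrict B'ᶜ) (m - k)) (g := fun _ => 1)
        hwz'.aemeasurable aemeasurable_const
      simp only [mul_one] at h2
      rw [h2, lintegral_const, one_mul, binLaw_univ, hout, ← ENNReal.ofReal_pow hout0, hrestr,
        lintegral_zoomSet_binLaw hκ1 hκm hκb y hs r k hw']
    · intro k hk
      have : m.choose k = 0 := Nat.choose_eq_zero_of_lt (by simpa using hk)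
      simp [this]
  rw [ENNReal.tsum_prod (f := fun p q => ENNReal.ofReal ((n.choose p * (s ^ d)⁻¹ ^ p) *
          ((n - p).choose q * (s ^ d)⁻¹ ^ q) * ρ ^ (n - p - q)) *
        ((∫⁻ X, w X ∂(binLaw (localLaw κ μM x s r) p)) *
          ∫⁻ X, w' X ∂(binLaw (localLaw κ μM y s r) q))),
    tsum_eq_sum (s := Finset.range (n + 1))]
  · refine Finset.sum_congr rfl fun j _ => ?_
    rw [lintegral_prod_mul hwz.aemeasurable hwz''.aemeasurable, hinner,
      lintegral_zoomSet_binLaw hκ1 hκm hκb x hs r j hw, ← ENNReal.tsum_mul_left,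
      ← ENNReal.tsum_mul_left]
    refine tsum_congr fun k => ?_
    rw [ENNReal.ofReal_mul (by positivity), ENNReal.ofReal_mul (by positivity),
      ENNReal.ofReal_mul (by positivity), ENNReal.ofReal_mul (by positivity),
      ENNReal.ofReal_natCast, ENNReal.ofReal_natCast]
    ring
  · intro j hj
    have : n.choose j = 0 := Nat.choose_eq_zero_of_lt (by simpa using hj)
    simp [this]

end Zoom

/-! ### Limit of the configurations near two distinct points. -/

section TwoBallLimit

variable {d : ℕ} {M : Type*} [MeasurableSpace M] {κ : Sp d → ℝ≥0} {μM : Measure M}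
  [IsProbabilityMeasure μM] {ι : Type*} {F : Filter ι}

lemma lintegral_binLaw_localLaw_le {C : ℝ≥0} (hκb : ∀ x, κ x ≤ C) (x : Sp d) (s r : ℝ) (j : ℕ)
    {w : Set (Sp d × M) → ℝ≥0∞} {K : ℝ≥0} (hwK : ∀ X, w X ≤ K) :
    ∫⁻ X, w X ∂(binLaw (localLaw κ μM x s r) j)
      ≤ K * ((C * (volume (Metric.closedBall (0 : Sp d) r)).toNNReal : ℝ≥0) : ℝ≥0∞) ^ j := by
  have := isFiniteMeasure_localLaw (μM := μM) hκb x s r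
  calc ∫⁻ X, w X ∂(binLaw (localLaw κ μM x s r) j)
      ≤ ∫⁻ _, (K : ℝ≥0∞) ∂(binLaw (localLaw κ μM x s r) j) := lintegral_mono hwK
    _ = K * (localLaw κ μM x s r Set.univ) ^ j := by rw [lintegral_const, binLaw_univ]
    _ ≤ _ := by
      gcongr
      rw [ENNReal.coe_mul, ENNReal.coe_toNNReal measure_closedBall_lt_top.ne]
      exact localLaw_univ_le hκb x s r

/-- In magnified coordinates the density is `κ(x + y/s)` over a fixed finite measure. It tends to `κ
x` for every `y` by continuity at `x`, and the constant `C ^ j * K` dominates the integrand. -/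
lemma tendsto_lintegral_localLaw [F.IsCountablyGenerated] (hκm : Measurable κ) {C : ℝ≥0}
    (hκb : ∀ x, κ x ≤ C) {x : Sp d} (hx : ContinuousAt κ x) {s : ι → ℝ} (hs : Tendsto s F atTop)
    (r : ℝ) (j : ℕ) {w : ι → Set (Sp d × M) → ℝ≥0∞} {v : Set (Sp d × M) → ℝ≥0∞} {K : ℝ≥0}
    (hw : ∀ᶠ i in F, Measurable (w i)) (hv : Measurable v) (hwK : ∀ i X, w i X ≤ K)
    (hlim : ∀ X : Set (Sp d × M), X.Finite → Tendsto (fun i => w i X) F (𝓝 (v X))) :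
    Tendsto (fun i => ∫⁻ X, w i X ∂(binLaw (localLaw κ μM x (s i) r) j)) F
      (𝓝 (∫⁻ X, v X ∂(binLaw ((κ x : ℝ≥0∞) • (leb d μM).restrict (cyl d M r)) j))) := by
  have hden : ∀ i, Measurable fun w : Sp d × M => κ (x + (s i)⁻¹ • w.1) := fun i =>
    hκm.comp (by fun_prop)
  rcases F.eq_or_neBot with rfl | hF
  · exact tendsto_bot
  have hvK : ∀ X : Set (Sp d × M), X.Finite → v X ≤ K := fun X hX =>
    le_of_tendsto (hlim X hX) (Eventually.of_forall fun i => hwK i X)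
  have e2 : ∫⁻ X, v X ∂(binLaw ((κ x : ℝ≥0∞) • (leb d μM).restrict (cyl d M r)) j)
      = ∫⁻ z, (κ x : ℝ≥0∞) ^ j * v (pointSet z)
        ∂(Measure.pi fun _ : Fin j => (leb d μM).restrict (cyl d M r)) := by
    have hvp : Measurable fun z : Fin j → Sp d × M => v (pointSet z) := hv.comp measurable_pointSet
    rw [binLaw_smul _ ENNReal.coe_ne_top, lintegral_smul_measure, lintegral_binLaw _ _ hv,
      lintegral_const_mul _ hvp, smul_eq_mul]
  rw [e2]
  have e1 : (fun i => ∫⁻ z, (∏ k, (κ (x + (s i)⁻¹ • (z k).1) : ℝ≥0∞)) * w i (pointSet z)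
        ∂(Measure.pi fun _ : Fin j => (leb d μM).restrict (cyl d M r)))
      =ᶠ[F] fun i => ∫⁻ X, w i X ∂(binLaw (localLaw κ μM x (s i) r) j) := by
    filter_upwards [hw] with i hi
    exact (lintegral_binLaw_withDensity ((leb d μM).restrict (cyl d M r)) j (hden i) hi).symm
  refine Tendsto.congr' e1 ?_
  refine tendsto_lintegral_filter_of_dominated_convergence' (fun _ => (C : ℝ≥0∞) ^ j * K) ?_ ?_ ?_ ?_
  · filter_upwards [hw] with i hi
    refine Measurable.aemeasurable (Measurable.mul ?_ (hi.comp measurable_pointSet))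
    exact Finset.measurable_prod _ fun k _ =>
      ((hden i).comp (measurable_pi_apply k)).coe_nnreal_ennreal
  · refine Eventually.of_forall fun i => Eventually.of_forall fun z => ?_
    refine mul_le_mul' ?_ (hwK i _)
    calc ∏ k, (κ (x + (s i)⁻¹ • (z k).1) : ℝ≥0∞) ≤ ∏ _k : Fin j, (C : ℝ≥0∞) :=
          Finset.prod_le_prod' fun k _ => ENNReal.coe_le_coe.2 (hκb _)
      _ = _ := by simp
  · rw [lintegral_const]
    exact ENNReal.mul_ne_top (ENNReal.mul_ne_top (by simp) (by simp)) (measure_ne_top _ _)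
  · refine Eventually.of_forall fun z => ?_
    have hsinv : Tendsto (fun i => (s i)⁻¹) F (𝓝 0) := tendsto_inv_atTop_zero.comp hs
    have h1 : ∀ k : Fin j, Tendsto (fun i => (κ (x + (s i)⁻¹ • (z k).1) : ℝ≥0∞)) F
        (𝓝 (κ x : ℝ≥0∞)) := by
      intro k
      have h2 : Tendsto (fun i => x + (s i)⁻¹ • (z k).1) F (𝓝 x) := by
        have := (tendsto_const_nhds (x := x)).add (hsinv.smul_const (z k).1)
        simpa using this
      exact ENNReal.tendsto_coe.2 (hx.tendsto.comp h2)
    have h3 : Tendsto (fun i => ∏ k, (κ (x + (s i)⁻¹ • (z k).1) : ℝ≥0∞)) F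
        (𝓝 ((κ x : ℝ≥0∞) ^ j)) := by
      have h4 : ∀ i, ∏ k, (κ (x + (s i)⁻¹ • (z k).1) : ℝ≥0∞)
          = ((∏ k, κ (x + (s i)⁻¹ • (z k).1) : ℝ≥0) : ℝ≥0∞) := fun i => by push_cast; rfl
      simp_rw [h4]
      rw [← ENNReal.coe_pow]
      refine ENNReal.tendsto_coe.2 ?_
      have := tendsto_finsetProd (s := (Finset.univ : Finset (Fin j)))
        (fun k _ => ENNReal.tendsto_coe.1 (h1 k))
      simpa using this
    exact ENNReal.Tendsto.mul h3 (Or.inr (ne_top_of_le_ne_top ENNReal.coe_ne_top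
      (hvK _ (finite_pointSet z)))) (hlim _ (finite_pointSet z)) (Or.inr (by simp))

lemma tendsto_rpow_inv_atTop (hd : 0 < d) {L : ι → ℝ} (hL : Tendsto L F atTop) :
    Tendsto (fun i => L i ^ (1 / (d : ℝ))) F atTop :=
  (tendsto_rpow_atTop (by positivity)).comp hL

lemma rpow_inv_pow (hd : 0 < d) {l : ℝ} (hl : 0 ≤ l) : (l ^ (1 / (d : ℝ))) ^ d = l := by
  rw [← Real.rpow_natCast, ← Real.rpow_mul hl]
  have : (d : ℝ) ≠ 0 := by positivity
  rw [one_div_mul_cancel this, Real.rpow_one]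

lemma disjoint_preimage_cyl {x y : Sp d} {s r : ℝ} (hs : 0 < s) (h : 2 * r < s * dist x y) :
    Disjoint (posMap (zoom x s) ⁻¹' cyl d M r) (posMap (zoom y s) ⁻¹' cyl d M r) := by
  refine Set.disjoint_left.2 fun w h1 h2 => ?_
  have h1' : ‖zoom x s w.1‖ ≤ r := by simpa [posMap] using h1.1
  have h2' : ‖zoom y s w.1‖ ≤ r := by simpa [posMap] using h2.1
  simp only [zoom, norm_smul, Real.norm_of_nonneg hs.le] at h1' h2'
  have h3 : dist x y ≤ ‖w.1 - x‖ + ‖w.1 - y‖ := by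
    rw [dist_eq_norm, show x - y = (w.1 - y) - (w.1 - x) by abel]
    exact (norm_sub_le _ _).trans (by rw [add_comm])
  nlinarith

/-- Near two distinct points of continuity of the density, a rescaled binomial process looks like
two independent homogeneous Poisson processes. -/
lemma tendsto_lintegral_twoBall [F.IsCountablyGenerated] (hd : 0 < d)
    (hκ1 : ∫⁻ x, (κ x : ℝ≥0∞) = 1) (hκm : Measurable κ) {C : ℝ≥0} (hκb : ∀ x, κ x ≤ C)
    {x y : Sp d} (hxy : x ≠ y) (hx : ContinuousAt κ x) (hy : ContinuousAt κ y) (r : ℝ)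
    {N : ι → ℕ} {L : ι → ℝ} (hL : Tendsto L F atTop)
    (hN : Tendsto (fun i => (N i : ℝ) / L i) F (𝓝 1))
    {w w' : ι → Set (Sp d × M) → ℝ≥0∞} {v v' : Set (Sp d × M) → ℝ≥0∞} {K : ℝ≥0}
    (hw : ∀ᶠ i in F, Measurable (w i)) (hw' : ∀ᶠ i in F, Measurable (w' i))
    (hv : Measurable v) (hv' : Measurable v')
    (hwK : ∀ i X, w i X ≤ K) (hwK' : ∀ i X, w' i X ≤ K)
    (hlim : ∀ X : Set (Sp d × M), X.Finite → Tendsto (fun i => w i X) F (𝓝 (v X)))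
    (hlim' : ∀ X : Set (Sp d × M), X.Finite → Tendsto (fun i => w' i X) F (𝓝 (v' X))) :
    Tendsto (fun i => ∫⁻ X, w i (zoomSet x (L i ^ (1 / (d : ℝ))) X ∩ cyl d M r) *
        w' i (zoomSet y (L i ^ (1 / (d : ℝ))) X ∩ cyl d M r) ∂(binLaw (pointLaw κ μM) (N i))) F
      (𝓝 ((∫⁻ X, v X ∂(poisLaw ((κ x : ℝ≥0∞) • (leb d μM).restrict (cyl d M r)))) *
        ∫⁻ X, v' X ∂(poisLaw ((κ y : ℝ≥0∞) • (leb d μM).restrict (cyl d M r))))) := by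
  rcases F.eq_or_neBot with rfl | hF
  · exact tendsto_bot
  have hsT := tendsto_rpow_inv_atTop hd hL
  have hmass : ∀ {z : Sp d}, ContinuousAt κ z →
      Tendsto (fun i => localLaw κ μM z (L i ^ (1 / (d : ℝ))) r Set.univ) F
        (𝓝 (((κ z : ℝ≥0∞) • (leb d μM).restrict (cyl d M r)) Set.univ)) := by
    intro z hz
    -- A single point and the constant functional `1` give convergence of the total masses.
    have h1 := tendsto_lintegral_localLaw (μM := μM) hκm hκb hz hsT r 1
      (w := fun _ _ => 1) (v := fun _ => 1) (K := 1) (Eventually.of_forall fun i => measurable_const)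
      measurable_const (fun _ _ => by simp) (fun _ _ => tendsto_const_nhds)
    have hf1 : IsFiniteMeasure ((κ z : ℝ≥0∞) • (leb d μM).restrict (cyl d M r)) :=
      Measure.smul_finite _ ENNReal.coe_ne_top
    have hf2 := fun s => isFiniteMeasure_localLaw (μM := μM) hκb z s r
    simpa [binLaw_univ] using h1
  have hf : ∀ z : Sp d, IsFiniteMeasure ((κ z : ℝ≥0∞) • (leb d μM).restrict (cyl d M r)) :=
    fun z => Measure.smul_finite _ ENNReal.coe_ne_top
  have hfx := hf x
  have hfy := hf y
  set νx := (κ x : ℝ≥0∞) • (leb d μM).restrict (cyl d M r) with hνx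
  set νy := (κ y : ℝ≥0∞) • (leb d μM).restrict (cyl d M r) with hνy
  have hmassR : ∀ {z : Sp d}, ContinuousAt κ z →
      Tendsto (fun i => (localLaw κ μM z (L i ^ (1 / (d : ℝ))) r Set.univ).toReal) F
        (𝓝 (((κ z : ℝ≥0∞) • (leb d μM).restrict (cyl d M r)) Set.univ).toReal) := fun {z} hz => by
    have := hf z
    exact (ENNReal.tendsto_toReal (measure_ne_top _ _)).comp (hmass hz)
  set ρ : ι → ℝ := fun i => 1 - (L i)⁻¹ *
    ((localLaw κ μM x (L i ^ (1 / (d : ℝ))) r Set.univ).toReal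
      + (localLaw κ μM y (L i ^ (1 / (d : ℝ))) r Set.univ).toReal) with hρdef
  have hsum := (hmassR hx).add (hmassR hy)
  have hρ : Tendsto (fun i => L i * (1 - ρ i)) F
      (𝓝 ((νx Set.univ).toReal + (νy Set.univ).toReal)) := by
    refine hsum.congr' ?_
    filter_upwards [hL.eventually_gt_atTop 0] with i hi
    simp only [hρdef]
    field_simp
    ring
  have hρlim : Tendsto ρ F (𝓝 1) := by
    have h0 := (tendsto_inv_atTop_zero.comp hL).mul hsum
    rw [zero_mul] at h0
    have := (tendsto_const_nhds (x := (1 : ℝ))).sub h0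
    rw [sub_zero] at this
    exact this
  have hρ0 : ∀ᶠ i in F, 0 ≤ ρ i :=
    (hρlim.eventually_const_lt (show (0 : ℝ) < 1 by norm_num)).mono fun i hi => hi.le
  have hρ1 : ∀ᶠ i in F, ρ i ≤ 1 := by
    filter_upwards [hL.eventually_gt_atTop 0] with i hi
    simp only [hρdef, sub_le_self_iff]
    positivity
  have hvK : ∀ X : Set (Sp d × M), X.Finite → v X ≤ K := fun X hX =>
    le_of_tendsto (hlim X hX) (Eventually.of_forall fun i => hwK i X)
  have hvK' : ∀ X : Set (Sp d × M), X.Finite → v' X ≤ K := fun X hX =>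
    le_of_tendsto (hlim' X hX) (Eventually.of_forall fun i => hwK' i X)
  have hfin : ∀ (ν : Measure (Sp d × M)) [IsFiniteMeasure ν] (u : Set (Sp d × M) → ℝ≥0∞) (j : ℕ),
      (∀ X : Set (Sp d × M), X.Finite → u X ≤ K) → ∫⁻ X, u X ∂(binLaw ν j) ≠ ∞ := by
    intro ν _ u j hu
    refine ne_top_of_le_ne_top ?_ (lintegral_mono_ae (g := fun _ => (K : ℝ≥0∞)) ?_)
    · rw [lintegral_const]
      exact ENNReal.mul_ne_top ENNReal.coe_ne_top (measure_ne_top _ _)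
    · filter_upwards [ae_finite_binLaw ν j] with X hX using hu X hX
  have key := tendsto_trinomial_sum hL hN hρ0 hρ1 hρ
    (a := fun i j => ∫⁻ X, w i X ∂(binLaw (localLaw κ μM x (L i ^ (1 / (d : ℝ))) r) j))
    (a' := fun i j => ∫⁻ X, w' i X ∂(binLaw (localLaw κ μM y (L i ^ (1 / (d : ℝ))) r) j))
    (Eventually.of_forall fun i j => lintegral_binLaw_localLaw_le hκb x _ r j (hwK i))
    (Eventually.of_forall fun i j => lintegral_binLaw_localLaw_le hκb y _ r j (hwK' i))
    (fun j => tendsto_lintegral_localLaw hκm hκb hx hsT r j hw hv hwK hlim)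
    (fun j => tendsto_lintegral_localLaw hκm hκb hy hsT r j hw' hv' hwK' hlim')
    (fun j => hfin νx v j hvK) (fun j => hfin νy v' j hvK')
  have hlimit : ∑' p : ℕ × ℕ, ENNReal.ofReal (1 / p.1 ! * (1 / p.2 !) *
        Real.exp (-((νx Set.univ).toReal + (νy Set.univ).toReal))) *
        ((∫⁻ X, v X ∂(binLaw νx p.1)) * ∫⁻ X, v' X ∂(binLaw νy p.2))
      = (∫⁻ X, v X ∂(poisLaw νx)) * ∫⁻ X, v' X ∂(poisLaw νy) := by
    rw [lintegral_poisLaw, lintegral_poisLaw, ← ENNReal.tsum_mul_right]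
    simp_rw [← ENNReal.tsum_mul_left]
    rw [← ENNReal.tsum_prod]
    refine tsum_congr fun p => ?_
    have : (1 / p.1 ! * (1 / p.2 !) *
        Real.exp (-((νx Set.univ).toReal + (νy Set.univ).toReal)) : ℝ)
        = (Real.exp (-(νx Set.univ).toReal) / p.1 !) * (Real.exp (-(νy Set.univ).toReal) / p.2 !) := by
      rw [neg_add, Real.exp_add]; ring
    rw [this, ENNReal.ofReal_mul (by positivity)]
    ring
  rw [hlimit] at key
  refine key.congr' ?_
  have hdist : 0 < dist x y := dist_pos.2 hxy
  -- Two fixed distinct points eventually have disjoint neighbourhoods of magnified radius `r`,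
  -- which the exact formula requires.
  have hfar : ∀ᶠ i in F, 2 * r < L i ^ (1 / (d : ℝ)) * dist x y :=
    (hsT.atTop_mul_const hdist).eventually_gt_atTop _
  filter_upwards [hw, hw', hL.eventually_gt_atTop 0, hsT.eventually_gt_atTop 0, hfar]
    with i h1 h2 h3 h4 h5
  rw [lintegral_twoBall hd hκ1 hκm hκb h4 (disjoint_preimage_cyl h4 h5) (N i) h1 h2,
    rpow_inv_pow hd h3.le]

end TwoBallLimit

/-! ### A measurable version of stabilization. -/

section Stab

variable {d : ℕ} {M : Type*} [MeasurableSpace M] {κ : Sp d → ℝ≥0} {μM : Measure M}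
  [IsProbabilityMeasure μM]

lemma pi_absolutelyContinuous {α : Type*} [MeasurableSpace α] {ν ν' : Measure α} [SigmaFinite ν]
    [SigmaFinite ν'] (h : ν ≪ ν') (n : ℕ) :
    (Measure.pi fun _ : Fin n => ν) ≪ Measure.pi fun _ : Fin n => ν' := by
  induction n with
  | zero => rw [Measure.pi_of_empty, Measure.pi_of_empty]
  | succ n ih =>
    have m1 := (measurePreserving_piFinSuccAbove (fun _ : Fin (n + 1) => ν) 0).symm
    have m2 := (measurePreserving_piFinSuccAbove (fun _ : Fin (n + 1) => ν') 0).symm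
    rw [← m1.map_eq, ← m2.map_eq]
    exact (h.prod ih).map m1.measurable

lemma binLaw_mono_ac {ν ν' : Measure (Sp d × M)} [SigmaFinite ν] [SigmaFinite ν'] (h : ν ≪ ν')
    (n : ℕ) : binLaw ν n ≪ binLaw ν' n :=
  (pi_absolutelyContinuous h n).map measurable_pointSet

/-- A countably generated σ-algebra is generated by a countable algebra, which is a π-system;
equality of the measures is then a countable intersection of equalities of their values. -/
lemma measurableSet_eq_measure {α β : Type*} [MeasurableSpace α] [MeasurableSpace β]
    [MeasurableSpace.CountablyGenerated α] {f g : β → Measure α} (hf : Measurable f)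
    (hg : Measurable g) (hfin : ∀ b, IsFiniteMeasure (f b)) :
    MeasurableSet {b | f b = g b} := by
  let C := generateSetAlgebra (MeasurableSpace.countableGeneratingSet α)
  have hC : C.Countable :=
    countable_generateSetAlgebra (MeasurableSpace.countable_countableGeneratingSet)
  have hgen : ‹MeasurableSpace α› = MeasurableSpace.generateFrom C := by
    rw [generateFrom_generateSetAlgebra_eq, MeasurableSpace.generateFrom_countableGeneratingSet]
  have hCm : ∀ s ∈ C, MeasurableSet s := fun s hs => by
    rw [hgen]
    exact MeasurableSpace.measurableSet_generateFrom hs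
  have hpi : IsPiSystem C := fun s hs t ht _ =>
    (isSetAlgebra_generateSetAlgebra (𝒜 := MeasurableSpace.countableGeneratingSet α)).inter_mem hs ht
  have : {b | f b = g b} = {b | f b Set.univ = g b Set.univ} ∩ ⋂ s ∈ C, {b | f b s = g b s} := by
    ext b
    simp only [Set.mem_ofPred_eq, Set.mem_inter_iff, Set.mem_iInter]
    refine ⟨fun h => by simp [h], fun h => ?_⟩
    have := hfin b
    exact ext_of_generate_finite C hgen hpi h.2 h.1
  rw [this]
  refine MeasurableSet.inter ?_ (MeasurableSet.biInter hC fun s hs => ?_)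
  · exact measurableSet_eq_fun ((Measure.measurable_coe MeasurableSet.univ).comp hf)
      ((Measure.measurable_coe MeasurableSet.univ).comp hg)
  · exact measurableSet_eq_fun ((Measure.measurable_coe (hCm s hs)).comp hf)
      ((Measure.measurable_coe (hCm s hs)).comp hg)

open Classical in
/-- `zoomSet` on finite configurations, and `∅` on infinite ones. -/
def zoomFin (x : Sp d) (s : ℝ) (X : Set (Sp d × M)) : Set (Sp d × M) :=
  if X.Finite then zoomSet x s X else ∅

lemma zoomFin_of_finite {X : Set (Sp d × M)} (hX : X.Finite) (x : Sp d) (s : ℝ) :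
    zoomFin x s X = zoomSet x s X := if_pos hX

lemma finite_zoomFin (x : Sp d) (s : ℝ) (X : Set (Sp d × M)) : (zoomFin x s X).Finite := by
  unfold zoomFin
  split_ifs with h
  · exact h.image _
  · exact Set.finite_empty

lemma measurable_zoomFin {s : ℝ} (hs : 0 < s) :
    Measurable fun p : (Sp d × M) × Set (Sp d × M) => zoomFin p.1.1 s p.2 := by
  classical
  refine measurable_config_iff.2 fun B hB => ?_
  have hC : MeasurableSet {q : (Sp d × M) × (Sp d × M) | (zoom q.2.1 s q.1.1, q.1.2) ∈ B} := by
    have : Measurable fun q : (Sp d × M) × (Sp d × M) =>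
        ((zoom q.2.1 s q.1.1, q.1.2) : Sp d × M) := by
      unfold zoom; fun_prop
    exact this hB
  have h := measurable_encard_section_ite hC
  have : (fun p : (Sp d × M) × Set (Sp d × M) => (zoomFin p.1.1 s p.2 ∩ B).encard)
      = fun q => if q.2.Finite then (q.2 ∩ {w | (w, q.1) ∈
        {q : (Sp d × M) × (Sp d × M) | (zoom q.2.1 s q.1.1, q.1.2) ∈ B}}).encard else 0 := by
    ext q : 1
    by_cases hq : q.2.Finite
    · rw [zoomFin_of_finite hq, if_pos hq, zoomSet, ← Set.image_inter_preimage,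
        (posMap_injective (zoom_injective q.1.1 hs.ne')).encard_image]
      rfl
    · simp [zoomFin, hq]
  rw [this]
  exact h

/-- A law of configurations that dominates those of all binomial processes. -/
def refLaw (d : ℕ) (μM : Measure M) : Measure (Set (Sp d × M)) :=
  Measure.sum fun n : ℕ => binLaw (leb d μM) n

instance : SFinite (refLaw d μM) := by unfold refLaw; infer_instance

/-- Pairs `(z, X)` such that changing `X` off the ball of radius `r` almost never affects `θ`. -/
def stabSet (θ : Sp d × M → Set (Sp d × M) → Measure (Sp d)) (μM : Measure M) (r : ℝ) :
    Set ((Sp d × M) × Set (Sp d × M)) :=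
  {p | ∀ᵐ Y ∂(refLaw d μM), θ p.1 (glue (cyl d M r) p.2 Y) = θ p.1 (p.2 ∩ cyl d M r)}

lemma glue_inter_self (B X Y : Set (Sp d × M)) : glue B (X ∩ B) Y = glue B X Y := by
  rw [glue, glue, Set.inter_assoc, Set.inter_self]

lemma glue_self (B X : Set (Sp d × M)) : glue B (X ∩ B) (X \ B) = X := by
  ext w
  simp only [glue, Set.mem_union, Set.mem_inter_iff, Set.mem_sdiff]
  tauto

lemma mem_stabSet_inter {θ : Sp d × M → Set (Sp d × M) → Measure (Sp d)} {r : ℝ} {z : Sp d × M}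
    {X : Set (Sp d × M)} : (z, X ∩ cyl d M r) ∈ stabSet θ μM r ↔ (z, X) ∈ stabSet θ μM r := by
  simp only [stabSet, Set.mem_ofPred_eq, glue_inter_self, Set.inter_assoc, Set.inter_self]

variable {θ : Sp d × M → Set (Sp d × M) → Measure (Sp d)}

/-- Invariance under all finite modifications off the ball is an uncountable condition with no
evident measurability. Required only for `refLaw`-almost every `Y`, it says that a section of a
measurable set is null, which is a measurable condition by Fubini. -/
lemma measurableSet_stabSet (hθ : Measurable fun p : (Sp d × M) × Set (Sp d × M) => θ p.1 p.2)
    (hfin : ∀ z X, IsFiniteMeasure (θ z X)) (r : ℝ) : MeasurableSet (stabSet θ μM r) := by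
  have hm : MeasurableSet {q : ((Sp d × M) × Set (Sp d × M)) × Set (Sp d × M) |
      θ q.1.1 (glue (cyl d M r) q.1.2 q.2) = θ q.1.1 (q.1.2 ∩ cyl d M r)} := by
    refine measurableSet_eq_measure ?_ ?_ fun q => hfin _ _
    · exact hθ.comp ((measurable_fst.comp measurable_fst).prodMk ((measurable_glue
        (measurableSet_cyl r)).comp ((measurable_snd.comp measurable_fst).prodMk measurable_snd)))
    · exact hθ.comp ((measurable_fst.comp measurable_fst).prodMk ((measurable_config_inter
        (measurableSet_cyl r)).comp (measurable_snd.comp measurable_fst)))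
  have h := measurable_measure_prodMk_left (ν := refLaw d μM) hm.compl
  exact h (measurableSet_singleton 0)

/-- By `binLaw_split` the points off the ball are governed by laws, independent of the points
inside, that are absolutely continuous with respect to `refLaw`. They almost surely avoid the
exceptional `Y` allowed in the definition of `stabSet`. -/
lemma ae_stab_binLaw (hd : 0 < d) (hθ : Measurable fun p : (Sp d × M) × Set (Sp d × M) => θ p.1 p.2)
    (hfin : ∀ z X, IsFiniteMeasure (θ z X)) (r : ℝ) {ν : Measure (Sp d × M)} [IsFiniteMeasure ν]
    (hν : ν ≪ leb d μM) (n : ℕ) (z : Sp d × M) :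
    ∀ᵐ X ∂(binLaw ν n), (z, X) ∈ stabSet θ μM r → θ z X = θ z (X ∩ cyl d M r) := by
  have hz : Measurable fun X : Set (Sp d × M) => (z, X) := measurable_prodMk_left
  have hS : MeasurableSet {X : Set (Sp d × M) | (z, X) ∈ stabSet θ μM r} :=
    hz (measurableSet_stabSet hθ hfin r)
  have hθz : Measurable (θ z) := hθ.comp hz
  have hE : MeasurableSet {p : Set (Sp d × M) × Set (Sp d × M) |
      θ z (glue (cyl d M r) p.1 p.2) = θ z (p.1 ∩ cyl d M r)} := by
    refine measurableSet_eq_measure ?_ ?_ fun q => hfin _ _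
    · exact hθz.comp (measurable_glue (measurableSet_cyl r))
    · exact hθz.comp ((measurable_config_inter (measurableSet_cyl r)).comp measurable_fst)
  have hbad : MeasurableSet {p : Set (Sp d × M) × Set (Sp d × M) |
      (z, p.1) ∈ stabSet θ μM r ∧ ¬ θ z (glue (cyl d M r) p.1 p.2) = θ z (p.1 ∩ cyl d M r)} :=
    (measurable_fst hS).inter hE.compl
  set bad := {p : Set (Sp d × M) × Set (Sp d × M) |
      (z, p.1) ∈ stabSet θ μM r ∧ ¬ θ z (glue (cyl d M r) p.1 p.2) = θ z (p.1 ∩ cyl d M r)}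
    with hbaddef
  have hat : NoPosAtoms ν := (noPosAtoms_leb hd).mono hν
  have hsplit := binLaw_split ν hat (measurableSet_cyl r) n
    (F := bad.indicator fun _ => 1) (measurable_const.indicator hbad)
  have hzero : ∀ j ∈ Finset.range (n + 1), (n.choose j : ℝ≥0∞) *
      ∫⁻ p, bad.indicator (fun _ => 1) p ∂((binLaw (ν.restrict (cyl d M r)) j).prod
        (binLaw (ν.restrict (cyl d M r)ᶜ) (n - j))) = 0 := by
    intro j _
    rw [lintegral_indicator hbad, setLIntegral_one, Measure.prod_apply hbad,
      lintegral_eq_zero_of_ae_eq_zero, mul_zero]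
    refine Eventually.of_forall fun X => ?_
    by_cases hX : (z, X) ∈ stabSet θ μM r
    · have hac : binLaw (ν.restrict (cyl d M r)ᶜ) (n - j) ≪ refLaw d μM :=
        (binLaw_mono_ac (Measure.restrict_le_self.absolutelyContinuous.trans hν) _).trans
          (Measure.absolutelyContinuous_sum_right _ (Measure.AbsolutelyContinuous.refl _))
      have h1 := hac.ae_le hX
      refine measure_mono_null ?_ h1
      intro Y hY
      exact hY.2
    · have : Prod.mk X ⁻¹' bad = ∅ := by
        ext Y
        simp [hbaddef, hX]
      simp [this]
  rw [Finset.sum_eq_zero hzero] at hsplit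
  have hmeas : Measurable fun X : Set (Sp d × M) =>
      bad.indicator (fun _ => (1 : ℝ≥0∞)) (X ∩ cyl d M r, X \ cyl d M r) :=
    (measurable_const.indicator hbad).comp ((measurable_config_inter (measurableSet_cyl r)).prodMk
      (measurable_config_diff (measurableSet_cyl r)))
  rw [lintegral_eq_zero_iff hmeas] at hsplit
  filter_upwards [hsplit] with X hX hXS
  by_contra hne
  have hmem : (X ∩ cyl d M r, X \ cyl d M r) ∈ bad := by
    refine ⟨mem_stabSet_inter.2 hXS, ?_⟩
    rw [glue_self, Set.inter_assoc, Set.inter_self]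
    exact hne
  simp [Set.indicator_of_mem hmem] at hX

lemma posMap_zoom_map_ac (hκm : Measurable κ) (x : Sp d) {s : ℝ} (hs : 0 < s) :
    (pointLaw κ μM).map (posMap (zoom x s)) ≪ leb d μM := by
  rw [map_posMap_zoom_pointLaw hκm x hs]
  exact (withDensity_absolutelyContinuous _ _).smul_left _

lemma ae_stab_zoomFin (hd : 0 < d) (hκ1 : ∫⁻ x, (κ x : ℝ≥0∞) = 1) (hκm : Measurable κ)
    (hθ : Measurable fun p : (Sp d × M) × Set (Sp d × M) => θ p.1 p.2)
    (hfin : ∀ z X, IsFiniteMeasure (θ z X)) (r : ℝ) {s : ℝ} (hs : 0 < s) (n : ℕ) (z : Sp d × M) :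
    ∀ᵐ X ∂(binLaw (pointLaw κ μM) n), (z, zoomFin z.1 s X) ∈ stabSet θ μM r →
      θ z (zoomFin z.1 s X) = θ z (zoomFin z.1 s X ∩ cyl d M r) := by
  have := pointLaw_prob (μM := μM) hκ1
  have h := ae_stab_binLaw hd hθ hfin r (posMap_zoom_map_ac (μM := μM) hκm z.1 hs) n z
  rw [binLaw_map (measurable_zoom z.1 s) (zoom_injective z.1 hs.ne')] at h
  have h2 := ae_of_ae_map (measurable_zoomSet z.1 hs).aemeasurable h
  filter_upwards [h2, ae_finite_binLaw (pointLaw κ μM) n] with X hX hXf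
  rw [zoomFin_of_finite hXf]
  exact hX

end Stab

/-! ### Local configurations at two typical points. -/

section Pairs

variable {d : ℕ} {M : Type*} [MeasurableSpace M] {κ : Sp d → ℝ≥0} {μM : Measure M}
  [IsProbabilityMeasure μM] {ι : Type*} {F : Filter ι}

/-- The law of a homogeneous Poisson process of intensity `a` in the ball of radius `r`. -/
def homLaw (μM : Measure M) (a : ℝ≥0) (r : ℝ) : Measure (Set (Sp d × M)) :=
  poisLaw ((a : ℝ≥0∞) • (leb d μM).restrict (cyl d M r))

instance (a : ℝ≥0) (r : ℝ) : IsProbabilityMeasure (homLaw (d := d) μM a r) := by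
  have : IsFiniteMeasure ((a : ℝ≥0∞) • (leb d μM).restrict (cyl d M r)) :=
    Measure.smul_finite _ ENNReal.coe_ne_top
  unfold homLaw; infer_instance

lemma measurable_lintegral_homLaw (hκm : Measurable κ)
    {w : Sp d × M → Set (Sp d × M) → ℝ≥0∞}
    (hw : Measurable fun p : (Sp d × M) × Set (Sp d × M) => w p.1 p.2) (r : ℝ) :
    Measurable fun z : Sp d × M => ∫⁻ X, w z X ∂(homLaw μM (κ z.1) r) := by
  have hk : Measurable fun z : Sp d × M => κ z.1 := hκm.comp measurable_fst
  simp_rw [homLaw, lintegral_poisLaw, binLaw_smul _ ENNReal.coe_ne_top, lintegral_smul_measure,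
    Measure.smul_apply, smul_eq_mul]
  refine Measurable.tsum fun n => ?_
  refine Measurable.mul ?_ (Measurable.mul (hk.coe_nnreal_ennreal.pow_const n) ?_)
  · refine Measurable.ennreal_ofReal (Measurable.div_const ?_ _)
    exact ((hk.coe_nnreal_ennreal.mul_const _).ennreal_toReal.neg).exp
  · exact hw.lintegral_prod_right'

lemma ae_pointLaw_of_ae_volume (hκm : Measurable κ) {p : Sp d → Prop} (h : ∀ᵐ x, p x) :
    ∀ᵐ z ∂(pointLaw κ μM), p z.1 := by
  rw [pointLaw_eq_withDensity hκm]
  refine (withDensity_absolutelyContinuous _ _).ae_le ?_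
  exact Measure.quasiMeasurePreserving_fst.ae h

lemma ae_fst_ne_fst (hd : 0 < d) (hκm : Measurable κ) (hκ1 : ∫⁻ x, (κ x : ℝ≥0∞) = 1) :
    ∀ᵐ p ∂((pointLaw κ μM).prod (pointLaw κ μM)), p.1.1 ≠ p.2.1 := by
  have := pointLaw_prob (μM := μM) hκ1
  have hm : MeasurableSet {p : (Sp d × M) × (Sp d × M) | p.1.1 ≠ p.2.1} :=
    (measurableSet_eq_fun (by fun_prop) (by fun_prop)).compl
  refine (Measure.ae_prod_mem_iff_ae_ae_mem hm).2 (Eventually.of_forall fun z => ?_)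
  have h0 := noPosAtoms_pointLaw (μM := μM) hd hκm z.1
  filter_upwards [measure_eq_zero_iff_ae_notMem.1 h0] with w hw heq
  exact hw ⟨heq.symm, trivial⟩

/-- Two typical points of a binomial process see independent homogeneous Poisson processes. -/
lemma tendsto_lintegral_pairs [F.IsCountablyGenerated] (hd : 0 < d)
    (hκ1 : ∫⁻ x, (κ x : ℝ≥0∞) = 1) (hκm : Measurable κ) {C : ℝ≥0} (hκb : ∀ x, κ x ≤ C)
    (hκc : ∀ᵐ x, ContinuousAt κ x) (r : ℝ) {N : ι → ℕ} {L : ι → ℝ} (hL : Tendsto L F atTop)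
    (hN : Tendsto (fun i => (N i : ℝ) / L i) F (𝓝 1))
    {w w' : ι → Sp d × M → Set (Sp d × M) → ℝ≥0∞} {v v' : Sp d × M → Set (Sp d × M) → ℝ≥0∞}
    {K : ℝ≥0}
    (hw : ∀ᶠ i in F, Measurable fun p : (Sp d × M) × Set (Sp d × M) => w i p.1 p.2)
    (hw' : ∀ᶠ i in F, Measurable fun p : (Sp d × M) × Set (Sp d × M) => w' i p.1 p.2)
    (hv : Measurable fun p : (Sp d × M) × Set (Sp d × M) => v p.1 p.2)
    (hv' : Measurable fun p : (Sp d × M) × Set (Sp d × M) => v' p.1 p.2)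
    (hwK : ∀ i z X, w i z X ≤ K) (hwK' : ∀ i z X, w' i z X ≤ K)
    (hlim : ∀ᵐ z ∂(pointLaw κ μM), ∀ X : Set (Sp d × M), X.Finite →
      Tendsto (fun i => w i z X) F (𝓝 (v z X)))
    (hlim' : ∀ᵐ z ∂(pointLaw κ μM), ∀ X : Set (Sp d × M), X.Finite →
      Tendsto (fun i => w' i z X) F (𝓝 (v' z X))) :
    Tendsto (fun i => ∫⁻ q, w i q.1.1 (zoomFin q.1.1.1 (L i ^ (1 / (d : ℝ))) q.2 ∩ cyl d M r) *
        w' i q.1.2 (zoomFin q.1.2.1 (L i ^ (1 / (d : ℝ))) q.2 ∩ cyl d M r)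
        ∂(((pointLaw κ μM).prod (pointLaw κ μM)).prod (binLaw (pointLaw κ μM) (N i)))) F
      (𝓝 ((∫⁻ z, ∫⁻ X, v z X ∂(homLaw μM (κ z.1) r) ∂(pointLaw κ μM)) *
        ∫⁻ z, ∫⁻ X, v' z X ∂(homLaw μM (κ z.1) r) ∂(pointLaw κ μM))) := by
  have := pointLaw_prob (μM := μM) hκ1
  set μ := pointLaw κ μM with hμ
  have hsT := tendsto_rpow_inv_atTop hd hL
  have hmeas : ∀ᶠ i in F, Measurable fun q : ((Sp d × M) × (Sp d × M)) × Set (Sp d × M) =>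
      w i q.1.1 (zoomFin q.1.1.1 (L i ^ (1 / (d : ℝ))) q.2 ∩ cyl d M r) *
        w' i q.1.2 (zoomFin q.1.2.1 (L i ^ (1 / (d : ℝ))) q.2 ∩ cyl d M r) := by
    filter_upwards [hw, hw', hsT.eventually_gt_atTop 0] with i h1 h2 h3
    have hz := measurable_zoomFin (d := d) (M := M) h3
    have hc := measurable_config_inter (measurableSet_cyl (d := d) (M := M) r)
    refine Measurable.mul ?_ ?_
    · exact h1.comp ((measurable_fst.comp measurable_fst).prodMk (hc.comp (hz.comp
        ((measurable_fst.comp measurable_fst).prodMk measurable_snd))))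
    · exact h2.comp ((measurable_snd.comp measurable_fst).prodMk (hc.comp (hz.comp
        ((measurable_snd.comp measurable_fst).prodMk measurable_snd))))
  rw [← lintegral_prod_mul (measurable_lintegral_homLaw hκm hv r).aemeasurable
    (measurable_lintegral_homLaw hκm hv' r).aemeasurable]
  have e1 : (fun i => ∫⁻ p, ∫⁻ X, w i p.1 (zoomFin p.1.1 (L i ^ (1 / (d : ℝ))) X ∩ cyl d M r) *
        w' i p.2 (zoomFin p.2.1 (L i ^ (1 / (d : ℝ))) X ∩ cyl d M r) ∂(binLaw μ (N i)) ∂(μ.prod μ))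
      =ᶠ[F] fun i => ∫⁻ q, w i q.1.1 (zoomFin q.1.1.1 (L i ^ (1 / (d : ℝ))) q.2 ∩ cyl d M r) *
        w' i q.1.2 (zoomFin q.1.2.1 (L i ^ (1 / (d : ℝ))) q.2 ∩ cyl d M r)
        ∂((μ.prod μ).prod (binLaw μ (N i))) := by
    filter_upwards [hmeas] with i hi
    rw [lintegral_prod _ hi.aemeasurable]
  refine Tendsto.congr' e1 ?_
  refine tendsto_lintegral_filter_of_dominated_convergence' (fun _ => (K : ℝ≥0∞) * K) ?_ ?_ ?_ ?_
  · filter_upwards [hmeas] with i hi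
    exact hi.lintegral_prod_right'.aemeasurable
  · refine Eventually.of_forall fun i => Eventually.of_forall fun p => ?_
    refine (lintegral_mono (g := fun _ => (K : ℝ≥0∞) * K) fun X =>
      mul_le_mul' (hwK _ _ _) (hwK' _ _ _)).trans ?_
    simp
  · rw [lintegral_const]
    exact ENNReal.mul_ne_top (ENNReal.mul_ne_top ENNReal.coe_ne_top ENNReal.coe_ne_top)
      (measure_ne_top _ _)
  -- Almost every pair consists of two distinct continuity points of `κ`. For such a frozen pair the
  -- two-ball limit applies, and the bound `K * K` carries it through the integral over pairs.
  · have hc := ae_pointLaw_of_ae_volume (μM := μM) hκm hκc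
    filter_upwards [ae_fst_ne_fst (μM := μM) hd hκm hκ1,
      (Measure.quasiMeasurePreserving_fst (μ := μ) (ν := μ)).ae hc,
      (Measure.quasiMeasurePreserving_snd (μ := μ) (ν := μ)).ae hc,
      (Measure.quasiMeasurePreserving_fst (μ := μ) (ν := μ)).ae hlim,
      (Measure.quasiMeasurePreserving_snd (μ := μ) (ν := μ)).ae hlim'] with p hne hc1 hc2 hl1 hl2
    have h := tendsto_lintegral_twoBall (μM := μM) hd hκ1 hκm hκb hne hc1 hc2 r hL hN
      (w := fun i => w i p.1) (w' := fun i => w' i p.2) (v := v p.1) (v' := v' p.2) (K := K)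
      (hw.mono fun i hi => hi.comp measurable_prodMk_left)
      (hw'.mono fun i hi => hi.comp measurable_prodMk_left)
      (hv.comp measurable_prodMk_left) (hv'.comp measurable_prodMk_left)
      (fun i X => hwK i _ X) (fun i X => hwK' i _ X) hl1 hl2
    refine h.congr fun i => ?_
    refine lintegral_congr_ae ?_
    filter_upwards [ae_finite_binLaw μ (N i)] with X hX
    rw [zoomFin_of_finite hX, zoomFin_of_finite hX]

end Pairs

/-! ### Localization of functionals at two points. -/

section Core

variable {d : ℕ} {M : Type*} [MeasurableSpace M] {κ : Sp d → ℝ≥0} {μM : Measure M}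
  [IsProbabilityMeasure μM] {ι : Type*} {F : Filter ι}
  {θ : Sp d × M → Set (Sp d × M) → Measure (Sp d)}

/-- The mean over a typical point of `u`, restricted to stabilization within radius `r`. -/
def locVal (κ : Sp d → ℝ≥0) (μM : Measure M) (θ : Sp d × M → Set (Sp d × M) → Measure (Sp d))
    (u : Sp d × M → Set (Sp d × M) → ℝ≥0∞) (r : ℝ) : ℝ≥0∞ :=
  ∫⁻ z, ∫⁻ X, (stabSet θ μM r).indicator (fun p => u p.1 p.2) (z, X) ∂(homLaw μM (κ z.1) r)
    ∂(pointLaw κ μM)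

/-- The probability that a typical point is not stabilized within radius `r`. -/
def stabErr (κ : Sp d → ℝ≥0) (μM : Measure M) (θ : Sp d × M → Set (Sp d × M) → Measure (Sp d))
    (r : ℝ) : ℝ≥0∞ :=
  ∫⁻ z, ∫⁻ X, (stabSet θ μM r)ᶜ.indicator (fun _ => 1) (z, X) ∂(homLaw μM (κ z.1) r)
    ∂(pointLaw κ μM)

lemma zoomSet_insert_inter_cyl {x : Sp d} {s r : ℝ} {w : Sp d × M} {X : Set (Sp d × M)}
    (h : r < ‖zoom x s w.1‖) :
    zoomSet x s (insert w X) ∩ cyl d M r = zoomSet x s X ∩ cyl d M r := by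
  rw [zoomSet, Set.image_insert_eq, Set.insert_inter_of_notMem]
  · rfl
  · rintro ⟨h1, -⟩
    have : ‖zoom x s w.1‖ ≤ r := by simpa [posMap] using h1
    exact absurd this (not_le.2 h)

lemma norm_zoom_comm (x y : Sp d) (s : ℝ) : ‖zoom x s y‖ = ‖zoom y s x‖ := by
  simp only [zoom, norm_smul, norm_sub_rev]

/-- By `binLaw_succ`, inserting the second point gives a binomial process of `n + 1` points
independent of the first point, to which `ae_stab_zoomFin` applies. -/
lemma ae_prod_stab_ins (hd : 0 < d) (hκ1 : ∫⁻ x, (κ x : ℝ≥0∞) = 1) (hκm : Measurable κ)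
    (hθ : Measurable fun p : (Sp d × M) × Set (Sp d × M) => θ p.1 p.2)
    (hfin : ∀ z X, IsFiniteMeasure (θ z X)) (r : ℝ) {s : ℝ} (hs : 0 < s) (n : ℕ) :
    ∀ᵐ q ∂(((pointLaw κ μM).prod (pointLaw κ μM)).prod (binLaw (pointLaw κ μM) n)),
      (q.1.1, zoomFin q.1.1.1 s (ins q.1.2 q.2)) ∈ stabSet θ μM r →
      θ q.1.1 (zoomFin q.1.1.1 s (ins q.1.2 q.2))
        = θ q.1.1 (zoomFin q.1.1.1 s (ins q.1.2 q.2) ∩ cyl d M r) := by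
  have := pointLaw_prob (μM := μM) hκ1
  set μ := pointLaw κ μM with hμ
  have hz := measurable_zoomFin (M := M) (d := d) hs
  have hc := measurable_config_inter (measurableSet_cyl (d := d) (M := M) r)
  have hzi : Measurable fun q : ((Sp d × M) × (Sp d × M)) × Set (Sp d × M) =>
      zoomFin q.1.1.1 s (ins q.1.2 q.2) :=
    hz.comp ((measurable_fst.comp measurable_fst).prodMk (measurable_ins.comp
      ((measurable_snd.comp measurable_fst).prodMk measurable_snd)))
  have hQ : MeasurableSet {q : ((Sp d × M) × (Sp d × M)) × Set (Sp d × M) |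
      (q.1.1, zoomFin q.1.1.1 s (ins q.1.2 q.2)) ∈ stabSet θ μM r →
      θ q.1.1 (zoomFin q.1.1.1 s (ins q.1.2 q.2))
        = θ q.1.1 (zoomFin q.1.1.1 s (ins q.1.2 q.2) ∩ cyl d M r)} := by
    have h1 : MeasurableSet {q : ((Sp d × M) × (Sp d × M)) × Set (Sp d × M) |
        (q.1.1, zoomFin q.1.1.1 s (ins q.1.2 q.2)) ∈ stabSet θ μM r} :=
      ((measurable_fst.comp measurable_fst).prodMk hzi) (measurableSet_stabSet hθ hfin r)
    have h2 : MeasurableSet {q : ((Sp d × M) × (Sp d × M)) × Set (Sp d × M) |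
        θ q.1.1 (zoomFin q.1.1.1 s (ins q.1.2 q.2))
        = θ q.1.1 (zoomFin q.1.1.1 s (ins q.1.2 q.2) ∩ cyl d M r)} := by
      refine measurableSet_eq_measure ?_ ?_ fun q => hfin _ _
      · exact hθ.comp ((measurable_fst.comp measurable_fst).prodMk hzi)
      · exact hθ.comp ((measurable_fst.comp measurable_fst).prodMk (hc.comp hzi))
    exact h1.imp h2
  have hassoc := (measurePreserving_prodAssoc μ μ (binLaw μ n)).symm
  rw [← hassoc.map_eq]
  rw [ae_map_iff hassoc.measurable.aemeasurable hQ]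
  refine (Measure.ae_prod_mem_iff_ae_ae_mem (hassoc.measurable hQ)).2
    (Eventually.of_forall fun z => ?_)
  have h := ae_stab_zoomFin (μM := μM) hd hκ1 hκm hθ hfin r hs (n + 1) z
  rw [binLaw_succ (noPosAtoms_pointLaw hd hκm)] at h
  exact ae_of_ae_map measurable_ins.aemeasurable h

/-- Localization: products of two bounded stabilizing functionals. -/
lemma ae_prod_localize (hd : 0 < d) (hκ1 : ∫⁻ x, (κ x : ℝ≥0∞) = 1) (hκm : Measurable κ)
    (hθ : Measurable fun p : (Sp d × M) × Set (Sp d × M) => θ p.1 p.2)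
    (hfin : ∀ z X, IsFiniteMeasure (θ z X)) (r : ℝ) {s : ℝ} (hs : 0 < s) (n : ℕ)
    {U : Sp d × M → Set (Sp d × M) → ℝ≥0∞} (hU : ∀ z X X', θ z X = θ z X' → U z X = U z X') :
    ∀ᵐ q ∂(((pointLaw κ μM).prod (pointLaw κ μM)).prod (binLaw (pointLaw κ μM) n)),
      r < ‖zoom q.1.1.1 s q.1.2.1‖ →
      ((q.1.1, zoomFin q.1.1.1 s q.2 ∩ cyl d M r) ∈ stabSet θ μM r →
      U q.1.1 (zoomFin q.1.1.1 s (ins q.1.2 q.2)) = U q.1.1 (zoomFin q.1.1.1 s q.2 ∩ cyl d M r)) := by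
  have := pointLaw_prob (μM := μM) hκ1
  have hf : ∀ᵐ q ∂(((pointLaw κ μM).prod (pointLaw κ μM)).prod (binLaw (pointLaw κ μM) n)),
      (q.1.2, q.2) ∈ FreshPairs d M := by
    have hm : MeasurableSet {q : ((Sp d × M) × (Sp d × M)) × Set (Sp d × M) |
        (q.1.2, q.2) ∈ FreshPairs d M} :=
      ((measurable_snd.comp measurable_fst).prodMk measurable_snd) measurableSet_freshPairs
    refine (Measure.ae_prod_mem_iff_ae_ae_mem hm).2 (Eventually.of_forall fun p => ?_)
    filter_upwards [ae_finite_binLaw (pointLaw κ μM) n,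
      ae_inter_eq_empty_binLaw (noPosAtoms_pointLaw (μM := μM) hd hκm) n p.2.1] with X h1 h2
    exact ⟨h1, h2⟩
  filter_upwards [hf, ae_prod_stab_ins hd hκ1 hκm hθ hfin r hs n] with q hq1 hq2 hfar hst
  rw [ins_of_mem hq1] at hq2 ⊢
  have hfinX : q.2.Finite := hq1.1
  -- The inserted point has magnified distance larger than `r` and is invisible inside the ball.
  have e : zoomFin q.1.1.1 s (insert q.1.2 q.2) ∩ cyl d M r = zoomFin q.1.1.1 s q.2 ∩ cyl d M r := by
    rw [zoomFin_of_finite hfinX, zoomFin_of_finite (hfinX.insert _)]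
    exact zoomSet_insert_inter_cyl hfar
  have hmem : (q.1.1, zoomFin q.1.1.1 s (insert q.1.2 q.2)) ∈ stabSet θ μM r := by
    rw [← mem_stabSet_inter, e]; exact hst
  rw [← e]
  exact hU _ _ _ (hq2 hmem)

end Core

/-! ### Joint limit of stabilizing functionals at two points. -/

section CoreLimit

variable {d : ℕ} {M : Type*} [MeasurableSpace M] {κ : Sp d → ℝ≥0} {μM : Measure M}
  [IsProbabilityMeasure μM] {ι : Type*} {F : Filter ι}
  {θ : Sp d × M → Set (Sp d × M) → Measure (Sp d)}

/-- Distinct positions are separated beyond every fixed distance by magnification, and coincident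
positions form a null set. -/
lemma tendsto_measure_close (hd : 0 < d) (hκ1 : ∫⁻ x, (κ x : ℝ≥0∞) = 1) (hκm : Measurable κ)
    [F.IsCountablyGenerated] (r : ℝ) {s : ι → ℝ} (hs : Tendsto s F atTop) :
    Tendsto (fun i => ((pointLaw κ μM).prod (pointLaw κ μM))
      {p | ‖zoom p.1.1 (s i) p.2.1‖ ≤ r}) F (𝓝 0) := by
  have := pointLaw_prob (μM := μM) hκ1
  have hm : ∀ i, MeasurableSet {p : (Sp d × M) × (Sp d × M) | ‖zoom p.1.1 (s i) p.2.1‖ ≤ r} := by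
    intro i
    refine measurableSet_le ?_ measurable_const
    unfold zoom; fun_prop
  simp_rw [← fun i => lintegral_indicator_one (μ := (pointLaw κ μM).prod (pointLaw κ μM)) (hm i)]
  have h0 : (0 : ℝ≥0∞) = ∫⁻ _, 0 ∂((pointLaw κ μM).prod (pointLaw κ μM)) := by simp
  rw [h0]
  refine tendsto_lintegral_filter_of_dominated_convergence (fun _ => 1)
    (Eventually.of_forall fun i => measurable_one.indicator (hm i))
    (Eventually.of_forall fun i => Eventually.of_forall fun p => ?_) (by simp) ?_
  · exact Set.indicator_le_self' (by simp) _
  · filter_upwards [ae_fst_ne_fst (μM := μM) hd hκm hκ1] with p hp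
    have hpos : 0 < ‖p.2.1 - p.1.1‖ := norm_pos_iff.2 (sub_ne_zero.2 hp.symm)
    refine tendsto_const_nhds.congr' ?_
    filter_upwards [hs.eventually_gt_atTop (r / ‖p.2.1 - p.1.1‖), hs.eventually_ge_atTop 0]
      with i hi hi0
    rw [Set.indicator_of_notMem]
    simp only [Set.mem_ofPred_eq, not_le, zoom, norm_smul, Real.norm_of_nonneg hi0]
    exact (div_lt_iff₀ hpos).1 hi

lemma ae_prod_localize_swap (hd : 0 < d) (hκ1 : ∫⁻ x, (κ x : ℝ≥0∞) = 1) (hκm : Measurable κ)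
    (hθ : Measurable fun p : (Sp d × M) × Set (Sp d × M) => θ p.1 p.2)
    (hfin : ∀ z X, IsFiniteMeasure (θ z X)) (r : ℝ) {s : ℝ} (hs : 0 < s) (n : ℕ)
    {U : Sp d × M → Set (Sp d × M) → ℝ≥0∞} (hU : ∀ z X X', θ z X = θ z X' → U z X = U z X') :
    ∀ᵐ q ∂(((pointLaw κ μM).prod (pointLaw κ μM)).prod (binLaw (pointLaw κ μM) n)),
      r < ‖zoom q.1.1.1 s q.1.2.1‖ →
      ((q.1.2, zoomFin q.1.2.1 s q.2 ∩ cyl d M r) ∈ stabSet θ μM r →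
      U q.1.2 (zoomFin q.1.2.1 s (ins q.1.1 q.2)) = U q.1.2 (zoomFin q.1.2.1 s q.2 ∩ cyl d M r)) := by
  have := pointLaw_prob (μM := μM) hκ1
  have hsw := ((Measure.measurePreserving_swap (μ := pointLaw κ μM) (ν := pointLaw κ μM)).prod
    (MeasurePreserving.id (binLaw (pointLaw κ μM) n))).quasiMeasurePreserving
  have h := hsw.ae (ae_prod_localize (μM := μM) hd hκ1 hκm hθ hfin r hs n hU)
  filter_upwards [h] with q hq hfar
  rw [norm_zoom_comm] at hfar
  exact hq hfar

lemma measurable_indicator_prodMk {α β γ : Type*} [MeasurableSpace α] [MeasurableSpace β]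
    [MeasurableSpace γ] {S : Set (α × β)} (hS : MeasurableSet S) {f : γ → α} {g : γ → β}
    (hf : Measurable f) (hg : Measurable g) :
    Measurable fun q => S.indicator (fun _ => (1 : ℝ≥0∞)) (f q, g q) := by
  have h : Measurable (S.indicator fun _ => (1 : ℝ≥0∞)) := measurable_const.indicator hS
  exact h.comp (hf.prodMk hg)

/-- Joint limit of two bounded stabilizing functionals evaluated at two typical points. -/
lemma tendsto_lintegral_pair_functional [F.IsCountablyGenerated] (hd : 0 < d)
    (hκ1 : ∫⁻ x, (κ x : ℝ≥0∞) = 1) (hκm : Measurable κ) {C : ℝ≥0} (hκb : ∀ x, κ x ≤ C)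
    (hκc : ∀ᵐ x, ContinuousAt κ x)
    (hθ : Measurable fun p : (Sp d × M) × Set (Sp d × M) => θ p.1 p.2)
    (hfin : ∀ z X, IsFiniteMeasure (θ z X))
    {N : ι → ℕ} {L : ι → ℝ} (hL : Tendsto L F atTop)
    (hN : Tendsto (fun i => (N i : ℝ) / L i) F (𝓝 1))
    {U U' : ι → Sp d × M → Set (Sp d × M) → ℝ≥0∞} {u u' : Sp d × M → Set (Sp d × M) → ℝ≥0∞}
    {K : ℝ≥0}
    (hUm : ∀ᶠ i in F, Measurable fun p : (Sp d × M) × Set (Sp d × M) => U i p.1 p.2)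
    (hUm' : ∀ᶠ i in F, Measurable fun p : (Sp d × M) × Set (Sp d × M) => U' i p.1 p.2)
    (hu : Measurable fun p : (Sp d × M) × Set (Sp d × M) => u p.1 p.2)
    (hu' : Measurable fun p : (Sp d × M) × Set (Sp d × M) => u' p.1 p.2)
    (hUK : ∀ i z X, U i z X ≤ K) (hUK' : ∀ i z X, U' i z X ≤ K)
    (hU : ∀ i z X X', θ z X = θ z X' → U i z X = U i z X')
    (hU' : ∀ i z X X', θ z X = θ z X' → U' i z X = U' i z X')
    (hlim : ∀ᵐ z ∂(pointLaw κ μM), ∀ X : Set (Sp d × M), X.Finite →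
      Tendsto (fun i => U i z X) F (𝓝 (u z X)))
    (hlim' : ∀ᵐ z ∂(pointLaw κ μM), ∀ X : Set (Sp d × M), X.Finite →
      Tendsto (fun i => U' i z X) F (𝓝 (u' z X)))
    (herr : Tendsto (fun r : ℕ => stabErr κ μM θ r) atTop (𝓝 0)) {j : ℝ≥0∞}
    (hj : Tendsto (fun r : ℕ => locVal κ μM θ u r * locVal κ μM θ u' r) atTop (𝓝 j)) :
    Tendsto (fun i => ∫⁻ q,
        U i q.1.1 (zoomFin q.1.1.1 (L i ^ (1 / (d : ℝ))) (ins q.1.2 q.2)) *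
        U' i q.1.2 (zoomFin q.1.2.1 (L i ^ (1 / (d : ℝ))) (ins q.1.1 q.2))
        ∂(((pointLaw κ μM).prod (pointLaw κ μM)).prod (binLaw (pointLaw κ μM) (N i)))) F
      (𝓝 j) := by
  rcases F.eq_or_neBot with rfl | hne
  · exact tendsto_bot
  have := pointLaw_prob (μM := μM) hκ1
  set μ := pointLaw κ μM with hμ
  have hsT := tendsto_rpow_inv_atTop hd hL
  set s : ι → ℝ := fun i => L i ^ (1 / (d : ℝ)) with hs
  set S : ℕ → Set ((Sp d × M) × Set (Sp d × M)) := fun r => stabSet θ μM r with hS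
  have hSm : ∀ r, MeasurableSet (S r) := fun r => measurableSet_stabSet hθ hfin r
  -- `A` is the integral with both functionals evaluated on local configurations and cut down to
  -- stabilization within `r`. `e₁` and `e₂` are the probabilities that stabilization fails at the
  -- first or the second point, and `D` is the probability that the points are close on the
  -- magnified scale.
  set A : ℕ → ι → ℝ≥0∞ := fun r i => ∫⁻ q,
      (S r).indicator (fun p => U i p.1 p.2) (q.1.1, zoomFin q.1.1.1 (s i) q.2 ∩ cyl d M r) *
      (S r).indicator (fun p => U' i p.1 p.2) (q.1.2, zoomFin q.1.2.1 (s i) q.2 ∩ cyl d M r)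
      ∂((μ.prod μ).prod (binLaw μ (N i))) with hA
  set e₁ : ℕ → ι → ℝ≥0∞ := fun r i => ∫⁻ q,
      (S r)ᶜ.indicator (fun _ => 1) (q.1.1, zoomFin q.1.1.1 (s i) q.2 ∩ cyl d M r)
      ∂((μ.prod μ).prod (binLaw μ (N i))) with he₁
  set e₂ : ℕ → ι → ℝ≥0∞ := fun r i => ∫⁻ q,
      (S r)ᶜ.indicator (fun _ => 1) (q.1.2, zoomFin q.1.2.1 (s i) q.2 ∩ cyl d M r)
      ∂((μ.prod μ).prod (binLaw μ (N i))) with he₂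
  set D : ℕ → ι → ℝ≥0∞ := fun r i => (μ.prod μ) {p | ‖zoom p.1.1 (s i) p.2.1‖ ≤ r} with hD
  set J : ι → ℝ≥0∞ := fun i => ∫⁻ q, U i q.1.1 (zoomFin q.1.1.1 (s i) (ins q.1.2 q.2)) *
        U' i q.1.2 (zoomFin q.1.2.1 (s i) (ins q.1.1 q.2))
        ∂((μ.prod μ).prod (binLaw μ (N i))) with hJ
  have hone : ∀ r : ℕ, ∫⁻ z, ∫⁻ _, 1 ∂(homLaw (d := d) μM (κ z.1) (r : ℝ)) ∂μ = 1 := by intro r; simp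
  have hindm : ∀ r, Measurable fun p : (Sp d × M) × Set (Sp d × M) =>
      (S r)ᶜ.indicator (fun _ => (1 : ℝ≥0∞)) (p.1, p.2) :=
    fun r => measurable_const.indicator (hSm r).compl
  have hindl : ∀ r z X, (S r)ᶜ.indicator (fun _ => (1 : ℝ≥0∞)) (z, X) ≤ (1 : ℝ≥0) :=
    fun r z X => Set.indicator_le_self' (by simp) _
  have tA : ∀ r, Tendsto (A r) F (𝓝 (locVal κ μM θ u r * locVal κ μM θ u' r)) := by
    intro r
    refine tendsto_lintegral_pairs (μM := μM) hd hκ1 hκm hκb hκc r hL hN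
      (w := fun i z X => (S r).indicator (fun p => U i p.1 p.2) (z, X))
      (w' := fun i z X => (S r).indicator (fun p => U' i p.1 p.2) (z, X))
      (v := fun z X => (S r).indicator (fun p => u p.1 p.2) (z, X))
      (v' := fun z X => (S r).indicator (fun p => u' p.1 p.2) (z, X)) (K := K)
      (hUm.mono fun i hi => hi.indicator (hSm r)) (hUm'.mono fun i hi => hi.indicator (hSm r))
      (hu.indicator (hSm r)) (hu'.indicator (hSm r))
      (fun i z X => (Set.indicator_le_self _ _ _).trans (hUK i z X))
      (fun i z X => (Set.indicator_le_self _ _ _).trans (hUK' i z X)) ?_ ?_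
    · filter_upwards [hlim] with z hz X hX
      by_cases h : (z, X) ∈ S r
      · simpa [h] using hz X hX
      · simp [h]
    · filter_upwards [hlim'] with z hz X hX
      by_cases h : (z, X) ∈ S r
      · simpa [h] using hz X hX
      · simp [h]
  have te₁ : ∀ r, Tendsto (e₁ r) F (𝓝 (stabErr κ μM θ r)) := by
    intro r
    -- The constant `1` at the second point turns the two-point limit into a one-point limit.
    have h := tendsto_lintegral_pairs (μM := μM) hd hκ1 hκm hκb hκc r hL hN
      (w := fun _ z X => (S r)ᶜ.indicator (fun _ => 1) (z, X)) (w' := fun _ _ _ => 1)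
      (v := fun z X => (S r)ᶜ.indicator (fun _ => 1) (z, X)) (v' := fun _ _ => 1) (K := 1)
      (Eventually.of_forall fun _ => hindm r) (Eventually.of_forall fun _ => measurable_const)
      (hindm r) measurable_const (fun _ => hindl r) (by simp)
      (Eventually.of_forall fun z X _ => tendsto_const_nhds)
      (Eventually.of_forall fun z X _ => tendsto_const_nhds)
    rw [hone, mul_one] at h
    simp only [mul_one] at h
    exact h
  have te₂ : ∀ r, Tendsto (e₂ r) F (𝓝 (stabErr κ μM θ r)) := by
    intro r
    have h := tendsto_lintegral_pairs (μM := μM) hd hκ1 hκm hκb hκc r hL hN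
      (w' := fun _ z X => (S r)ᶜ.indicator (fun _ => 1) (z, X)) (w := fun _ _ _ => 1)
      (v' := fun z X => (S r)ᶜ.indicator (fun _ => 1) (z, X)) (v := fun _ _ => 1) (K := 1)
      (Eventually.of_forall fun _ => measurable_const) (Eventually.of_forall fun _ => hindm r)
      measurable_const (hindm r) (by simp) (fun _ => hindl r)
      (Eventually.of_forall fun z X _ => tendsto_const_nhds)
      (Eventually.of_forall fun z X _ => tendsto_const_nhds)
    rw [hone, one_mul] at h
    simp only [one_mul] at h
    exact h
  have tD : ∀ r, Tendsto (D r) F (𝓝 0) := fun r =>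
    tendsto_measure_close (μM := μM) hd hκ1 hκm r hsT
  have hDm : ∀ (r : ℕ) i, MeasurableSet
      {p : (Sp d × M) × (Sp d × M) | ‖zoom p.1.1 (s i) p.2.1‖ ≤ r} := by
    intro r i
    refine measurableSet_le ?_ measurable_const
    unfold zoom; fun_prop
  have hDeq : ∀ r i, D r i = ∫⁻ q : ((Sp d × M) × (Sp d × M)) × Set (Sp d × M),
      {p : (Sp d × M) × (Sp d × M) | ‖zoom p.1.1 (s i) p.2.1‖ ≤ r}.indicator 1 q.1
      ∂((μ.prod μ).prod (binLaw μ (N i))) := by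
    intro r i
    rw [lintegral_prod _ (by
      exact ((measurable_one.indicator (hDm r i)).comp measurable_fst).aemeasurable)]
    simp only [lintegral_const, measure_univ, mul_one]
    rw [lintegral_indicator_one (hDm r i)]
  have hae : ∀ (r : ℕ) i, 0 < s i → ∀ᵐ q ∂((μ.prod μ).prod (binLaw μ (N i))),
      (r : ℝ) < ‖zoom q.1.1.1 (s i) q.1.2.1‖ →
      (((q.1.1, zoomFin q.1.1.1 (s i) q.2 ∩ cyl d M r) ∈ S r →
        U i q.1.1 (zoomFin q.1.1.1 (s i) (ins q.1.2 q.2))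
          = U i q.1.1 (zoomFin q.1.1.1 (s i) q.2 ∩ cyl d M r)) ∧
      ((q.1.2, zoomFin q.1.2.1 (s i) q.2 ∩ cyl d M r) ∈ S r →
        U' i q.1.2 (zoomFin q.1.2.1 (s i) (ins q.1.1 q.2))
          = U' i q.1.2 (zoomFin q.1.2.1 (s i) q.2 ∩ cyl d M r))) := by
    intro r i hsi
    have h1 := ae_prod_localize (μM := μM) hd hκ1 hκm hθ hfin r hsi (N i) (hU i)
    have h2 := ae_prod_localize_swap (μM := μM) hd hκ1 hκm hθ hfin r hsi (N i) (hU' i)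
    filter_upwards [h1, h2] with q hq1 hq2 hfar
    exact ⟨hq1 hfar, hq2 hfar⟩
  have hzi : ∀ i, 0 < s i → Measurable fun q : ((Sp d × M) × (Sp d × M)) × Set (Sp d × M) =>
      zoomFin q.1.1.1 (s i) q.2 := fun i hi => (measurable_zoomFin (d := d) (M := M) hi).comp
      ((measurable_fst.comp measurable_fst).prodMk measurable_snd)
  have hzi' : ∀ i, 0 < s i → Measurable fun q : ((Sp d × M) × (Sp d × M)) × Set (Sp d × M) =>
      zoomFin q.1.2.1 (s i) q.2 := fun i hi => (measurable_zoomFin (d := d) (M := M) hi).comp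
      ((measurable_snd.comp measurable_fst).prodMk measurable_snd)
  have hm₁ : ∀ (r : ℕ) i, 0 < s i → Measurable fun q : ((Sp d × M) × (Sp d × M)) × Set (Sp d × M) =>
      (S r)ᶜ.indicator (fun _ => (1 : ℝ≥0∞)) (q.1.1, zoomFin q.1.1.1 (s i) q.2 ∩ cyl d M r) :=
    fun r i hi => measurable_indicator_prodMk (hSm r).compl (measurable_fst.comp measurable_fst)
      ((measurable_config_inter (measurableSet_cyl (d := d) (M := M) r)).comp (hzi i hi))
  have hm₂ : ∀ (r : ℕ) i, 0 < s i → Measurable fun q : ((Sp d × M) × (Sp d × M)) × Set (Sp d × M) =>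
      (S r)ᶜ.indicator (fun _ => (1 : ℝ≥0∞)) (q.1.2, zoomFin q.1.2.1 (s i) q.2 ∩ cyl d M r) :=
    fun r i hi => measurable_indicator_prodMk (hSm r).compl (measurable_snd.comp measurable_fst)
      ((measurable_config_inter (measurableSet_cyl (d := d) (M := M) r)).comp (hzi' i hi))
  have hmD : ∀ (r : ℕ) i, Measurable fun q : ((Sp d × M) × (Sp d × M)) × Set (Sp d × M) =>
      {p : (Sp d × M) × (Sp d × M) | ‖zoom p.1.1 (s i) p.2.1‖ ≤ r}.indicator
        (1 : (Sp d × M) × (Sp d × M) → ℝ≥0∞) q.1 :=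
    fun r i => (measurable_one.indicator (hDm r i)).comp measurable_fst
  -- For distant points each localized factor is either the true one or zero; for close points the
  -- product is at most `K * K`.
  have lower : ∀ (r : ℕ), ∀ᶠ i in F, A r i ≤ J i + (K : ℝ≥0∞) * K * D r i := by
    intro r
    filter_upwards [hsT.eventually_gt_atTop 0] with i hi
    rw [hDeq, ← lintegral_const_mul _ (hmD r i),
      ← lintegral_add_right _ ((hmD r i).const_mul _)]
    refine lintegral_mono_ae ?_
    filter_upwards [hae r i hi] with q hq
    by_cases hfar : (r : ℝ) < ‖zoom q.1.1.1 (s i) q.1.2.1‖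
    · obtain ⟨h1, h2⟩ := hq hfar
      refine le_trans (mul_le_mul' ?_ ?_) le_self_add
      · classical rw [Set.indicator_apply]
        split_ifs with h
        exacts [(h1 h).ge, zero_le]
      · classical rw [Set.indicator_apply]
        split_ifs with h
        exacts [(h2 h).ge, zero_le]
    · have hmem : q.1 ∈ {p : (Sp d × M) × (Sp d × M) | ‖zoom p.1.1 (s i) p.2.1‖ ≤ r} :=
        not_lt.1 hfar
      rw [Set.indicator_of_mem hmem]
      refine le_trans (mul_le_mul' ?_ ?_) (le_add_left (le_of_eq (mul_one _).symm))
      · exact (Set.indicator_le_self _ _ _).trans (hUK _ _ _)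
      · exact (Set.indicator_le_self _ _ _).trans (hUK' _ _ _)
  -- Closeness of the points, or failure of stabilization at either of them, costs at most `K * K`.
  have upper : ∀ (r : ℕ), ∀ᶠ i in F,
      J i ≤ A r i + (K : ℝ≥0∞) * K * (e₁ r i + e₂ r i + D r i) := by
    intro r
    filter_upwards [hsT.eventually_gt_atTop 0] with i hi
    rw [hDeq, he₁, he₂]
    have hsum : Measurable fun q : ((Sp d × M) × (Sp d × M)) × Set (Sp d × M) =>
        (S r)ᶜ.indicator (fun _ => (1 : ℝ≥0∞)) (q.1.1, zoomFin q.1.1.1 (s i) q.2 ∩ cyl d M r) +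
        (S r)ᶜ.indicator (fun _ => (1 : ℝ≥0∞)) (q.1.2, zoomFin q.1.2.1 (s i) q.2 ∩ cyl d M r) :=
      (hm₁ r i hi).add (hm₂ r i hi)
    have htot : Measurable fun q : ((Sp d × M) × (Sp d × M)) × Set (Sp d × M) =>
        (S r)ᶜ.indicator (fun _ => (1 : ℝ≥0∞)) (q.1.1, zoomFin q.1.1.1 (s i) q.2 ∩ cyl d M r) +
        (S r)ᶜ.indicator (fun _ => (1 : ℝ≥0∞)) (q.1.2, zoomFin q.1.2.1 (s i) q.2 ∩ cyl d M r) +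
        {p : (Sp d × M) × (Sp d × M) | ‖zoom p.1.1 (s i) p.2.1‖ ≤ r}.indicator
        (1 : (Sp d × M) × (Sp d × M) → ℝ≥0∞) q.1 := hsum.add (hmD r i)
    rw [← lintegral_add_left (hm₁ r i hi), ← lintegral_add_left hsum,
      ← lintegral_const_mul _ htot, hA, ← lintegral_add_right _ (htot.const_mul _)]
    refine lintegral_mono_ae ?_
    filter_upwards [hae r i hi] with q hq
    have hKK : ∀ {t : ℝ≥0∞}, 1 ≤ t →
        U i q.1.1 (zoomFin q.1.1.1 (s i) (ins q.1.2 q.2)) *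
        U' i q.1.2 (zoomFin q.1.2.1 (s i) (ins q.1.1 q.2)) ≤ (K : ℝ≥0∞) * K * t := by
      intro t ht
      calc _ ≤ (K : ℝ≥0∞) * K * 1 := by rw [mul_one]; exact mul_le_mul' (hUK _ _ _) (hUK' _ _ _)
        _ ≤ _ := mul_le_mul' le_rfl ht
    by_cases hfar : (r : ℝ) < ‖zoom q.1.1.1 (s i) q.1.2.1‖
    · obtain ⟨h1, h2⟩ := hq hfar
      by_cases m1 : (q.1.1, zoomFin q.1.1.1 (s i) q.2 ∩ cyl d M r) ∈ S r
      · by_cases m2 : (q.1.2, zoomFin q.1.2.1 (s i) q.2 ∩ cyl d M r) ∈ S r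
        · rw [h1 m1, h2 m2, Set.indicator_of_mem m1, Set.indicator_of_mem m2]
          exact le_self_add
        · refine (hKK ?_).trans le_add_self
          rw [Set.indicator_of_mem (s := (S r)ᶜ) (a := (q.1.2, _)) m2]
          exact le_add_right le_add_self
      · refine (hKK ?_).trans le_add_self
        rw [Set.indicator_of_mem (s := (S r)ᶜ) (a := (q.1.1, _)) m1, add_assoc]
        exact le_self_add
    · have hmem : q.1 ∈ {p : (Sp d × M) × (Sp d × M) | ‖zoom p.1.1 (s i) p.2.1‖ ≤ r} :=
        not_lt.1 hfar
      refine (hKK ?_).trans le_add_self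
      rw [Set.indicator_of_mem hmem]
      exact le_add_self
  have hKfin : (K : ℝ≥0∞) * K ≠ ∞ := ENNReal.mul_ne_top ENNReal.coe_ne_top ENNReal.coe_ne_top
  -- The limit along `F` is taken at fixed `r`, and `r → ∞` only afterwards; no rate relating the
  -- two is needed.
  refine tendsto_of_le_liminf_of_limsup_le ?_ ?_
  · refine le_of_tendsto' hj fun r => ?_
    have hlow : Tendsto (fun i => A r i - (K : ℝ≥0∞) * K * D r i) F
        (𝓝 (locVal κ μM θ u r * locVal κ μM θ u' r)) := by
      have h0 : Tendsto (fun i => (K : ℝ≥0∞) * K * D r i) F (𝓝 0) := by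
        simpa using ENNReal.Tendsto.const_mul (tD r) (Or.inr hKfin)
      simpa using ENNReal.Tendsto.sub (tA r) h0 (Or.inr ENNReal.zero_ne_top)
    rw [← hlow.liminf_eq]
    refine liminf_le_liminf ?_
    filter_upwards [lower r] with i hi
    exact tsub_le_iff_right.2 hi
  · have hup : ∀ r : ℕ, limsup J F ≤ locVal κ μM θ u r * locVal κ μM θ u' r +
        (K : ℝ≥0∞) * K * (stabErr κ μM θ r + stabErr κ μM θ r + 0) := by
      intro r
      have h := (tA r).add (ENNReal.Tendsto.const_mul (((te₁ r).add (te₂ r)).add (tD r))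
        (Or.inr hKfin))
      rw [← h.limsup_eq]
      exact limsup_le_limsup (upper r)
    refine ge_of_tendsto' (f := fun r : ℕ => locVal κ μM θ u r * locVal κ μM θ u' r +
        (K : ℝ≥0∞) * K * (stabErr κ μM θ r + stabErr κ μM θ r + 0)) (x := atTop) ?_ hup
    have h := hj.add (ENNReal.Tendsto.const_mul ((herr.add herr).add
      (tendsto_const_nhds (x := (0 : ℝ≥0∞)))) (Or.inr hKfin))
    simpa using h

end CoreLimit

/-! ### Sums over the points of a configuration and their first two moments. -/

section CfgSum

variable {d : ℕ} {M : Type*} [MeasurableSpace M]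

/-- The sum over the points `w` of a configuration `X` of `V w (X \ {w})`. -/
def cfgSum (V : Sp d × M → Set (Sp d × M) → ℝ≥0∞) (X : Set (Sp d × M)) : ℝ≥0∞ :=
  ∑' w : X, V w (X \ {(w : Sp d × M)})

lemma pointSet_removeNth {n : ℕ} {z : Fin (n + 1) → Sp d × M} (h : PosInj z) (i : Fin (n + 1)) :
    pointSet (i.removeNth z) = pointSet z \ {z i} := by
  have h' : PosInj (i.removeNth z) := h.comp Fin.succAbove_right_injective
  rw [pointSet_of_posInj h, pointSet_of_posInj h']
  ext w
  constructor
  · rintro ⟨j, rfl⟩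
    exact ⟨⟨_, rfl⟩, fun he => Fin.succAbove_ne i j (h.injective he)⟩
  · rintro ⟨⟨j, rfl⟩, hj⟩
    obtain ⟨k, hk⟩ := Fin.exists_succAbove_eq (x := j) (y := i) fun e => hj (by rw [e]; rfl)
    exact ⟨k, by rw [Fin.removeNth, hk]⟩

lemma cfgSum_pointSet (V : Sp d × M → Set (Sp d × M) → ℝ≥0∞) {n : ℕ}
    {z : Fin (n + 1) → Sp d × M} (h : PosInj z) :
    cfgSum V (pointSet z) = ∑ i, V (z i) (pointSet (i.removeNth z)) := by
  simp_rw [pointSet_removeNth h]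
  rw [cfgSum, pointSet_of_posInj h]
  rw [tsum_range (g := z) (fun w => V w (Set.range z \ {w})) h.injective, tsum_fintype]

/-- The index of the cell of side length `1 / k` containing `x`. -/
def cell (k : ℕ) (x : Sp d) : Fin d → ℤ := fun i => ⌊(k : ℝ) * x i⌋

lemma measurable_cell (k : ℕ) : Measurable (cell k : Sp d → Fin d → ℤ) := by
  refine measurable_pi_iff.2 fun i => Int.measurable_floor.comp ?_
  fun_prop

lemma eventually_cell_ne {x y : Sp d} (h : x ≠ y) : ∀ᶠ k : ℕ in atTop, cell k x ≠ cell k y := by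
  obtain ⟨i, hi⟩ : ∃ i, x i ≠ y i := by
    by_contra hc
    push Not at hc
    exact h (PiLp.ext hc)
  have hpos : 0 < |x i - y i| := abs_pos.2 (sub_ne_zero.2 hi)
  filter_upwards [tendsto_natCast_atTop_atTop.eventually_ge_atTop (1 / |x i - y i|)] with k hk he
  have h1 : ⌊(k : ℝ) * x i⌋ = ⌊(k : ℝ) * y i⌋ := congrFun he i
  have h2 := Int.abs_sub_lt_one_of_floor_eq_floor h1
  rw [← mul_sub, abs_mul, Nat.abs_cast] at h2
  rw [div_le_iff₀ hpos] at hk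
  linarith

/-- The marked points in a given cell. -/
def cellSet (M : Type*) (k : ℕ) (c : Fin d → ℤ) : Set (Sp d × M) := {w | cell k w.1 = c}

lemma measurableSet_cellSet (k : ℕ) (c : Fin d → ℤ) : MeasurableSet (cellSet M k c) :=
  ((measurable_cell k).comp measurable_fst) (measurableSet_singleton c)

/-- Finite configurations that are separated by all sufficiently fine cells. -/
def SepSet (d : ℕ) (M : Type*) : Set (Set (Sp d × M)) :=
  {X | X.Finite ∧ ∃ k₀ : ℕ, ∀ k ≥ k₀, ∀ c, (X ∩ cellSet M k c).encard ≤ 1}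

lemma measurableSet_sepSet : MeasurableSet (SepSet d M) := by
  have : SepSet d M = {X | X.Finite} ∩ ⋃ k₀ : ℕ, ⋂ k : ℕ, ⋂ _ : k ≥ k₀, ⋂ c, {X | (X ∩ cellSet M k c).encard ≤ 1} := by
    ext X; simp [SepSet]
  rw [this]
  refine measurableSet_finite_config.inter ?_
  refine MeasurableSet.iUnion fun k₀ => MeasurableSet.iInter fun k => MeasurableSet.iInter fun _ =>
    MeasurableSet.iInter fun c => ?_
  exact (measurable_encard_inter (measurableSet_cellSet k c)) (MeasurableSet.of_discrete (s := Set.Iic 1))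

lemma pointSet_mem_sepSet {ι : Type*} [Finite ι] (z : ι → Sp d × M) : pointSet z ∈ SepSet d M := by
  refine ⟨finite_pointSet z, ?_⟩
  by_cases h : PosInj z
  · have h1 : ∀ᶠ k : ℕ in atTop, ∀ i j : ι, i ≠ j → cell k (z i).1 ≠ cell k (z j).1 := by
      refine eventually_all.2 fun i => eventually_all.2 fun j => ?_
      by_cases hij : i = j
      · simp [hij]
      · filter_upwards [eventually_cell_ne (h.ne hij)] with k hk _ using hk
    obtain ⟨k₀, hk₀⟩ := eventually_atTop.1 h1
    refine ⟨k₀, fun k hk c => Set.encard_le_one_iff.2 ?_⟩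
    rw [pointSet_of_posInj h]
    rintro a b ⟨⟨i, rfl⟩, hi⟩ ⟨⟨j, rfl⟩, hj⟩
    by_contra hne
    exact hk₀ k hk i j (fun e => hne (by rw [e])) (hi.trans hj.symm)
  · exact ⟨0, fun k _ c => by simp [pointSet, h]⟩

lemma ae_mem_sepSet (ν : Measure (Sp d × M)) (n : ℕ) : ∀ᵐ X ∂(binLaw ν n), X ∈ SepSet d M := by
  rw [binLaw, ae_map_iff (p := fun X => X ∈ SepSet d M) measurable_pointSet.aemeasurable
    measurableSet_sepSet]
  exact Eventually.of_forall fun z => pointSet_mem_sepSet z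

open Classical in
lemma measurable_ite_finite {α : Type*} [MeasurableSpace α] {G : Set α → ℝ≥0∞}
    (h : Measurable fun X : {X : Set α // X.Finite} => G X) :
    Measurable fun X : Set α => if X.Finite then G X else 0 := by
  refine measurable_of_restrict_of_restrict_compl (s := {X : Set α | X.Finite})
    measurableSet_finite_config ?_ ?_
  · refine Eq.subst (motive := Measurable) ?_ h
    ext X
    exact (if_pos X.2).symm
  · refine Eq.subst (motive := Measurable) ?_ (measurable_const (a := (0 : ℝ≥0∞)))
    ext X
    exact (if_neg X.2).symm

open Classical in
/-- Approximation of `cfgSum` through the cells that contain at most one point. -/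
def cellSum (V : Sp d × M → Set (Sp d × M) → ℝ≥0∞) (k : ℕ) (X : Set (Sp d × M)) : ℝ≥0∞ :=
  ∑' c : Fin d → ℤ, if (X ∩ cellSet M k c).encard ≤ 1 then
    (if X.Finite then ∑' w : X, (cellSet M k c).indicator (fun w => V w (X \ cellSet M k c)) w else 0)
    else 0

lemma measurable_cellSum {V : Sp d × M → Set (Sp d × M) → ℝ≥0∞}
    (hV : Measurable fun p : (Sp d × M) × Set (Sp d × M) => V p.1 p.2) (k : ℕ) :
    Measurable (cellSum V k) := by
  classical
  refine Measurable.tsum fun c => Measurable.ite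
    ((measurable_encard_inter (measurableSet_cellSet k c)) (MeasurableSet.of_discrete (s := Set.Iic 1))) ?_
    measurable_const
  refine measurable_ite_finite ?_
  have h1 : Measurable fun p : (Sp d × M) × Set (Sp d × M) =>
      (cellSet M k c ×ˢ Set.univ).indicator (fun p => V p.1 p.2) p :=
    hV.indicator ((measurableSet_cellSet k c).prod MeasurableSet.univ)
  have h2 := measurable_tsum_config h1
  have h3 : Measurable fun X : {X : Set (Sp d × M) // X.Finite} =>
      ((X : Set (Sp d × M)) \ cellSet M k c, X) :=
    ((measurable_config_diff (measurableSet_cellSet k c)).comp measurable_subtype_coe).prodMk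
      measurable_id
  refine Eq.subst (motive := Measurable) ?_ (h2.comp h3)
  ext X
  refine tsum_congr fun w => ?_
  by_cases hw : (w : Sp d × M) ∈ cellSet M k c <;> simp [hw]

lemma cellSum_eq {V : Sp d × M → Set (Sp d × M) → ℝ≥0∞} {k : ℕ} {X : Set (Sp d × M)}
    (hX : X.Finite) (h : ∀ c, (X ∩ cellSet M k c).encard ≤ 1) : cellSum V k X = cfgSum V X := by
  classical
  have : ∀ c, (if (X ∩ cellSet M k c).encard ≤ 1 then
    (if X.Finite then ∑' w : X, (cellSet M k c).indicator (fun w => V w (X \ cellSet M k c)) w else 0)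
    else 0) = ∑' w : X, (cellSet M k c).indicator (fun w => V w (X \ cellSet M k c)) w := by
    intro c; rw [if_pos (h c), if_pos hX]
  simp_rw [cellSum, this]
  rw [ENNReal.tsum_comm]
  refine tsum_congr fun w => ?_
  rw [tsum_eq_single (cell k (w : Sp d × M).1)]
  · have hw : (w : Sp d × M) ∈ cellSet M k (cell k (w : Sp d × M).1) := rfl
    rw [Set.indicator_of_mem hw]
    congr 1
    ext y
    simp only [Set.mem_sdiff, Set.mem_singleton_iff, and_congr_right_iff]
    refine fun hy => not_congr ⟨fun hc => ?_, fun e => e ▸ hw⟩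
    exact Set.encard_le_one_iff.1 (h _) y w ⟨hy, hc⟩ ⟨w.2, hw⟩
  · intro c hc
    exact Set.indicator_of_notMem (fun e => hc e.symm) _

/-- Removal of a point is not evidently measurable in the pair of the point and the configuration.
Removal of all points in its cell is, and the two agree when every cell contains at most one point.
Almost surely this holds for all fine enough cells, so `cfgSum` is an almost sure limit of the
measurable `cellSum`. -/
lemma aemeasurable_cfgSum {V : Sp d × M → Set (Sp d × M) → ℝ≥0∞}
    (hV : Measurable fun p : (Sp d × M) × Set (Sp d × M) => V p.1 p.2)
    (ν : Measure (Sp d × M)) (n : ℕ) : AEMeasurable (cfgSum V) (binLaw ν n) := by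
  refine aemeasurable_of_tendsto_metrizable_ae atTop
    (fun k => (measurable_cellSum hV k).aemeasurable) ?_
  filter_upwards [ae_mem_sepSet ν n] with X hX
  obtain ⟨hf, k₀, hk₀⟩ := hX
  refine tendsto_const_nhds.congr' ?_
  filter_upwards [eventually_ge_atTop k₀] with k hk
  exact (cellSum_eq hf (hk₀ k hk)).symm

lemma lintegral_binLaw' (ν : Measure (Sp d × M)) (n : ℕ) {F : Set (Sp d × M) → ℝ≥0∞}
    (hF : AEMeasurable F (binLaw ν n)) :
    ∫⁻ X, F X ∂(binLaw ν n) = ∫⁻ z, F (pointSet z) ∂(Measure.pi fun _ : Fin n => ν) :=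
  lintegral_map' hF measurable_pointSet.aemeasurable

lemma measurable_pair_functional {V V' : Sp d × M → Set (Sp d × M) → ℝ≥0∞}
    (hV : Measurable fun p : (Sp d × M) × Set (Sp d × M) => V p.1 p.2)
    (hV' : Measurable fun p : (Sp d × M) × Set (Sp d × M) => V' p.1 p.2) :
    Measurable fun q : ((Sp d × M) × (Sp d × M)) × Set (Sp d × M) =>
      V q.1.1 (ins q.1.2 q.2) * V' q.1.2 (ins q.1.1 q.2) := by
  have h1 : Measurable fun q : ((Sp d × M) × (Sp d × M)) × Set (Sp d × M) => ins q.1.2 q.2 :=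
    measurable_ins.comp ((measurable_snd.comp measurable_fst).prodMk measurable_snd)
  have h2 : Measurable fun q : ((Sp d × M) × (Sp d × M)) × Set (Sp d × M) => ins q.1.1 q.2 :=
    measurable_ins.comp ((measurable_fst.comp measurable_fst).prodMk measurable_snd)
  exact (hV.comp ((measurable_fst.comp measurable_fst).prodMk h1)).mul
    (hV'.comp ((measurable_snd.comp measurable_fst).prodMk h2))

variable {ν : Measure (Sp d × M)} [SigmaFinite ν]

lemma measurable_term {V : Sp d × M → Set (Sp d × M) → ℝ≥0∞}
    (hV : Measurable fun p : (Sp d × M) × Set (Sp d × M) => V p.1 p.2) {n : ℕ} (i : Fin (n + 1)) :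
    Measurable fun z : Fin (n + 1) → Sp d × M => V (z i) (pointSet (i.removeNth z)) := by
  have h1 : Measurable fun z : Fin (n + 1) → Sp d × M => i.removeNth z :=
    measurable_pi_iff.2 fun j => measurable_pi_apply _
  exact hV.comp ((measurable_pi_apply i).prodMk (measurable_pointSet.comp h1))

/-- All `n` points contribute equally. The truncated `n - 1` at `n = 0` is harmless because the
prefactor vanishes. -/
lemma lintegral_cfgSum_binLaw (hν : NoPosAtoms ν) {V : Sp d × M → Set (Sp d × M) → ℝ≥0∞}
    (hV : Measurable fun p : (Sp d × M) × Set (Sp d × M) => V p.1 p.2) (n : ℕ) :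
    ∫⁻ X, cfgSum V X ∂(binLaw ν n)
      = n * ∫⁻ p, V p.1 p.2 ∂(ν.prod (binLaw ν (n - 1))) := by
  rw [lintegral_binLaw' ν n (aemeasurable_cfgSum hV ν n)]
  cases n with
  | zero =>
    simp only [Nat.cast_zero, zero_mul]
    refine (lintegral_congr fun z => ?_).trans lintegral_zero
    have : pointSet z = ∅ := by
      rw [pointSet_of_posInj (fun i => i.elim0)]; simp
    simp [cfgSum, this]
  | succ n =>
    rw [lintegral_congr_ae (g := fun z => ∑ i, V (z i) (pointSet (i.removeNth z)))]
    · rw [lintegral_finsetSum _ fun i _ => measurable_term hV i]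
      simp_rw [fun i => lintegral_pi_extract ν n i hV]
      simp
    · filter_upwards [ae_posInj hν (n + 1)] with z hz using cfgSum_pointSet V hz

/-- The two points are extracted one after the other; each of them then sees the remaining `n`
points with the other one inserted. -/
lemma lintegral_pi_extract_pair (hν : NoPosAtoms ν) {V V' : Sp d × M → Set (Sp d × M) → ℝ≥0∞}
    (hV : Measurable fun p : (Sp d × M) × Set (Sp d × M) => V p.1 p.2)
    (hV' : Measurable fun p : (Sp d × M) × Set (Sp d × M) => V' p.1 p.2)
    (n : ℕ) (i : Fin (n + 2)) (j : Fin (n + 1)) :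
    ∫⁻ z, V (z i) (pointSet (i.removeNth z)) *
      V' (z (i.succAbove j)) (pointSet ((i.succAbove j).removeNth z))
        ∂(Measure.pi fun _ : Fin (n + 2) => ν)
      = ∫⁻ q, V q.1.1 (ins q.1.2 q.2) * V' q.1.2 (ins q.1.1 q.2)
        ∂((ν.prod ν).prod (binLaw ν n)) := by
  have hm := measurable_pair_functional hV hV'
  have mp := measurePreserving_piFinSuccAbove (fun _ : Fin (n + 2) => ν) i
  set G : (Sp d × M) × (Fin (n + 1) → Sp d × M) → ℝ≥0∞ := fun p =>
    V p.1 (ins (p.2 j) (pointSet (j.removeNth p.2))) *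
      V' (p.2 j) (ins p.1 (pointSet (j.removeNth p.2))) with hG
  have hrem : Measurable fun p : (Sp d × M) × (Fin (n + 1) → Sp d × M) =>
      pointSet (j.removeNth p.2) :=
    measurable_pointSet.comp (measurable_pi_iff.2 fun k =>
      (measurable_pi_apply _).comp measurable_snd)
  have hpj : Measurable fun p : (Sp d × M) × (Fin (n + 1) → Sp d × M) => p.2 j :=
    (measurable_pi_apply j).comp measurable_snd
  have hGm : Measurable G := hm.comp ((measurable_fst.prodMk hpj).prodMk hrem)
  have h1 : ∫⁻ z, V (z i) (pointSet (i.removeNth z)) *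
      V' (z (i.succAbove j)) (pointSet ((i.succAbove j).removeNth z))
        ∂(Measure.pi fun _ : Fin (n + 2) => ν)
      = ∫⁻ z, G (z i, i.removeNth z) ∂(Measure.pi fun _ : Fin (n + 2) => ν) := by
    refine lintegral_congr_ae ?_
    filter_upwards [ae_posInj hν (n + 2)] with z hz
    have hz' : PosInj (i.removeNth z) := hz.comp Fin.succAbove_right_injective
    have e1 := pointSet_eq_ins hz' j
    have e2 : pointSet ((i.succAbove j).removeNth z)
        = ins (z i) (pointSet (j.removeNth (i.removeNth z))) := by
      have hfr : (z i, pointSet (j.removeNth (i.removeNth z))) ∈ FreshPairs d M := by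
        refine ⟨finite_pointSet _, Set.eq_empty_of_forall_notMem ?_⟩
        rintro w ⟨hw, hw1, -⟩
        rw [pointSet_removeNth hz' j, pointSet_removeNth hz i, pointSet_of_posInj hz] at hw
        obtain ⟨⟨⟨k, rfl⟩, hk⟩, -⟩ := hw
        exact hk (by rw [hz hw1]; rfl)
      rw [ins_of_mem hfr, pointSet_removeNth hz, pointSet_removeNth hz', pointSet_removeNth hz]
      have hmem : z i ∈ pointSet z := by rw [pointSet_of_posInj hz]; exact ⟨i, rfl⟩
      have hne : z i ≠ z (i.succAbove j) := fun e => Fin.succAbove_ne i j (hz.injective e).symm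
      ext w
      simp only [Set.mem_sdiff, Set.mem_singleton_iff, Set.mem_insert_iff, Fin.removeNth]
      by_cases hw : w = z i
      · subst hw; simp [hmem, hne]
      · simp [hw]
    simp only [hG]
    rw [← e1, ← e2]
    rfl
  rw [h1]
  have h2 := mp.lintegral_comp hGm
  refine Eq.trans h2 ?_
  rw [lintegral_prod _ hGm.aemeasurable]
  have hassoc := (measurePreserving_prodAssoc ν ν (binLaw ν n)).symm
  have h4 : Measurable fun q : (Sp d × M) × (Sp d × M) × Set (Sp d × M) =>
      V q.1 (ins q.2.1 q.2.2) * V' q.2.1 (ins q.1 q.2.2) := hm.comp hassoc.measurable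
  rw [← hassoc.lintegral_comp hm]
  refine Eq.trans ?_ (lintegral_prod _ h4.aemeasurable).symm
  refine lintegral_congr fun w => ?_
  have h3 : Measurable fun p : (Sp d × M) × Set (Sp d × M) =>
      V w (ins p.1 p.2) * V' p.1 (ins w p.2) := by
    exact hm.comp ((measurable_const.prodMk measurable_fst).prodMk measurable_snd)
  exact lintegral_pi_extract ν n j h3

/-- The product of two sums has `n` diagonal and `n (n - 1)` off-diagonal terms. For bounded
functionals the diagonal is negligible after division by `n ^ 2`, which is the source of the law of
large numbers. -/
lemma lintegral_cfgSum_mul_binLaw (hν : NoPosAtoms ν)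
    {V V' : Sp d × M → Set (Sp d × M) → ℝ≥0∞}
    (hV : Measurable fun p : (Sp d × M) × Set (Sp d × M) => V p.1 p.2)
    (hV' : Measurable fun p : (Sp d × M) × Set (Sp d × M) => V' p.1 p.2) (n : ℕ) :
    ∫⁻ X, cfgSum V X * cfgSum V' X ∂(binLaw ν n)
      = n * ∫⁻ p, V p.1 p.2 * V' p.1 p.2 ∂(ν.prod (binLaw ν (n - 1))) +
        (n * (n - 1) : ℕ) * ∫⁻ q, V q.1.1 (ins q.1.2 q.2) * V' q.1.2 (ins q.1.1 q.2)
          ∂((ν.prod ν).prod (binLaw ν (n - 2))) := by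
  rw [lintegral_binLaw' ν n (F := fun X => cfgSum V X * cfgSum V' X)
    ((aemeasurable_cfgSum hV ν n).mul (aemeasurable_cfgSum hV' ν n))]
  cases n with
  | zero =>
    simp only [Nat.cast_zero, zero_mul, add_zero]
    refine (lintegral_congr fun z => ?_).trans lintegral_zero
    have : pointSet z = ∅ := by
      rw [pointSet_of_posInj (fun i => i.elim0)]; simp
    simp [cfgSum, this]
  | succ n =>
    rw [lintegral_congr_ae (g := fun z => ∑ i, (V (z i) (pointSet (i.removeNth z)) *
      V' (z i) (pointSet (i.removeNth z)) + ∑ j : Fin n, V (z i) (pointSet (i.removeNth z)) *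
      V' (z (i.succAbove j)) (pointSet ((i.succAbove j).removeNth z))))]
    · have hm1 : ∀ i : Fin (n + 1), Measurable fun z : Fin (n + 1) → Sp d × M =>
          V (z i) (pointSet (i.removeNth z)) * V' (z i) (pointSet (i.removeNth z)) :=
        fun i => (measurable_term hV i).mul (measurable_term hV' i)
      have hm2 : ∀ (i : Fin (n + 1)) (j : Fin n), Measurable fun z : Fin (n + 1) → Sp d × M =>
          V (z i) (pointSet (i.removeNth z)) *
          V' (z (i.succAbove j)) (pointSet ((i.succAbove j).removeNth z)) :=
        fun i j => (measurable_term hV i).mul (measurable_term hV' _)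
      have hm3 : ∀ i : Fin (n + 1), Measurable fun z : Fin (n + 1) → Sp d × M =>
          V (z i) (pointSet (i.removeNth z)) * V' (z i) (pointSet (i.removeNth z)) +
          ∑ j : Fin n, V (z i) (pointSet (i.removeNth z)) *
          V' (z (i.succAbove j)) (pointSet ((i.succAbove j).removeNth z)) :=
        fun i => (hm1 i).add (Finset.measurable_sum _ fun j _ => hm2 i j)
      rw [lintegral_finsetSum _ fun i _ => hm3 i]
      simp_rw [fun i => lintegral_add_left (μ := Measure.pi fun _ : Fin (n + 1) => ν) (hm1 i)
        (fun z => ∑ j : Fin n, V (z i) (pointSet (i.removeNth z)) *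
          V' (z (i.succAbove j)) (pointSet ((i.succAbove j).removeNth z))),
        fun i => lintegral_finsetSum (μ := Measure.pi fun _ : Fin (n + 1) => ν) Finset.univ
          (fun j _ => hm2 i j), fun i => lintegral_pi_extract ν n i (F := fun p => V p.1 p.2 * V' p.1 p.2)
          (hV.mul hV')]
      rw [Finset.sum_add_distrib]
      congr 1
      · simp
      · cases n with
        | zero => simp
        | succ n =>
          simp_rw [fun i j => lintegral_pi_extract_pair hν hV hV' n i j]
          simp only [Finset.sum_const, Finset.card_univ, Fintype.card_fin, nsmul_eq_mul]
          rw [← mul_assoc]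
          push_cast
          rfl
    · filter_upwards [ae_posInj hν (n + 1)] with z hz
      rw [cfgSum_pointSet V hz, cfgSum_pointSet V' hz, Finset.sum_mul]
      refine Finset.sum_congr rfl fun i _ => ?_
      rw [Fin.sum_univ_succAbove _ i, mul_add, Finset.mul_sum]

end CfgSum

/-! ### Poisson mixtures over the number of points. -/

section PoissonWeights

/-- The Poisson weights of parameter `c`. -/
def pw (c : ℝ≥0∞) (n : ℕ) : ℝ≥0∞ := ENNReal.ofReal (Real.exp (-c.toReal) / n !) * c ^ n

lemma tsum_pw {c : ℝ≥0∞} (hc : c ≠ ∞) : ∑' n, pw c n = 1 := tsum_poisson_weights hc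

lemma pw_succ_mul (c : ℝ≥0∞) (n : ℕ) : pw c (n + 1) * ((n + 1 : ℕ) : ℝ≥0∞) = c * pw c n := by
  have h : ENNReal.ofReal (Real.exp (-c.toReal) / (n + 1)!) * ((n + 1 : ℕ) : ℝ≥0∞)
      = ENNReal.ofReal (Real.exp (-c.toReal) / n !) := by
    rw [← ENNReal.ofReal_natCast, ← ENNReal.ofReal_mul (by positivity)]
    congr 1
    rw [Nat.factorial_succ]
    push_cast
    field_simp
  rw [pw, pw, ← h, pow_succ]
  ring

/-- A shift of the index: the factor `n` and the loss of one point are absorbed by the Poisson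
weight. For this reason the reduced laws of a Poisson process coincide with its own law. -/
lemma tsum_pw_mul_natCast (c : ℝ≥0∞) (I : ℕ → ℝ≥0∞) :
    ∑' n, pw c n * (n * I (n - 1)) = c * ∑' n, pw c n * I n := by
  rw [tsum_eq_zero_add' ENNReal.summable, ← ENNReal.tsum_mul_left]
  simp only [Nat.cast_zero, zero_mul, mul_zero, zero_add, Nat.add_sub_cancel]
  refine tsum_congr fun n => ?_
  rw [← mul_assoc, pw_succ_mul, mul_assoc]

lemma tsum_pw_mul_natCast_pair (c : ℝ≥0∞) (I : ℕ → ℝ≥0∞) :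
    ∑' n, pw c n * ((n * (n - 1) : ℕ) * I (n - 2)) = c * c * ∑' n, pw c n * I n := by
  have := tsum_pw_mul_natCast c fun m => m * I (m - 1)
  rw [mul_assoc, ← tsum_pw_mul_natCast, ← this]
  refine tsum_congr fun n => ?_
  rw [Nat.cast_mul, mul_assoc, Nat.sub_sub]

/-- The variance of the Poisson law, computed from its first two factorial moments. The negative
term is kept on the other side because subtraction in `ℝ≥0∞` truncates. -/
lemma tsum_pw_sq_sub {l : ℝ} (hl : 0 ≤ l) :
    ∑' n, pw (ENNReal.ofReal l) n * ENNReal.ofReal (((n : ℝ) - l) ^ 2) = ENNReal.ofReal l := by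
  set c := ENNReal.ofReal l with hc
  have h1 : ∑' n, pw c n * ((n : ℕ) : ℝ≥0∞) = c := by
    simpa [tsum_pw (c := c) ENNReal.ofReal_ne_top] using tsum_pw_mul_natCast c fun _ => 1
  have h2 : ∑' n, pw c n * ((n * (n - 1) : ℕ) : ℝ≥0∞) = c * c := by
    simpa [tsum_pw (c := c) ENNReal.ofReal_ne_top] using tsum_pw_mul_natCast_pair c fun _ => 1
  have h3 : ∀ n : ℕ, pw c n * ENNReal.ofReal (((n : ℝ) - l) ^ 2) + 2 * c * (pw c n * (n : ℝ≥0∞))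
      = pw c n * ((n * (n - 1) : ℕ) : ℝ≥0∞) + pw c n * (n : ℝ≥0∞) + c * c * pw c n := by
    intro n
    have : ENNReal.ofReal (((n : ℝ) - l) ^ 2) + 2 * c * n
        = ((n * (n - 1) : ℕ) : ℝ≥0∞) + n + c * c := by
      rw [hc, ← ENNReal.ofReal_natCast, ← ENNReal.ofReal_natCast, ← ENNReal.ofReal_mul hl,
        ← ENNReal.ofReal_ofNat, ← ENNReal.ofReal_mul (by norm_num),
        ← ENNReal.ofReal_mul (by positivity), ← ENNReal.ofReal_add (by positivity) (by positivity),
        ← ENNReal.ofReal_add (by positivity) (by positivity),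
        ← ENNReal.ofReal_add (by positivity) (by positivity)]
      congr 1
      cases n with
      | zero => simp; ring
      | succ n => push_cast [Nat.add_sub_cancel]; ring
    calc _ = pw c n * (ENNReal.ofReal (((n : ℝ) - l) ^ 2) + 2 * c * n) := by ring
      _ = _ := by rw [this]; ring
  have h4 : (∑' n, pw c n * ENNReal.ofReal (((n : ℝ) - l) ^ 2)) + 2 * c * c
      = c + 2 * c * c := by
    calc _ = ∑' n : ℕ, (pw c n * ENNReal.ofReal (((n : ℝ) - l) ^ 2) +
          2 * c * (pw c n * (n : ℝ≥0∞))) := by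
          rw [ENNReal.tsum_add, ENNReal.tsum_mul_left, h1]
      _ = c * c + c + c * c * 1 := by
          simp_rw [h3]
          rw [ENNReal.tsum_add, ENNReal.tsum_add, ENNReal.tsum_mul_left, h1, h2,
            tsum_pw ENNReal.ofReal_ne_top]
      _ = _ := by ring
  refine (ENNReal.add_left_inj ?_).1 h4
  exact ENNReal.mul_ne_top (ENNReal.mul_ne_top (by simp) ENNReal.ofReal_ne_top)
    ENNReal.ofReal_ne_top

/-- The filter of pairs `(n, l)` with `l → ∞` and `n / l → 1`. -/
def ratioFilter : Filter (ℕ × ℝ) :=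
  comap (fun p : ℕ × ℝ => (p.2, (p.1 : ℝ) / p.2)) (atTop ×ˢ 𝓝 1)

instance : ratioFilter.IsCountablyGenerated := by unfold ratioFilter; infer_instance

lemma tendsto_snd_ratioFilter : Tendsto Prod.snd ratioFilter atTop :=
  tendsto_fst.comp (tendsto_comap (f := fun p : ℕ × ℝ => (p.2, (p.1 : ℝ) / p.2)))

lemma tendsto_div_ratioFilter :
    Tendsto (fun p : ℕ × ℝ => (p.1 : ℝ) / p.2) ratioFilter (𝓝 1) :=
  tendsto_snd.comp (tendsto_comap (f := fun p : ℕ × ℝ => (p.2, (p.1 : ℝ) / p.2)))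

/-- Chebyshev's inequality: where `|n / l - 1| ≥ δ`, the quantity `(n - l)² / (δ l)²` is at least
one, and its Poisson mean is `1 / (δ² l)`. -/
lemma tsum_pw_far_le {l : ℝ} (hl : 0 < l) {δ : ℝ} (hδ : 0 < δ) (h : ℕ → ℝ≥0∞) {C ε : ℝ≥0∞}
    (hC : ∀ n, h n ≤ C) (hε : ∀ n : ℕ, |(n : ℝ) / l - 1| < δ → h n ≤ ε) :
    ∑' n, pw (ENNReal.ofReal l) n * h n ≤ ε + C * ENNReal.ofReal (1 / (δ ^ 2 * l)) := by
  have hle : ∀ n : ℕ, h n ≤ ε + C * (ENNReal.ofReal (1 / (δ ^ 2 * l ^ 2)) *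
      ENNReal.ofReal (((n : ℝ) - l) ^ 2)) := by
    intro n
    by_cases hn : |(n : ℝ) / l - 1| < δ
    · exact le_add_right (hε n hn)
    · refine le_add_left ((hC n).trans ?_)
      refine le_mul_of_one_le_right' ?_
      rw [← ENNReal.ofReal_mul (by positivity), ENNReal.one_le_ofReal]
      have h1 : (n : ℝ) - l = l * ((n : ℝ) / l - 1) := by field_simp
      rw [h1, mul_pow, ← sq_abs ((n : ℝ) / l - 1)]
      have h2 : δ ^ 2 ≤ |(n : ℝ) / l - 1| ^ 2 := pow_le_pow_left₀ hδ.le (not_lt.1 hn) 2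
      rw [one_div, inv_mul_eq_div, le_div_iff₀ (by positivity)]
      nlinarith [sq_nonneg l]
  calc _ ≤ ∑' n : ℕ, (pw (ENNReal.ofReal l) n * ε + C * ENNReal.ofReal (1 / (δ ^ 2 * l ^ 2)) *
        (pw (ENNReal.ofReal l) n * ENNReal.ofReal (((n : ℝ) - l) ^ 2))) := by
        refine ENNReal.tsum_le_tsum fun n => (mul_le_mul' le_rfl (hle n)).trans (le_of_eq ?_)
        ring
    _ = ε + C * ENNReal.ofReal (1 / (δ ^ 2 * l ^ 2)) * ENNReal.ofReal l := by
        rw [ENNReal.tsum_add, ENNReal.tsum_mul_right, ENNReal.tsum_mul_left, tsum_pw_sq_sub hl.le,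
          tsum_pw ENNReal.ofReal_ne_top, one_mul]
    _ = _ := by
        rw [mul_assoc, ← ENNReal.ofReal_mul (by positivity)]
        congr 3
        field_simp

/-- Poisson mixtures of bounded quantities that converge as `n / l → 1`. -/
lemma tendsto_tsum_pw {g : ℕ × ℝ → ℝ≥0∞} {K : ℝ≥0} (hK : ∀ p, g p ≤ K) {j : ℝ≥0∞} (hj : j ≠ ∞)
    (hg : Tendsto g ratioFilter (𝓝 j)) :
    Tendsto (fun l : ℝ => ∑' n, pw (ENNReal.ofReal l) n * g (n, l)) atTop (𝓝 j) := by
  -- At least one of the two truncated differences is zero, so `h` is the distance from `g` to `j`.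
  set h : ℕ × ℝ → ℝ≥0∞ := fun p => (g p - j) + (j - g p) with hh
  have hh0 : Tendsto h ratioFilter (𝓝 0) := by
    have h1 := ENNReal.Tendsto.sub hg (tendsto_const_nhds (x := j)) (Or.inr hj)
    have h2 := ENNReal.Tendsto.sub (tendsto_const_nhds (x := j)) hg (Or.inl hj)
    simpa using h1.add h2
  have hhC : ∀ p, h p ≤ K + j := fun p =>
    add_le_add (tsub_le_self.trans (hK p)) tsub_le_self
  have hCfin : (K : ℝ≥0∞) + j ≠ ∞ := ENNReal.add_ne_top.2 ⟨ENNReal.coe_ne_top, hj⟩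
  have hs : Tendsto (fun l : ℝ => ∑' n, pw (ENNReal.ofReal l) n * h (n, l)) atTop (𝓝 0) := by
    rw [ENNReal.tendsto_nhds_zero]
    intro ε hε
    have hε2 : 0 < ε / 2 := ENNReal.half_pos hε.ne'
    have he := ENNReal.tendsto_nhds_zero.1 hh0 (ε / 2) hε2
    rw [ratioFilter, eventually_comap] at he
    obtain ⟨p₁, hp₁, p₂, hp₂, himp⟩ := eventually_prod_iff.1 he
    obtain ⟨δ, hδ, hball⟩ := Metric.eventually_nhds_iff.1 hp₂
    have hlim : Tendsto (fun l : ℝ => ((K : ℝ≥0∞) + j) * ENNReal.ofReal (1 / (δ ^ 2 * l))) atTop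
        (𝓝 0) := by
      have h0 : Tendsto (fun l : ℝ => 1 / (δ ^ 2 * l)) atTop (𝓝 0) := by
        have := (tendsto_id.const_mul_atTop (pow_pos hδ 2) : Tendsto (fun l : ℝ => δ ^ 2 * l) atTop atTop)
        simp_rw [one_div]
        exact this.inv_tendsto_atTop
      have h1 := ENNReal.tendsto_ofReal h0
      rw [ENNReal.ofReal_zero] at h1
      simpa using ENNReal.Tendsto.const_mul h1 (Or.inr hCfin)
    filter_upwards [hp₁, eventually_gt_atTop 0, ENNReal.tendsto_nhds_zero.1 hlim _ hε2]
      with l hl1 hl0 hl2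
    refine (tsum_pw_far_le hl0 hδ (fun n => h (n, l)) (fun n => hhC _) (ε := ε / 2)
      fun n hn => ?_).trans ?_
    · refine himp hl1 (hball ?_) (n, l) rfl
      rwa [Real.dist_eq]
    · exact (add_le_add le_rfl hl2).trans (ENNReal.add_halves ε).le
  have hpw1 : ∀ l : ℝ, ∑' n, pw (ENNReal.ofReal l) n * j = j := fun l => by
    rw [ENNReal.tsum_mul_right, tsum_pw ENNReal.ofReal_ne_top, one_mul]
  have hup : Tendsto (fun l : ℝ => j + ∑' n, pw (ENNReal.ofReal l) n * h (n, l)) atTop (𝓝 j) := by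
    simpa using hs.const_add j
  have hlow : Tendsto (fun l : ℝ => j - ∑' n, pw (ENNReal.ofReal l) n * h (n, l)) atTop (𝓝 j) := by
    simpa using ENNReal.Tendsto.sub (tendsto_const_nhds (x := j)) hs (Or.inl hj)
  refine tendsto_of_tendsto_of_tendsto_of_le_of_le hlow hup (fun l => ?_) fun l => ?_
  · refine tsub_le_iff_right.2 ?_
    calc j = ∑' n, pw (ENNReal.ofReal l) n * j := (hpw1 l).symm
      _ ≤ ∑' n, (pw (ENNReal.ofReal l) n * g (n, l) + pw (ENNReal.ofReal l) n * h (n, l)) := by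
        refine ENNReal.tsum_le_tsum fun n => ?_
        rw [← mul_add]
        refine mul_le_mul' le_rfl ?_
        calc j ≤ g (n, l) + (j - g (n, l)) := le_add_tsub
          _ ≤ _ := add_le_add le_rfl le_add_self
      _ = _ := ENNReal.tsum_add
  · calc ∑' n, pw (ENNReal.ofReal l) n * g (n, l)
        ≤ ∑' n, (pw (ENNReal.ofReal l) n * j + pw (ENNReal.ofReal l) n * h (n, l)) := by
          refine ENNReal.tsum_le_tsum fun n => ?_
          rw [← mul_add]
          refine mul_le_mul' le_rfl ?_
          calc g (n, l) ≤ j + (g (n, l) - j) := le_add_tsub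
            _ ≤ _ := add_le_add le_rfl le_self_add
      _ = _ := by rw [ENNReal.tsum_add, hpw1]

end PoissonWeights

/-! ### Moment formulas for binomial and Poisson processes. -/

section Mecke

variable {d : ℕ} {M : Type*} [MeasurableSpace M]

/-- First and second moment formulas for sums over the points of a point process of law `Q`, with
reduced laws `Q₁` and `Q₂`. -/
structure HasMecke (μ : Measure (Sp d × M)) (Q Q₁ Q₂ : Measure (Set (Sp d × M))) (a b : ℝ≥0∞) :
    Prop where
  finite : ∀ᵐ X ∂Q, X.Finite
  aemeasurable : ∀ V : Sp d × M → Set (Sp d × M) → ℝ≥0∞,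
    (Measurable fun p : (Sp d × M) × Set (Sp d × M) => V p.1 p.2) → AEMeasurable (cfgSum V) Q
  first : ∀ V : Sp d × M → Set (Sp d × M) → ℝ≥0∞,
    (Measurable fun p : (Sp d × M) × Set (Sp d × M) => V p.1 p.2) →
    ∫⁻ X, cfgSum V X ∂Q = a * ∫⁻ p, V p.1 p.2 ∂(μ.prod Q₁)
  second : ∀ V : Sp d × M → Set (Sp d × M) → ℝ≥0∞,
    (Measurable fun p : (Sp d × M) × Set (Sp d × M) => V p.1 p.2) →
    ∫⁻ X, cfgSum V X * cfgSum V X ∂Q = a * ∫⁻ p, V p.1 p.2 * V p.1 p.2 ∂(μ.prod Q₁) +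
      b * ∫⁻ q, V q.1.1 (ins q.1.2 q.2) * V q.1.2 (ins q.1.1 q.2) ∂((μ.prod μ).prod Q₂)

variable {μ : Measure (Sp d × M)} [IsProbabilityMeasure μ]

lemma hasMecke_binLaw (hμ : NoPosAtoms μ) (n : ℕ) :
    HasMecke μ (binLaw μ n) (binLaw μ (n - 1)) (binLaw μ (n - 2)) n (n * (n - 1) : ℕ) where
  finite := ae_finite_binLaw μ n
  aemeasurable _ hV := aemeasurable_cfgSum hV μ n
  first _ hV := lintegral_cfgSum_binLaw hμ hV n
  second _ hV := lintegral_cfgSum_mul_binLaw hμ hV hV n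

lemma lintegral_poisLaw_smul {c : ℝ≥0∞} (hc : c ≠ ∞) (F : Set (Sp d × M) → ℝ≥0∞) :
    ∫⁻ X, F X ∂(poisLaw (c • μ)) = ∑' n, pw c n * ∫⁻ X, F X ∂(binLaw μ n) := by
  rw [lintegral_poisLaw]
  refine tsum_congr fun n => ?_
  rw [binLaw_smul μ hc, lintegral_smul_measure, Measure.smul_apply, measure_univ, smul_eq_mul,
    smul_eq_mul, mul_one, pw, mul_assoc]

lemma lintegral_prod_poisLaw_smul {α : Type*} [MeasurableSpace α] (ρ : Measure α) [SFinite ρ]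
    {c : ℝ≥0∞} (hc : c ≠ ∞) {G : α × Set (Sp d × M) → ℝ≥0∞} (hG : Measurable G) :
    ∫⁻ p, G p ∂(ρ.prod (poisLaw (c • μ)))
      = ∑' n, pw c n * ∫⁻ p, G p ∂(ρ.prod (binLaw μ n)) := by
  have := Measure.smul_finite μ hc
  rw [lintegral_prod _ hG.aemeasurable]
  simp_rw [lintegral_poisLaw_smul hc]
  rw [lintegral_tsum fun n => (hG.lintegral_prod_right'.const_mul _).aemeasurable]
  refine tsum_congr fun n => ?_
  rw [lintegral_const_mul _ hG.lintegral_prod_right', lintegral_prod _ hG.aemeasurable]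

lemma hasMecke_poisLaw (hμ : NoPosAtoms μ) {c : ℝ≥0∞} (hc : c ≠ ∞) :
    HasMecke μ (poisLaw (c • μ)) (poisLaw (c • μ)) (poisLaw (c • μ)) c (c * c) where
  finite := ae_poisLaw_of_forall fun n => ae_finite_binLaw _ n
  aemeasurable V hV := by
    refine aemeasurable_sum_measure_iff.2 fun n => ?_
    exact (aemeasurable_cfgSum hV _ n).smul_measure _
  first V hV := by
    rw [lintegral_poisLaw_smul hc, lintegral_prod_poisLaw_smul μ hc hV, ← tsum_pw_mul_natCast]
    exact tsum_congr fun n => by rw [lintegral_cfgSum_binLaw hμ hV]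
  second V hV := by
    rw [lintegral_poisLaw_smul hc,
      lintegral_prod_poisLaw_smul μ hc (G := fun p => V p.1 p.2 * V p.1 p.2) (hV.mul hV),
      lintegral_prod_poisLaw_smul (μ.prod μ) hc (measurable_pair_functional hV hV),
      ← tsum_pw_mul_natCast, ← tsum_pw_mul_natCast_pair, ← ENNReal.tsum_add]
    exact tsum_congr fun n => by rw [lintegral_cfgSum_mul_binLaw hμ hV hV, mul_add]

end Mecke

/-! ### The second-moment law of large numbers for bounded functionals. -/

section AbstractLLN

variable {d : ℕ} {M : Type*} [MeasurableSpace M] {μ : Measure (Sp d × M)} [IsProbabilityMeasure μ]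
  {Q Q₁ Q₂ : Measure (Set (Sp d × M))} {a b : ℝ≥0∞}

lemma cfgSum_ne_top {V : Sp d × M → Set (Sp d × M) → ℝ≥0∞} (hV : ∀ z X, V z X ≠ ∞)
    {X : Set (Sp d × M)} (hX : X.Finite) : cfgSum V X ≠ ∞ := by
  have := hX.fintype
  rw [cfgSum, tsum_fintype]
  exact ENNReal.sum_ne_top.2 fun w _ => hV _ _

lemma cfgSum_add (V W : Sp d × M → Set (Sp d × M) → ℝ≥0∞) (X : Set (Sp d × M)) :
    cfgSum (fun z X => V z X + W z X) X = cfgSum V X + cfgSum W X := ENNReal.tsum_add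

lemma enorm_toReal_div {S : ℝ≥0∞} (hS : S ≠ ∞) {A : ℝ} (hA : 0 < A) :
    ‖S.toReal / A‖ₑ = S / ENNReal.ofReal A := by
  rw [Real.enorm_of_nonneg (by positivity), ENNReal.ofReal_div_of_pos hA, ENNReal.ofReal_toReal hS]

lemma two_mul_le_sq_add_sq (x y : ℝ≥0∞) : 2 * (x * y) ≤ x ^ 2 + y ^ 2 := by
  rcases eq_or_ne x ∞ with rfl | hx
  · simp
  rcases eq_or_ne y ∞ with rfl | hy
  · simp
  lift x to ℝ≥0 using hx
  lift y to ℝ≥0 using hy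
  norm_cast
  rw [← mul_assoc]
  exact two_mul_le_add_sq x y

/-- From `2xy ≤ x² + y²` and symmetry under exchange of the two points. A moment at one point in the
presence of the other thereby controls the off-diagonal term. -/
lemma lintegral_pair_le_sq [SFinite Q₂] {V : Sp d × M → Set (Sp d × M) → ℝ≥0∞}
    (hV : Measurable fun p : (Sp d × M) × Set (Sp d × M) => V p.1 p.2) :
    ∫⁻ q, V q.1.1 (ins q.1.2 q.2) * V q.1.2 (ins q.1.1 q.2) ∂((μ.prod μ).prod Q₂)
      ≤ ∫⁻ q, V q.1.1 (ins q.1.2 q.2) ^ 2 ∂((μ.prod μ).prod Q₂) := by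
  have h1 : Measurable fun q : ((Sp d × M) × (Sp d × M)) × Set (Sp d × M) => V q.1.1 (ins q.1.2 q.2) := by
    simpa using measurable_pair_functional hV (V' := fun _ _ => 1) measurable_const
  have h2 : Measurable fun q : ((Sp d × M) × (Sp d × M)) × Set (Sp d × M) => V q.1.2 (ins q.1.1 q.2) := by
    simpa using measurable_pair_functional (V := fun _ _ => 1) measurable_const hV
  have hsw := (Measure.measurePreserving_swap (μ := μ) (ν := μ)).prod (MeasurePreserving.id Q₂)
  have e : ∫⁻ q, V q.1.2 (ins q.1.1 q.2) ^ 2 ∂((μ.prod μ).prod Q₂)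
      = ∫⁻ q, V q.1.1 (ins q.1.2 q.2) ^ 2 ∂((μ.prod μ).prod Q₂) :=
    hsw.lintegral_comp (h1.pow_const 2)
  have h3 : 2 * ∫⁻ q, V q.1.1 (ins q.1.2 q.2) * V q.1.2 (ins q.1.1 q.2) ∂((μ.prod μ).prod Q₂)
      ≤ 2 * ∫⁻ q, V q.1.1 (ins q.1.2 q.2) ^ 2 ∂((μ.prod μ).prod Q₂) := by
    calc _ = ∫⁻ q, 2 * (V q.1.1 (ins q.1.2 q.2) * V q.1.2 (ins q.1.1 q.2))
          ∂((μ.prod μ).prod Q₂) := (lintegral_const_mul _ (measurable_pair_functional hV hV)).symm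
      _ ≤ ∫⁻ q, (V q.1.1 (ins q.1.2 q.2) ^ 2 + V q.1.2 (ins q.1.1 q.2) ^ 2)
          ∂((μ.prod μ).prod Q₂) := lintegral_mono fun q => two_mul_le_sq_add_sq _ _
      _ = _ := by rw [lintegral_add_left (h1.pow_const 2), e, two_mul]
  exact (ENNReal.mul_le_mul_iff_right two_ne_zero (by simp)).1 h3

/-- Moments of order `1` and `2` of normalized sums. -/
lemma lintegral_cfgSum_pow_le [SFinite Q₂] (hQ : HasMecke μ Q Q₁ Q₂ a b)
    {W : Sp d × M → Set (Sp d × M) → ℝ≥0∞} (hWfin : ∀ z X, W z X ≠ ∞)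
    (hW : Measurable fun p : (Sp d × M) × Set (Sp d × M) => W p.1 p.2) {q : ℕ}
    (hq : q = 1 ∨ q = 2) {A : ℝ} (hA : 1 ≤ A) (ha : a / ENNReal.ofReal A ≤ 2)
    (hb : b / ENNReal.ofReal A ^ 2 ≤ 2) {B : ℝ≥0∞}
    (h1 : ∫⁻ p, W p.1 p.2 ^ q ∂(μ.prod Q₁) ≤ B)
    (h2 : q = 2 → ∫⁻ p, W p.1.1 (ins p.1.2 p.2) ^ q ∂((μ.prod μ).prod Q₂) ≤ B) :
    ∫⁻ X, ‖(cfgSum W X).toReal / A‖ₑ ^ q ∂Q ≤ 4 * B := by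
  have hA0 : 0 < A := one_pos.trans_le hA
  have hA0' : ENNReal.ofReal A ≠ 0 := by simpa using hA0
  have hA1 : 1 ≤ ENNReal.ofReal A := by simpa using hA
  have e : ∫⁻ X, ‖(cfgSum W X).toReal / A‖ₑ ^ q ∂Q
      = ∫⁻ X, cfgSum W X ^ q * ((ENNReal.ofReal A) ^ q)⁻¹ ∂Q := by
    refine lintegral_congr_ae ?_
    filter_upwards [hQ.finite] with X hX
    rw [enorm_toReal_div (cfgSum_ne_top hWfin hX) hA0, div_eq_mul_inv, mul_pow, ENNReal.inv_pow]
  have hAq : ((ENNReal.ofReal A) ^ q)⁻¹ ≠ ∞ := ENNReal.inv_ne_top.2 (pow_ne_zero _ hA0')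
  rw [e, lintegral_mul_const' _ _ hAq]
  rcases hq with rfl | rfl
  · simp only [pow_one] at h1 ⊢
    rw [hQ.first W hW]
    calc _ = a / ENNReal.ofReal A * ∫⁻ p, W p.1 p.2 ∂(μ.prod Q₁) := by
          rw [div_eq_mul_inv]; ring
      _ ≤ 2 * B := mul_le_mul' ha h1
      _ ≤ 4 * B := mul_le_mul' (by norm_num) le_rfl
  · have hs := hQ.second W hW
    simp_rw [← pow_two (cfgSum W _), ← pow_two (W _ _)] at hs
    rw [hs, add_mul]
    have hpair := (lintegral_pair_le_sq (μ := μ) (Q₂ := Q₂) hW).trans (h2 rfl)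
    -- Since `A ≥ 1`, the bound on `a / A` also serves for `a / A ^ 2`.
    have ha2 : a / ENNReal.ofReal A ^ 2 ≤ 2 := by
      refine le_trans (ENNReal.div_le_div_left ?_ _) ha
      rw [pow_two]; exact le_mul_of_one_le_right' hA1
    calc _ = a / ENNReal.ofReal A ^ 2 * ∫⁻ p, W p.1 p.2 ^ 2 ∂(μ.prod Q₁) +
          b / ENNReal.ofReal A ^ 2 * ∫⁻ q, W q.1.1 (ins q.1.2 q.2) * W q.1.2 (ins q.1.1 q.2)
            ∂((μ.prod μ).prod Q₂) := by
          rw [div_eq_mul_inv, div_eq_mul_inv]; ring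
      _ ≤ 2 * B + 2 * B := add_le_add (mul_le_mul' ha2 h1) (mul_le_mul' hb hpair)
      _ = 4 * B := by ring

variable {ι : Type*} {F : Filter ι}

lemma tendsto_eLpNorm_of_lintegral {Ω : Type*} [MeasurableSpace Ω] {P : ι → Measure Ω}
    {f : ι → Ω → ℝ} {q : ℕ} (hq : q ≠ 0)
    (h : Tendsto (fun i => ∫⁻ ω, ‖f i ω‖ₑ ^ q ∂(P i)) F (𝓝 0)) :
    Tendsto (fun i => eLpNorm (f i) q (P i)) F (𝓝 0) := by
  have hq0 : (0 : ℝ) < 1 / (q : ℝ) := by positivity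
  have h1 := (ENNReal.continuous_rpow_const (y := 1 / (q : ℝ))).tendsto 0 |>.comp h
  rw [ENNReal.zero_rpow_of_pos hq0] at h1
  refine h1.congr fun i => ?_
  rw [eLpNorm_eq_lintegral_rpow_enorm_toReal (by simpa using hq) (by simp)]
  simp

/-- Weak law of large numbers in `L²` for bounded functionals. -/
lemma tendsto_eLpNorm_bounded {Q Q₁ Q₂ : ι → Measure (Set (Sp d × M))} {a b : ι → ℝ≥0∞} {A : ι → ℝ}
    [∀ i, IsProbabilityMeasure (Q i)] [∀ i, IsProbabilityMeasure (Q₁ i)]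
    (hQ : ∀ᶠ i in F, HasMecke μ (Q i) (Q₁ i) (Q₂ i) (a i) (b i)) (hA : Tendsto A F atTop)
    (ha : Tendsto (fun i => a i / ENNReal.ofReal (A i)) F (𝓝 1))
    (hb : Tendsto (fun i => b i / ENNReal.ofReal (A i) ^ 2) F (𝓝 1))
    {V : ι → Sp d × M → Set (Sp d × M) → ℝ≥0∞} {K : ℝ≥0} (hVK : ∀ i z X, V i z X ≤ K)
    (hV : ∀ᶠ i in F, Measurable fun p : (Sp d × M) × Set (Sp d × M) => V i p.1 p.2) {c : ℝ≥0∞}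
    (hc : c ≠ ∞) (h1 : Tendsto (fun i => ∫⁻ p, V i p.1 p.2 ∂(μ.prod (Q₁ i))) F (𝓝 c))
    (h2 : Tendsto (fun i => ∫⁻ q, V i q.1.1 (ins q.1.2 q.2) * V i q.1.2 (ins q.1.1 q.2)
      ∂((μ.prod μ).prod (Q₂ i))) F (𝓝 (c * c))) :
    Tendsto (fun i => eLpNorm (fun X => (cfgSum (V i) X).toReal / A i - c.toReal) 2 (Q i)) F
      (𝓝 0) := by
  have key : Tendsto (fun i => ∫⁻ X, ‖(cfgSum (V i) X).toReal / A i - c.toReal‖ₑ ^ 2 ∂(Q i)) F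
      (𝓝 0) := by
    have hAinv : Tendsto (fun i => (ENNReal.ofReal (A i))⁻¹) F (𝓝 0) := by
      have := ENNReal.tendsto_ofReal_atTop.comp hA
      simpa using _root_.tendsto_inv_iff.2 this
    have m1 : Tendsto (fun i => a i / ENNReal.ofReal (A i) * ∫⁻ p, V i p.1 p.2 ∂(μ.prod (Q₁ i))) F
        (𝓝 c) := by
      simpa using ENNReal.Tendsto.mul ha (Or.inr hc) h1 (Or.inr ENNReal.one_ne_top)
    -- The diagonal term is at most `K * K` times `a / A ^ 2`, which tends to zero.
    have mA : Tendsto (fun i => a i / ENNReal.ofReal (A i) * (ENNReal.ofReal (A i))⁻¹ *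
        ∫⁻ p, V i p.1 p.2 * V i p.1 p.2 ∂(μ.prod (Q₁ i))) F (𝓝 0) := by
      have h0 : Tendsto (fun i => a i / ENNReal.ofReal (A i) * (ENNReal.ofReal (A i))⁻¹ *
          ((K : ℝ≥0∞) * K)) F (𝓝 0) := by
        have := ENNReal.Tendsto.mul_const (b := (K : ℝ≥0∞) * K) (ENNReal.Tendsto.mul ha
          (Or.inr ENNReal.zero_ne_top) hAinv (Or.inr ENNReal.one_ne_top))
          (Or.inr (ENNReal.mul_ne_top ENNReal.coe_ne_top ENNReal.coe_ne_top))
        simpa using this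
      refine tendsto_of_tendsto_of_tendsto_of_le_of_le tendsto_const_nhds h0 (fun _ => zero_le)
        fun i => mul_le_mul' le_rfl ?_
      refine (lintegral_mono (g := fun _ => (K : ℝ≥0∞) * K) fun p =>
        mul_le_mul' (hVK _ _ _) (hVK _ _ _)).trans ?_
      simp
    have m2 : Tendsto (fun i => a i / ENNReal.ofReal (A i) * (ENNReal.ofReal (A i))⁻¹ *
        (∫⁻ p, V i p.1 p.2 * V i p.1 p.2 ∂(μ.prod (Q₁ i))) + b i / ENNReal.ofReal (A i) ^ 2 *
        ∫⁻ q, V i q.1.1 (ins q.1.2 q.2) * V i q.1.2 (ins q.1.1 q.2)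
          ∂((μ.prod μ).prod (Q₂ i))) F (𝓝 (c * c)) := by
      have := mA.add (ENNReal.Tendsto.mul hb (Or.inr (ENNReal.mul_ne_top hc hc)) h2
        (Or.inr ENNReal.one_ne_top))
      simpa using this
    have hfin : 2 * c * c ≠ ∞ := ENNReal.mul_ne_top (ENNReal.mul_ne_top (by simp) hc) hc
    -- With `S` the sum, `E (S/A - c)² = E (S/A)² + c² - 2c E (S/A)`, and the limit on the right is
    -- `c² + c² - 2c² = 0`.
    have m3 := ENNReal.Tendsto.sub (m2.add (tendsto_const_nhds (x := c * c)))
      (ENNReal.Tendsto.const_mul (a := 2 * c) m1 (Or.inr (ENNReal.mul_ne_top (by simp) hc)))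
      (Or.inr hfin)
    have hz : c * c + c * c - 2 * c * c = 0 := by
      rw [mul_assoc, two_mul, tsub_self]
    rw [hz] at m3
    refine m3.congr' ?_
    filter_upwards [hQ, hV, hA.eventually_gt_atTop 0, m1.eventually_ne hc.symm.symm] with i hi hVi hAi hmi
    have hA0 : ENNReal.ofReal (A i) ≠ 0 := by simpa using hAi
    have hVfin : ∀ z X, V i z X ≠ ∞ := fun z X => ((hVK i z X).trans_lt ENNReal.coe_lt_top).ne
    have hS := hi.aemeasurable (V i) hVi
    have e1 : ∫⁻ X, cfgSum (V i) X / ENNReal.ofReal (A i) ∂(Q i)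
        = a i / ENNReal.ofReal (A i) * ∫⁻ p, V i p.1 p.2 ∂(μ.prod (Q₁ i)) := by
      simp_rw [div_eq_mul_inv]
      rw [lintegral_mul_const' _ _ (ENNReal.inv_ne_top.2 hA0), hi.first _ hVi]
      ring
    have e2 : ∫⁻ X, (cfgSum (V i) X / ENNReal.ofReal (A i)) ^ 2 ∂(Q i)
        = a i / ENNReal.ofReal (A i) * (ENNReal.ofReal (A i))⁻¹ *
        (∫⁻ p, V i p.1 p.2 * V i p.1 p.2 ∂(μ.prod (Q₁ i))) + b i / ENNReal.ofReal (A i) ^ 2 *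
        ∫⁻ q, V i q.1.1 (ins q.1.2 q.2) * V i q.1.2 (ins q.1.1 q.2)
          ∂((μ.prod μ).prod (Q₂ i)) := by
      have : ∀ X, (cfgSum (V i) X / ENNReal.ofReal (A i)) ^ 2
          = cfgSum (V i) X * cfgSum (V i) X * ((ENNReal.ofReal (A i))⁻¹) ^ 2 := by
        intro X; rw [div_eq_mul_inv]; ring
      simp_rw [this]
      rw [lintegral_mul_const' _ _ (ENNReal.pow_ne_top (ENNReal.inv_ne_top.2 hA0)),
        hi.second _ hVi]
      simp_rw [div_eq_mul_inv, ENNReal.inv_pow]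
      ring
    -- The expanded square is first proved in additive form, where truncated subtraction plays no
    -- role.
    have e3 : (∫⁻ X, ‖(cfgSum (V i) X).toReal / A i - c.toReal‖ₑ ^ 2 ∂(Q i)) +
        2 * c * ∫⁻ X, cfgSum (V i) X / ENNReal.ofReal (A i) ∂(Q i)
        = (∫⁻ X, (cfgSum (V i) X / ENNReal.ofReal (A i)) ^ 2 ∂(Q i)) + c * c := by
      have hS1 : AEMeasurable (fun X => cfgSum (V i) X / ENNReal.ofReal (A i)) (Q i) :=
        hS.div_const _
      rw [← lintegral_const_mul'' _ hS1, ← lintegral_add_right' _ (hS1.const_mul _)]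
      have : c * c = ∫⁻ _, c * c ∂(Q i) := by simp
      rw [this, ← lintegral_add_right _ measurable_const]
      refine lintegral_congr_ae ?_
      filter_upwards [hi.finite] with X hX
      have hSX := cfgSum_ne_top hVfin hX
      obtain ⟨t, ht⟩ : ∃ t : ℝ≥0, cfgSum (V i) X / ENNReal.ofReal (A i) = t :=
        ⟨_, (ENNReal.coe_toNNReal (ENNReal.div_ne_top hSX hA0)).symm⟩
      have ht' : (cfgSum (V i) X).toReal / A i = t := by
        have := congrArg ENNReal.toReal ht
        rwa [ENNReal.toReal_div, ENNReal.toReal_ofReal hAi.le] at this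
      lift c to ℝ≥0 using hc
      rw [ht, ht', Real.enorm_eq_ofReal_abs, ← ENNReal.ofReal_pow (abs_nonneg _), sq_abs]
      simp only [ENNReal.coe_toReal]
      rw [← ENNReal.ofReal_coe_nnreal (p := c), ← ENNReal.ofReal_coe_nnreal (p := t),
        ← ENNReal.ofReal_ofNat, ← ENNReal.ofReal_mul (by positivity),
        ← ENNReal.ofReal_mul (by positivity), ← ENNReal.ofReal_mul (by positivity),
        ← ENNReal.ofReal_pow (by positivity), ← ENNReal.ofReal_add (by positivity) (by positivity),
        ← ENNReal.ofReal_add (by positivity) (by positivity)]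
      congr 1
      ring
    rw [e1, e2] at e3
    refine (ENNReal.eq_sub_of_add_eq ?_ e3).symm
    exact ENNReal.mul_ne_top (ENNReal.mul_ne_top (by simp) hc) hmi
  have := tendsto_eLpNorm_of_lintegral (q := 2) two_ne_zero key
  simpa using this

end AbstractLLN

/-! ### Truncation by means of moments of order `p > q`. -/

section Truncation

variable {d : ℕ} {M : Type*} [MeasurableSpace M] {μ : Measure (Sp d × M)} [IsProbabilityMeasure μ]
  {ι : Type*} {F : Filter ι}

lemma pow_le_one_add_rpow {q : ℕ} {p : ℝ} (hp : (q : ℝ) < p) (v : ℝ≥0∞) : v ^ q ≤ 1 + v ^ p := by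
  rcases le_total v 1 with h | h
  · exact le_add_right (pow_le_one₀ zero_le h)
  · refine le_add_left ?_
    rw [← ENNReal.rpow_natCast]
    exact ENNReal.rpow_le_rpow_of_exponent_le h hp.le

/-- Where `v ≥ K` one has `K ^ (p - q) ≤ v ^ (p - q)`; where `v ≤ K` the truncated difference
vanishes. The factor makes the truncation error small uniformly in the scale. -/
lemma tsub_pow_le {q : ℕ} {p : ℝ} (hp : (q : ℝ) < p) {K : ℕ} (hK : 0 < K) (hq : q ≠ 0)
    (v : ℝ≥0∞) : (v - K) ^ q ≤ ((K : ℝ≥0∞) ^ (p - q))⁻¹ * v ^ p := by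
  rcases le_total v K with h | h
  · rw [tsub_eq_zero_of_le h, zero_pow hq]; exact zero_le
  · have hK0 : (K : ℝ≥0∞) ^ (p - q) ≠ 0 := by
      have : (K : ℝ≥0∞) ≠ 0 := by simpa using hK.ne'
      simp [ENNReal.rpow_eq_zero_iff, this]
    have hKt : (K : ℝ≥0∞) ^ (p - q) ≠ ∞ :=
      ENNReal.rpow_ne_top_of_nonneg (sub_nonneg.2 hp.le) (ENNReal.natCast_ne_top K)
    rw [mul_comm, ← div_eq_mul_inv, ENNReal.le_div_iff_mul_le (Or.inl hK0) (Or.inl hKt)]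
    calc (v - K) ^ q * (K : ℝ≥0∞) ^ (p - q) ≤ v ^ q * v ^ (p - q) :=
          mul_le_mul' (pow_le_pow_left₀ zero_le tsub_le_self q)
            (ENNReal.rpow_le_rpow h (sub_nonneg.2 hp.le))
      _ = v ^ p := by
          rw [← ENNReal.rpow_natCast, ← ENNReal.rpow_add_of_nonneg _ _ (Nat.cast_nonneg q)
            (sub_nonneg.2 hp.le)]
          congr 1; ring

lemma tendsto_inv_rpow_atTop {e : ℝ} (he : 0 < e) :
    Tendsto (fun K : ℕ => ((K : ℝ≥0∞) ^ e)⁻¹) atTop (𝓝 0) := by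
  have h2 := (ENNReal.tendsto_rpow_at_top he).comp ENNReal.tendsto_nat_nhds_top
  simpa using _root_.tendsto_inv_iff.2 h2

/-- Weak law of large numbers in `L^q`, `q = 1, 2`, for functionals with bounded `p`-th moments,
`p > q`, whose truncations have converging one-point and two-point means. -/
theorem tendsto_eLpNorm_cfgSum [F.NeBot] {Q Q₁ Q₂ : ι → Measure (Set (Sp d × M))}
    {a b : ι → ℝ≥0∞} {A : ι → ℝ} [∀ i, IsProbabilityMeasure (Q i)]
    [∀ i, IsProbabilityMeasure (Q₁ i)] [∀ i, IsProbabilityMeasure (Q₂ i)]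
    (hQ : ∀ᶠ i in F, HasMecke μ (Q i) (Q₁ i) (Q₂ i) (a i) (b i)) (hA : Tendsto A F atTop)
    (ha : Tendsto (fun i => a i / ENNReal.ofReal (A i)) F (𝓝 1))
    (hb : Tendsto (fun i => b i / ENNReal.ofReal (A i) ^ 2) F (𝓝 1))
    {V : ι → Sp d × M → Set (Sp d × M) → ℝ≥0∞} (hVfin : ∀ i z X, V i z X ≠ ∞)
    (hV : ∀ᶠ i in F, Measurable fun p : (Sp d × M) × Set (Sp d × M) => V i p.1 p.2)
    {q : ℕ} (hq : q = 1 ∨ q = 2) {p : ℝ} (hp : (q : ℝ) < p) {H : ℝ≥0}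
    (hM1 : ∀ᶠ i in F, ∫⁻ w, V i w.1 w.2 ^ p ∂(μ.prod (Q₁ i)) ≤ H)
    (hM2 : ∀ᶠ i in F, q = 2 →
      ∫⁻ w, V i w.1.1 (ins w.1.2 w.2) ^ p ∂((μ.prod μ).prod (Q₂ i)) ≤ H)
    {c : ℕ → ℝ≥0∞} {cinf : ℝ≥0∞} (hc : Tendsto c atTop (𝓝 cinf))
    (h1 : ∀ K : ℕ, Tendsto (fun i => ∫⁻ p, min (V i p.1 p.2) K ∂(μ.prod (Q₁ i))) F (𝓝 (c K)))
    (h2 : ∀ K : ℕ, Tendsto (fun i => ∫⁻ q, min (V i q.1.1 (ins q.1.2 q.2)) K *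
      min (V i q.1.2 (ins q.1.1 q.2)) K ∂((μ.prod μ).prod (Q₂ i))) F (𝓝 (c K * c K))) :
    cinf ≠ ∞ ∧ (∀ᶠ i in F, MemLp (fun X => (cfgSum (V i) X).toReal / A i) q (Q i)) ∧
    Tendsto (fun i => eLpNorm (fun X => (cfgSum (V i) X).toReal / A i - cinf.toReal) q (Q i)) F
      (𝓝 0) := by
  have hq0 : q ≠ 0 := by rcases hq with rfl | rfl <;> norm_num
  have hq1 : (1 : ℝ≥0∞) ≤ (q : ℝ≥0∞) := by exact_mod_cast Nat.one_le_iff_ne_zero.2 hq0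
  -- A truncated mean is at most the full mean, and `v ≤ 1 + v ^ p`. The bound does not depend on
  -- `K`, so it survives in the limit and shows `cinf` to be finite.
  have hcb : ∀ K, c K ≤ 1 + H := by
    intro K
    refine le_of_tendsto (h1 K) ?_
    filter_upwards [hM1] with i hi
    calc _ ≤ ∫⁻ w, (1 + V i w.1 w.2 ^ p) ∂(μ.prod (Q₁ i)) := by
          refine lintegral_mono fun w => (min_le_left _ _).trans ?_
          have hp1 : ((1 : ℕ) : ℝ) < p := by
            refine lt_of_le_of_lt ?_ hp
            exact_mod_cast Nat.one_le_iff_ne_zero.2 hq0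
          simpa using pow_le_one_add_rpow hp1 (V i w.1 w.2)
      _ ≤ 1 + H := by
          rw [lintegral_add_left measurable_const, lintegral_one, measure_univ]
          exact add_le_add le_rfl hi
  have h1H : (1 : ℝ≥0∞) + H ≠ ∞ := by simp
  have hcK : ∀ K, c K ≠ ∞ := fun K => ((hcb K).trans_lt h1H.lt_top).ne
  have hcinf : cinf ≠ ∞ := ((le_of_tendsto' hc hcb).trans_lt h1H.lt_top).ne
  have ha2 : ∀ᶠ i in F, a i / ENNReal.ofReal (A i) ≤ 2 :=
    (ha.eventually_lt_const (by norm_num)).mono fun _ h => le_of_lt h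
  have hb2 : ∀ᶠ i in F, b i / ENNReal.ofReal (A i) ^ 2 ≤ 2 :=
    (hb.eventually_lt_const (by norm_num)).mono fun _ h => le_of_lt h
  have hint : ∀ {i} (f : Set (Sp d × M) → ℝ),
      eLpNorm f q (Q i) = (∫⁻ X, ‖f X‖ₑ ^ q ∂(Q i)) ^ (1 / (q : ℝ)) := by
    intro i f
    rw [eLpNorm_eq_lintegral_rpow_enorm_toReal (by simpa using hq0) (by simp)]
    simp
  have hmeas : ∀ {i} {W : Sp d × M → Set (Sp d × M) → ℝ≥0∞},
      HasMecke μ (Q i) (Q₁ i) (Q₂ i) (a i) (b i) →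
      (Measurable fun p : (Sp d × M) × Set (Sp d × M) => W p.1 p.2) →
      AEStronglyMeasurable (fun X => (cfgSum W X).toReal / A i) (Q i) := fun h1 h2 =>
    ((h1.aemeasurable _ h2).ennreal_toReal.div_const _).aestronglyMeasurable
  refine ⟨hcinf, ?_, ?_⟩
  · filter_upwards [hQ, hV, hA.eventually_ge_atTop 1, ha2, hb2, hM1, hM2]
      with i hi hVi hAi hai hbi hm1 hm2
    refine ⟨hmeas hi hVi, ?_⟩
    rw [hint]
    refine ENNReal.rpow_lt_top_of_nonneg (by positivity) (ne_of_lt ?_)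
    have hle : ∀ {α : Type _} [MeasurableSpace α] (ρ : Measure α) [IsProbabilityMeasure ρ]
        (v : α → ℝ≥0∞), ∫⁻ w, v w ^ p ∂ρ ≤ H → ∫⁻ w, v w ^ q ∂ρ ≤ 1 + H := by
      intro α _ ρ _ v hv
      calc _ ≤ ∫⁻ w, (1 + v w ^ p) ∂ρ := lintegral_mono fun w => pow_le_one_add_rpow hp _
        _ ≤ 1 + H := by
          rw [lintegral_add_left measurable_const, lintegral_one, measure_univ]
          exact add_le_add le_rfl hv
    refine (lintegral_cfgSum_pow_le hi (hVfin i) hVi hq hAi hai hbi (B := 1 + H) (hle _ _ hm1)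
      fun h => hle _ _ (hm2 h)).trans_lt ?_
    exact ENNReal.mul_lt_top (by norm_num) h1H.lt_top
  · rw [ENNReal.tendsto_nhds_zero]
    intro ε hε
    have hε3 : 0 < ε / 3 := ENNReal.div_pos hε.ne' (by norm_num)
    have hpq : 0 < p - q := sub_pos.2 hp
    -- `t2` bounds the contribution above the truncation level, with the `4` of
    -- `lintegral_cfgSum_pow_le`; `t3` bounds the distance between truncated and full limits. One
    -- `K` is fixed for both before `i` moves.
    have t2 : Tendsto (fun K : ℕ => (4 * (((K : ℝ≥0∞) ^ (p - q))⁻¹ * H)) ^ (1 / (q : ℝ))) atTop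
        (𝓝 0) := by
      have h := ENNReal.Tendsto.const_mul (a := 4) (ENNReal.Tendsto.mul_const (b := (H : ℝ≥0∞))
        (tendsto_inv_rpow_atTop hpq) (Or.inr ENNReal.coe_ne_top)) (Or.inr (by norm_num))
      rw [zero_mul, mul_zero] at h
      have h' := ((ENNReal.continuous_rpow_const (y := 1 / (q : ℝ))).tendsto 0).comp h
      rwa [ENNReal.zero_rpow_of_pos (by positivity)] at h'
    have t3 : Tendsto (fun K : ℕ => ‖(c K).toReal - cinf.toReal‖ₑ) atTop (𝓝 0) := by
      have h := (ENNReal.tendsto_toReal hcinf).comp hc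
      have h' := (h.sub_const cinf.toReal).enorm
      simpa using h'
    obtain ⟨K, hK0, hK2, hK3⟩ := ((eventually_gt_atTop 0).and
      ((ENNReal.tendsto_nhds_zero.1 t2 _ hε3).and (ENNReal.tendsto_nhds_zero.1 t3 _ hε3))).exists
    have hVKm : ∀ᶠ i in F, Measurable fun p : (Sp d × M) × Set (Sp d × M) =>
        min (V i p.1 p.2) (K : ℝ≥0∞) := hV.mono fun i hi => hi.min measurable_const
    have t1 := tendsto_eLpNorm_bounded (K := (K : ℝ≥0)) hQ hA ha hb
      (V := fun i z X => min (V i z X) K) (fun i z X => by simp) hVKm (hcK K) (h1 K) (h2 K)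
    filter_upwards [hQ, hV, hVKm, hA.eventually_ge_atTop 1, ha2, hb2, hM1, hM2,
      ENNReal.tendsto_nhds_zero.1 t1 _ hε3] with i hi hVi hVKi hAi hai hbi hm1 hm2 ht1
    have hVsub : Measurable fun p : (Sp d × M) × Set (Sp d × M) => V i p.1 p.2 - (K : ℝ≥0∞) :=
      hVi.sub_const _
    set f₁ : Set (Sp d × M) → ℝ :=
      fun X => (cfgSum (fun z X => min (V i z X) K) X).toReal / A i - (c K).toReal with hf₁
    set f₂ : Set (Sp d × M) → ℝ := fun X => (cfgSum (fun z X => V i z X - K) X).toReal / A i with hf₂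
    set f₃ : Set (Sp d × M) → ℝ := fun _ => (c K).toReal - cinf.toReal with hf₃
    have hm₁ : AEStronglyMeasurable f₁ (Q i) :=
      (hmeas (W := fun z X => min (V i z X) K) hi hVKi).sub aestronglyMeasurable_const
    have hm₂ : AEStronglyMeasurable f₂ (Q i) := hmeas (W := fun z X => V i z X - K) hi hVsub
    have hm₃ : AEStronglyMeasurable f₃ (Q i) := aestronglyMeasurable_const
    -- From `v = min v K + (v - K)`: a centred bounded part, a remainder with small moments, and the
    -- deterministic difference of the limits.
    have heq : (fun X => (cfgSum (V i) X).toReal / A i - cinf.toReal) =ᵐ[Q i] f₁ + f₂ + f₃ := by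
      filter_upwards [hi.finite] with X hX
      have e : cfgSum (V i) X = cfgSum (fun z X => min (V i z X) K) X +
          cfgSum (fun z X => V i z X - K) X := by
        rw [← cfgSum_add]
        congr 1
        ext z X
        rw [add_comm, tsub_add_min]
      have f1 : cfgSum (fun z X => min (V i z X) (K : ℝ≥0∞)) X ≠ ∞ :=
        cfgSum_ne_top (fun z X => ne_top_of_le_ne_top (hVfin i z X) (min_le_left _ _)) hX
      have f2 : cfgSum (fun z X => V i z X - (K : ℝ≥0∞)) X ≠ ∞ :=
        cfgSum_ne_top (fun z X => ne_top_of_le_ne_top (hVfin i z X) tsub_le_self) hX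
      simp only [Pi.add_apply, hf₁, hf₂, hf₃]
      rw [e, ENNReal.toReal_add f1 f2]
      ring
    rw [eLpNorm_congr_ae heq]
    have b1 : eLpNorm f₁ q (Q i) ≤ ε / 3 := by
      -- The bounded part converges in `L²`, hence in `L^q` for `q ≤ 2` on a probability space.
      refine (eLpNorm_le_eLpNorm_of_exponent_le ?_ hm₁).trans ht1
      rcases hq with rfl | rfl <;> norm_num
    have hle : ∀ {α : Type _} [MeasurableSpace α] (ρ : Measure α) (v : α → ℝ≥0∞),
        ∫⁻ w, v w ^ p ∂ρ ≤ H → ∫⁻ w, (v w - K) ^ q ∂ρ ≤ ((K : ℝ≥0∞) ^ (p - q))⁻¹ * H := by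
      intro α _ ρ v hv
      calc _ ≤ ∫⁻ w, ((K : ℝ≥0∞) ^ (p - q))⁻¹ * v w ^ p ∂ρ :=
            lintegral_mono fun w => tsub_pow_le hp hK0 hq0 _
        _ ≤ _ := by
          rw [lintegral_const_mul']
          · exact mul_le_mul' le_rfl hv
          · refine ENNReal.inv_ne_top.2 ?_
            have : (K : ℝ≥0∞) ≠ 0 := by simpa using hK0.ne'
            simp [ENNReal.rpow_eq_zero_iff, this]
    have b2 : eLpNorm f₂ q (Q i) ≤ ε / 3 := by
      rw [hint]
      refine (ENNReal.rpow_le_rpow ?_ (by positivity)).trans hK2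
      exact lintegral_cfgSum_pow_le hi (fun z X => ne_top_of_le_ne_top (hVfin i z X) tsub_le_self)
        hVsub hq hAi hai hbi (hle _ _ hm1) fun h => hle _ _ (hm2 h)
    have b3 : eLpNorm f₃ q (Q i) ≤ ε / 3 := by
      rw [hf₃, eLpNorm_const _ (by simpa using hq0) (IsProbabilityMeasure.ne_zero _)]
      simpa using hK3
    calc _ ≤ eLpNorm (f₁ + f₂) q (Q i) + eLpNorm f₃ q (Q i) :=
          eLpNorm_add_le (hm₁.add hm₂) hm₃ hq1
      _ ≤ eLpNorm f₁ q (Q i) + eLpNorm f₂ q (Q i) + eLpNorm f₃ q (Q i) :=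
          add_le_add (eLpNorm_add_le hm₁ hm₂ hq1) le_rfl
      _ ≤ ε / 3 + ε / 3 + ε / 3 := add_le_add (add_le_add b1 b2) b3
      _ = ε := ENNReal.add_thirds ε

end Truncation

/-! ### The score in coordinates centred at its own point. -/

section LocalScore

variable {d : ℕ} {M : Type*} [MeasurableSpace M] {ξ : Score d M} {G : Set (Sp d)}

open Classical in
/-- The measure `ξ(x,t; x + X)` for finite `X` without points above the origin, set to zero
when `x ∉ G`. -/
def localScore (ξ : Score d M) (G : Set (Sp d)) (z : Sp d × M) (X : Set (Sp d × M)) :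
    Measure (Sp d) :=
  if X.Finite ∧ X ∩ ({0} ×ˢ Set.univ) = ∅ ∧ z.1 ∈ G then scoreAt ξ z (shiftSet z.1 X) else 0

lemma localScore_of_mem {z : Sp d × M} {X : Set (Sp d × M)} (hX : X.Finite)
    (h0 : X ∩ ({0} ×ˢ Set.univ) = ∅) (hz : z.1 ∈ G) :
    localScore ξ G z X = scoreAt ξ z (shiftSet z.1 X) := if_pos ⟨hX, h0, hz⟩

lemma localScore_of_notMem {z : Sp d × M} (hz : z.1 ∉ G) (X : Set (Sp d × M)) :
    localScore ξ G z X = 0 := if_neg fun h => hz h.2.2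

lemma shiftSet_eq_zoomSet (x : Sp d) (X : Set (Sp d × M)) : shiftSet x X = zoomSet (-x) 1 X := by
  unfold shiftSet zoomSet
  congr 1
  ext1 w
  simp [posMap, zoom, add_comm]

lemma finite_shiftSet {X : Set (Sp d × M)} (hX : X.Finite) (x : Sp d) : (shiftSet x X).Finite :=
  hX.image _

lemma isFiniteMeasure_localScore (hξ : IsScore ξ) (z : Sp d × M) (X : Set (Sp d × M)) :
    IsFiniteMeasure (localScore ξ G z X) := by
  unfold localScore
  split_ifs with h
  · exact ⟨hξ.finite _ _ ((finite_shiftSet h.1 _).insert _) (Set.mem_insert _ _)⟩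
  · infer_instance

/-- If no point of `X` lies above the origin, no point of `x + X` lies above `x`. Adding `(x,t)` is
then a fresh insertion, which `ins` performs measurably; on all other arguments the value is zero by
convention. -/
lemma measurable_localScore (hξ : IsScore ξ) (hG : MeasurableSet G) :
    Measurable fun p : (Sp d × M) × Set (Sp d × M) => localScore ξ G p.1 p.2 := by
  classical
  set T : Set ((Sp d × M) × Set (Sp d × M)) :=
    {p | p.2.Finite ∧ p.2 ∩ ({0} ×ˢ Set.univ) = ∅ ∧ p.1.1 ∈ G} with hT
  have h0 : MeasurableSet ({0} ×ˢ Set.univ : Set (Sp d × M)) :=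
    (measurableSet_singleton 0).prod MeasurableSet.univ
  have hTm : MeasurableSet T := by
    have : T = ({p | p.2.Finite} ∩ {p | p.2 ∩ ({0} ×ˢ Set.univ) = ∅}) ∩ {p | p.1.1 ∈ G} := by
      ext p; simp [hT, and_assoc]
    rw [this]
    exact ((measurable_snd measurableSet_finite_config).inter
      (measurable_snd (measurableSet_inter_eq_empty h0))).inter
      ((measurable_fst.comp measurable_fst) hG)
  have hshift : Measurable fun p : (Sp d × M) × Set (Sp d × M) =>
      ins p.1 (zoomFin (-p.1.1) 1 p.2) := by
    have h1 : Measurable fun p : (Sp d × M) × Set (Sp d × M) =>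
        (((-p.1.1, p.1.2), p.2) : (Sp d × M) × Set (Sp d × M)) :=
      (((measurable_fst.comp measurable_fst).neg).prodMk (measurable_snd.comp measurable_fst)).prodMk
        measurable_snd
    have h2 : Measurable fun p : (Sp d × M) × Set (Sp d × M) => zoomFin (-p.1.1) 1 p.2 :=
      (measurable_zoomFin (d := d) (M := M) one_pos).comp h1
    exact measurable_ins.comp (measurable_fst.prodMk h2)
  have hfresh : ∀ p ∈ T, (p.1, zoomFin (-p.1.1) 1 p.2) ∈ FreshPairs d M := by
    intro p hp
    refine ⟨finite_zoomFin _ _ _, Set.eq_empty_of_forall_notMem ?_⟩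
    rintro w ⟨hw, hw1, -⟩
    rw [zoomFin_of_finite hp.1] at hw
    obtain ⟨y, hy, rfl⟩ := hw
    have : y ∈ p.2 ∩ ({0} ×ˢ Set.univ) := by
      refine ⟨hy, ?_, trivial⟩
      simpa [posMap, zoom] using hw1
    rw [hp.2.1] at this
    exact this
  have hins : ∀ p ∈ T, ins p.1 (zoomFin (-p.1.1) 1 p.2) = insert p.1 (shiftSet p.1.1 p.2) := by
    intro p hp
    rw [ins_of_mem (hfresh p hp), zoomFin_of_finite hp.1, shiftSet_eq_zoomSet]
  refine Measure.measurable_of_measurable_coe _ fun A hA => ?_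
  refine measurable_of_restrict_of_restrict_compl hTm ?_ ?_
  · have hsub : Measurable fun p : T =>
        (⟨(p.1.1, ins p.1.1 (zoomFin (-p.1.1.1) 1 p.1.2)), finite_ins _ _, by
          rw [hins p p.2]; exact Set.mem_insert _ _⟩ :
          {p : (Sp d × M) × Set (Sp d × M) // p.2.Finite ∧ p.1 ∈ p.2}) :=
      ((measurable_fst.comp measurable_subtype_coe).prodMk
        (hshift.comp measurable_subtype_coe)).subtype_mk
    refine Eq.subst (motive := Measurable) ?_ ((hξ.measurable A hA).comp hsub)
    ext p
    simp only [Function.comp_def, Set.domRestrict_apply]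
    rw [localScore_of_mem p.2.1 p.2.2.1 p.2.2.2, hins p p.2, scoreAt]
  · refine Eq.subst (motive := Measurable) ?_ (measurable_const (a := (0 : ℝ≥0∞)))
    ext p
    simp only [Set.domRestrict_apply]
    have : ¬ (p.1.2.Finite ∧ p.1.2 ∩ ({0} ×ˢ Set.univ) = ∅ ∧ p.1.1.1 ∈ G) := p.2
    rw [localScore, if_neg this]
    rfl

/-- Stabilization at radius `r`. -/
def StabAt (ξ : Score d M) (z : Sp d × M) (X : Set (Sp d × M)) (r : ℕ) : Prop :=
  ∀ Y : Set (Sp d × M), Y.Finite → Y ⊆ (Set.univ \ Metric.closedBall 0 (r : ℝ)) ×ˢ Set.univ →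
    scoreAt ξ z (shiftSet z.1 (restrictBall r X ∪ Y)) = scoreAt ξ z (shiftSet z.1 (restrictBall r X))

lemma exists_stabAt {z : Sp d × M} {X : Set (Sp d × M)}
    (h : stabRadius ξ z X Set.univ < ⊤) : ∃ r, StabAt ξ z X r := by
  by_contra hc
  push Not at hc
  refine h.ne ?_
  rw [stabRadius, iInf_eq_top]
  intro r
  rw [iInf_eq_top]
  intro hr
  exact absurd (fun Y hY hYs => Measure.ext fun B hB => hr Y hY hYs B hB) (hc r)

/-- A finite set agreeing with `X` on the ball is `X ∩ B_r` plus finitely many points outside, which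
is the form in which stabilization is stated. -/
lemma StabAt.eq_of_superset {z : Sp d × M} {X X' : Set (Sp d × M)} {r : ℕ} (h : StabAt ξ z X r)
    (hfin : X'.Finite) (heq : X' ∩ cyl d M r = X ∩ cyl d M r) :
    scoreAt ξ z (shiftSet z.1 X') = scoreAt ξ z (shiftSet z.1 (X ∩ cyl d M r)) := by
  have e : X' = restrictBall r X ∪ X' \ cyl d M r := by
    have : restrictBall (r : ℝ) X = X ∩ cyl d M r := rfl
    rw [this, ← heq, Set.inter_union_sdiff]
  rw [e]
  refine h _ (hfin.subset Set.sdiff_subset) ?_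
  rintro w ⟨-, hw⟩
  refine ⟨⟨trivial, fun hb => hw ⟨hb, trivial⟩⟩, trivial⟩

lemma IsLocFinite.finite_inter_cyl {X : Set (Sp d × M)} (h : IsLocFinite X) (r : ℝ) :
    (X ∩ cyl d M r).Finite := h _ Metric.isBounded_closedBall

lemma cyl_mono {r r' : ℝ} (h : r ≤ r') : cyl d M r ⊆ cyl d M r' :=
  Set.prod_mono (Metric.closedBall_subset_closedBall h) subset_rfl

/-- The upper limit is over an eventually constant function. For `K ≥ r + ‖x‖` the ball of radius
`K` about the origin contains the ball of radius `r` about `x`, and stabilization makes all further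
points irrelevant. -/
lemma StabAt.scoreInf_eq {z : Sp d × M} {X : Set (Sp d × M)} (hX : IsLocFinite X) {r : ℕ}
    (h : StabAt ξ z X r) :
    scoreInf ξ z X Set.univ = scoreAt ξ z (shiftSet z.1 (X ∩ cyl d M r)) Set.univ := by
  have hu : (fun y : Sp d => z.1 + y) '' Set.univ = Set.univ :=
    Set.image_univ_of_surjective (add_left_surjective z.1)
  rw [scoreInf, scoreExt, hu]
  refine Tendsto.limsup_eq (tendsto_const_nhds.congr' ?_)
  filter_upwards [eventually_ge_atTop ((r : ℝ) + ‖z.1‖)] with K hK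
  set X' : Set (Sp d × M) := X ∩ {w | z.1 + w.1 ∈ Metric.closedBall 0 K} with hX'
  have e : restrictBall K (shiftSet z.1 X) = shiftSet z.1 X' := by
    ext w
    constructor
    · rintro ⟨⟨y, hy, rfl⟩, hb, -⟩
      exact ⟨y, ⟨hy, hb⟩, rfl⟩
    · rintro ⟨y, ⟨hy, hb⟩, rfl⟩
      exact ⟨⟨y, hy, rfl⟩, hb, trivial⟩
  have hsub : X' ⊆ X ∩ cyl d M (K + ‖z.1‖) := by
    rintro w ⟨hw, hb⟩
    refine ⟨hw, ?_, trivial⟩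
    have hb' : ‖z.1 + w.1‖ ≤ K := by simpa using hb
    have : ‖w.1‖ ≤ ‖z.1 + w.1‖ + ‖z.1‖ := by
      calc ‖w.1‖ = ‖z.1 + w.1 - z.1‖ := by rw [add_sub_cancel_left]
        _ ≤ _ := norm_sub_le _ _
    simp only [mem_closedBall_zero_iff]
    linarith
  have heq : X' ∩ cyl d M r = X ∩ cyl d M r := by
    ext w
    refine ⟨fun hw => ⟨hw.1.1, hw.2⟩, fun hw => ⟨⟨hw.1, ?_⟩, hw.2⟩⟩
    have h1 : ‖w.1‖ ≤ r := by simpa using hw.2.1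
    have h2 := norm_add_le z.1 w.1
    simp only [Set.mem_ofPred_eq, mem_closedBall_zero_iff]
    linarith
  rw [e, h.eq_of_superset ((hX.finite_inter_cyl _).subset hsub) heq]

lemma ae_finite_refLaw {μM : Measure M} [IsProbabilityMeasure μM] :
    ∀ᵐ Y ∂(refLaw d μM), Y.Finite :=
  (Measure.ae_sum_iff' measurableSet_finite_config).2 fun n => ae_finite_binLaw _ n

/-- Stabilized configurations belong to `stabSet`. -/
lemma StabAt.mem_stabSet {μM : Measure M} [IsProbabilityMeasure μM] {z : Sp d × M}
    {X : Set (Sp d × M)} (hX : IsLocFinite X) {r₀ r : ℕ} (h : StabAt ξ z X r₀) (hr : r₀ ≤ r) :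
    (z, X ∩ cyl d M r) ∈ stabSet (localScore ξ G) μM r := by
  rw [mem_stabSet_inter]
  show ∀ᵐ Y ∂(refLaw d μM), _
  filter_upwards [ae_finite_refLaw] with Y hY
  have hr' : (r₀ : ℝ) ≤ r := by exact_mod_cast hr
  have hg : (glue (cyl d M r) X Y).Finite :=
    (hX.finite_inter_cyl r).union (hY.subset Set.sdiff_subset)
  -- Points added off the ball never lie above the origin, so the convention in `localScore` treats
  -- both configurations alike.
  have hzero : glue (cyl d M r) X Y ∩ ({0} ×ˢ Set.univ) = (X ∩ cyl d M r) ∩ ({0} ×ˢ Set.univ) := by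
    ext w
    refine ⟨?_, fun hw => ⟨Or.inl hw.1, hw.2⟩⟩
    rintro ⟨hw | hw, hw0⟩
    · exact ⟨hw, hw0⟩
    · refine absurd ?_ hw.2
      have h0 : w.1 = 0 := hw0.1
      exact ⟨by simp [h0], trivial⟩
  by_cases hc : (X ∩ cyl d M r) ∩ ({0} ×ˢ Set.univ) = ∅ ∧ z.1 ∈ G
  · rw [localScore_of_mem hg (hzero.trans hc.1) hc.2,
      localScore_of_mem (hX.finite_inter_cyl r) hc.1 hc.2,
      h.eq_of_superset hg, h.eq_of_superset (hX.finite_inter_cyl r)]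
    · rw [Set.inter_assoc, Set.inter_eq_self_of_subset_right (cyl_mono hr')]
    · ext w
      refine ⟨?_, fun hw => ⟨Or.inl ⟨hw.1, cyl_mono hr' hw.2⟩, hw.2⟩⟩
      rintro ⟨hw | hw, hw0⟩
      · exact ⟨hw.1, hw0⟩
      · exact absurd (cyl_mono hr' hw0) hw.2
  · rw [localScore, localScore, if_neg, if_neg]
    · exact fun h' => hc h'.2
    · exact fun h' => hc ⟨hzero ▸ h'.2.1, h'.2.2⟩

lemma StabAt.localScore_eq {z : Sp d × M} {X : Set (Sp d × M)} (hX : IsLocFinite X)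
    (h0 : X ∩ ({0} ×ˢ Set.univ) = ∅) (hz : z.1 ∈ G) {r₀ r : ℕ} (h : StabAt ξ z X r₀) (hr : r₀ ≤ r) :
    localScore ξ G z (X ∩ cyl d M r) Set.univ = scoreInf ξ z X Set.univ := by
  have hr' : (r₀ : ℝ) ≤ r := by exact_mod_cast hr
  rw [localScore_of_mem (hX.finite_inter_cyl r) _ hz, h.scoreInf_eq hX,
    h.eq_of_superset (hX.finite_inter_cyl r)]
  · rw [Set.inter_assoc, Set.inter_eq_self_of_subset_right (cyl_mono hr')]
  · rw [Set.inter_right_comm, h0, Set.empty_inter]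

/-- Off `G` the local score is identically zero, so nothing about stabilization has to be assumed
there. -/
lemma mem_stabSet_of_notMem {μM : Measure M} [IsProbabilityMeasure μM] {z : Sp d × M}
    (hz : z.1 ∉ G) (X : Set (Sp d × M)) (r : ℝ) : (z, X) ∈ stabSet (localScore ξ G) μM r := by
  show ∀ᵐ Y ∂(refLaw d μM), _
  exact Eventually.of_forall fun Y => by simp only [localScore_of_notMem hz]

end LocalScore

/-! ### Homogeneous Poisson processes observed in growing balls. -/

section Homogeneous

variable {d : ℕ} {M Ω : Type*} [MeasurableSpace M] [MeasurableSpace Ω] {μM : Measure M}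
  [IsProbabilityMeasure μM] {P : Measure Ω} [IsProbabilityMeasure P]
  {ξ : Score d M} {G : Set (Sp d)} {κ : Sp d → ℝ≥0} {HH : ℝ≥0 → Ω → Set (Sp d × M)}

lemma map_inter_cyl_eq_homLaw (hd : 0 < d) {a : ℝ≥0} {η : Ω → Set (Sp d × M)}
    (hη : IsPoissonProcess η ((a : ℝ≥0∞) • (volume : Measure (Sp d)).prod μM) P) (r : ℝ) :
    P.map (fun ω => η ω ∩ cyl d M r) = homLaw μM a r := by
  rw [hη.map_inter (measurableSet_cyl r), Measure.restrict_smul]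
  · rfl
  · rw [Measure.smul_apply, smul_eq_mul]
    have : (volume : Measure (Sp d)).prod μM (cyl d M r) = volume (Metric.closedBall (0 : Sp d) r) :=
      leb_cyl r
    rw [this]
    exact ENNReal.mul_ne_top ENNReal.coe_ne_top measure_closedBall_lt_top.ne
  · exact (noPosAtoms_leb (μM := μM) hd).mono Measure.smul_absolutelyContinuous

lemma ae_inter_zero_eq_empty (hd : 0 < d) {a : ℝ≥0} {η : Ω → Set (Sp d × M)}
    (hη : IsPoissonProcess η ((a : ℝ≥0∞) • (volume : Measure (Sp d)).prod μM) P) :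
    ∀ᵐ ω ∂P, η ω ∩ ({0} ×ˢ Set.univ) = ∅ := by
  have hm : Measurable fun ω => η ω ∩ cyl d M 1 :=
    (measurable_config_inter (measurableSet_cyl 1)).comp hη.measurable
  have h : ∀ᵐ X ∂(homLaw μM a 1), X ∩ ({(0 : Sp d)} ×ˢ Set.univ) = (∅ : Set (Sp d × M)) := by
    have : IsFiniteMeasure ((a : ℝ≥0∞) • (leb d μM).restrict (cyl d M 1)) :=
      Measure.smul_finite _ ENNReal.coe_ne_top
    refine ae_poisLaw_of_forall fun n => ae_inter_eq_empty_binLaw ?_ n 0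
    exact ((noPosAtoms_leb (μM := μM) hd).restrict _).mono Measure.smul_absolutelyContinuous
  rw [← map_inter_cyl_eq_homLaw hd hη 1] at h
  filter_upwards [ae_of_ae_map hm.aemeasurable h] with ω hω
  rw [← hω, Set.inter_assoc]
  congr 1
  refine (Set.inter_eq_self_of_subset_right ?_).symm
  rintro w ⟨hw, -⟩
  have h0 : w.1 = 0 := hw
  exact ⟨by simp [h0], trivial⟩

/-- Limits of local functionals of homogeneous Poisson processes in growing balls. -/
lemma tendsto_lintegral_homLaw_atTop (hd : 0 < d) {a : ℝ≥0} {η : Ω → Set (Sp d × M)}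
    (hη : IsPoissonProcess η ((a : ℝ≥0∞) • (volume : Measure (Sp d)).prod μM) P) (x : Sp d)
    {W : ℕ → Sp d × M → Set (Sp d × M) → ℝ≥0∞} {K : ℝ≥0} (hWK : ∀ r z X, W r z X ≤ K)
    (hW : ∀ r, Measurable fun p : (Sp d × M) × Set (Sp d × M) => W r p.1 p.2) {g : M × Ω → ℝ≥0∞}
    (hlim : ∀ᵐ w ∂(μM.prod P),
      Tendsto (fun r : ℕ => W r (x, w.1) (η w.2 ∩ cyl d M r)) atTop (𝓝 (g w))) :
    Tendsto (fun r : ℕ => ∫⁻ t, ∫⁻ X, W r (x, t) X ∂(homLaw μM a r) ∂μM) atTop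
      (𝓝 (∫⁻ w, g w ∂(μM.prod P))) := by
  have hm : ∀ r : ℕ, Measurable fun ω => η ω ∩ cyl d M r := fun r =>
    (measurable_config_inter (measurableSet_cyl r)).comp hη.measurable
  have hWm : ∀ r : ℕ, Measurable fun w : M × Ω => W r (x, w.1) (η w.2 ∩ cyl d M r) := fun r =>
    (hW r).comp ((measurable_const.prodMk measurable_fst).prodMk ((hm r).comp measurable_snd))
  have e : ∀ r : ℕ, ∫⁻ t, ∫⁻ X, W r (x, t) X ∂(homLaw μM a r) ∂μM
      = ∫⁻ w, W r (x, w.1) (η w.2 ∩ cyl d M r) ∂(μM.prod P) := by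
    intro r
    rw [lintegral_prod _ (hWm r).aemeasurable]
    refine lintegral_congr fun t => ?_
    rw [← map_inter_cyl_eq_homLaw hd hη, lintegral_map _ (hm r)]
    exact (hW r).comp measurable_prodMk_left
  simp_rw [e]
  refine tendsto_lintegral_of_dominated_convergence (fun _ => (K : ℝ≥0∞)) hWm
    (fun r => Eventually.of_forall fun w => hWK _ _ _) (by simp) hlim

/-- The mean of `min (c₀(x) ξ_∞, K)`. -/
def truncMean (ξ : Score d M) (κ : Sp d → ℝ≥0) (μM : Measure M) (P : Measure Ω)
    (HH : ℝ≥0 → Ω → Set (Sp d × M)) (c₀ : Sp d → ℝ≥0∞) (K : ℕ) (x : Sp d) : ℝ≥0∞ :=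
  ∫⁻ w : M × Ω, min (c₀ x * scoreInf ξ (x, w.1) (HH (κ x) w.2) Set.univ) K ∂(μM.prod P)

/-- Every `r` beyond the almost surely finite radius of stabilization will do. The passages `r → ∞`
rest on this. -/
lemma ae_eventually_stab (hd : 0 < d) {a : ℝ≥0} {η : Ω → Set (Sp d × M)}
    (hη : IsPoissonProcess η ((a : ℝ≥0∞) • (volume : Measure (Sp d)).prod μM) P) {x : Sp d}
    (hx : x ∈ G) (hR : ∀ᵐ w ∂(μM.prod P), stabRadius ξ (x, w.1) (η w.2) Set.univ < ⊤) :
    ∀ᵐ w ∂(μM.prod P), ∀ᶠ r : ℕ in atTop,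
      ((x, w.1), η w.2 ∩ cyl d M r) ∈ stabSet (localScore ξ G) μM r ∧
      localScore ξ G (x, w.1) (η w.2 ∩ cyl d M r) Set.univ
        = scoreInf ξ (x, w.1) (η w.2) Set.univ := by
  have h0 := (Measure.quasiMeasurePreserving_snd (μ := μM) (ν := P)).ae (ae_inter_zero_eq_empty hd hη)
  filter_upwards [hR, h0] with w hw hw0
  obtain ⟨r₀, hr₀⟩ := exists_stabAt hw
  filter_upwards [eventually_ge_atTop r₀] with r hr
  exact ⟨hr₀.mem_stabSet (hη.locFinite _) hr, hr₀.localScore_eq (hη.locFinite _) hw0 hx hr⟩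

/-- `scoreInf` is an upper limit over real `K` and has no evident measurability in the process;
almost surely it is a limit of measurable local scores along integer radii. -/
lemma aemeasurable_scoreInf (hd : 0 < d) (hξ : IsScore ξ) (hG : MeasurableSet G) {a : ℝ≥0}
    {η : Ω → Set (Sp d × M)}
    (hη : IsPoissonProcess η ((a : ℝ≥0∞) • (volume : Measure (Sp d)).prod μM) P) {x : Sp d}
    (hx : x ∈ G) (hR : ∀ᵐ w ∂(μM.prod P), stabRadius ξ (x, w.1) (η w.2) Set.univ < ⊤) :
    AEMeasurable (fun w : M × Ω => scoreInf ξ (x, w.1) (η w.2) Set.univ) (μM.prod P) := by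
  have hm : ∀ r : ℕ, Measurable fun ω => η ω ∩ cyl d M r := fun r =>
    (measurable_config_inter (measurableSet_cyl r)).comp hη.measurable
  refine aemeasurable_of_tendsto_metrizable_ae atTop
    (f := fun (r : ℕ) (w : M × Ω) => localScore ξ G (x, w.1) (η w.2 ∩ cyl d M r) Set.univ)
    (fun r => ?_) ?_
  · refine Measurable.aemeasurable ?_
    exact (Measure.measurable_coe MeasurableSet.univ).comp ((measurable_localScore hξ hG).comp
      ((measurable_const.prodMk measurable_fst).prodMk ((hm r).comp measurable_snd)))
  · filter_upwards [ae_eventually_stab hd hη hx hR] with w hw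
    exact tendsto_const_nhds.congr' (hw.mono fun r hr => hr.2.symm)

variable (hd : 0 < d) (hξ : IsScore ξ) (hG : MeasurableSet G) (hκm : Measurable κ)
    (hκ1 : ∫⁻ x, (κ x : ℝ≥0∞) = 1)
    (hHH : ∀ a, IsPoissonProcess (HH a) ((a : ℝ≥0∞) • (volume : Measure (Sp d)).prod μM) P)
    (hR : ∀ᵐ x ∂((densityMeasure κ).restrict G), ∀ᵐ w ∂(μM.prod P),
      stabRadius ξ (x, w.1) (HH (κ x) w.2) Set.univ < ⊤)

include hd hξ hG hκm hHH in
lemma tendsto_inner_truncMean {c₀ : Sp d → ℝ≥0∞} (hc₀ : Measurable c₀) (K : ℕ) {x : Sp d}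
    (hx : x ∈ G)
    (hRx : ∀ᵐ w ∂(μM.prod P), stabRadius ξ (x, w.1) (HH (κ x) w.2) Set.univ < ⊤) :
    Tendsto (fun r : ℕ => ∫⁻ t, ∫⁻ X, (stabSet (localScore ξ G) μM r).indicator
      (fun p => min (c₀ p.1.1 * localScore ξ G p.1 p.2 Set.univ) (K : ℝ≥0∞)) ((x, t), X)
      ∂(homLaw μM (κ x) r) ∂μM) atTop (𝓝 (truncMean ξ κ μM P HH c₀ K x)) := by
  refine tendsto_lintegral_homLaw_atTop hd (hHH (κ x)) x (K := (K : ℝ≥0))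
    (W := fun r z X => (stabSet (localScore ξ G) μM r).indicator
      (fun p => min (c₀ p.1.1 * localScore ξ G p.1 p.2 Set.univ) (K : ℝ≥0∞)) (z, X))
    (fun r z X => (Set.indicator_le_self _ _ _).trans (by simp)) (fun r => ?_) ?_
  · refine Measurable.indicator ?_ (measurableSet_stabSet (measurable_localScore hξ hG)
      (isFiniteMeasure_localScore hξ) r)
    refine Measurable.min (Measurable.mul (hc₀.comp (measurable_fst.comp measurable_fst)) ?_)
      measurable_const
    exact (Measure.measurable_coe MeasurableSet.univ).comp (measurable_localScore hξ hG)
  · filter_upwards [ae_eventually_stab hd (hHH (κ x)) hx hRx] with w hw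
    refine tendsto_const_nhds.congr' ?_
    filter_upwards [hw] with r hr
    rw [Set.indicator_of_mem hr.1, hr.2]

include hR in
lemma ae_good (hG : MeasurableSet G) : ∀ᵐ x ∂(densityMeasure κ), x ∈ G → ∀ᵐ w ∂(μM.prod P),
      stabRadius ξ (x, w.1) (HH (κ x) w.2) Set.univ < ⊤ := (ae_restrict_iff' hG).1 hR

-- For `x ∈ G` the indicators vanish eventually by `ae_eventually_stab`, for `x ∉ G` they vanish
-- identically; dominated convergence passes this to the mean.
include hd hξ hG hκm hκ1 hHH hR in
lemma tendsto_stabErr :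
    Tendsto (fun r : ℕ => stabErr κ μM (localScore ξ G) r) atTop (𝓝 0) := by
  have := densityMeasure_prob hκ1
  have hS : ∀ r : ℕ, MeasurableSet (stabSet (localScore ξ G) μM r) := fun r =>
    measurableSet_stabSet (measurable_localScore hξ hG) (isFiniteMeasure_localScore hξ) r
  have hWm : ∀ r : ℕ, Measurable fun p : (Sp d × M) × Set (Sp d × M) =>
      (stabSet (localScore ξ G) μM r)ᶜ.indicator (fun _ => (1 : ℝ≥0∞)) (p.1, p.2) :=
    fun r => measurable_const.indicator (hS r).compl
  have hle : ∀ (r : ℕ) z X, (stabSet (localScore ξ G) μM r)ᶜ.indicator (fun _ => (1 : ℝ≥0∞)) (z, X)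
      ≤ (1 : ℝ≥0) := fun r z X => Set.indicator_le_self' (by simp) _
  have hz := fun r : ℕ => measurable_lintegral_homLaw (μM := μM) hκm
    (w := fun z X => (stabSet (localScore ξ G) μM r)ᶜ.indicator (fun _ => (1 : ℝ≥0∞)) (z, X))
    (hWm r) r
  have e : ∀ r : ℕ, stabErr κ μM (localScore ξ G) r = ∫⁻ x, ∫⁻ t, ∫⁻ X,
      (stabSet (localScore ξ G) μM r)ᶜ.indicator (fun _ => (1 : ℝ≥0∞)) ((x, t), X)
        ∂(homLaw μM (κ x) r) ∂μM ∂(densityMeasure κ) := fun r =>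
    lintegral_prod _ (hz r).aemeasurable
  simp_rw [e]
  have h0 : (0 : ℝ≥0∞) = ∫⁻ _, 0 ∂(densityMeasure κ) := by simp
  rw [h0]
  refine tendsto_lintegral_of_dominated_convergence (fun _ => 1)
    (fun r => (hz r).lintegral_prod_right') (fun r => Eventually.of_forall fun x => ?_) (by simp) ?_
  · calc _ ≤ ∫⁻ _ : M, ∫⁻ _ : Set (Sp d × M), 1 ∂(homLaw μM (κ x) r) ∂μM :=
        lintegral_mono fun t => lintegral_mono fun X => hle r _ _
      _ ≤ 1 := by simp
  · filter_upwards [ae_good hR hG] with x hx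
    by_cases hxG : x ∈ G
    · have h1 : (0 : ℝ≥0∞) = ∫⁻ _, 0 ∂(μM.prod P) := by simp
      rw [h1]
      refine tendsto_lintegral_homLaw_atTop hd (hHH (κ x)) x (hle) hWm ?_
      filter_upwards [ae_eventually_stab hd (hHH (κ x)) hxG (hx hxG)] with w hw
      refine tendsto_const_nhds.congr' ?_
      filter_upwards [hw] with r hr
      rw [Set.indicator_of_notMem]
      simpa using hr.1
    · refine tendsto_const_nhds.congr fun r => ?_
      have : ∀ t X, (stabSet (localScore ξ G) μM r)ᶜ.indicator (fun _ => (1 : ℝ≥0∞)) ((x, t), X) = 0 :=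
        fun t X => Set.indicator_of_notMem (by
          simpa using mem_stabSet_of_notMem (ξ := ξ) (z := (x, t)) hxG X (r : ℝ)) _
      simp [this]

include hd hξ hG hκm hκ1 hHH hR in
lemma tendsto_locVal {c₀ : Sp d → ℝ≥0∞} (hc₀ : Measurable c₀) (K : ℕ) :
    Tendsto (fun r : ℕ => locVal κ μM (localScore ξ G)
      (fun z X => min (c₀ z.1 * localScore ξ G z X Set.univ) (K : ℝ≥0∞)) r) atTop
      (𝓝 (∫⁻ x in G, truncMean ξ κ μM P HH c₀ K x ∂(densityMeasure κ))) := by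
  have := densityMeasure_prob hκ1
  have hum : Measurable fun p : (Sp d × M) × Set (Sp d × M) =>
      min (c₀ p.1.1 * localScore ξ G p.1 p.2 Set.univ) (K : ℝ≥0∞) := by
    refine Measurable.min (Measurable.mul (hc₀.comp (measurable_fst.comp measurable_fst)) ?_)
      measurable_const
    exact (Measure.measurable_coe MeasurableSet.univ).comp (measurable_localScore hξ hG)
  have hWm : ∀ r : ℕ, Measurable fun p : (Sp d × M) × Set (Sp d × M) =>
      (stabSet (localScore ξ G) μM r).indicator
      (fun p => min (c₀ p.1.1 * localScore ξ G p.1 p.2 Set.univ) (K : ℝ≥0∞)) (p.1, p.2) :=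
    fun r => hum.indicator (measurableSet_stabSet (measurable_localScore hξ hG)
      (isFiniteMeasure_localScore hξ) r)
  have hz := fun r : ℕ => measurable_lintegral_homLaw (μM := μM) hκm (w := fun z X =>
    (stabSet (localScore ξ G) μM r).indicator
      (fun p => min (c₀ p.1.1 * localScore ξ G p.1 p.2 Set.univ) (K : ℝ≥0∞)) (z, X)) (hWm r) r
  have e : ∀ r : ℕ, locVal κ μM (localScore ξ G)
      (fun z X => min (c₀ z.1 * localScore ξ G z X Set.univ) (K : ℝ≥0∞)) r = ∫⁻ x, ∫⁻ t, ∫⁻ X,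
      (stabSet (localScore ξ G) μM r).indicator
      (fun p => min (c₀ p.1.1 * localScore ξ G p.1 p.2 Set.univ) (K : ℝ≥0∞)) ((x, t), X)
        ∂(homLaw μM (κ x) r) ∂μM ∂(densityMeasure κ) := fun r =>
    lintegral_prod _ (hz r).aemeasurable
  simp_rw [e]
  rw [← lintegral_indicator hG]
  refine tendsto_lintegral_of_dominated_convergence (fun _ => (K : ℝ≥0∞))
    (fun r => (hz r).lintegral_prod_right') (fun r => Eventually.of_forall fun x => ?_) (by simp) ?_
  · calc _ ≤ ∫⁻ _ : M, ∫⁻ _ : Set (Sp d × M), (K : ℝ≥0∞) ∂(homLaw μM (κ x) r) ∂μM :=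
        lintegral_mono fun t => lintegral_mono fun X => by
          refine (Set.indicator_le_self _ _ _).trans ?_
          exact min_le_right _ _
      _ ≤ K := by simp
  · filter_upwards [ae_good hR hG] with x hx
    by_cases hxG : x ∈ G
    · rw [Set.indicator_of_mem hxG]
      exact tendsto_inner_truncMean hd hξ hG hκm hHH hc₀ K hxG (hx hxG)
    · rw [Set.indicator_of_notMem hxG]
      refine tendsto_const_nhds.congr fun r => ?_
      have : ∀ t X, (stabSet (localScore ξ G) μM r).indicator
          (fun p => min (c₀ p.1.1 * localScore ξ G p.1 p.2 Set.univ) (K : ℝ≥0∞)) ((x, t), X) = 0 := by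
        intro t X
        rw [Set.indicator_of_mem (mem_stabSet_of_notMem hxG X r)]
        simp [localScore_of_notMem (ξ := ξ) (z := (x, t)) hxG]
      simp [this]

include hd hξ hG hκm hHH hR in
lemma aemeasurable_truncMean {c₀ : Sp d → ℝ≥0∞} (hc₀ : Measurable c₀) (K : ℕ) :
    AEMeasurable (truncMean ξ κ μM P HH c₀ K) ((densityMeasure κ).restrict G) := by
  have hum : Measurable fun p : (Sp d × M) × Set (Sp d × M) =>
      min (c₀ p.1.1 * localScore ξ G p.1 p.2 Set.univ) (K : ℝ≥0∞) := by
    refine Measurable.min (Measurable.mul (hc₀.comp (measurable_fst.comp measurable_fst)) ?_)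
      measurable_const
    exact (Measure.measurable_coe MeasurableSet.univ).comp (measurable_localScore hξ hG)
  have hWm : ∀ r : ℕ, Measurable fun p : (Sp d × M) × Set (Sp d × M) =>
      (stabSet (localScore ξ G) μM r).indicator
      (fun p => min (c₀ p.1.1 * localScore ξ G p.1 p.2 Set.univ) (K : ℝ≥0∞)) (p.1, p.2) :=
    fun r => hum.indicator (measurableSet_stabSet (measurable_localScore hξ hG)
      (isFiniteMeasure_localScore hξ) r)
  have hz := fun r : ℕ => measurable_lintegral_homLaw (μM := μM) hκm (w := fun z X =>
    (stabSet (localScore ξ G) μM r).indicator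
      (fun p => min (c₀ p.1.1 * localScore ξ G p.1 p.2 Set.univ) (K : ℝ≥0∞)) (z, X)) (hWm r) r
  refine aemeasurable_of_tendsto_metrizable_ae atTop
    (fun r : ℕ => (hz r).lintegral_prod_right' (ν := μM) |>.aemeasurable) ?_
  filter_upwards [hR, ae_restrict_mem hG] with x hx hxG
  exact tendsto_inner_truncMean hd hξ hG hκm hHH hc₀ K hxG hx

lemma tendsto_min_natCast (v : ℝ≥0∞) : Tendsto (fun K : ℕ => min v (K : ℝ≥0∞)) atTop (𝓝 v) := by
  have h := (tendsto_const_nhds (x := v)).min ENNReal.tendsto_nat_nhds_top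
  simpa using h

include hd hξ hG hHH in
lemma tendsto_truncMean {c₀ : Sp d → ℝ≥0∞} {x : Sp d} (hx : x ∈ G)
    (hRx : ∀ᵐ w ∂(μM.prod P), stabRadius ξ (x, w.1) (HH (κ x) w.2) Set.univ < ⊤) :
    Tendsto (fun K : ℕ => truncMean ξ κ μM P HH c₀ K x) atTop
      (𝓝 (c₀ x * meanScoreInf ξ μM P (HH (κ x)) x)) := by
  have hm := aemeasurable_scoreInf hd hξ hG (hHH (κ x)) hx hRx
  rw [meanScoreInf, ← lintegral_const_mul'' _ hm]
  refine lintegral_tendsto_of_tendsto_of_monotone (fun K => (hm.const_mul _).min aemeasurable_const)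
    (Eventually.of_forall fun w K K' h => ?_) (Eventually.of_forall fun w => tendsto_min_natCast _)
  exact min_le_min le_rfl (by exact_mod_cast h)

lemma truncMean_mono (c₀ : Sp d → ℝ≥0∞) (x : Sp d) :
    Monotone fun K => truncMean ξ κ μM P HH c₀ K x := fun K K' h =>
  lintegral_mono fun w => min_le_min le_rfl (by exact_mod_cast h)

-- Monotone convergence in the truncation level identifies the limit without presupposing that it is
-- finite; finiteness is deduced later from the moment bounds.
include hd hξ hG hκm hHH hR in
lemma tendsto_setLIntegral_truncMean {c₀ : Sp d → ℝ≥0∞} (hc₀ : Measurable c₀) :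
    Tendsto (fun K : ℕ => ∫⁻ x in G, truncMean ξ κ μM P HH c₀ K x ∂(densityMeasure κ)) atTop
      (𝓝 (∫⁻ x in G, c₀ x * meanScoreInf ξ μM P (HH (κ x)) x ∂(densityMeasure κ))) := by
  refine lintegral_tendsto_of_tendsto_of_monotone
    (fun K => aemeasurable_truncMean hd hξ hG hκm hHH hR hc₀ K)
    (Eventually.of_forall fun x => truncMean_mono c₀ x) ?_
  filter_upwards [hR, ae_restrict_mem hG] with x hx hxG
  exact tendsto_truncMean hd hξ hG hHH hxG hx

include hd hξ hG hκm hHH hR in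
lemma aemeasurable_meanScoreInf :
    AEMeasurable (fun x => meanScoreInf ξ μM P (HH (κ x)) x) ((densityMeasure κ).restrict G) := by
  refine aemeasurable_of_tendsto_metrizable_ae atTop
    (fun K : ℕ => aemeasurable_truncMean hd hξ hG hκm hHH hR (c₀ := fun _ => 1) measurable_const K) ?_
  filter_upwards [hR, ae_restrict_mem hG] with x hx hxG
  simpa using tendsto_truncMean (c₀ := fun _ => 1) hd hξ hG hHH hxG hx

end Homogeneous

/-! ### Binomial and Poisson processes under a common interface. -/

section Model

variable {d : ℕ} {M : Type*} [MeasurableSpace M]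

/-- A family of point process laws `Q i` to which the law of large numbers applies: moment formulas
with reduced laws `Q₁ i` and `Q₂ i`, normalization `A i`, scaling parameter `L i`, and transfer of
limits from binomial processes. -/
structure LLNModel {ι : Type*} (F : Filter ι) (μ : Measure (Sp d × M))
    (Q Q₁ Q₂ : ι → Measure (Set (Sp d × M))) (a b : ι → ℝ≥0∞) (A L : ι → ℝ) : Prop where
  prob : ∀ i, IsProbabilityMeasure (Q i)
  prob₁ : ∀ i, IsProbabilityMeasure (Q₁ i)
  prob₂ : ∀ i, IsProbabilityMeasure (Q₂ i)
  mecke : ∀ᶠ i in F, HasMecke μ (Q i) (Q₁ i) (Q₂ i) (a i) (b i)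
  tendsto_A : Tendsto A F atTop
  tendsto_L : Tendsto L F atTop
  tendsto_a : Tendsto (fun i => a i / ENNReal.ofReal (A i)) F (𝓝 1)
  tendsto_b : Tendsto (fun i => b i / ENNReal.ofReal (A i) ^ 2) F (𝓝 1)
  one : ∀ (g : ℝ → (Sp d × M) × Set (Sp d × M) → ℝ≥0∞) (K : ℝ≥0) (j : ℝ≥0∞), (∀ l p, g l p ≤ K) →
    (∀ l, 1 ≤ l → Measurable (g l)) →
    Tendsto (fun p : ℕ × ℝ => ∫⁻ w, g p.2 w ∂(μ.prod (binLaw μ p.1))) ratioFilter (𝓝 j) →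
    Tendsto (fun i => ∫⁻ w, g (L i) w ∂(μ.prod (Q₁ i))) F (𝓝 j)
  two : ∀ (g : ℝ → ((Sp d × M) × (Sp d × M)) × Set (Sp d × M) → ℝ≥0∞) (K : ℝ≥0) (j : ℝ≥0∞),
    (∀ l p, g l p ≤ K) → (∀ l, 1 ≤ l → Measurable (g l)) →
    Tendsto (fun p : ℕ × ℝ => ∫⁻ w, g p.2 w ∂((μ.prod μ).prod (binLaw μ p.1))) ratioFilter (𝓝 j) →
    Tendsto (fun i => ∫⁻ w, g (L i) w ∂((μ.prod μ).prod (Q₂ i))) F (𝓝 j)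

variable {μ : Measure (Sp d × M)} [IsProbabilityMeasure μ]

instance neBot_ratioFilter : ratioFilter.NeBot := by
  refine comap_neBot_iff_frequently.2 ?_
  have h : Tendsto (fun n : ℕ => ((n : ℝ), (n : ℝ) / (n : ℝ))) atTop (atTop ×ˢ 𝓝 1) := by
    refine tendsto_natCast_atTop_atTop.prodMk (tendsto_const_nhds.congr' ?_)
    filter_upwards [eventually_gt_atTop 0] with n hn
    rw [div_self]
    exact_mod_cast hn.ne'
  refine h.frequently (Eventually.of_forall fun n => ⟨(n, (n : ℝ)), rfl⟩).frequently

lemma tendsto_ratioFilter {ι : Type*} {F : Filter ι} {N : ι → ℕ} {L : ι → ℝ}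
    (hL : Tendsto L F atTop) (hN : Tendsto (fun i => (N i : ℝ) / L i) F (𝓝 1)) :
    Tendsto (fun i => (N i, L i)) F ratioFilter :=
  tendsto_comap_iff.2 (hL.prodMk hN)

lemma tendsto_div_of_div {l : ℕ → ℝ} (hl : Tendsto (fun n : ℕ => l n / n) atTop (𝓝 1)) :
    Tendsto l atTop atTop ∧ Tendsto (fun n : ℕ => (n : ℝ) / l n) atTop (𝓝 1) := by
  constructor
  · have h := (tendsto_natCast_atTop_atTop (R := ℝ)).atTop_mul_pos one_pos hl
    refine h.congr' ?_
    filter_upwards [eventually_gt_atTop 0] with n hn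
    have : (n : ℝ) ≠ 0 := by exact_mod_cast hn.ne'
    field_simp
  · have h := hl.inv₀ one_ne_zero
    simpa using h

/-- The reduced sample sizes `n - 1` and `n - 2` still have ratio to `l n` tending to one, so limits
along `ratioFilter` specialize. -/
lemma llnModel_binLaw (hμ : NoPosAtoms μ) {l : ℕ → ℝ}
    (hl : Tendsto (fun n : ℕ => l n / n) atTop (𝓝 1)) :
    LLNModel atTop μ (fun n => binLaw μ n) (fun n => binLaw μ (n - 1)) (fun n => binLaw μ (n - 2))
      (fun n => (n : ℝ≥0∞)) (fun n => ((n * (n - 1) : ℕ) : ℝ≥0∞)) (fun n => (n : ℝ)) l := by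
  obtain ⟨hL, hN⟩ := tendsto_div_of_div hl
  have hcast : Tendsto (fun n : ℕ => (n : ℝ)) atTop atTop := tendsto_natCast_atTop_atTop
  refine ⟨fun n => inferInstance, fun n => inferInstance, fun n => inferInstance,
    Eventually.of_forall fun n => hasMecke_binLaw hμ n, hcast, hL, ?_, ?_, ?_, ?_⟩
  · refine tendsto_const_nhds.congr' ?_
    filter_upwards [eventually_gt_atTop 0] with n hn
    rw [ENNReal.ofReal_natCast, ENNReal.div_self (by simpa using hn.ne') (ENNReal.natCast_ne_top n)]
  · have h1 := tendsto_natSub_div (N := fun n : ℕ => n) hcast (tendsto_const_nhds.congr' (by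
      filter_upwards [eventually_gt_atTop 0] with n hn
      exact (div_self (by exact_mod_cast hn.ne' : (n : ℝ) ≠ 0)).symm)) 1
    have h2 := ENNReal.tendsto_ofReal h1
    rw [ENNReal.ofReal_one] at h2
    refine h2.congr' ?_
    filter_upwards [eventually_gt_atTop 0] with n hn
    have hn' : (n : ℝ≥0∞) ≠ 0 := by simpa using hn.ne'
    have hnr : (0 : ℝ) < n := by exact_mod_cast hn
    rw [ENNReal.ofReal_div_of_pos hnr, ENNReal.ofReal_natCast, ENNReal.ofReal_natCast, Nat.cast_mul,
      pow_two, ENNReal.mul_div_mul_left _ _ hn' (ENNReal.natCast_ne_top n)]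
  · intro g K j _ _ h
    exact h.comp (tendsto_ratioFilter hL (tendsto_natSub_div hL hN 1))
  · intro g K j _ _ h
    exact h.comp (tendsto_ratioFilter hL (tendsto_natSub_div hL hN 2))

/-- The number of points concentrates around `l`, so limits along `ratioFilter` persist under the
Poisson mixture; boundedness of `g` takes care of atypical numbers of points. -/
lemma llnModel_poisLaw (hμ : NoPosAtoms μ) :
    LLNModel atTop μ (fun l : ℝ => poisLaw (ENNReal.ofReal l • μ))
      (fun l : ℝ => poisLaw (ENNReal.ofReal l • μ)) (fun l : ℝ => poisLaw (ENNReal.ofReal l • μ))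
      (fun l => ENNReal.ofReal l) (fun l => ENNReal.ofReal l * ENNReal.ofReal l)
      (fun l => l) fun l => l := by
  have hp : ∀ l : ℝ, IsProbabilityMeasure (poisLaw (ENNReal.ofReal l • μ)) := fun l => by
    have := Measure.smul_finite μ (ENNReal.ofReal_ne_top (r := l))
    infer_instance
  refine ⟨hp, hp, hp, Eventually.of_forall fun l => hasMecke_poisLaw hμ ENNReal.ofReal_ne_top,
    tendsto_id, tendsto_id, ?_, ?_, ?_, ?_⟩
  · refine tendsto_const_nhds.congr' ?_
    filter_upwards [eventually_gt_atTop 0] with l hl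
    rw [ENNReal.div_self (by simpa using hl) ENNReal.ofReal_ne_top]
  · refine tendsto_const_nhds.congr' ?_
    filter_upwards [eventually_gt_atTop 0] with l hl
    rw [← pow_two, ENNReal.div_self (by simpa using hl) (by simp)]
  · intro g K j hK hg h
    have hb : ∀ p : ℕ × ℝ, ∫⁻ w, g p.2 w ∂(μ.prod (binLaw μ p.1)) ≤ K := fun p =>
      (lintegral_mono fun w => hK p.2 w).trans (by simp)
    have hj : j ≠ ∞ := ((le_of_tendsto' h hb).trans_lt ENNReal.coe_lt_top).ne
    refine (tendsto_tsum_pw hb hj h).congr' ?_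
    filter_upwards [eventually_ge_atTop 1] with l hl
    rw [lintegral_prod_poisLaw_smul μ ENNReal.ofReal_ne_top (hg l hl)]
  · intro g K j hK hg h
    have hb : ∀ p : ℕ × ℝ, ∫⁻ w, g p.2 w ∂((μ.prod μ).prod (binLaw μ p.1)) ≤ K := fun p =>
      (lintegral_mono fun w => hK p.2 w).trans (by simp)
    have hj : j ≠ ∞ := ((le_of_tendsto' h hb).trans_lt ENNReal.coe_lt_top).ne
    refine (tendsto_tsum_pw hb hj h).congr' ?_
    filter_upwards [eventually_ge_atTop 1] with l hl
    rw [lintegral_prod_poisLaw_smul (μ.prod μ) ENNReal.ofReal_ne_top (hg l hl)]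

/-- Adding an independent point to a binomial process of `n` points. -/
lemma lintegral_prod_binLaw_succ (hμ : NoPosAtoms μ) (n : ℕ)
    {V : (Sp d × M) × Set (Sp d × M) → ℝ≥0∞} (hV : Measurable V) :
    ∫⁻ w, V w ∂(μ.prod (binLaw μ (n + 1)))
      = ∫⁻ q, V (q.1.1, ins q.1.2 q.2) ∂((μ.prod μ).prod (binLaw μ n)) := by
  have hassoc := (measurePreserving_prodAssoc μ μ (binLaw μ n)).symm
  have hq : Measurable fun q : ((Sp d × M) × (Sp d × M)) × Set (Sp d × M) =>
      V (q.1.1, ins q.1.2 q.2) := by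
    simpa using measurable_pair_functional (V := fun z X => V (z, X)) hV
      (V' := fun _ _ => 1) measurable_const
  rw [binLaw_succ hμ, lintegral_prod _ hV.aemeasurable]
  have e1 := hassoc.lintegral_comp hq
  have hq' : Measurable fun q : (Sp d × M) × (Sp d × M) × Set (Sp d × M) =>
      V (q.1, ins q.2.1 q.2.2) := hq.comp hassoc.measurable
  refine Eq.trans ?_ e1
  refine Eq.trans ?_ (lintegral_prod _ hq'.aemeasurable).symm
  refine lintegral_congr fun z => ?_
  have hz : Measurable fun X : Set (Sp d × M) => V (z, X) := hV.comp measurable_prodMk_left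
  exact lintegral_map hz measurable_ins

end Model

/-! ### The law of large numbers for functionals of the score. -/

section Functional

variable {d : ℕ} {M Ω : Type*} [MeasurableSpace M] [MeasurableSpace Ω] {μM : Measure M}
  [IsProbabilityMeasure μM] {P : Measure Ω} [IsProbabilityMeasure P]
  {ξ : Score d M} {G : Set (Sp d)} {κ : Sp d → ℝ≥0} {HH : ℝ≥0 → Ω → Set (Sp d × M)}
  {Γ : ℝ → Set (Sp d)}

/-- The value of a functional of the score at the point `z` of the configuration `X ∪ {z}`, at
scale `l`. -/
def scaled (ξ : Score d M) (G : Set (Sp d)) (Ψ : ℝ → Sp d × M → Measure (Sp d) → ℝ≥0∞) (l : ℝ)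
    (z : Sp d × M) (X : Set (Sp d × M)) : ℝ≥0∞ :=
  Ψ l z (localScore ξ G z (zoomFin z.1 (l ^ (1 / (d : ℝ))) X))

/-- The total mass of a measure, times the indicator of `Γ l`. -/
def massAt (Γ : ℝ → Set (Sp d)) (l : ℝ) (z : Sp d × M) (ν : Measure (Sp d)) : ℝ≥0∞ :=
  (Γ l).indicator (fun _ => ν Set.univ) z.1

/-- A functional of the score that is dominated by the total mass and asymptotically
proportional to it, with factor `c₀`. -/
structure IsReadout (ξ : Score d M) (G : Set (Sp d)) (κ : Sp d → ℝ≥0) (μM : Measure M)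
    (Γ : ℝ → Set (Sp d)) (C : ℝ≥0) (c₀ : Sp d → ℝ≥0∞)
    (Ψ : ℝ → Sp d × M → Measure (Sp d) → ℝ≥0∞) : Prop where
  measurable : ∀ l, 1 ≤ l → Measurable fun p : (Sp d × M) × Set (Sp d × M) =>
    Ψ l p.1 (localScore ξ G p.1 p.2)
  bound : ∀ l z X, Ψ l z (localScore ξ G z X) ≤ C * massAt Γ l z (localScore ξ G z X)
  measurable_factor : Measurable c₀
  tendsto : ∀ᵐ z ∂(pointLaw κ μM), ∀ X : Set (Sp d × M), X.Finite →
    Tendsto (fun l => Ψ l z (localScore ξ G z X)) atTop (𝓝 (c₀ z.1 * localScore ξ G z X Set.univ))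

lemma scaled_le {C : ℝ≥0} {c₀ : Sp d → ℝ≥0∞} {Ψ : ℝ → Sp d × M → Measure (Sp d) → ℝ≥0∞}
    (hΨ : IsReadout ξ G κ μM Γ C c₀ Ψ) (l : ℝ) (z : Sp d × M) (X : Set (Sp d × M)) :
    scaled ξ G Ψ l z X ≤ C * scaled ξ G (massAt Γ) l z X := hΨ.bound _ _ _

lemma scaled_ne_top (hξ : IsScore ξ) {C : ℝ≥0} {c₀ : Sp d → ℝ≥0∞}
    {Ψ : ℝ → Sp d × M → Measure (Sp d) → ℝ≥0∞} (hΨ : IsReadout ξ G κ μM Γ C c₀ Ψ) (l : ℝ)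
    (z : Sp d × M) (X : Set (Sp d × M)) : scaled ξ G Ψ l z X ≠ ∞ := by
  refine ne_top_of_le_ne_top ?_ (scaled_le hΨ l z X)
  have := isFiniteMeasure_localScore (G := G) hξ z (zoomFin z.1 (l ^ (1 / (d : ℝ))) X)
  refine ENNReal.mul_ne_top ENNReal.coe_ne_top ?_
  rw [scaled, massAt]
  exact ne_top_of_le_ne_top (measure_ne_top _ _) (Set.indicator_le_self _ _ _)

lemma measurable_scaled {C : ℝ≥0} {c₀ : Sp d → ℝ≥0∞}
    {Ψ : ℝ → Sp d × M → Measure (Sp d) → ℝ≥0∞} (hΨ : IsReadout ξ G κ μM Γ C c₀ Ψ) {l : ℝ}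
    (hl : 1 ≤ l) : Measurable fun p : (Sp d × M) × Set (Sp d × M) => scaled ξ G Ψ l p.1 p.2 := by
  have hs : 0 < l ^ (1 / (d : ℝ)) := Real.rpow_pos_of_pos (one_pos.trans_le hl) _
  exact (hΨ.measurable l hl).comp (measurable_fst.prodMk (measurable_zoomFin (d := d) (M := M) hs))

lemma lintegral_indicator_section_add_compl {α β : Type*} [MeasurableSpace α] [MeasurableSpace β]
    {S : Set (α × β)} (hS : MeasurableSet S) (ρ : Measure β) [IsProbabilityMeasure ρ] (z : α) :
    (∫⁻ X, S.indicator (fun _ => (1 : ℝ≥0∞)) (z, X) ∂ρ) +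
      ∫⁻ X, Sᶜ.indicator (fun _ => (1 : ℝ≥0∞)) (z, X) ∂ρ = 1 := by
  have h4 : Measurable fun X : β => S.indicator (fun _ => (1 : ℝ≥0∞)) (z, X) :=
    measurable_indicator_prodMk hS measurable_const measurable_id
  rw [← lintegral_add_left h4]
  have h3 : ∀ X, S.indicator (fun _ => (1 : ℝ≥0∞)) (z, X) +
      Sᶜ.indicator (fun _ => (1 : ℝ≥0∞)) (z, X) = 1 := by
    intro X
    by_cases h : (z, X) ∈ S <;> simp [h]
  simp [h3]

lemma tendsto_locVal_one (hξ : IsScore ξ) (hG : MeasurableSet G) (hκm : Measurable κ)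
    (hκ1 : ∫⁻ x, (κ x : ℝ≥0∞) = 1)
    (herr : Tendsto (fun r : ℕ => stabErr κ μM (localScore ξ G) r) atTop (𝓝 0)) :
    Tendsto (fun r : ℕ => locVal κ μM (localScore ξ G) (fun _ _ => 1) r) atTop (𝓝 1) := by
  have := pointLaw_prob (μM := μM) hκ1
  have e : ∀ r : ℕ, locVal κ μM (localScore ξ G) (fun _ _ => 1) r
      = 1 - stabErr κ μM (localScore ξ G) r := by
    intro r
    have hS := measurableSet_stabSet (μM := μM) (measurable_localScore hξ hG)
      (isFiniteMeasure_localScore hξ) (r : ℝ)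
    have h1 : Measurable fun p : (Sp d × M) × Set (Sp d × M) =>
      (stabSet (localScore ξ G) μM r).indicator (fun _ => (1 : ℝ≥0∞)) (p.1, p.2) :=
      measurable_const.indicator hS
    have hsum : locVal κ μM (localScore ξ G) (fun _ _ => 1) r + stabErr κ μM (localScore ξ G) r
        = 1 := by
      rw [locVal, stabErr, ← lintegral_add_left (measurable_lintegral_homLaw hκm
        (w := fun z X => (stabSet (localScore ξ G) μM r).indicator (fun _ => (1 : ℝ≥0∞)) (z, X)) h1 r)]
      refine (lintegral_congr fun z => lintegral_indicator_section_add_compl hS _ z).trans ?_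
      simp
    refine ENNReal.eq_sub_of_add_eq ?_ hsum
    exact ne_top_of_le_ne_top ENNReal.one_ne_top (hsum ▸ le_add_self)
  simp_rw [e]
  simpa using ENNReal.Tendsto.sub (tendsto_const_nhds (x := (1 : ℝ≥0∞))) herr
    (Or.inl ENNReal.one_ne_top)

variable (hd : 0 < d) (hξ : IsScore ξ) (hG : MeasurableSet G) (hκm : Measurable κ)
    (hκ1 : ∫⁻ x, (κ x : ℝ≥0∞) = 1) {B : ℝ≥0} (hκb : ∀ x, κ x ≤ B) (hκc : ∀ᵐ x, ContinuousAt κ x)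
    (hHH : ∀ a, IsPoissonProcess (HH a) ((a : ℝ≥0∞) • (volume : Measure (Sp d)).prod μM) P)
    (hR : ∀ᵐ x ∂((densityMeasure κ).restrict G), ∀ᵐ w ∂(μM.prod P),
      stabRadius ξ (x, w.1) (HH (κ x) w.2) Set.univ < ⊤)

include hd hξ hG hκm hκ1 hκb hκc hHH hR

lemma tendsto_trunc_pair {C : ℝ≥0} {c₀ : Sp d → ℝ≥0∞}
    {Ψ : ℝ → Sp d × M → Measure (Sp d) → ℝ≥0∞} (hΨ : IsReadout ξ G κ μM Γ C c₀ Ψ) (K : ℕ) :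
    Tendsto (fun p : ℕ × ℝ => ∫⁻ q, min (scaled ξ G Ψ p.2 q.1.1 (ins q.1.2 q.2)) K *
      min (scaled ξ G Ψ p.2 q.1.2 (ins q.1.1 q.2)) K
      ∂(((pointLaw κ μM).prod (pointLaw κ μM)).prod (binLaw (pointLaw κ μM) p.1))) ratioFilter
      (𝓝 ((∫⁻ x in G, truncMean ξ κ μM P HH c₀ K x ∂(densityMeasure κ)) *
        ∫⁻ x in G, truncMean ξ κ μM P HH c₀ K x ∂(densityMeasure κ))) := by
  have hum : ∀ᶠ p : ℕ × ℝ in ratioFilter, Measurable fun w : (Sp d × M) × Set (Sp d × M) =>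
      min (Ψ p.2 w.1 (localScore ξ G w.1 w.2)) (K : ℝ≥0∞) := by
    filter_upwards [tendsto_snd_ratioFilter.eventually_ge_atTop 1] with p hp
    exact (hΨ.measurable _ hp).min measurable_const
  have hu : Measurable fun w : (Sp d × M) × Set (Sp d × M) =>
      min (c₀ w.1.1 * localScore ξ G w.1 w.2 Set.univ) (K : ℝ≥0∞) := by
    refine Measurable.min (Measurable.mul (hΨ.measurable_factor.comp
      (measurable_fst.comp measurable_fst)) ?_) measurable_const
    exact (Measure.measurable_coe MeasurableSet.univ).comp (measurable_localScore hξ hG)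
  have hl : ∀ᵐ z ∂(pointLaw κ μM), ∀ X : Set (Sp d × M), X.Finite →
      Tendsto (fun p : ℕ × ℝ => min (Ψ p.2 z (localScore ξ G z X)) (K : ℝ≥0∞)) ratioFilter
        (𝓝 (min (c₀ z.1 * localScore ξ G z X Set.univ) K)) := by
    filter_upwards [hΨ.tendsto] with z hz X hX
    exact ((hz X hX).comp tendsto_snd_ratioFilter).min tendsto_const_nhds
  have hloc := tendsto_locVal hd hξ hG hκm hκ1 hHH hR hΨ.measurable_factor K
  have hKK : ∫⁻ x in G, truncMean ξ κ μM P HH c₀ K x ∂(densityMeasure κ) ≠ ∞ := by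
    have := densityMeasure_prob hκ1
    refine ne_top_of_le_ne_top (ENNReal.natCast_ne_top K) ?_
    calc _ ≤ ∫⁻ _ in G, (K : ℝ≥0∞) ∂(densityMeasure κ) := by
          refine lintegral_mono fun x => ?_
          calc _ ≤ ∫⁻ _ : M × Ω, (K : ℝ≥0∞) ∂(μM.prod P) := lintegral_mono fun w => min_le_right _ _
            _ = K := by simp
      _ ≤ K := by
          rw [setLIntegral_const]
          exact mul_le_of_le_one_right' prob_le_one
  exact tendsto_lintegral_pair_functional hd hκ1 hκm hκb hκc (measurable_localScore hξ hG)
    (isFiniteMeasure_localScore hξ) tendsto_snd_ratioFilter tendsto_div_ratioFilter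
    (U := fun p z X => min (Ψ p.2 z (localScore ξ G z X)) K)
    (U' := fun p z X => min (Ψ p.2 z (localScore ξ G z X)) K)
    (u := fun z X => min (c₀ z.1 * localScore ξ G z X Set.univ) K)
    (u' := fun z X => min (c₀ z.1 * localScore ξ G z X Set.univ) K) (K := (K : ℝ≥0))
    hum hum hu hu (fun p z X => by simp) (fun p z X => by simp)
    (fun p z X X' h => by rw [h]) (fun p z X X' h => by rw [h]) hl hl
    (tendsto_stabErr hd hξ hG hκm hκ1 hHH hR)
    (ENNReal.Tendsto.mul hloc (Or.inr hKK) hloc (Or.inr hKK))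

/-- The pair limit with the constant functional `1` at the second point. The first functional sees
the second point inserted, so one starts from `n - 1` points in order to reach `n`. -/
lemma tendsto_trunc_one {C : ℝ≥0} {c₀ : Sp d → ℝ≥0∞}
    {Ψ : ℝ → Sp d × M → Measure (Sp d) → ℝ≥0∞} (hΨ : IsReadout ξ G κ μM Γ C c₀ Ψ) (K : ℕ) :
    Tendsto (fun p : ℕ × ℝ => ∫⁻ w, min (scaled ξ G Ψ p.2 w.1 w.2) K
      ∂((pointLaw κ μM).prod (binLaw (pointLaw κ μM) p.1))) ratioFilter
      (𝓝 (∫⁻ x in G, truncMean ξ κ μM P HH c₀ K x ∂(densityMeasure κ))) := by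
  have := pointLaw_prob (μM := μM) hκ1
  have hum : ∀ᶠ p : ℕ × ℝ in ratioFilter, Measurable fun w : (Sp d × M) × Set (Sp d × M) =>
      min (Ψ p.2 w.1 (localScore ξ G w.1 w.2)) (K : ℝ≥0∞) := by
    filter_upwards [tendsto_snd_ratioFilter.eventually_ge_atTop 1] with p hp
    exact (hΨ.measurable _ hp).min measurable_const
  have hu : Measurable fun w : (Sp d × M) × Set (Sp d × M) =>
      min (c₀ w.1.1 * localScore ξ G w.1 w.2 Set.univ) (K : ℝ≥0∞) := by
    refine Measurable.min (Measurable.mul (hΨ.measurable_factor.comp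
      (measurable_fst.comp measurable_fst)) ?_) measurable_const
    exact (Measure.measurable_coe MeasurableSet.univ).comp (measurable_localScore hξ hG)
  have hl : ∀ᵐ z ∂(pointLaw κ μM), ∀ X : Set (Sp d × M), X.Finite →
      Tendsto (fun p : ℕ × ℝ => min (Ψ p.2 z (localScore ξ G z X)) (K : ℝ≥0∞)) ratioFilter
        (𝓝 (min (c₀ z.1 * localScore ξ G z X Set.univ) K)) := by
    filter_upwards [hΨ.tendsto] with z hz X hX
    exact ((hz X hX).comp tendsto_snd_ratioFilter).min tendsto_const_nhds
  have hloc := tendsto_locVal hd hξ hG hκm hκ1 hHH hR hΨ.measurable_factor K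
  have herr := tendsto_stabErr hd hξ hG hκm hκ1 hHH hR
  have hKK : (∫⁻ x in G, truncMean ξ κ μM P HH c₀ K x ∂(densityMeasure κ)) ≠ ∞ := by
    have := densityMeasure_prob hκ1
    refine ne_top_of_le_ne_top (ENNReal.natCast_ne_top K) ?_
    calc _ ≤ ∫⁻ _ in G, (K : ℝ≥0∞) ∂(densityMeasure κ) := by
          refine lintegral_mono fun x => ?_
          calc _ ≤ ∫⁻ _ : M × Ω, (K : ℝ≥0∞) ∂(μM.prod P) := lintegral_mono fun w => min_le_right _ _
            _ = K := by simp
      _ ≤ K := by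
          rw [setLIntegral_const]
          exact mul_le_of_le_one_right' prob_le_one
  have hj := ENNReal.Tendsto.mul hloc (Or.inr ENNReal.one_ne_top)
    (tendsto_locVal_one hξ hG hκm hκ1 herr) (Or.inr hKK)
  rw [mul_one] at hj
  have h := tendsto_lintegral_pair_functional hd hκ1 hκm hκb hκc (measurable_localScore hξ hG)
    (isFiniteMeasure_localScore hξ) tendsto_snd_ratioFilter
    (tendsto_natSub_div tendsto_snd_ratioFilter tendsto_div_ratioFilter 1)
    (U := fun p z X => min (Ψ p.2 z (localScore ξ G z X)) K) (U' := fun p z X => 1)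
    (u := fun z X => min (c₀ z.1 * localScore ξ G z X Set.univ) K)
    (u' := fun z X => 1) (K := (K : ℝ≥0) + 1)
    hum (Eventually.of_forall fun _ => measurable_const) hu measurable_const
    (fun p z X => (min_le_right _ _).trans (by push_cast; exact le_self_add))
    (fun p z X => by push_cast; exact le_add_self)
    (fun p z X X' h => by rw [h]) (fun p z X X' h => rfl) hl
    (Eventually.of_forall fun z X _ => tendsto_const_nhds) herr hj
  refine h.congr' ?_
  -- Positivity of the number of points is needed for `n - 1 + 1 = n`.
  have hpos : ∀ᶠ p : ℕ × ℝ in ratioFilter, 0 < p.1 := by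
    filter_upwards [tendsto_div_ratioFilter.eventually_const_lt (u := 0) one_pos,
      tendsto_snd_ratioFilter.eventually_gt_atTop 0] with p h1 h2
    have : (0 : ℝ) < p.1 := by
      by_contra hc
      exact absurd h1 (not_lt.2 (div_nonpos_of_nonpos_of_nonneg (not_lt.1 hc) h2.le))
    exact_mod_cast this
  filter_upwards [hpos, tendsto_snd_ratioFilter.eventually_ge_atTop 1] with p hp hp1
  obtain ⟨n, hn⟩ : ∃ n, p.1 = n + 1 := ⟨p.1 - 1, by omega⟩
  have hm : Measurable fun w : (Sp d × M) × Set (Sp d × M) =>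
      min (scaled ξ G Ψ p.2 w.1 w.2) (K : ℝ≥0∞) := (measurable_scaled hΨ hp1).min measurable_const
  simp only [mul_one, hn, Nat.add_sub_cancel]
  exact (lintegral_prod_binLaw_succ (noPosAtoms_pointLaw hd hκm) n hm).symm

/-- The law of large numbers for sums of functionals of the score. -/
theorem tendsto_eLpNorm_scaled {ι : Type*} {F : Filter ι} [F.NeBot]
    {Q Q₁ Q₂ : ι → Measure (Set (Sp d × M))} {a b : ι → ℝ≥0∞} {A L : ι → ℝ}
    (hmod : LLNModel F (pointLaw κ μM) Q Q₁ Q₂ a b A L) {q : ℕ} (hq : q = 1 ∨ q = 2) {p : ℝ}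
    (hp : (q : ℝ) < p) {H : ℝ≥0}
    (hM1 : ∀ᶠ i in F, ∫⁻ w, scaled ξ G (massAt Γ) (L i) w.1 w.2 ^ p
      ∂((pointLaw κ μM).prod (Q₁ i)) ≤ H)
    (hM2 : ∀ᶠ i in F, ∫⁻ w, scaled ξ G (massAt Γ) (L i) w.1.1 (ins w.1.2 w.2) ^ p
      ∂(((pointLaw κ μM).prod (pointLaw κ μM)).prod (Q₂ i)) ≤ H)
    {C : ℝ≥0} {c₀ : Sp d → ℝ≥0∞}
    {Ψ : ℝ → Sp d × M → Measure (Sp d) → ℝ≥0∞} (hΨ : IsReadout ξ G κ μM Γ C c₀ Ψ) :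
    (∫⁻ x in G, c₀ x * meanScoreInf ξ μM P (HH (κ x)) x ∂(densityMeasure κ)) ≠ ∞ ∧
    (∀ᶠ i in F, MemLp (fun X => (cfgSum (scaled ξ G Ψ (L i)) X).toReal / A i) q (Q i)) ∧
    Tendsto (fun i => eLpNorm (fun X => (cfgSum (scaled ξ G Ψ (L i)) X).toReal / A i -
      (∫⁻ x in G, c₀ x * meanScoreInf ξ μM P (HH (κ x)) x ∂(densityMeasure κ)).toReal) q (Q i)) F
      (𝓝 0) := by
  have := pointLaw_prob (μM := μM) hκ1
  have := hmod.prob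
  have := hmod.prob₁
  have := hmod.prob₂
  have hp0 : 0 ≤ p := (Nat.cast_nonneg q).trans hp.le
  have hCp : (C : ℝ≥0∞) ^ p ≠ ∞ := ENNReal.rpow_ne_top_of_nonneg hp0 ENNReal.coe_ne_top
  have hV : ∀ᶠ i in F, Measurable fun p : (Sp d × M) × Set (Sp d × M) =>
      scaled ξ G Ψ (L i) p.1 p.2 := by
    filter_upwards [hmod.tendsto_L.eventually_ge_atTop 1] with i hi
    exact measurable_scaled hΨ hi
  have hmono : ∀ l z X, scaled ξ G Ψ l z X ^ p ≤ (C : ℝ≥0∞) ^ p * scaled ξ G (massAt Γ) l z X ^ p := by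
    intro l z X
    rw [← ENNReal.mul_rpow_of_nonneg _ _ hp0]
    exact ENNReal.rpow_le_rpow (scaled_le hΨ l z X) hp0
  have hH : (((C : ℝ≥0∞) ^ p * H).toNNReal : ℝ≥0∞) = (C : ℝ≥0∞) ^ p * H :=
    ENNReal.coe_toNNReal (ENNReal.mul_ne_top hCp ENNReal.coe_ne_top)
  refine tendsto_eLpNorm_cfgSum hmod.mecke hmod.tendsto_A hmod.tendsto_a hmod.tendsto_b
    (V := fun i => scaled ξ G Ψ (L i)) (fun i z X => scaled_ne_top hξ hΨ _ z X) hV hq hp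
    (H := ((C : ℝ≥0∞) ^ p * H).toNNReal) ?_ ?_
    (tendsto_setLIntegral_truncMean hd hξ hG hκm hHH hR hΨ.measurable_factor) ?_ ?_
  · filter_upwards [hM1] with i hi
    rw [hH]
    refine (lintegral_mono fun w => hmono _ _ _).trans ?_
    rw [lintegral_const_mul' _ _ hCp]
    exact mul_le_mul' le_rfl hi
  · filter_upwards [hM2] with i hi _
    rw [hH]
    refine (lintegral_mono fun w => hmono _ _ _).trans ?_
    rw [lintegral_const_mul' _ _ hCp]
    exact mul_le_mul' le_rfl hi
  · intro K
    refine hmod.one (fun l w => min (scaled ξ G Ψ l w.1 w.2) K) K _ (fun l w => by simp)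
      (fun l hl => (measurable_scaled hΨ hl).min measurable_const) ?_
    exact tendsto_trunc_one hd hξ hG hκm hκ1 hκb hκc hHH hR hΨ K
  · intro K
    refine hmod.two (fun l q => min (scaled ξ G Ψ l q.1.1 (ins q.1.2 q.2)) K *
      min (scaled ξ G Ψ l q.1.2 (ins q.1.1 q.2)) K) (K * K) _ (fun l w => ?_) (fun l hl => ?_) ?_
    · push_cast
      exact mul_le_mul' (min_le_right _ _) (min_le_right _ _)
    · exact measurable_pair_functional (V := fun z X => min (scaled ξ G Ψ l z X) K)
        (V' := fun z X => min (scaled ξ G Ψ l z X) K)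
        ((measurable_scaled hΨ hl).min measurable_const)
        ((measurable_scaled hΨ hl).min measurable_const)
    · exact tendsto_trunc_pair hd hξ hG hκm hκ1 hκb hκc hHH hR hΨ K

end Functional

/-! ### Concentration of contracted measures. -/

section LebesguePoint

variable {d : ℕ}

lemma dilate_eq (x : Sp d) (s : ℝ) (y : Sp d) : dilate x s y = x + zoom x s y := by
  rw [dilate, zoom, neg_add_eq_sub]

lemma continuous_dilate (x : Sp d) (s : ℝ) : Continuous (dilate x s) := by
  unfold dilate; fun_prop

lemma measurable_dilate (x : Sp d) (s : ℝ) : Measurable (dilate x s) :=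
  (continuous_dilate x s).measurable

lemma dilate_self (x : Sp d) (s : ℝ) : dilate x s x = x := by simp [dilate]

lemma map_dilate_volume (x : Sp d) {s : ℝ} (hs : 0 < s) :
    (volume : Measure (Sp d)).map (dilate x s) = ENNReal.ofReal (s ^ d)⁻¹ • volume := by
  have h1 : dilate x s = (fun y => x + y) ∘ zoom x s := funext fun y => dilate_eq x s y
  rw [h1, ← Measure.map_map (by fun_prop) (measurable_zoom x s), map_zoom_volume x hs,
    Measure.map_smul, map_add_left_eq_self]

lemma preimage_dilate_closedBall (x : Sp d) {s : ℝ} (hs : 0 < s) (R : ℝ) :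
    dilate x s ⁻¹' Metric.closedBall x (s * R) = Metric.closedBall x R := by
  ext y
  rw [Set.mem_preimage, mem_closedBall_iff_norm, mem_closedBall_iff_norm, dilate,
    add_sub_cancel_left, norm_smul, Real.norm_of_nonneg hs.le, neg_add_eq_sub]
  exact mul_le_mul_iff_right₀ hs

lemma setLIntegral_comp_dilate (x : Sp d) {s : ℝ} (hs : 0 < s) (R : ℝ) {h : Sp d → ℝ≥0∞}
    (hh : Measurable h) :
    ∫⁻ y in Metric.closedBall x R, h (dilate x s y)
      = ENNReal.ofReal (s ^ d)⁻¹ * ∫⁻ y in Metric.closedBall x (s * R), h y := by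
  rw [← preimage_dilate_closedBall x hs R,
    ← setLIntegral_map Metric.isClosed_closedBall.measurableSet hh (measurable_dilate x s),
    map_dilate_volume x hs, Measure.restrict_smul, lintegral_smul_measure, smul_eq_mul]

/-- The point `x` is a Lebesgue point of `f`. -/
def IsLebesguePoint (f : Sp d → ℝ) (x : Sp d) : Prop :=
  Tendsto (fun δ : ℝ => (∫⁻ y in Metric.closedBall x δ, ‖f y - f x‖ₑ)
    / volume (Metric.closedBall x δ)) (𝓝[>] 0) (𝓝 0)

lemma ae_isLebesguePoint {f : Sp d → ℝ} (hf : LocallyIntegrable f) :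
    ∀ᵐ x, IsLebesguePoint f x := by
  filter_upwards [(IsUnifLocDoublingMeasure.vitaliFamily (volume : Measure (Sp d))
    1).ae_tendsto_lintegral_enorm_sub_div hf] with x hx
  refine hx.comp (IsUnifLocDoublingMeasure.tendsto_closedBall_filterAt volume (fun _ => x)
    (fun δ => δ) tendsto_id ?_)
  filter_upwards [self_mem_nhdsWithin] with δ hδ
  exact Metric.mem_closedBall_self (by simpa using (Set.mem_Ioi.1 hδ).le)

/-- The change of variables turns an integral over a fixed ball into its volume times an average
over a shrinking ball. -/
lemma IsLebesguePoint.tendsto_setLIntegral_dilate {f : Sp d → ℝ} (hf : Measurable f)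
    {x : Sp d} (hx : IsLebesguePoint f x) {R : ℝ} (hR : 0 < R) :
    Tendsto (fun s : ℝ => ∫⁻ y in Metric.closedBall x R, ‖f (dilate x s y) - f x‖ₑ) (𝓝[>] 0)
      (𝓝 0) := by
  have hm : Tendsto (fun s : ℝ => s * R) (𝓝[>] 0) (𝓝[>] 0) := by
    refine tendsto_nhdsWithin_iff.2 ⟨?_, ?_⟩
    · refine Tendsto.mono_left ?_ nhdsWithin_le_nhds
      simpa using (tendsto_id (x := 𝓝 (0 : ℝ))).mul_const R
    · filter_upwards [self_mem_nhdsWithin] with s hs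
      exact mul_pos hs hR
  have h := ENNReal.Tendsto.const_mul (hx.comp hm) (a := volume (Metric.closedBall x R))
    (Or.inr measure_closedBall_lt_top.ne)
  rw [mul_zero] at h
  refine h.congr' ?_
  filter_upwards [self_mem_nhdsWithin] with s hs
  have hs : 0 < s := hs
  have hme : Measurable fun y => ‖f y - f x‖ₑ := (hf.sub_const _).enorm
  have hv := setLIntegral_comp_dilate x hs R (h := fun _ => 1) measurable_const
  rw [setLIntegral_one, setLIntegral_one] at hv
  rw [setLIntegral_comp_dilate x hs R hme, Function.comp_apply, hv, mul_assoc,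
    ENNReal.mul_div_cancel (Metric.measure_closedBall_pos _ _ (mul_pos hs hR)).ne'
      measure_closedBall_lt_top.ne]

/-- Conditions on a measure under which its images under contractions towards `x`, integrated
against `f`, concentrate at `f x`. -/
def Concentrates (f : Sp d → ℝ) (x : Sp d) (ν : Measure (Sp d)) : Prop :=
  Tendsto (fun s : ℝ => ∫⁻ y, ‖f (dilate x s y) - f x‖ₑ ∂ν) (𝓝[>] 0) (𝓝 0)

lemma concentrates_smul_dirac {f : Sp d → ℝ} (x : Sp d) (c : ℝ≥0∞) :
    Concentrates f x (c • Measure.dirac x) := by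
  refine tendsto_const_nhds.congr fun s => ?_
  rw [lintegral_smul_measure, lintegral_dirac, dilate_self]
  simp

lemma concentrates_zero {f : Sp d → ℝ} (x : Sp d) : Concentrates f x 0 := by
  simp [Concentrates]

lemma enorm_sub_le_of_abs_le {f : Sp d → ℝ} {C : ℝ≥0} (hC : ∀ x, |f x| ≤ C) (x y : Sp d) :
    ‖f x - f y‖ₑ ≤ (2 * C : ℝ≥0) := by
  rw [← ofReal_norm, ← ENNReal.ofReal_coe_nnreal]
  refine ENNReal.ofReal_le_ofReal ((norm_sub_le _ _).trans ?_)
  rw [Real.norm_eq_abs, Real.norm_eq_abs]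
  push_cast
  linarith [hC x, hC y]

lemma concentrates_of_continuousAt {f : Sp d → ℝ} (hf : Measurable f) {C : ℝ≥0}
    (hC : ∀ x, |f x| ≤ C) {x : Sp d} (hx : ContinuousAt f x) (ν : Measure (Sp d))
    [IsFiniteMeasure ν] : Concentrates f x ν := by
  have h := tendsto_lintegral_filter_of_dominated_convergence (μ := ν) (l := 𝓝[>] (0 : ℝ))
    (F := fun s y => ‖f (dilate x s y) - f x‖ₑ) (f := fun _ => 0)
    (fun _ => ((2 * C : ℝ≥0) : ℝ≥0∞))
    (Eventually.of_forall fun s => ((hf.comp (measurable_dilate x s)).sub_const _).enorm)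
    (Eventually.of_forall fun s => Eventually.of_forall fun y => enorm_sub_le_of_abs_le hC _ _)
    (by simp [ENNReal.mul_eq_top])
    (Eventually.of_forall fun y => ?_)
  · simpa [Concentrates] using h
  · have h1 : Tendsto (fun s : ℝ => dilate x s y) (𝓝[>] 0) (𝓝 x) := by
      refine Tendsto.mono_left ?_ nhdsWithin_le_nhds
      have : Continuous fun s : ℝ => dilate x s y := by unfold dilate; fun_prop
      simpa [dilate] using this.tendsto 0
    have h2 := ((hx.tendsto.comp h1).sub_const (f x)).enorm
    simpa using h2

/-- A finite measure leaves little mass outside a large ball, where `|f| ≤ C` suffices. Inside, `ν`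
is dominated by a multiple of Lebesgue measure and the Lebesgue point property applies. -/
lemma concentrates_of_isLebesguePoint {f : Sp d → ℝ} (hf : Measurable f) {C : ℝ≥0}
    (hC : ∀ x, |f x| ≤ C) {x : Sp d} (hx : IsLebesguePoint f x) (ν : Measure (Sp d))
    [IsFiniteMeasure ν] {K₀ : ℝ≥0} (hν : ν ≤ K₀ • volume) : Concentrates f x ν := by
  have htail : Tendsto (fun n : ℕ => ν (Metric.closedBall x n)ᶜ) atTop (𝓝 0) := by
    have h := tendsto_measure_iInter_atTop (μ := ν) (s := fun n : ℕ => (Metric.closedBall x (n : ℝ))ᶜ)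
      (fun n => Metric.isClosed_closedBall.measurableSet.compl.nullMeasurableSet)
      (fun m n h => Set.compl_subset_compl.2 (Metric.closedBall_subset_closedBall (by exact_mod_cast h)))
      ⟨0, measure_ne_top _ _⟩
    rwa [← Set.compl_iUnion, Metric.iUnion_closedBall_nat, Set.compl_univ, measure_empty] at h
  have htail2 := ENNReal.Tendsto.const_mul htail (a := ((2 * C : ℝ≥0) : ℝ≥0∞))
    (Or.inr ENNReal.coe_ne_top)
  rw [mul_zero] at htail2
  refine ENNReal.tendsto_nhds_zero.2 fun ε hε => ?_
  have hε2 : 0 < ε / 2 := ENNReal.half_pos hε.ne'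
  obtain ⟨n, hn, hn0⟩ := ((ENNReal.tendsto_nhds_zero.1 htail2 _ hε2).and
    (eventually_gt_atTop 0)).exists
  have hball := ENNReal.Tendsto.const_mul (hx.tendsto_setLIntegral_dilate hf
    (R := n) (by exact_mod_cast hn0)) (a := (K₀ : ℝ≥0∞)) (Or.inr ENNReal.coe_ne_top)
  rw [mul_zero] at hball
  filter_upwards [ENNReal.tendsto_nhds_zero.1 hball _ hε2] with s hs
  rw [← lintegral_add_compl _ (Metric.isClosed_closedBall (x := x) (ε := (n : ℝ))).measurableSet,
    ← ENNReal.add_halves ε]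
  refine add_le_add ?_ ?_
  · refine le_trans ?_ hs
    refine (lintegral_mono' (Measure.restrict_mono le_rfl hν) le_rfl).trans ?_
    rw [Measure.restrict_smul, lintegral_smul_measure]
    exact le_rfl
  · refine (lintegral_mono fun y => enorm_sub_le_of_abs_le hC _ _).trans ?_
    rw [setLIntegral_const]
    exact hn

end LebesguePoint

/-! ### Integrals against measurable families of finite measures. -/

section FiniteKernel

variable {α β : Type*} [MeasurableSpace α] [MeasurableSpace β]

/-- The masses need not be uniformly bounded, so the family is not directly a finite kernel. It is
normalized to mass at most one and the mass is multiplied back; at mass zero both sides vanish. -/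
lemma measurable_lintegral_of_isFiniteMeasure {ν : α → Measure β} (hν : Measurable ν)
    (hfin : ∀ a, IsFiniteMeasure (ν a)) {g : α × β → ℝ≥0∞} (hg : Measurable g) :
    Measurable fun a => ∫⁻ y, g (a, y) ∂(ν a) := by
  have hm : Measurable fun a => ν a Set.univ := (Measure.measurable_coe MeasurableSet.univ).comp hν
  have hν' : Measurable fun a => (ν a Set.univ)⁻¹ • ν a := by
    refine Measure.measurable_of_measurable_coe _ fun s hs => ?_
    simp only [Measure.smul_apply, smul_eq_mul]
    exact hm.inv.mul ((Measure.measurable_coe hs).comp hν)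
  let k : Kernel α β := ⟨fun a => (ν a Set.univ)⁻¹ • ν a, hν'⟩
  have hk : IsFiniteKernel k := ⟨1, ENNReal.one_lt_top, fun a => by
    change ((ν a Set.univ)⁻¹ • ν a) Set.univ ≤ 1
    rw [Measure.smul_apply, smul_eq_mul]
    exact ENNReal.inv_mul_le_one _⟩
  have h := hm.mul (Measurable.lintegral_kernel_prod_right' (κ := k) hg)
  refine Eq.subst (motive := Measurable) (funext fun a => ?_) h
  change ν a Set.univ * ∫⁻ y, g (a, y) ∂((ν a Set.univ)⁻¹ • ν a) = _
  rw [lintegral_smul_measure, smul_eq_mul, ← mul_assoc]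
  by_cases h0 : ν a Set.univ = 0
  · rw [Measure.measure_univ_eq_zero.1 h0]; simp
  · rw [ENNReal.mul_inv_cancel h0 (measure_ne_top _ _), one_mul]

lemma measurable_integral_of_isFiniteMeasure {ν : α → Measure β} (hν : Measurable ν)
    (hfin : ∀ a, IsFiniteMeasure (ν a)) {g : α × β → ℝ} (hg : Measurable g) {C : ℝ}
    (hC : ∀ p, |g p| ≤ C) : Measurable fun a => ∫ y, g (a, y) ∂(ν a) := by
  have h1 := (measurable_lintegral_of_isFiniteMeasure hν hfin hg.ennreal_ofReal).ennreal_toReal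
  have h2 := (measurable_lintegral_of_isFiniteMeasure hν hfin hg.neg.ennreal_ofReal).ennreal_toReal
  refine Eq.subst (motive := Measurable) (funext fun a => ?_) (h1.sub h2)
  have hi : Integrable (fun y => g (a, y)) (ν a) :=
    Integrable.of_bound (hg.comp measurable_prodMk_left).aestronglyMeasurable C
      (Eventually.of_forall fun y => hC _)
  exact (integral_eq_lintegral_pos_part_sub_lintegral_neg_part hi).symm

end FiniteKernel

/-! ### Concentration under each of the three alternatives. -/

section Concentration

variable {d : ℕ} {M : Type*} [MeasurableSpace M] {μM : Measure M} [IsProbabilityMeasure μM]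
  {ξ : Score d M} {G : Set (Sp d)} {κ : Sp d → ℝ≥0}

lemma shiftSet_finite (x : Sp d) {X : Set (Sp d × M)} (hX : X.Finite) : (shiftSet x X).Finite :=
  hX.image _

lemma le_smul_volume_of_rnDeriv_le {ν : Measure (Sp d)} [IsFiniteMeasure ν] (h : ν ≪ volume)
    {K₀ : ℝ≥0} (hK : ∀ᵐ y, ν.rnDeriv volume y ≤ K₀) : ν ≤ K₀ • volume := by
  rw [← Measure.withDensity_rnDeriv_eq ν volume h]
  refine (withDensity_mono hK).trans ?_
  rw [withDensity_const]
  exact le_rfl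

lemma concentrates_localScore_of_scoreAt {f : Sp d → ℝ} {z : Sp d × M}
    (h : ∀ Y : Set (Sp d × M), Y.Finite → Concentrates f z.1 (scoreAt ξ z Y))
    (X : Set (Sp d × M)) : Concentrates f z.1 (localScore ξ G z X) := by
  unfold localScore
  split_ifs with hc
  · exact h _ (shiftSet_finite _ hc.1)
  · exact concentrates_zero _

/-- A point mass at `x` is fixed by dilations about `x`; a bounded density needs only a Lebesgue
point of `f`; continuity of `f` at `x` serves every finite measure. The exceptional positions depend
on `f` alone, not on the configuration. -/
lemma ae_concentrates_localScore (hξ : IsScore ξ) (hκm : Measurable κ)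
    {f : Sp d → ℝ} (hf : Measurable f) {C : ℝ≥0} (hC : ∀ x, |f x| ≤ C)
    (hA : AssumptionA1 ξ ∨ AssumptionA2 ξ ∨ AssumptionA3 f) :
    ∀ᵐ z ∂(pointLaw κ μM), ∀ X, Concentrates f z.1 (localScore ξ G z X) := by
  have hfin : ∀ z (Y : Set (Sp d × M)), Y.Finite → IsFiniteMeasure (scoreAt ξ z Y) := fun z Y hY =>
    ⟨hξ.finite z _ (hY.insert z) (Set.mem_insert z Y)⟩
  rcases hA with h1 | ⟨K₀, h2⟩ | h3
  · refine Eventually.of_forall fun z X => concentrates_localScore_of_scoreAt (fun Y hY => ?_) X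
    rw [scoreAt, h1 z _ (hY.insert z) (Set.mem_insert z Y), star]
    exact concentrates_smul_dirac _ _
  · have hloc : LocallyIntegrable f (volume : Measure (Sp d)) := by
      refine (locallyIntegrable_const (C : ℝ)).mono hf.aestronglyMeasurable ?_
      exact Eventually.of_forall fun x => by simpa using hC x
    filter_upwards [ae_pointLaw_of_ae_volume (μM := μM) hκm (ae_isLebesguePoint hloc)] with z hz X
    refine concentrates_localScore_of_scoreAt (fun Y hY => ?_) X
    obtain ⟨ha, hb⟩ := h2 z _ (hY.insert z) (Set.mem_insert z Y)
    have : IsFiniteMeasure (ξ z (insert z Y)) := hfin z Y hY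
    have : IsFiniteMeasure (scoreAt ξ z Y) := hfin z Y hY
    exact concentrates_of_isLebesguePoint hf hC hz _ (K₀ := K₀) (le_smul_volume_of_rnDeriv_le ha hb)
  · filter_upwards [ae_pointLaw_of_ae_volume (μM := μM) hκm h3] with z hz X
    refine concentrates_localScore_of_scoreAt (fun Y hY => ?_) X
    have := hfin z Y hY
    exact concentrates_of_continuousAt hf hC hz _

end Concentration

/-! ### Functionals reading off masses, integrals and errors. -/

section Readout

variable {d : ℕ} {M : Type*} [MeasurableSpace M] {μM : Measure M} [IsProbabilityMeasure μM]
  {ξ : Score d M} {G : Set (Sp d)} {κ : Sp d → ℝ≥0} {Γ : ℝ → Set (Sp d)}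

/-- The scaling factor `l ^ (-1/d)` tends to zero from above. -/
lemma tendsto_scale (hd : 0 < d) :
    Tendsto (fun l : ℝ => l ^ (-(1 / (d : ℝ)))) atTop (𝓝[>] 0) := by
  refine tendsto_nhdsWithin_iff.2 ⟨tendsto_rpow_neg_atTop (by positivity), ?_⟩
  filter_upwards [eventually_gt_atTop 0] with l hl
  exact Real.rpow_pos_of_pos hl _

/-- The integral of a function `h ≥ 0` over the image of a measure under contraction. -/
def integralAt (h : Sp d → ℝ≥0∞) (Γ : ℝ → Set (Sp d)) (l : ℝ) (z : Sp d × M)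
    (ν : Measure (Sp d)) : ℝ≥0∞ :=
  (Γ l).indicator (fun _ => ∫⁻ y, h (dilate z.1 (l ^ (-(1 / (d : ℝ)))) y) ∂ν) z.1

/-- The absolute difference between the integral of `f` over the image of a measure under
contraction and its limit. -/
def errorAt (f : Sp d → ℝ) (Γ : ℝ → Set (Sp d)) (l : ℝ) (z : Sp d × M)
    (ν : Measure (Sp d)) : ℝ≥0∞ :=
  (Γ l).indicator (fun _ => ENNReal.ofReal
    |∫ y, f (dilate z.1 (l ^ (-(1 / (d : ℝ)))) y) ∂ν - f z.1 * (ν Set.univ).toReal|) z.1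

/-- A point of `G` eventually lies in `Γ l`, and off `G` the score is zero, so the indicator does
not affect the limit. -/
lemma tendsto_indicator_localScore (hΓG : ∀ x ∈ G, ∀ᶠ l in atTop, x ∈ Γ l)
    {g : ℝ → Measure (Sp d) → ℝ≥0∞} (hg0 : ∀ l, g l 0 = 0) (z : Sp d × M) (X : Set (Sp d × M))
    {c : ℝ≥0∞} (hg : Tendsto (fun l => g l (localScore ξ G z X)) atTop
      (𝓝 (c * localScore ξ G z X Set.univ))) :
    Tendsto (fun l => (Γ l).indicator (fun _ => g l (localScore ξ G z X)) z.1) atTop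
      (𝓝 (c * localScore ξ G z X Set.univ)) := by
  by_cases hz : z.1 ∈ G
  · refine hg.congr' ?_
    filter_upwards [hΓG _ hz] with l hl
    rw [Set.indicator_of_mem hl]
  · rw [localScore_of_notMem hz]
    have : ∀ l, (Γ l).indicator (fun _ => g l 0) z.1 = 0 := fun l => by simp [hg0]
    simp [this]

lemma measurable_localScore_integrand {β : Type*} [MeasurableSpace β] {f : Sp d → β}
    (hf : Measurable f) (s : ℝ) :
    Measurable fun q : ((Sp d × M) × Set (Sp d × M)) × Sp d => f (dilate q.1.1.1 s q.2) := by
  refine hf.comp ?_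
  have h : Continuous fun p : Sp d × Sp d => dilate p.1 s p.2 := by unfold dilate; fun_prop
  exact h.measurable.comp ((measurable_fst.comp (measurable_fst.comp measurable_fst)).prodMk
    measurable_snd)

lemma measurable_indicator_fst {α β : Type*} [MeasurableSpace α] [MeasurableSpace β]
    {S : Set (Sp d)} (hS : MeasurableSet S) {g : (Sp d × α) × β → ℝ≥0∞} (hg : Measurable g) :
    Measurable fun p : (Sp d × α) × β => S.indicator (fun _ => g p) p.1.1 := by
  have h : MeasurableSet {p : (Sp d × α) × β | p.1.1 ∈ S} :=
    (measurable_fst.comp measurable_fst) hS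
  exact hg.indicator h

lemma isReadout_integralAt (hd : 0 < d) (hξ : IsScore ξ) (hG : MeasurableSet G)
    (hκm : Measurable κ) (hΓm : ∀ l, 1 ≤ l → MeasurableSet (Γ l))
    (hΓG : ∀ x ∈ G, ∀ᶠ l in atTop, x ∈ Γ l) {f : Sp d → ℝ} (hf : Measurable f) {C : ℝ≥0}
    (hC : ∀ x, |f x| ≤ C) (hA : AssumptionA1 ξ ∨ AssumptionA2 ξ ∨ AssumptionA3 f) :
    IsReadout ξ G κ μM Γ C (fun x => ENNReal.ofReal (f x))
      (integralAt (fun x => ENNReal.ofReal (f x)) Γ) where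
  measurable l hl := by
    refine measurable_indicator_fst (hΓm l hl)
      (g := fun p => ∫⁻ y, ENNReal.ofReal (f (dilate p.1.1 (l ^ (-(1 / (d : ℝ)))) y))
        ∂(localScore ξ G p.1 p.2)) ?_
    exact measurable_lintegral_of_isFiniteMeasure (measurable_localScore hξ hG)
      (fun p => isFiniteMeasure_localScore hξ p.1 p.2)
      (measurable_localScore_integrand hf.ennreal_ofReal _)
  bound l z X := by
    unfold integralAt massAt
    by_cases hz : z.1 ∈ Γ l
    · rw [Set.indicator_of_mem hz, Set.indicator_of_mem hz, ← lintegral_const]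
      refine lintegral_mono fun y => ?_
      rw [← ENNReal.ofReal_coe_nnreal]
      exact ENNReal.ofReal_le_ofReal ((le_abs_self _).trans (hC _))
    · rw [Set.indicator_of_notMem hz]; exact zero_le
  measurable_factor := hf.ennreal_ofReal
  tendsto := by
    filter_upwards [ae_concentrates_localScore (G := G) (μM := μM) hξ hκm hf hC hA] with z hz X _
    have := isFiniteMeasure_localScore (G := G) hξ z X
    refine tendsto_indicator_localScore hΓG (g := fun l ν =>
      ∫⁻ y, ENNReal.ofReal (f (dilate z.1 (l ^ (-(1 / (d : ℝ)))) y)) ∂ν) (fun l => by simp) z X ?_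
    set ν := localScore ξ G z X
    have hk := (hz X).comp (tendsto_scale hd)
    have hc : ENNReal.ofReal (f z.1) * ν Set.univ ≠ ∞ :=
      ENNReal.mul_ne_top ENNReal.ofReal_ne_top (measure_ne_top _ _)
    -- Taking positive parts is a contraction. Used in both directions, this squeezes the integral
    -- around `f(x)` times the mass.
    have hpt : ∀ a b : ℝ, ENNReal.ofReal a ≤ ENNReal.ofReal b + ‖a - b‖ₑ := fun a b => by
      rw [← ofReal_norm]
      refine le_trans (ENNReal.ofReal_le_ofReal ?_) ENNReal.ofReal_add_le
      have := le_abs_self (a - b)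
      rw [Real.norm_eq_abs]; linarith
    refine tendsto_of_tendsto_of_tendsto_of_le_of_le
      (g := fun l : ℝ => ENNReal.ofReal (f z.1) * ν Set.univ -
        ∫⁻ y, ‖f (dilate z.1 (l ^ (-(1 / (d : ℝ)))) y) - f z.1‖ₑ ∂ν)
      (h := fun l : ℝ => ENNReal.ofReal (f z.1) * ν Set.univ +
        ∫⁻ y, ‖f (dilate z.1 (l ^ (-(1 / (d : ℝ)))) y) - f z.1‖ₑ ∂ν) ?_ ?_ ?_ ?_
    · simpa using ENNReal.Tendsto.sub tendsto_const_nhds hk (Or.inl hc)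
    · simpa using tendsto_const_nhds.add hk
    · intro l
      refine tsub_le_iff_right.2 ?_
      have hm : Measurable fun y => ‖f (dilate z.1 (l ^ (-(1 / (d : ℝ)))) y) - f z.1‖ₑ :=
        ((hf.comp (measurable_dilate _ _)).sub_const _).enorm
      rw [← lintegral_add_right _ hm, ← lintegral_const]
      refine lintegral_mono fun y => ?_
      rw [enorm_sub_rev]
      exact hpt _ _
    · intro l
      have hm : Measurable fun y => ‖f (dilate z.1 (l ^ (-(1 / (d : ℝ)))) y) - f z.1‖ₑ :=
        ((hf.comp (measurable_dilate _ _)).sub_const _).enorm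
      change _ ≤ _ + _
      rw [← lintegral_const, ← lintegral_add_right _ hm]
      exact lintegral_mono fun y => hpt _ _

lemma integral_sub_const_mul (ν : Measure (Sp d)) [IsFiniteMeasure ν] {f : Sp d → ℝ}
    (hf : Measurable f) {C : ℝ≥0} (hC : ∀ x, |f x| ≤ C) (x : Sp d) (s : ℝ) :
    ∫ y, f (dilate x s y) ∂ν - f x * (ν Set.univ).toReal = ∫ y, (f (dilate x s y) - f x) ∂ν := by
  have hi : Integrable (fun y => f (dilate x s y)) ν :=
    Integrable.of_bound (hf.comp (measurable_dilate x s)).aestronglyMeasurable C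
      (Eventually.of_forall fun y => hC _)
  rw [integral_sub hi (integrable_const _), integral_const, smul_eq_mul, mul_comm (f x)]
  rfl

/-- The error is at most the integral of the deviation of `f` from `f(x)`, which tends to zero by
concentration; hence the factor `0`. The deviation is at most `2 * C`, which gives the domination by
the mass. -/
lemma isReadout_errorAt (hd : 0 < d) (hξ : IsScore ξ) (hG : MeasurableSet G)
    (hκm : Measurable κ) (hΓm : ∀ l, 1 ≤ l → MeasurableSet (Γ l))
    (hΓG : ∀ x ∈ G, ∀ᶠ l in atTop, x ∈ Γ l) {f : Sp d → ℝ} (hf : Measurable f) {C : ℝ≥0}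
    (hC : ∀ x, |f x| ≤ C) (hA : AssumptionA1 ξ ∨ AssumptionA2 ξ ∨ AssumptionA3 f) :
    IsReadout ξ G κ μM Γ (2 * C) (fun _ => 0) (errorAt f Γ) := by
  have hle : ∀ (l : ℝ) (z : Sp d × M) (X : Set (Sp d × M)), ENNReal.ofReal
      |∫ y, f (dilate z.1 (l ^ (-(1 / (d : ℝ)))) y) ∂(localScore ξ G z X) -
        f z.1 * (localScore ξ G z X Set.univ).toReal|
      ≤ ∫⁻ y, ‖f (dilate z.1 (l ^ (-(1 / (d : ℝ)))) y) - f z.1‖ₑ ∂(localScore ξ G z X) := by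
    intro l z X
    have := isFiniteMeasure_localScore (G := G) hξ z X
    rw [integral_sub_const_mul _ hf hC, ← Real.norm_eq_abs, ofReal_norm]
    exact enorm_integral_le_lintegral_enorm _
  refine ⟨fun l hl => ?_, fun l z X => ?_, measurable_const, ?_⟩
  · refine measurable_indicator_fst (hΓm l hl) (g := fun p => ENNReal.ofReal
      |∫ y, f (dilate p.1.1 (l ^ (-(1 / (d : ℝ)))) y) ∂(localScore ξ G p.1 p.2) -
        f p.1.1 * (localScore ξ G p.1 p.2 Set.univ).toReal|) ?_
    have h1 := measurable_integral_of_isFiniteMeasure (measurable_localScore hξ hG)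
      (fun p => isFiniteMeasure_localScore hξ p.1 p.2)
      (measurable_localScore_integrand hf (l ^ (-(1 / (d : ℝ))))) (C := C) (fun q => hC _)
    have h2 : Measurable fun p : (Sp d × M) × Set (Sp d × M) =>
        (localScore ξ G p.1 p.2 Set.univ).toReal :=
      ((Measure.measurable_coe MeasurableSet.univ).comp (measurable_localScore hξ hG)).ennreal_toReal
    have h3 : Measurable fun p : (Sp d × M) × Set (Sp d × M) => f p.1.1 :=
      hf.comp (measurable_fst.comp measurable_fst)
    exact (h1.sub (h3.mul h2)).abs.ennreal_ofReal
  · unfold errorAt massAt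
    by_cases hz : z.1 ∈ Γ l
    · rw [Set.indicator_of_mem hz, Set.indicator_of_mem hz, ← lintegral_const]
      exact (hle l z X).trans (lintegral_mono fun y => enorm_sub_le_of_abs_le hC _ _)
    · rw [Set.indicator_of_notMem hz]; exact zero_le
  · filter_upwards [ae_concentrates_localScore (G := G) (μM := μM) hξ hκm hf hC hA] with z hz X _
    refine tendsto_indicator_localScore hΓG (g := fun l ν => ENNReal.ofReal
      |∫ y, f (dilate z.1 (l ^ (-(1 / (d : ℝ)))) y) ∂ν - f z.1 * (ν Set.univ).toReal|)
      (fun l => by simp) z X ?_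
    rw [zero_mul]
    exact tendsto_of_tendsto_of_tendsto_of_le_of_le tendsto_const_nhds
      ((hz X).comp (tendsto_scale hd)) (fun l => zero_le) fun l => hle l z X

lemma measurable_massAt (hξ : IsScore ξ) (hG : MeasurableSet G) {l : ℝ}
    (hΓm : MeasurableSet (Γ l)) : Measurable fun p : (Sp d × M) × Set (Sp d × M) =>
      massAt Γ l p.1 (localScore ξ G p.1 p.2) := by
  refine measurable_indicator_fst hΓm (g := fun p => localScore ξ G p.1 p.2 Set.univ) ?_
  exact (Measure.measurable_coe MeasurableSet.univ).comp (measurable_localScore hξ hG)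

lemma isReadout_massAt (hξ : IsScore ξ) (hG : MeasurableSet G)
    (hΓm : ∀ l, 1 ≤ l → MeasurableSet (Γ l)) (hΓG : ∀ x ∈ G, ∀ᶠ l in atTop, x ∈ Γ l) :
    IsReadout ξ G κ μM Γ 1 (fun _ => 1) (massAt Γ) where
  measurable l hl := measurable_massAt hξ hG (hΓm l hl)
  bound l z X := by simp
  measurable_factor := measurable_const
  tendsto := Eventually.of_forall fun z X _ =>
    tendsto_indicator_localScore hΓG (g := fun l ν => ν Set.univ) (fun l => by simp) z X (by simp)

end Readout

/-! ### The rescaled measures in terms of local scores. -/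

section Link

variable {d : ℕ} {M : Type*} [MeasurableSpace M] {ξ : Score d M} {G : Set (Sp d)}
  {Γ : ℝ → Set (Sp d)}

lemma dilateSet_eq (x : Sp d) (s : ℝ) (X : Set (Sp d × M)) :
    dilateSet x s X = shiftSet x (zoomSet x s X) := by
  rw [shiftSet, zoomSet, ← Set.image_comp]
  refine Set.image_congr fun w _ => ?_
  simp only [Function.comp_apply, posMap, dilate_eq]

lemma dilateSet_insert (z : Sp d × M) (s : ℝ) (X : Set (Sp d × M)) :
    dilateSet z.1 s (insert z X) = insert z (dilateSet z.1 s X) := by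
  rw [dilateSet, dilateSet, Set.image_insert_eq, dilate_self]

lemma rescaled_insert (l : ℝ) (z : Sp d × M) (X : Set (Sp d × M)) :
    rescaled Γ ξ l z (insert z X) = rescaled Γ ξ l z X := by
  rw [rescaled, rescaled, scoreAt, dilateSet_insert, Set.insert_idem]
  rfl

lemma scoreAt_dilateSet {l : ℝ} (hl : 0 < l) {z : Sp d × M} {X : Set (Sp d × M)}
    (hX : (z, X) ∈ FreshPairs d M) (hz : z.1 ∈ G) :
    scoreAt ξ z (dilateSet z.1 (l ^ (1 / (d : ℝ))) X)
      = localScore ξ G z (zoomFin z.1 (l ^ (1 / (d : ℝ))) X) := by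
  have hs : l ^ (1 / (d : ℝ)) ≠ 0 := (Real.rpow_pos_of_pos hl _).ne'
  have hf : X.Finite := hX.1
  have hfz : (zoomSet z.1 (l ^ (1 / (d : ℝ))) X).Finite := hf.image _
  rw [zoomFin_of_finite hf, localScore_of_mem hfz _ hz, dilateSet_eq]
  rw [Set.eq_empty_iff_forall_notMem]
  rintro _ ⟨⟨w, hw, rfl⟩, h0, -⟩
  have h1 : zoom z.1 (l ^ (1 / (d : ℝ))) w.1 = 0 := h0
  have h2 : w.1 = z.1 := by
    rw [zoom, smul_eq_zero, sub_eq_zero] at h1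
    exact h1.resolve_left hs
  have h3 : w ∈ X ∩ ({z.1} ×ˢ Set.univ) := ⟨hw, h2, trivial⟩
  rw [hX.2] at h3
  exact h3

lemma rescaled_of_mem {l : ℝ} (hl : 0 < l) (hG : Γ l ⊆ G) {z : Sp d × M} {X : Set (Sp d × M)}
    (hX : (z, X) ∈ FreshPairs d M) (hz : z.1 ∈ Γ l) :
    rescaled Γ ξ l z X = (localScore ξ G z (zoomFin z.1 (l ^ (1 / (d : ℝ))) X)).map
      (dilate z.1 (l ^ (-(1 / (d : ℝ))))) := by
  rw [rescaled, if_pos hz, scoreAt_dilateSet hl hX (hG hz)]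

lemma rescaled_of_notMem {l : ℝ} {z : Sp d × M} {X : Set (Sp d × M)} (hz : z.1 ∉ Γ l) :
    rescaled Γ ξ l z X = 0 := by
  rw [rescaled, if_neg hz]

lemma rescaled_univ {l : ℝ} (hl : 0 < l) (hG : Γ l ⊆ G) {z : Sp d × M} {X : Set (Sp d × M)}
    (hX : (z, X) ∈ FreshPairs d M) :
    rescaled Γ ξ l z X Set.univ = scaled ξ G (massAt Γ) l z X := by
  rw [scaled, massAt]
  by_cases hz : z.1 ∈ Γ l
  · rw [Set.indicator_of_mem hz, rescaled_of_mem hl hG hX hz,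
      Measure.map_apply (measurable_dilate _ _) MeasurableSet.univ, Set.preimage_univ]
  · rw [Set.indicator_of_notMem hz, rescaled_of_notMem hz, Measure.coe_zero, Pi.zero_apply]

lemma lintegral_rescaled {l : ℝ} (hl : 0 < l) (hG : Γ l ⊆ G) {z : Sp d × M}
    {X : Set (Sp d × M)} (hX : (z, X) ∈ FreshPairs d M) {h : Sp d → ℝ≥0∞} (hh : Measurable h) :
    ∫⁻ y, h y ∂(rescaled Γ ξ l z X) = scaled ξ G (integralAt h Γ) l z X := by
  rw [scaled, integralAt]
  by_cases hz : z.1 ∈ Γ l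
  · rw [Set.indicator_of_mem hz, rescaled_of_mem hl hG hX hz,
      lintegral_map hh (measurable_dilate _ _)]
  · rw [Set.indicator_of_notMem hz, rescaled_of_notMem hz, lintegral_zero_measure]

lemma rescaled_star_of_mem {l : ℝ} (hl : 0 < l) (hG : Γ l ⊆ G) {z : Sp d × M}
    {X : Set (Sp d × M)} (hX : (z, X) ∈ FreshPairs d M) (hz : z.1 ∈ Γ l) :
    rescaled Γ (star ξ) l z X
      = localScore ξ G z (zoomFin z.1 (l ^ (1 / (d : ℝ))) X) Set.univ • Measure.dirac z.1 := by
  rw [rescaled, if_pos hz, scoreAt, star, Measure.map_smul,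
    Measure.map_dirac' (measurable_dilate _ _), dilate_self, ← scoreAt_dilateSet hl hX (hG hz)]
  rfl

lemma abs_integral_rescaled_sub {l : ℝ} (hl : 0 < l) (hG : Γ l ⊆ G) {z : Sp d × M}
    {X : Set (Sp d × M)} (hX : (z, X) ∈ FreshPairs d M) {f : Sp d → ℝ} (hf : Measurable f) :
    |∫ y, f y ∂(rescaled Γ ξ l z X) - ∫ y, f y ∂(rescaled Γ (star ξ) l z X)|
      = (scaled ξ G (errorAt f Γ) l z X).toReal := by
  rw [scaled, errorAt]
  by_cases hz : z.1 ∈ Γ l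
  · rw [Set.indicator_of_mem hz, rescaled_of_mem hl hG hX hz, rescaled_star_of_mem hl hG hX hz,
      integral_map (measurable_dilate _ _).aemeasurable hf.aestronglyMeasurable,
      integral_smul_measure, integral_dirac, ENNReal.toReal_ofReal (abs_nonneg _), smul_eq_mul,
      mul_comm (f z.1)]
  · rw [Set.indicator_of_notMem hz, rescaled_of_notMem hz, rescaled_of_notMem hz]
    simp

/-- The points of a separated configuration have distinct positions. -/
lemma mem_freshPairs_of_mem_sepSet {X : Set (Sp d × M)} (hX : X ∈ SepSet d M) {w : Sp d × M}
    (hw : w ∈ X) : (w, X \ {w}) ∈ FreshPairs d M := by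
  obtain ⟨hf, k, hk⟩ := hX
  refine ⟨hf.subset Set.sdiff_subset, Set.eq_empty_iff_forall_notMem.2 ?_⟩
  rintro v ⟨⟨hv, hne⟩, hv1, -⟩
  have hv1 : v.1 = w.1 := hv1
  have h := Set.encard_le_one_iff.1 (hk k le_rfl (cell k w.1)) v w
    ⟨hv, by change cell k v.1 = _; rw [hv1]⟩ ⟨hw, rfl⟩
  exact hne h

/-- `scoreAt` reinserts the point, so deleting it beforehand changes nothing. Deletion yields a
fresh pair, as the comparison with `localScore` requires. -/
lemma rescaled_sdiff (l : ℝ) {w : Sp d × M} {X : Set (Sp d × M)} (hw : w ∈ X) :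
    rescaled Γ ξ l w X = rescaled Γ ξ l w (X \ {w}) := by
  rw [← rescaled_insert l w (X \ {w}), Set.insert_sdiff_singleton, Set.insert_eq_of_mem hw]

lemma lintegral_totalMeasure {l : ℝ} (hl : 0 < l) (hG : Γ l ⊆ G) {X : Set (Sp d × M)}
    (hX : X ∈ SepSet d M) {h : Sp d → ℝ≥0∞} (hh : Measurable h) :
    ∫⁻ y, h y ∂(totalMeasure Γ ξ l X) = cfgSum (scaled ξ G (integralAt h Γ) l) X := by
  rw [totalMeasure, lintegral_sum_measure, cfgSum]
  refine tsum_congr fun w => ?_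
  rw [rescaled_sdiff l w.2, lintegral_rescaled hl hG (mem_freshPairs_of_mem_sepSet hX w.2) hh]

lemma scaled_integralAt_ne_top (hξ : IsScore ξ) {h : Sp d → ℝ≥0∞} {C : ℝ≥0} (hC : ∀ x, h x ≤ C)
    (l : ℝ) (z : Sp d × M) (X : Set (Sp d × M)) : scaled ξ G (integralAt h Γ) l z X ≠ ∞ := by
  rw [scaled, integralAt]
  refine ne_top_of_le_ne_top ?_ (Set.indicator_le_self _ _ _)
  have := isFiniteMeasure_localScore (G := G) hξ z (zoomFin z.1 (l ^ (1 / (d : ℝ))) X)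
  refine ne_top_of_le_ne_top ?_ (lintegral_mono fun y => hC _)
  rw [lintegral_const]
  exact ENNReal.mul_ne_top ENNReal.coe_ne_top (measure_ne_top _ _)

/-- Finitely many finite scores make the total measure finite. The integral of `f` then splits into
two nonnegative sums over points, to which the law of large numbers applies. -/
lemma integral_totalMeasure (hξ : IsScore ξ) {l : ℝ} (hl : 0 < l) (hG : Γ l ⊆ G)
    {X : Set (Sp d × M)} (hX : X ∈ SepSet d M) {f : Sp d → ℝ} (hf : Measurable f) {C : ℝ≥0}
    (hC : ∀ x, |f x| ≤ C) :
    ∫ y, f y ∂(totalMeasure Γ ξ l X)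
      = (cfgSum (scaled ξ G (integralAt (fun x => ENNReal.ofReal (f x)) Γ) l) X).toReal -
        (cfgSum (scaled ξ G (integralAt (fun x => ENNReal.ofReal (-f x)) Γ) l) X).toReal := by
  have hfin : IsFiniteMeasure (totalMeasure Γ ξ l X) := by
    constructor
    rw [← lintegral_one, lintegral_totalMeasure (h := fun _ => 1) hl hG hX measurable_const]
    exact (cfgSum_ne_top (scaled_integralAt_ne_top hξ (C := 1) (fun _ => by simp) l) hX.1).lt_top
  have hi : Integrable f (totalMeasure Γ ξ l X) :=
    Integrable.of_bound hf.aestronglyMeasurable C (Eventually.of_forall fun y => hC _)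
  rw [integral_eq_lintegral_pos_part_sub_lintegral_neg_part hi,
    lintegral_totalMeasure hl hG hX hf.ennreal_ofReal,
    lintegral_totalMeasure hl hG hX (h := fun x => ENNReal.ofReal (-f x)) hf.neg.ennreal_ofReal]

lemma discrepancy_eq {l : ℝ} (hl : 0 < l) (hG : Γ l ⊆ G) {X : Set (Sp d × M)}
    (hX : X ∈ SepSet d M) {f : Sp d → ℝ} (hf : Measurable f) :
    discrepancy Γ ξ l f X = (cfgSum (scaled ξ G (errorAt f Γ) l) X).toReal := by
  have hfin : ∀ w : X, scaled ξ G (errorAt f Γ) l w (X \ {(w : Sp d × M)}) ≠ ∞ := fun w => by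
    rw [scaled, errorAt]
    exact ne_top_of_le_ne_top ENNReal.ofReal_ne_top (Set.indicator_le_self _ _ _)
  rw [discrepancy, cfgSum, ENNReal.tsum_toReal_eq hfin]
  refine tsum_congr fun w => ?_
  rw [rescaled_sdiff l w.2, rescaled_sdiff l w.2,
    abs_integral_rescaled_sub hl hG (mem_freshPairs_of_mem_sepSet hX w.2) hf]

end Link

/-! ### Laws of the given point processes. -/

section Laws

variable {d : ℕ} {M Ω : Type*} [MeasurableSpace M] [MeasurableSpace Ω] {μM : Measure M}
  [IsProbabilityMeasure μM] {P : Measure Ω} [IsProbabilityMeasure P] {κ : Sp d → ℝ≥0}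

lemma map_eq_poisLaw (hd : 0 < d) (hκm : Measurable κ) (hκ1 : ∫⁻ x, (κ x : ℝ≥0∞) = 1)
    {η : Ω → Set (Sp d × M)} {l : ℝ}
    (hη : IsPoissonProcess η (ENNReal.ofReal l • (densityMeasure κ).prod μM) P) :
    P.map η = poisLaw (ENNReal.ofReal l • pointLaw κ μM) := by
  have := pointLaw_prob (μM := μM) hκ1
  have hna : NoPosAtoms (ENNReal.ofReal l • (densityMeasure κ).prod μM) := fun x => by
    have h0 : (densityMeasure κ).prod μM ({x} ×ˢ Set.univ) = 0 :=
      noPosAtoms_pointLaw (μM := μM) hd hκm x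
    rw [Measure.smul_apply, h0, smul_zero]
  have hfin : (ENNReal.ofReal l • (densityMeasure κ).prod μM) Set.univ ≠ ∞ := by
    have h1 : (densityMeasure κ).prod μM Set.univ = 1 := measure_univ (μ := pointLaw κ μM)
    rw [Measure.smul_apply, h1]
    simp
  have h := hη.map_inter MeasurableSet.univ hfin hna
  simp only [Set.inter_univ, Measure.restrict_univ] at h
  exact h

lemma ae_poisLaw_smul {c : ℝ≥0∞} (hc : c ≠ ∞) {ν : Measure (Sp d × M)} [IsFiniteMeasure ν]
    {p : Set (Sp d × M) → Prop} (h : ∀ n, ∀ᵐ X ∂(binLaw ν n), p X) :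
    ∀ᵐ X ∂(poisLaw (c • ν)), p X := by
  refine ae_poisLaw_of_forall fun n => ?_
  rw [binLaw_smul ν hc]
  exact Measure.ae_smul_measure (h n) _

lemma ae_fresh_of_map_eq (hd : 0 < d) (hκm : Measurable κ) (hκ1 : ∫⁻ x, (κ x : ℝ≥0∞) = 1)
    {η : Ω → Set (Sp d × M)} {l : ℝ} (hηm : Measurable η)
    (hlaw : P.map η = poisLaw (ENNReal.ofReal l • pointLaw κ μM)) (x : Sp d) :
    ∀ᵐ ω ∂P, (η ω).Finite ∧ η ω ∩ ({x} ×ˢ Set.univ) = ∅ := by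
  have := pointLaw_prob (μM := μM) hκ1
  have h : ∀ᵐ X ∂(P.map η), X.Finite ∧ X ∩ ({x} ×ˢ Set.univ) = ∅ := by
    rw [hlaw]
    refine ae_poisLaw_smul ENNReal.ofReal_ne_top fun n => ?_
    exact (ae_finite_binLaw _ n).and
      (ae_inter_eq_empty_binLaw (noPosAtoms_pointLaw (μM := μM) hd hκm) n x)
  exact ae_of_ae_map hηm.aemeasurable h

lemma ae_mem_sepSet_poisLaw (ν : Measure (Sp d × M)) :
    ∀ᵐ X ∂(poisLaw ν), X ∈ SepSet d M :=
  ae_poisLaw_of_forall fun n => ae_mem_sepSet ν n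

variable {Z : (n : ℕ) → Fin n → Ω → Sp d × M}

/-- The set of values need not be a measurable configuration, as marks may coincide; `pointSet` is
measurable and differs from it only on a null event. -/
lemma ae_binomialProcess_eq (hd : 0 < d) (hκm : Measurable κ) (hκ1 : ∫⁻ x, (κ x : ℝ≥0∞) = 1)
    (hZm : ∀ n i, Measurable (Z n i)) (hZi : ∀ n, iIndepFun (Z n) P)
    (hZl : ∀ n i, P.map (Z n i) = (densityMeasure κ).prod μM) (n : ℕ) :
    binomialProcess (Z n) =ᵐ[P] (fun ω => pointSet fun i => Z n i ω) ∧
      P.map (fun ω => pointSet fun i => Z n i ω) = binLaw (pointLaw κ μM) n := by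
  have := pointLaw_prob (μM := μM) hκ1
  have hm : Measurable fun ω i => Z n i ω := measurable_pi_iff.2 fun i => hZm n i
  have hlaw : P.map (fun ω i => Z n i ω) = Measure.pi fun _ : Fin n => pointLaw κ μM := by
    rw [(iIndepFun_iff_map_fun_eq_pi_map fun i => (hZm n i).aemeasurable).1 (hZi n)]
    congr 1
    ext1 i
    exact hZl n i
  constructor
  · have h := ae_posInj (noPosAtoms_pointLaw (μM := μM) hd hκm) n
    rw [← hlaw] at h
    filter_upwards [ae_of_ae_map hm.aemeasurable h] with ω hω
    rw [pointSet_of_posInj hω]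
    rfl
  · rw [binLaw, ← hlaw, Measure.map_map measurable_pointSet hm]
    rfl

end Laws

/-! ### The moment hypotheses as bounds under the reduced laws. -/

section MomentBounds

variable {d : ℕ} {M Ω : Type*} [MeasurableSpace M] [MeasurableSpace Ω] {μM : Measure M}
  [IsProbabilityMeasure μM] {P : Measure Ω} [IsProbabilityMeasure P] {κ : Sp d → ℝ≥0}
  {ξ : Score d M} {G : Set (Sp d)} {Γ : ℝ → Set (Sp d)}

lemma measurable_scaled_massAt (hξ : IsScore ξ) (hG : MeasurableSet G)
    (hΓm : ∀ l, 1 ≤ l → MeasurableSet (Γ l)) {l : ℝ} (hl : 1 ≤ l) (p : ℝ) :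
    Measurable fun w : (Sp d × M) × Set (Sp d × M) => scaled ξ G (massAt Γ) l w.1 w.2 ^ p := by
  have hs : 0 < l ^ (1 / (d : ℝ)) := Real.rpow_pos_of_pos (one_pos.trans_le hl) _
  have h := (measurable_massAt hξ hG (hΓm l hl)).comp
    (measurable_fst.prodMk (measurable_zoomFin (d := d) (M := M) hs))
  exact h.pow_const p

/-- The positions are brought outside, since the moment hypothesis bounds the integral over both
marks at fixed positions. -/
lemma lintegral_prod_prod_comm {α β : Type*} [MeasurableSpace α] [MeasurableSpace β]
    (ν : Measure α) (μ : Measure β) [SFinite ν] [SFinite μ] {J : (α × β) × (α × β) → ℝ≥0∞}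
    (hJ : Measurable J) :
    ∫⁻ r, J r ∂((ν.prod μ).prod (ν.prod μ))
      = ∫⁻ x, ∫⁻ y, ∫⁻ t, ∫⁻ t', J ((x, t), (y, t')) ∂μ ∂μ ∂ν ∂ν := by
  rw [lintegral_prod _ hJ.aemeasurable, lintegral_prod _ hJ.lintegral_prod_right'.aemeasurable]
  refine lintegral_congr fun x => ?_
  have h1 : ∀ t, ∫⁻ r, J ((x, t), r) ∂(ν.prod μ) = ∫⁻ y, ∫⁻ t', J ((x, t), (y, t')) ∂μ ∂ν :=
    fun t => lintegral_prod _ (hJ.comp measurable_prodMk_left).aemeasurable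
  simp_rw [h1]
  refine lintegral_lintegral_swap ?_
  have h2 : Measurable fun r : (β × α) × β => J ((x, r.1.1), (r.1.2, r.2)) :=
    hJ.comp (by fun_prop)
  exact h2.lintegral_prod_right'.aemeasurable

lemma lintegral_prod_prod_map {α β γ δ : Type*} [MeasurableSpace α] [MeasurableSpace β]
    [MeasurableSpace γ] [MeasurableSpace δ] {F : ((α × β) × (α × β)) × δ → ℝ≥0∞}
    (hF : Measurable F) {η : γ → δ} (hη : Measurable η) (μ : Measure β) [SFinite μ]
    (P : Measure γ) [SFinite P] (x y : α) :
    ∫⁻ w : β × β × γ, F (((x, w.1), (y, w.2.1)), η w.2.2) ∂(μ.prod (μ.prod P))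
      = ∫⁻ t, ∫⁻ t', ∫⁻ X, F (((x, t), (y, t')), X) ∂(P.map η) ∂μ ∂μ := by
  have hg : Measurable fun w : β × β × γ => (((x, w.1), (y, w.2.1)), η w.2.2) := by
    refine Measurable.prodMk ?_ (hη.comp ?_) <;> fun_prop
  have hm : Measurable fun w : β × β × γ => F (((x, w.1), (y, w.2.1)), η w.2.2) := hF.comp hg
  rw [lintegral_prod _ hm.aemeasurable]
  refine lintegral_congr fun t => ?_
  have hm' : Measurable fun w : β × γ => F (((x, t), (y, w.1)), η w.2) :=
    hm.comp measurable_prodMk_left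
  rw [lintegral_prod _ hm'.aemeasurable]
  refine lintegral_congr fun t' => ?_
  have ht : Measurable fun X => F (((x, t), (y, t')), X) := hF.comp measurable_prodMk_left
  exact (lintegral_map ht hη).symm

/-- The support of `κ` has full measure, so a bound at every position of the support bounds the mean
over a random position. -/
lemma lintegral_le_of_momentPoisson (hd : 0 < d) (hκm : Measurable κ)
    (hκ1 : ∫⁻ x, (κ x : ℝ≥0∞) = 1) (hξ : IsScore ξ) (hG : MeasurableSet G)
    (hΓm : ∀ l, 1 ≤ l → MeasurableSet (Γ l))
    {η : Ω → Set (Sp d × M)} {l : ℝ} (hl : 1 ≤ l) (hle : Γ l ⊆ G)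
    (hη : IsPoissonProcess η (ENNReal.ofReal l • (densityMeasure κ).prod μM) P) {p : ℝ} {H : ℝ≥0∞}
    (hH : ∀ x ∈ (densityMeasure κ).support,
      ∫⁻ w : M × Ω, rescaled Γ ξ l (x, w.1) (η w.2) Set.univ ^ p ∂(μM.prod P) ≤ H) :
    ∫⁻ w, scaled ξ G (massAt Γ) l w.1 w.2 ^ p
      ∂((pointLaw κ μM).prod (poisLaw (ENNReal.ofReal l • pointLaw κ μM))) ≤ H := by
  have := pointLaw_prob (μM := μM) hκ1
  have := densityMeasure_prob hκ1
  have hηm : Measurable η := hη.measurable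
  have hF := measurable_scaled_massAt hξ hG hΓm hl p
  have hlaw := map_eq_poisLaw hd hκm hκ1 hη
  have hfresh := ae_fresh_of_map_eq hd hκm hκ1 hηm hlaw
  have e : ∀ x, ∫⁻ w : M × Ω, rescaled Γ ξ l (x, w.1) (η w.2) Set.univ ^ p ∂(μM.prod P)
      = ∫⁻ t, ∫⁻ X, scaled ξ G (massAt Γ) l (x, t) X ^ p ∂(P.map η) ∂μM := by
    intro x
    have hm : Measurable fun w : M × Ω => scaled ξ G (massAt Γ) l (x, w.1) (η w.2) ^ p :=
      hF.comp ((measurable_const.prodMk measurable_fst).prodMk (hηm.comp measurable_snd))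
    have h1 : ∫⁻ w : M × Ω, rescaled Γ ξ l (x, w.1) (η w.2) Set.univ ^ p ∂(μM.prod P)
        = ∫⁻ w : M × Ω, scaled ξ G (massAt Γ) l (x, w.1) (η w.2) ^ p ∂(μM.prod P) := by
      refine lintegral_congr_ae ?_
      filter_upwards [(Measure.quasiMeasurePreserving_snd (μ := μM) (ν := P)).ae (hfresh x)]
        with w hw
      have hw' : ((x, w.1), η w.2) ∈ FreshPairs d M := hw
      rw [rescaled_univ (one_pos.trans_le hl) hle hw']
    rw [h1, lintegral_prod _ hm.aemeasurable]
    refine lintegral_congr fun t => ?_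
    have ht : Measurable fun X : Set (Sp d × M) => scaled ξ G (massAt Γ) l (x, t) X ^ p :=
      hF.comp measurable_prodMk_left
    exact (lintegral_map ht hηm).symm
  rw [← hlaw]
  have : IsProbabilityMeasure (P.map η) := Measure.isProbabilityMeasure_map hηm.aemeasurable
  refine (lintegral_prod _ hF.aemeasurable).trans_le ?_
  have hm2 : Measurable fun z : Sp d × M =>
      ∫⁻ X, scaled ξ G (massAt Γ) l z X ^ p ∂(P.map η) := hF.lintegral_prod_right'
  refine (lintegral_prod _ hm2.aemeasurable).trans_le ?_
  calc _ ≤ ∫⁻ _, H ∂(densityMeasure κ) := by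
        refine lintegral_mono_ae ?_
        filter_upwards [(densityMeasure κ).support_mem_ae] with x hx
        exact (e x).symm.trans_le (hH x hx)
    _ = H := by simp

lemma lintegral_le_of_momentPoissonPair (hd : 0 < d) (hκm : Measurable κ)
    (hκ1 : ∫⁻ x, (κ x : ℝ≥0∞) = 1) (hξ : IsScore ξ) (hG : MeasurableSet G)
    (hΓm : ∀ l, 1 ≤ l → MeasurableSet (Γ l))
    {η : Ω → Set (Sp d × M)} {l : ℝ} (hl : 1 ≤ l) (hle : Γ l ⊆ G)
    (hη : IsPoissonProcess η (ENNReal.ofReal l • (densityMeasure κ).prod μM) P) {p : ℝ} {H : ℝ≥0∞}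
    (hH : ∀ x ∈ (densityMeasure κ).support, ∀ y ∈ (densityMeasure κ).support,
      ∫⁻ w : M × M × Ω, rescaled Γ ξ l (x, w.1) (η w.2.2 ∪ {(y, w.2.1)}) Set.univ ^ p
        ∂(μM.prod (μM.prod P)) ≤ H) :
    ∫⁻ q, scaled ξ G (massAt Γ) l q.1.1 (ins q.1.2 q.2) ^ p
      ∂(((pointLaw κ μM).prod (pointLaw κ μM)).prod
        (poisLaw (ENNReal.ofReal l • pointLaw κ μM))) ≤ H := by
  have := pointLaw_prob (μM := μM) hκ1
  have := densityMeasure_prob hκ1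
  have hηm : Measurable η := hη.measurable
  have hF := measurable_scaled_massAt (M := M) hξ hG hΓm hl p
  have hF2 : Measurable fun q : ((Sp d × M) × (Sp d × M)) × Set (Sp d × M) =>
      scaled ξ G (massAt Γ) l q.1.1 (ins q.1.2 q.2) ^ p := by
    simpa using measurable_pair_functional (V := fun z X => scaled ξ G (massAt Γ) l z X ^ p) hF
      (V' := fun _ _ => 1) measurable_const
  have hlaw := map_eq_poisLaw hd hκm hκ1 hη
  have hfresh := ae_fresh_of_map_eq hd hκm hκ1 hηm hlaw
  -- Only for `x ≠ y` does the inserted point stay off the fibre above `x`, as a fresh pair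
  -- requires. Coincident positions are null for the two independent points.
  have e : ∀ x y, x ≠ y →
      ∫⁻ w : M × M × Ω, rescaled Γ ξ l (x, w.1) (η w.2.2 ∪ {(y, w.2.1)}) Set.univ ^ p
        ∂(μM.prod (μM.prod P))
      = ∫⁻ w : M × M × Ω, scaled ξ G (massAt Γ) l (x, w.1) (ins (y, w.2.1) (η w.2.2)) ^ p
        ∂(μM.prod (μM.prod P)) := by
    intro x y hxy
    refine lintegral_congr_ae ?_
    have hq := (Measure.quasiMeasurePreserving_snd (μ := μM) (ν := P)).comp
      (Measure.quasiMeasurePreserving_snd (μ := μM) (ν := μM.prod P))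
    filter_upwards [hq.ae (hfresh x), hq.ae (hfresh y)] with w hx hy
    have hx' : (η w.2.2).Finite ∧ η w.2.2 ∩ ({x} ×ˢ Set.univ) = ∅ := hx
    have hy' : ((y, w.2.1), η w.2.2) ∈ FreshPairs d M := hy
    rw [ins_of_mem hy', Set.union_singleton, rescaled_univ (one_pos.trans_le hl) hle]
    refine ⟨hx'.1.insert _, ?_⟩
    refine Set.eq_empty_iff_forall_notMem.2 ?_
    rintro v ⟨rfl | hv, hv1, -⟩
    · exact hxy (Eq.symm hv1)
    · have h3 : v ∈ η w.2.2 ∩ ({x} ×ˢ Set.univ) := ⟨hv, hv1, trivial⟩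
      rw [hx'.2] at h3
      exact h3
  rw [← hlaw]
  have : IsProbabilityMeasure (P.map η) := Measure.isProbabilityMeasure_map hηm.aemeasurable
  refine (lintegral_prod _ hF2.aemeasurable).trans_le ?_
  have hJ : Measurable fun r : (Sp d × M) × (Sp d × M) =>
      ∫⁻ X, scaled ξ G (massAt Γ) l r.1 (ins r.2 X) ^ p ∂(P.map η) := hF2.lintegral_prod_right'
  refine (lintegral_prod_prod_comm (densityMeasure κ) μM hJ).trans_le ?_
  have e2 : ∀ x y,
      ∫⁻ w : M × M × Ω, scaled ξ G (massAt Γ) l (x, w.1) (ins (y, w.2.1) (η w.2.2)) ^ p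
        ∂(μM.prod (μM.prod P))
      = ∫⁻ t, ∫⁻ t', ∫⁻ X, scaled ξ G (massAt Γ) l (x, t) (ins (y, t') X) ^ p
        ∂(P.map η) ∂μM ∂μM := by
    intro x y
    exact lintegral_prod_prod_map hF2 hηm μM P x y
  have hne : ∀ x : Sp d, ∀ᵐ y ∂(densityMeasure κ), x ≠ y := by
    intro x
    have : Nonempty (Fin d) := ⟨⟨0, hd⟩⟩
    have h : ∀ᵐ y : Sp d, x ≠ y := by
      rw [ae_iff]
      simp
    exact (withDensity_absolutelyContinuous _ _).ae_le h
  calc _ ≤ ∫⁻ _, ∫⁻ _, H ∂(densityMeasure κ) ∂(densityMeasure κ) := by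
        refine lintegral_mono_ae ?_
        filter_upwards [(densityMeasure κ).support_mem_ae] with x hx
        refine lintegral_mono_ae ?_
        filter_upwards [(densityMeasure κ).support_mem_ae, hne x] with y hy hxy
        exact ((e x y hxy).trans (e2 x y)).symm.trans_le (hH x hx y hy)
    _ = H := by simp

lemma lintegral_scaled_eq_moment_binomial (hξ : IsScore ξ) (hG : MeasurableSet G)
    (hκm : Measurable κ) (hκ1 : ∫⁻ x, (κ x : ℝ≥0∞) = 1) (hd : 0 < d)
    (hΓm : ∀ l, 1 ≤ l → MeasurableSet (Γ l))
    {Z : (n : ℕ) → Fin n → Ω → Sp d × M}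
    (hZm : ∀ n i, Measurable (Z n i)) (hZi : ∀ n, iIndepFun (Z n) P)
    (hZl : ∀ n i, P.map (Z n i) = (densityMeasure κ).prod μM) (n : ℕ) {l : ℝ} (hl : 1 ≤ l)
    (hle : Γ l ⊆ G) (p : ℝ) :
    ∫⁻ w, scaled ξ G (massAt Γ) l w.1 w.2 ^ p
      ∂((pointLaw κ μM).prod (binLaw (pointLaw κ μM) n))
      = ∫⁻ w : (Sp d × M) × Ω, rescaled Γ ξ l w.1 (binomialProcess (Z n) w.2) Set.univ ^ p
      ∂(((densityMeasure κ).prod μM).prod P) := by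
  have := pointLaw_prob (μM := μM) hκ1
  obtain ⟨hae, hlaw⟩ := ae_binomialProcess_eq hd hκm hκ1 hZm hZi hZl n
  have hm : Measurable fun ω => pointSet fun i => Z n i ω :=
    measurable_pointSet.comp (measurable_pi_iff.2 fun i => hZm n i)
  have hF := measurable_scaled_massAt (M := M) hξ hG hΓm hl p
  have hfresh := ae_mem_freshPairs (ν' := pointLaw κ μM)
    (noPosAtoms_pointLaw (μM := μM) hd hκm) n
  have hprod : ((pointLaw κ μM).prod P).map
      (Prod.map id fun ω => pointSet fun i => Z n i ω)
      = (pointLaw κ μM).prod (binLaw (pointLaw κ μM) n) := by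
    rw [← Measure.map_prod_map _ _ measurable_id hm, Measure.map_id, hlaw]
  rw [← hprod] at hfresh ⊢
  have hmm : Measurable (Prod.map (id : Sp d × M → Sp d × M) fun ω => pointSet fun i => Z n i ω) :=
    measurable_id.prodMap hm
  rw [lintegral_map hF hmm]
  refine lintegral_congr_ae ?_
  filter_upwards [ae_of_ae_map hmm.aemeasurable hfresh,
    (Measure.quasiMeasurePreserving_snd (μ := pointLaw κ μM) (ν := P)).ae hae] with w h1 h2
  rw [h2]
  exact (congrArg (· ^ p) (rescaled_univ (one_pos.trans_le hl) hle h1)).symm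

end MomentBounds

/-! ### Transfer of `L^q` convergence from laws to random variables. -/

section Transfer

variable {Ω S ι : Type*} [MeasurableSpace Ω] [MeasurableSpace S] {P : Measure Ω} {F : Filter ι}
  {Q : ι → Measure S} {η : ι → Ω → S} {g : ι → S → ℝ} {Y Y' : ι → Ω → ℝ} {q : ℝ≥0∞} {c c' : ℝ}

lemma TendstoLq.of_map (hη : ∀ᶠ i in F, AEMeasurable (η i) P ∧ P.map (η i) = Q i)
    (hmem : ∀ᶠ i in F, MemLp (g i) q (Q i))
    (hlim : Tendsto (fun i => eLpNorm (fun X => g i X - c) q (Q i)) F (𝓝 0)) :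
    TendstoLq q P (fun i ω => g i (η i ω)) F c := by
  constructor
  · filter_upwards [hη, hmem] with i hi hm
    rw [← hi.2] at hm
    exact (memLp_map_measure_iff hm.1 hi.1).1 hm
  · refine hlim.congr' ?_
    filter_upwards [hη, hmem] with i hi hm
    rw [← hi.2] at hm ⊢
    exact eLpNorm_map_measure (hm.1.sub aestronglyMeasurable_const) hi.1

lemma TendstoLq.congr (h : TendstoLq q P Y F c) (he : ∀ᶠ i in F, Y i =ᵐ[P] Y' i) :
    TendstoLq q P Y' F c := by
  constructor
  · filter_upwards [h.1, he] with i hi hei using hi.ae_eq hei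
  · refine h.2.congr' ?_
    filter_upwards [he] with i hei
    refine eLpNorm_congr_ae ?_
    filter_upwards [hei] with ω hω
    rw [hω]

lemma TendstoLq.sub [IsFiniteMeasure P] (hq : 1 ≤ q) (h : TendstoLq q P Y F c)
    (h' : TendstoLq q P Y' F c') :
    TendstoLq q P (fun i ω => Y i ω - Y' i ω) F (c - c') := by
  constructor
  · filter_upwards [h.1, h'.1] with i hi hi' using hi.sub hi'
  · have hs := h.2.add h'.2
    rw [add_zero] at hs
    refine tendsto_of_tendsto_of_tendsto_of_le_of_le' tendsto_const_nhds hs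
      (Eventually.of_forall fun i => zero_le) ?_
    filter_upwards [h.1, h'.1] with i hi hi'
    have e : (fun ω => Y i ω - Y' i ω - (c - c'))
        = (fun ω => Y i ω - c) - fun ω => Y' i ω - c' := by
      ext ω
      simp only [Pi.sub_apply]
      ring
    rw [e]
    exact eLpNorm_sub_le (hi.1.sub aestronglyMeasurable_const)
      (hi'.1.sub aestronglyMeasurable_const) hq

end Transfer

/-! ### The limiting integral. -/

section LimitValue

variable {d : ℕ} {M Ω : Type*} [MeasurableSpace M] [MeasurableSpace Ω] {μM : Measure M}
  {P : Measure Ω} {κ : Sp d → ℝ≥0} {ξ : Score d M} {G : Set (Sp d)}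
  {HH : ℝ≥0 → Ω → Set (Sp d × M)}

/-- A finite mean mass and boundedness of `f` make the positive and negative parts separately
integrable; the density is then moved between measure and integrand. -/
lemma integral_limitIntegrand (hG : MeasurableSet G) (hκm : Measurable κ)
    (hm : AEMeasurable (fun x => meanScoreInf ξ μM P (HH (κ x)) x) ((densityMeasure κ).restrict G))
    (hfin : ∫⁻ x in G, meanScoreInf ξ μM P (HH (κ x)) x ∂(densityMeasure κ) ≠ ∞)
    {f : Sp d → ℝ} (hf : Measurable f) {C : ℝ} (hC : ∀ x, |f x| ≤ C) :
    IntegrableOn (limitIntegrand ξ κ μM P HH f) G ∧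
    ∫ x in G, limitIntegrand ξ κ μM P HH f x
      = (∫⁻ x in G, ENNReal.ofReal (f x) * meanScoreInf ξ μM P (HH (κ x)) x
          ∂(densityMeasure κ)).toReal -
        (∫⁻ x in G, ENNReal.ofReal (-f x) * meanScoreInf ξ μM P (HH (κ x)) x
          ∂(densityMeasure κ)).toReal := by
  set m := fun x => meanScoreInf ξ μM P (HH (κ x)) x with hmdef
  have hae : ∀ᵐ x ∂((densityMeasure κ).restrict G), m x < ∞ := ae_lt_top' hm hfin
  have hmi : Integrable (fun x => (m x).toReal) ((densityMeasure κ).restrict G) :=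
    integrable_toReal_of_lintegral_ne_top hm hfin
  have hφ : Integrable (fun x => f x * (m x).toReal) ((densityMeasure κ).restrict G) :=
    hmi.bdd_mul hf.aestronglyMeasurable (Eventually.of_forall fun x => hC x)
  have hdens : (densityMeasure κ).restrict G
      = (volume.restrict G).withDensity fun x => (κ x : ℝ≥0∞) := by
    rw [densityMeasure, restrict_withDensity hG]
  have hlim : limitIntegrand ξ κ μM P HH f = fun x => κ x • (f x * (m x).toReal) := by
    ext x
    rw [limitIntegrand, NNReal.smul_def, smul_eq_mul, mul_comm]
  constructor
  · rw [IntegrableOn, hlim]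
    rw [hdens] at hφ
    exact (integrable_withDensity_iff_integrable_smul hκm).1 hφ
  · have e : ∫ x in G, limitIntegrand ξ κ μM P HH f x
        = ∫ x in G, f x * (m x).toReal ∂(densityMeasure κ) := by
      rw [hlim, hdens, integral_withDensity_eq_integral_smul hκm]
    rw [e, integral_eq_lintegral_pos_part_sub_lintegral_neg_part hφ]
    congr 2
    · refine lintegral_congr_ae ?_
      filter_upwards [hae] with x hx
      rw [ENNReal.ofReal_mul' ENNReal.toReal_nonneg, ENNReal.ofReal_toReal hx.ne]
    · refine lintegral_congr_ae ?_
      filter_upwards [hae] with x hx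
      rw [← neg_mul, ENNReal.ofReal_mul' ENNReal.toReal_nonneg, ENNReal.ofReal_toReal hx.ne]

end LimitValue

/-! ### The law of large numbers for a general model. -/

section Main

variable {d : ℕ} {M Ω : Type*} [MeasurableSpace M] [MeasurableSpace Ω] {μM : Measure M}
  [IsProbabilityMeasure μM] {P : Measure Ω} [IsProbabilityMeasure P]
  {ξ : Score d M} {G : Set (Sp d)} {κ : Sp d → ℝ≥0} {HH : ℝ≥0 → Ω → Set (Sp d × M)}
  {Γ : ℝ → Set (Sp d)}

/-- The law of large numbers for random configurations following one of the models. -/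
theorem tendstoLq_of_llnModel (hd : 0 < d) (hξ : IsScore ξ) (hG : MeasurableSet G)
    (hκm : Measurable κ)
    (hκ1 : ∫⁻ x, (κ x : ℝ≥0∞) = 1) {B : ℝ≥0} (hκb : ∀ x, κ x ≤ B) (hκc : ∀ᵐ x, ContinuousAt κ x)
    (hHH : ∀ a, IsPoissonProcess (HH a) ((a : ℝ≥0∞) • (volume : Measure (Sp d)).prod μM) P)
    (hR : ∀ᵐ x ∂((densityMeasure κ).restrict G), ∀ᵐ w ∂(μM.prod P),
      stabRadius ξ (x, w.1) (HH (κ x) w.2) Set.univ < ⊤)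
    (hΓm : ∀ l, 1 ≤ l → MeasurableSet (Γ l)) (hΓG : ∀ x ∈ G, ∀ᶠ l in atTop, x ∈ Γ l)
    (hle : ∀ l, 1 ≤ l → Γ l ⊆ G) {f : Sp d → ℝ} (hf : Measurable f) {C : ℝ≥0}
    (hC : ∀ x, |f x| ≤ C) (hA : AssumptionA1 ξ ∨ AssumptionA2 ξ ∨ AssumptionA3 f)
    {ι : Type*} {F : Filter ι} [F.NeBot]
    {Q Q₁ Q₂ : ι → Measure (Set (Sp d × M))} {a b : ι → ℝ≥0∞} {A L : ι → ℝ}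
    (hmod : LLNModel F (pointLaw κ μM) Q Q₁ Q₂ a b A L) {q : ℕ} (hq : q = 1 ∨ q = 2) {p : ℝ}
    (hp : (q : ℝ) < p) {H : ℝ≥0}
    (hM1 : ∀ᶠ i in F, ∫⁻ w, scaled ξ G (massAt Γ) (L i) w.1 w.2 ^ p
      ∂((pointLaw κ μM).prod (Q₁ i)) ≤ H)
    (hM2 : ∀ᶠ i in F, ∫⁻ w, scaled ξ G (massAt Γ) (L i) w.1.1 (ins w.1.2 w.2) ^ p
      ∂(((pointLaw κ μM).prod (pointLaw κ μM)).prod (Q₂ i)) ≤ H)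
    {η : ι → Ω → Set (Sp d × M)}
    (hη : ∀ᶠ i in F, AEMeasurable (η i) P ∧ P.map (η i) = Q i)
    (hsep : ∀ᶠ i in F, ∀ᵐ X ∂(Q i), X ∈ SepSet d M) :
    (∀ᵐ x ∂((densityMeasure κ).restrict G), meanScoreInf ξ μM P (HH (κ x)) x < ∞) ∧
    IntegrableOn (limitIntegrand ξ κ μM P HH f) G ∧
    TendstoLq q P (fun i ω => (A i)⁻¹ * ∫ y, f y ∂(totalMeasure Γ ξ (L i) (η i ω))) F
      (∫ x in G, limitIntegrand ξ κ μM P HH f x) ∧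
    TendstoLq 1 P (fun i ω => (A i)⁻¹ * discrepancy Γ ξ (L i) f (η i ω)) F 0 := by
  have hq1 : 1 ≤ q := by omega
  have hp1 : ((1 : ℕ) : ℝ) < p := lt_of_le_of_lt (by exact_mod_cast hq1) hp
  have hC' : ∀ x, |-f x| ≤ C := fun x => by rw [abs_neg]; exact hC x
  have hA' : AssumptionA1 ξ ∨ AssumptionA2 ξ ∨ AssumptionA3 fun x => -f x :=
    hA.imp_right (Or.imp_right fun h => h.mono fun x hx => hx.neg)
  -- The total mass, with factor `1`, yields finiteness of the mean limit score, and thereby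
  -- integrability of the limit for every bounded `f`.
  obtain ⟨hfin, -, -⟩ := tendsto_eLpNorm_scaled hd hξ hG hκm hκ1 hκb hκc hHH hR hmod hq hp hM1 hM2
    (isReadout_massAt hξ hG hΓm hΓG)
  simp only [one_mul] at hfin
  have hm := aemeasurable_meanScoreInf hd hξ hG hκm hHH hR
  obtain ⟨hint, hval⟩ := integral_limitIntegrand hG hκm hm hfin hf hC
  -- The functionals take values in `ℝ≥0∞`, so the positive and the negative part of `f` are treated
  -- separately and subtracted at the end.
  obtain ⟨-, hp2, hp3⟩ := tendsto_eLpNorm_scaled hd hξ hG hκm hκ1 hκb hκc hHH hR hmod hq hp hM1 hM2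
    (isReadout_integralAt hd hξ hG hκm hΓm hΓG hf hC hA)
  obtain ⟨-, hn2, hn3⟩ := tendsto_eLpNorm_scaled hd hξ hG hκm hκ1 hκb hκc hHH hR hmod hq hp hM1 hM2
    (isReadout_integralAt hd hξ hG hκm hΓm hΓG hf.neg hC' hA')
  -- The discrepancy has factor `0` and is wanted in `L¹` only; `p > q ≥ 1` allows the exponent `1`.
  obtain ⟨-, he2, he3⟩ := tendsto_eLpNorm_scaled hd hξ hG hκm hκ1 hκb hκc hHH hR hmod
    (Or.inl rfl) hp1 hM1 hM2 (isReadout_errorAt hd hξ hG hκm hΓm hΓG hf hC hA)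
  have hsep' : ∀ᶠ i in F, 1 ≤ L i ∧ ∀ᵐ ω ∂P, η i ω ∈ SepSet d M := by
    filter_upwards [hη, hsep, hmod.tendsto_L.eventually_ge_atTop 1] with i hi hs hl
    refine ⟨hl, ae_of_ae_map hi.1 ?_⟩
    rw [hi.2]
    exact hs
  refine ⟨ae_lt_top' hm hfin, hint, ?_, ?_⟩
  · rw [hval]
    refine ((TendstoLq.of_map hη hp2 hp3).sub (by exact_mod_cast hq1)
      (TendstoLq.of_map hη hn2 hn3)).congr ?_
    filter_upwards [hsep'] with i hi
    filter_upwards [hi.2] with ω hω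
    rw [integral_totalMeasure hξ (one_pos.trans_le hi.1) (hle _ hi.1) hω hf hC, div_eq_inv_mul,
      div_eq_inv_mul, mul_sub]
    rfl
  · have h := TendstoLq.of_map hη he2 he3
    simp only [Nat.cast_one, zero_mul, lintegral_zero, ENNReal.toReal_zero] at h
    refine h.congr ?_
    filter_upwards [hsep'] with i hi
    filter_upwards [hi.2] with ω hω
    rw [discrepancy_eq (one_pos.trans_le hi.1) (hle _ hi.1) hω hf, div_eq_inv_mul]

end Main

/-! ### The union of the windows. -/

section Windows

variable {d : ℕ} {Γ : ℝ → Set (Sp d)}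

/-- Monotonicity reduces the uncountable union to a countable one. -/
lemma measurableSet_iUnion_windows (hΓm : ∀ l, 1 ≤ l → MeasurableSet (Γ l))
    (hΓmono : MonotoneOn Γ (Set.Ici 1)) : MeasurableSet (⋃ l ∈ Set.Ici (1 : ℝ), Γ l) := by
  have h : ⋃ l ∈ Set.Ici (1 : ℝ), Γ l = ⋃ n : ℕ, Γ ((n : ℝ) + 1) := by
    have h1 : ∀ n : ℕ, (1 : ℝ) ≤ (n : ℝ) + 1 := fun n => by
      have := Nat.cast_nonneg (α := ℝ) n
      linarith
    refine Set.Subset.antisymm (Set.iUnion₂_subset fun l hl => ?_)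
      (Set.iUnion_subset fun n => Set.subset_biUnion_of_mem (u := Γ) (h1 n))
    obtain ⟨n, hn⟩ := exists_nat_ge l
    exact (hΓmono hl (h1 n) (by linarith)).trans
      (Set.subset_iUnion (fun n : ℕ => Γ ((n : ℝ) + 1)) n)
  rw [h]
  exact MeasurableSet.iUnion fun n => hΓm _ (by have := Nat.cast_nonneg (α := ℝ) n; linarith)

lemma eventually_mem_windows (hΓmono : MonotoneOn Γ (Set.Ici 1)) {x : Sp d}
    (hx : x ∈ ⋃ l ∈ Set.Ici (1 : ℝ), Γ l) : ∀ᶠ l in atTop, x ∈ Γ l := by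
  obtain ⟨l₀, hl₀, hx⟩ := Set.mem_iUnion₂.1 hx
  filter_upwards [eventually_ge_atTop l₀] with l hl
  exact hΓmono hl₀ (Set.mem_Ici.2 ((Set.mem_Ici.1 hl₀).trans hl)) hl hx

end Windows

/-! ### The Poisson and the binomial case. -/

section Main

variable {d : ℕ} {M Ω : Type*} [MeasurableSpace M] [MeasurableSpace Ω] {μM : Measure M}
  [IsProbabilityMeasure μM] {P : Measure Ω} [IsProbabilityMeasure P]
  {ξ : Score d M} {G : Set (Sp d)} {κ : Sp d → ℝ≥0} {HH : ℝ≥0 → Ω → Set (Sp d × M)}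
  {Γ : ℝ → Set (Sp d)}

theorem tendstoLq_poisson (hd : 0 < d) (hξ : IsScore ξ) (hG : MeasurableSet G)
    (hκm : Measurable κ)
    (hκ1 : ∫⁻ x, (κ x : ℝ≥0∞) = 1) {B : ℝ≥0} (hκb : ∀ x, κ x ≤ B) (hκc : ∀ᵐ x, ContinuousAt κ x)
    (hHH : ∀ a, IsPoissonProcess (HH a) ((a : ℝ≥0∞) • (volume : Measure (Sp d)).prod μM) P)
    (hR : ∀ᵐ x ∂((densityMeasure κ).restrict G), ∀ᵐ w ∂(μM.prod P),
      stabRadius ξ (x, w.1) (HH (κ x) w.2) Set.univ < ⊤)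
    (hΓm : ∀ l, 1 ≤ l → MeasurableSet (Γ l)) (hΓG : ∀ x ∈ G, ∀ᶠ l in atTop, x ∈ Γ l)
    (hle : ∀ l, 1 ≤ l → Γ l ⊆ G) {f : Sp d → ℝ} (hf : Measurable f) {C : ℝ≥0}
    (hC : ∀ x, |f x| ≤ C) (hA : AssumptionA1 ξ ∨ AssumptionA2 ξ ∨ AssumptionA3 f)
    {PP : ℝ → Ω → Set (Sp d × M)} (hPP : ∀ l, 0 < l →
      IsPoissonProcess (PP l) (ENNReal.ofReal l • (densityMeasure κ).prod μM) P)
    {q : ℕ} (hq : q = 1 ∨ q = 2) {p : ℝ} (hp : (q : ℝ) < p)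
    (hM1 : MomentPoisson Γ ξ κ μM P PP p) (hM2 : MomentPoissonPair Γ ξ κ μM P PP p) :
    (∀ᵐ x ∂((densityMeasure κ).restrict G), meanScoreInf ξ μM P (HH (κ x)) x < ∞) ∧
    IntegrableOn (limitIntegrand ξ κ μM P HH f) G ∧
    TendstoLq q P (fun (l : ℝ) ω => l⁻¹ * ∫ y, f y ∂(totalMeasure Γ ξ l (PP l ω))) atTop
      (∫ x in G, limitIntegrand ξ κ μM P HH f x) ∧
    TendstoLq 1 P (fun (l : ℝ) ω => l⁻¹ * discrepancy Γ ξ l f (PP l ω)) atTop 0 := by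
  have := pointLaw_prob (μM := μM) hκ1
  unfold MomentPoisson at hM1
  unfold MomentPoissonPair at hM2
  set H₁ : ℝ≥0∞ := ⨆ (l : ℝ) (_ : 1 ≤ l) (x : Sp d) (_ : x ∈ (densityMeasure κ).support),
    ∫⁻ w : M × Ω, rescaled Γ ξ l (x, w.1) (PP l w.2) Set.univ ^ p ∂(μM.prod P) with hH₁
  set H₂ : ℝ≥0∞ := ⨆ (l : ℝ) (_ : 1 ≤ l) (x : Sp d) (_ : x ∈ (densityMeasure κ).support)
      (y : Sp d) (_ : y ∈ (densityMeasure κ).support),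
    ∫⁻ w : M × M × Ω, rescaled Γ ξ l (x, w.1) (PP l w.2.2 ∪ {(y, w.2.1)}) Set.univ ^ p
      ∂(μM.prod (μM.prod P)) with hH₂
  have hH : ((max H₁ H₂).toNNReal : ℝ≥0∞) = max H₁ H₂ :=
    ENNReal.coe_toNNReal (max_lt hM1 hM2).ne
  have hb1 : ∀ l, 1 ≤ l → ∀ x ∈ (densityMeasure κ).support,
      ∫⁻ w : M × Ω, rescaled Γ ξ l (x, w.1) (PP l w.2) Set.univ ^ p ∂(μM.prod P) ≤ H₁ :=
    fun l hl x hx => le_iSup₂_of_le l hl (le_iSup₂_of_le x hx le_rfl)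
  have hb2 : ∀ l, 1 ≤ l → ∀ x ∈ (densityMeasure κ).support, ∀ y ∈ (densityMeasure κ).support,
      ∫⁻ w : M × M × Ω, rescaled Γ ξ l (x, w.1) (PP l w.2.2 ∪ {(y, w.2.1)}) Set.univ ^ p
        ∂(μM.prod (μM.prod P)) ≤ H₂ :=
    fun l hl x hx y hy => le_iSup₂_of_le l hl (le_iSup₂_of_le x hx (le_iSup₂_of_le y hy le_rfl))
  refine tendstoLq_of_llnModel hd hξ hG hκm hκ1 hκb hκc hHH hR hΓm hΓG hle hf hC hA
    (llnModel_poisLaw (noPosAtoms_pointLaw hd hκm)) hq hp (H := (max H₁ H₂).toNNReal) ?_ ?_ ?_ ?_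
  · filter_upwards [eventually_ge_atTop 1] with l hl
    rw [hH]
    exact (lintegral_le_of_momentPoisson hd hκm hκ1 hξ hG hΓm hl (hle l hl)
      (hPP l (one_pos.trans_le hl)) (hb1 l hl)).trans (le_max_left _ _)
  · filter_upwards [eventually_ge_atTop 1] with l hl
    rw [hH]
    exact (lintegral_le_of_momentPoissonPair hd hκm hκ1 hξ hG hΓm hl (hle l hl)
      (hPP l (one_pos.trans_le hl)) (hb2 l hl)).trans (le_max_right _ _)
  · filter_upwards [eventually_gt_atTop 0] with l hl
    have hm : Measurable (PP l) := (hPP l hl).measurable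
    exact ⟨hm.aemeasurable, map_eq_poisLaw hd hκm hκ1 (hPP l hl)⟩
  · exact Eventually.of_forall fun l => ae_mem_sepSet_poisLaw _

theorem tendstoLq_binomial (hd : 0 < d) (hξ : IsScore ξ) (hG : MeasurableSet G)
    (hκm : Measurable κ)
    (hκ1 : ∫⁻ x, (κ x : ℝ≥0∞) = 1) {B : ℝ≥0} (hκb : ∀ x, κ x ≤ B) (hκc : ∀ᵐ x, ContinuousAt κ x)
    (hHH : ∀ a, IsPoissonProcess (HH a) ((a : ℝ≥0∞) • (volume : Measure (Sp d)).prod μM) P)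
    (hR : ∀ᵐ x ∂((densityMeasure κ).restrict G), ∀ᵐ w ∂(μM.prod P),
      stabRadius ξ (x, w.1) (HH (κ x) w.2) Set.univ < ⊤)
    (hΓm : ∀ l, 1 ≤ l → MeasurableSet (Γ l)) (hΓG : ∀ x ∈ G, ∀ᶠ l in atTop, x ∈ Γ l)
    (hle : ∀ l, 1 ≤ l → Γ l ⊆ G) {f : Sp d → ℝ} (hf : Measurable f) {C : ℝ≥0}
    (hC : ∀ x, |f x| ≤ C) (hA : AssumptionA1 ξ ∨ AssumptionA2 ξ ∨ AssumptionA3 f)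
    {Z : (n : ℕ) → Fin n → Ω → Sp d × M}
    (hZm : ∀ n i, Measurable (Z n i)) (hZi : ∀ n, iIndepFun (Z n) P)
    (hZl : ∀ n i, P.map (Z n i) = (densityMeasure κ).prod μM)
    {l : ℕ → ℝ} (hl : Tendsto (fun n => l n / n) atTop (𝓝 1))
    {q : ℕ} (hq : q = 1 ∨ q = 2) {p : ℝ} (hp : (q : ℝ) < p) {n₀ : ℕ}
    (hM : MomentBinomial Γ ξ κ μM P Z l n₀ p) :
    (∀ᵐ x ∂((densityMeasure κ).restrict G), meanScoreInf ξ μM P (HH (κ x)) x < ∞) ∧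
    IntegrableOn (limitIntegrand ξ κ μM P HH f) G ∧
    TendstoLq q P (fun (n : ℕ) ω => (n : ℝ)⁻¹ *
      ∫ y, f y ∂(totalMeasure Γ ξ (l n) (binomialProcess (Z n) ω))) atTop
      (∫ x in G, limitIntegrand ξ κ μM P HH f x) ∧
    TendstoLq 1 P (fun (n : ℕ) ω => (n : ℝ)⁻¹ *
      discrepancy Γ ξ (l n) f (binomialProcess (Z n) ω)) atTop 0 := by
  have := pointLaw_prob (μM := μM) hκ1
  have hmod := llnModel_binLaw (noPosAtoms_pointLaw (μM := μM) hd hκm) hl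
  unfold MomentBinomial at hM
  set H : ℝ≥0∞ := ⨆ (n : ℕ) (_ : n₀ ≤ n),
    ∫⁻ w : (Sp d × M) × Ω,
      rescaled Γ ξ (l n) w.1 (binomialProcess (Z (n - 1)) w.2) Set.univ ^ p
      ∂(((densityMeasure κ).prod μM).prod P) with hHdef
  have hH : (H.toNNReal : ℝ≥0∞) = H := ENNReal.coe_toNNReal hM.ne
  have hb : ∀ n, n₀ ≤ n → 1 ≤ l n → ∫⁻ w, scaled ξ G (massAt Γ) (l n) w.1 w.2 ^ p
      ∂((pointLaw κ μM).prod (binLaw (pointLaw κ μM) (n - 1))) ≤ H := fun n hn hln => by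
    rw [lintegral_scaled_eq_moment_binomial hξ hG hκm hκ1 hd hΓm hZm hZi hZl (n - 1) hln (hle _ hln) p]
    exact le_iSup₂_of_le n hn le_rfl
  refine tendstoLq_of_llnModel hd hξ hG hκm hκ1 hκb hκc hHH hR hΓm hΓG hle hf hC hA
    hmod hq hp (H := H.toNNReal) ?_ ?_ ?_ ?_
  · filter_upwards [hmod.tendsto_L.eventually_ge_atTop 1, eventually_ge_atTop n₀] with n hln hn
    rw [hH]
    exact hb n hn hln
  · filter_upwards [hmod.tendsto_L.eventually_ge_atTop 1, eventually_ge_atTop n₀,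
      eventually_ge_atTop 2] with n hln hn hn2
    have h := hb n hn hln
    -- Inserting an independent point into the process of `n - 2` points gives the process of `n -
    -- 1` points, so the single moment hypothesis also covers pairs; `n ≥ 2` keeps the subtraction
    -- exact.
    rw [show n - 1 = n - 2 + 1 by omega] at h
    rw [hH]
    refine le_trans (le_of_eq ?_) h
    exact (lintegral_prod_binLaw_succ (noPosAtoms_pointLaw (μM := μM) hd hκm) (n - 2)
      (measurable_scaled_massAt (M := M) hξ hG hΓm hln p)).symm
  · refine Eventually.of_forall fun n => ?_
    obtain ⟨h1, h2⟩ := ae_binomialProcess_eq hd hκm hκ1 hZm hZi hZl n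
    have hm : Measurable fun ω => pointSet fun i => Z n i ω :=
      measurable_pointSet.comp (measurable_pi_iff.2 fun i => hZm n i)
    exact ⟨⟨_, hm, h1⟩, (Measure.map_congr h1).trans h2⟩
  · exact Eventually.of_forall fun n => ae_mem_sepSet _ n

end Main

end StabLLN

end

/-! ### The main theorem. -/

theorem theorem2p1 {d : ℕ} (hd : 0 < d)
    {M Ω : Type*} [MeasurableSpace M] [MeasurableSpace Ω]
    (μM : Measure M) [IsProbabilityMeasure μM]
    (P : Measure Ω) [IsProbabilityMeasure P]
    -- the random measure
    (ξ : Score d M) (hξ : IsScore ξ)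
    -- the density: a bounded, almost everywhere continuous probability density
    (κ : Sp d → ℝ≥0) (hκm : Measurable κ) (hκ1 : ∫⁻ x, (κ x : ℝ≥0∞) = 1)
    (hκb : ∃ C : ℝ≥0, ∀ x, κ x ≤ C) (hκc : ∀ᵐ x, ContinuousAt κ x)
    -- the sets `Γ_l`, `l ≥ 1`, and their union `Γ∞`
    (Γ : ℝ → Set (Sp d)) (Γinf : Set (Sp d)) (hΓm : ∀ l, 1 ≤ l → MeasurableSet (Γ l))
    (hΓmono : MonotoneOn Γ (Set.Ici 1)) (hΓinf : Γinf = ⋃ l ∈ Set.Ici (1 : ℝ), Γ l)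
    (hΓbd : volume (frontier Γinf) = 0)
    (hΓint : interior Γinf = ⋃ l ∈ Set.Ici (1 : ℝ), interior (Γ l))
    -- the point processes `𝒫_l`, `𝒳_n` and `ℋ_a`
    (PP : ℝ → Ω → Set (Sp d × M))
    (hPP : ∀ l, 0 < l →
      IsPoissonProcess (PP l) (ENNReal.ofReal l • (densityMeasure κ).prod μM) P)
    (Z : (n : ℕ) → Fin n → Ω → Sp d × M)
    (hZm : ∀ n i, Measurable (Z n i)) (hZi : ∀ n, iIndepFun (Z n) P)
    (hZl : ∀ n i, P.map (Z n i) = (densityMeasure κ).prod μM)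
    (HH : ℝ≥0 → Ω → Set (Sp d × M))
    (hHH : ∀ a, IsPoissonProcess (HH a) ((a : ℝ≥0∞) • (volume : Measure (Sp d)).prod μM) P)
    -- almost surely finite radii of stabilization
    (hR : ∀ᵐ x ∂((densityMeasure κ).restrict Γinf), ∀ᵐ w ∂(μM.prod P),
      stabRadius ξ (x, w.1) (HH (κ x) w.2) Set.univ < ⊤)
    -- the test function
    (f : Sp d → ℝ) (hfm : Measurable f) (hfb : ∃ C : ℝ, ∀ x, |f x| ≤ C)
    (hA : AssumptionA1 ξ ∨ AssumptionA2 ξ ∨ AssumptionA3 f)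
    (q : ℕ) (hq : q = 1 ∨ q = 2) :
    -- (i)
    ((∃ p : ℝ, (q : ℝ) < p ∧ MomentPoisson Γ ξ κ μM P PP p ∧
        MomentPoissonPair Γ ξ κ μM P PP p) →
      (∀ᵐ x ∂((densityMeasure κ).restrict Γinf), meanScoreInf ξ μM P (HH (κ x)) x < ∞) ∧
      IntegrableOn (limitIntegrand ξ κ μM P HH f) Γinf ∧
      TendstoLq q P (fun (l : ℝ) ω => l⁻¹ * ∫ y, f y ∂(totalMeasure Γ ξ l (PP l ω))) atTop
        (∫ x in Γinf, limitIntegrand ξ κ μM P HH f x) ∧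
      TendstoLq 1 P (fun (l : ℝ) ω => l⁻¹ * discrepancy Γ ξ l f (PP l ω)) atTop 0) ∧
    -- (ii)
    (∀ l : ℕ → ℝ, Tendsto (fun n => l n / n) atTop (𝓝 1) →
      (∃ n₀ : ℕ, 0 < n₀ ∧ ∃ p : ℝ, (q : ℝ) < p ∧ MomentBinomial Γ ξ κ μM P Z l n₀ p) →
      (∀ᵐ x ∂((densityMeasure κ).restrict Γinf), meanScoreInf ξ μM P (HH (κ x)) x < ∞) ∧
      IntegrableOn (limitIntegrand ξ κ μM P HH f) Γinf ∧
      TendstoLq q P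
        (fun (n : ℕ) ω => (n : ℝ)⁻¹ *
          ∫ y, f y ∂(totalMeasure Γ ξ (l n) (binomialProcess (Z n) ω))) atTop
        (∫ x in Γinf, limitIntegrand ξ κ μM P HH f x) ∧
      TendstoLq 1 P
        (fun (n : ℕ) ω => (n : ℝ)⁻¹ *
          discrepancy Γ ξ (l n) f (binomialProcess (Z n) ω)) atTop 0) := by
  obtain ⟨B, hκb⟩ := hκb
  obtain ⟨C, hfb⟩ := hfb
  have hG : MeasurableSet Γinf := hΓinf ▸ measurableSet_iUnion_windows hΓm hΓmono
  have hΓG : ∀ x ∈ Γinf, ∀ᶠ l in atTop, x ∈ Γ l := fun x hx =>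
    eventually_mem_windows hΓmono (hΓinf ▸ hx)
  have hle : ∀ l, 1 ≤ l → Γ l ⊆ Γinf := fun l hl => by
    rw [hΓinf]
    exact Set.subset_biUnion_of_mem (u := Γ) (Set.mem_Ici.2 hl)
  have hC : ∀ x, |f x| ≤ C.toNNReal := fun x => (hfb x).trans (Real.le_coe_toNNReal C)
  constructor
  · rintro ⟨p, hp, hM1, hM2⟩
    exact tendstoLq_poisson hd hξ hG hκm hκ1 hκb hκc hHH hR hΓm hΓG hle hfm hC hA hPP hq hp hM1 hM2
  · rintro l hl ⟨n₀, -, p, hp, hM⟩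
    exact tendstoLq_binomial hd hξ hG hκm hκ1 hκb hκc hHH hR hΓm hΓG hle hfm hC hA hZm hZi hZl hl
      hq hp hM
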